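/- **Theorem 1.2 (logarithmic epiperimetric inequality for $W_{2m}$).** Let $n,m\ge 1$ be integers, $s\in(0,1)$, $a=1-2s$ and $\beta=\frac{n-1}{n+1}$. Write points of $\mathbb{R}^{n+1}=\mathbb{R}^n\times\mathbb{R}$ as $X=(x,y)$, let $B_1$ be the unit ball of $\mathbb{R}^{n+1}$ and $B_1'=B_1\cap\{y=0\}$; $L^2(\cdot,a)$ and $H^1(\cdot,a)$ denote the Lebesgue and Sobolev spaces with weight $|y|^a$. For $c\in H^1(\partial B_1,a)$ put $$\mathcal{K}_c=\{v\in H^1(B_1,a):\ v\ge 0\text{ on }B_1',\ v=c\text{ on }\partial B_1,\ v(x,y)=v(x,-y)\}$$ (boundary values in the sense of traces), and let $$W_{2m}(v)=\int_{B_1}|\nabla v|^2|y|^a\,dX-2m\int_{\partial B_1}v^2|y|^a\,d\mathcal{H}^n .$$ There are constants $\varepsilon>0$ and $\varepsilon_1>0$, depending only on $n$, $m$ and $a$, such that the following holds. Let $\Theta>0$ and $c\in H^1(\partial B_1,a)$ be such that the $2m$-homogeneous extension $z=r^{2m}c(\theta)$ belongs to $\mathcal{K}_c$, and assume $$\|c\|^2_{L^2(\partial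 B_1,a)}\le\Theta\quad\text{and}\quad |W_{2m}(z)|\le\Theta .$$ Then there is $\zeta\in\mathcal{K}_c$ with $$W_{2m}(\zeta)\le W_{2m}(z)\left(1-\varepsilon\,\Theta^{-\beta}|W_{2m}(z)|^{\beta}\right),$$ and, more strongly, $$W_{2m}(\zeta)\le W_{2m}(z)\left(1-\varepsilon\,\Theta^{-\beta}|W_{2m}(z)|^{\beta}\right)-\varepsilon_1\,\Theta^{-\beta}\,\|\nabla_\theta\phi\|_{L^2(\partial B_1,a)}^{2+2\beta}.$$ Here $c=P+\phi$, where $P$ is a linear combination of eigenfunctions of $-L_a^S$ with eigenvalues at most $\lambda^a(2m)=2m(2m+n+a-1)$, and $\phi\in H^1(\partial B_1,a)$ is orthogonal in $L^2(\partial B_1,a)$ to all such eigenfunctions; $L_a^S$ is the restriction to $\partial B_1$ of $L_a=|y|^{-a}\,\mathrm{div}(|y|^a\nabla\,\cdot)$, that is, $-L_a^S e=\lambda e$ means $\int_{\partial B_1}\nabla_\theta e\cdot\nabla_\theta\eta\,|y|^a\,d\mathcal{H}^n=\lambda\int_{\partial B_1}e\,\eta\,|y|^a\,d\mathcal{H}^n$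 for all $\eta\in H^1(\partial B_1,a)$. -/

import Mathlib

open MeasureTheory Filter Topology Set
open scoped ENNReal ContDiff

noncomputable section

/-- The ambient space `ℝⁿ⁺¹ = ℝⁿ × ℝ`; a point is `X = (x, y)`, and `y` is its last coordinate. -/
abbrev Amb (n : ℕ) : Type := EuclideanSpace ℝ (Fin (n + 1))

/-- The unit sphere `∂B₁` of `ℝⁿ⁺¹`. -/
abbrev USphere (n : ℕ) : Type := Metric.sphere (0 : Amb n) 1

/-- The unit ball `B₁` of `ℝⁿ⁺¹`. -/
def unitBall (n : ℕ) : Set (Amb n) := Metric.ball 0 1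

/-- The thin ball `B₁' = B₁ ∩ {y = 0}`, as the unit ball of `ℝⁿ`. -/
def thinBall (n : ℕ) : Set (EuclideanSpace ℝ (Fin n)) := Metric.ball 0 1

/-- The coordinate `y` of `X = (x, y)`. -/
def yCoord {n : ℕ} (X : Amb n) : ℝ := X (Fin.last n)

/-- The component `x ∈ ℝⁿ` of `X = (x, y)`. -/
def xPart {n : ℕ} (X : Amb n) : EuclideanSpace ℝ (Fin n) :=
  WithLp.toLp 2 (fun i : Fin n => X i.castSucc)

/-- The reflection `(x, y) ↦ (x, -y)`. -/
def reflY {n : ℕ} (X : Amb n) : Amb n :=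
  X - (2 * yCoord X) • EuclideanSpace.single (Fin.last n) (1 : ℝ)

/-- The measure `|y|^a dX` on `ℝⁿ⁺¹`. -/
def bulkMeasure (n : ℕ) (a : ℝ) : Measure (Amb n) :=
  volume.withDensity (fun X => ENNReal.ofReal (|yCoord X| ^ a))

/-- The measure `|y|^a dℋⁿ` on `∂B₁`. The surface measure is `volume.toSphere`, which is `ℋⁿ` in its
usual normalization (polar coordinates read `dX = rⁿ dr dℋⁿ`); Mathlib's `μH[n]` differs from it by
a constant factor. -/
def sphereMeasure (n : ℕ) (a : ℝ) : Measure (USphere n) :=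
  ((volume : Measure (Amb n)).toSphere).withDensity
    (fun θ => ENNReal.ofReal (|yCoord (θ : Amb n)| ^ a))

/-- The `μ`-homogeneous extension `r^μ c(θ)` of a function `c` on the sphere, where `r = |X|` and
`θ = X / |X|`; its value at the origin is irrelevant. -/
def homExt {n : ℕ} {F : Type*} [AddCommGroup F] [Module ℝ F] (μ : ℝ) (c : USphere n → F)
    (X : Amb n) : F :=
  if h : X = 0 then 0 else
    (‖X‖ ^ μ) • c ⟨‖X‖⁻¹ • X, by
      rw [mem_sphere_zero_iff_norm, norm_smul, norm_inv, norm_norm,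
        inv_mul_cancel₀ (norm_ne_zero_iff.mpr h)]⟩

/-- `G` is the weak gradient of `v` in the open set `Ω`. -/
def HasWeakGradientOn {n : ℕ} (Ω : Set (Amb n)) (v : Amb n → ℝ) (G : Amb n → Amb n) : Prop :=
  LocallyIntegrableOn v Ω ∧ LocallyIntegrableOn G Ω ∧
    ∀ ψ : Amb n → ℝ, ContDiff ℝ ∞ ψ → HasCompactSupport ψ → tsupport ψ ⊆ Ω →
      ∀ w : Amb n,
        ∫ X in Ω, v X * fderiv ℝ ψ X w = - ∫ X in Ω, inner ℝ (G X) w * ψ X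

open Classical in
/-- The weak gradient of `v` in `Ω` (unique up to null sets of `Ω`), and `0` if there is none. -/
def weakGrad {n : ℕ} (Ω : Set (Amb n)) (v : Amb n → ℝ) : Amb n → Amb n :=
  if h : ∃ G, HasWeakGradientOn Ω v G then h.choose else 0

/-- `v ∈ H¹(Ω, a)`: `v` and its weak gradient are square integrable on `Ω` for `|y|^a dX`. -/
def MemH1 {n : ℕ} (Ω : Set (Amb n)) (a : ℝ) (v : Amb n → ℝ) : Prop :=
  MemLp v 2 ((bulkMeasure n a).restrict Ω) ∧
    ∃ G : Amb n → Amb n, HasWeakGradientOn Ω v G ∧ MemLp G 2 ((bulkMeasure n a).restrict Ω)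

/-- `T` is the (weak) tangential gradient `∇_θ c` of `c` on the sphere: the `0`-homogeneous
extension of `c` has in `ℝⁿ⁺¹ ∖ {0}` the weak gradient `r⁻¹ T(θ)`. -/
def IsTangentialGradient {n : ℕ} (c : USphere n → ℝ) (T : USphere n → Amb n) : Prop :=
  HasWeakGradientOn {X : Amb n | X ≠ 0} (homExt 0 c) (homExt (-1) T)

/-- `c ∈ H¹(∂B₁, a)`: `c` and its tangential gradient are square integrable for `|y|^a dℋⁿ`. -/
def MemH1Sphere {n : ℕ} (a : ℝ) (c : USphere n → ℝ) : Prop :=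
  MemLp c 2 (sphereMeasure n a) ∧
    ∃ T : USphere n → Amb n, IsTangentialGradient c T ∧ MemLp T 2 (sphereMeasure n a)

/-- `c ∈ L²(∂B₁, a)` is the trace on `∂B₁` of `v : B₁ → ℝ`: the mean over the layer
`{1 - δ < |X| < 1}` of the squared distance between `v(X)` and `c(X/|X|)` tends to `0`. -/
def IsSphereTrace {n : ℕ} (a : ℝ) (v : Amb n → ℝ) (c : USphere n → ℝ) : Prop :=
  MemLp c 2 (sphereMeasure n a) ∧
    Tendsto (fun δ : ℝ =>
        (∫⁻ X in {X : Amb n | 1 - δ < ‖X‖ ∧ ‖X‖ < 1}, ‖v X - homExt 0 c X‖ₑ ^ 2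
          ∂(bulkMeasure n a)) / ENNReal.ofReal δ)
      (𝓝[>] 0) (𝓝 0)

/-- `f ∈ L²(B₁')` is the trace on `B₁'` of `v : B₁ → ℝ`: the mean over the layer
`B₁ ∩ {|y| < δ}` of the squared distance between `v(x, y)` and `f(x)` tends to `0`. -/
def IsThinTrace {n : ℕ} (v : Amb n → ℝ) (f : EuclideanSpace ℝ (Fin n) → ℝ) : Prop :=
  MemLp f 2 (volume.restrict (thinBall n)) ∧
    Tendsto (fun δ : ℝ =>
        (∫⁻ X in unitBall n ∩ {X : Amb n | |yCoord X| < δ}, ‖v X - f (xPart X)‖ₑ ^ 2)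
          / ENNReal.ofReal δ)
      (𝓝[>] 0) (𝓝 0)

/-- The admissible class `𝒦_c` of all `v ∈ H¹(B₁, a)` with `v ≥ 0` on `B₁'`, `v = c` on `∂B₁` (both
in the sense of traces) and `v(x, y) = v(x, -y)`. -/
def admissibleClass {n : ℕ} (a : ℝ) (c : USphere n → ℝ) : Set (Amb n → ℝ) :=
  {v | MemH1 (unitBall n) a v ∧
    (∃ f, IsThinTrace v f ∧ ∀ᵐ x ∂(volume.restrict (thinBall n)), 0 ≤ f x) ∧
    IsSphereTrace a v c ∧
    ∀ᵐ X ∂(volume.restrict (unitBall n)), v (reflY X) = v X}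

open Classical in
/-- The trace of `v` on `∂B₁` (unique up to null sets), and `0` if there is none. -/
def sphereTrace {n : ℕ} (a : ℝ) (v : Amb n → ℝ) : USphere n → ℝ :=
  if h : ∃ c, IsSphereTrace a v c then h.choose else 0

/-- `‖c‖²` in `L²(∂B₁, a)`. -/
def sphereNormSq {n : ℕ} {F : Type*} [NormedAddCommGroup F] (a : ℝ) (c : USphere n → F) : ℝ :=
  ∫ θ, ‖c θ‖ ^ 2 ∂(sphereMeasure n a)

/-- The Weiss energy `W_μ(v) = ∫_{B₁} |∇v|² |y|^a dX - μ ∫_{∂B₁} v² |y|^a dℋⁿ`. -/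
def weissEnergy {n : ℕ} (a μ : ℝ) (v : Amb n → ℝ) : ℝ :=
  (∫ X in unitBall n, ‖weakGrad (unitBall n) v X‖ ^ 2 ∂(bulkMeasure n a))
    - μ * sphereNormSq a (sphereTrace a v)

/-- `e` lies in the eigenspace of `-L_a^S`, the operator `L_a = |y|^{-a} div(|y|^a ∇ ·)` restricted
to the sphere, for the eigenvalue `l`: in weak form, `∫ ∇_θ e · ∇_θ η |y|^a = l ∫ e η |y|^a` for
all `η ∈ H¹(∂B₁, a)`. -/
def IsSphereEigenfunction {n : ℕ} (a l : ℝ) (e : USphere n → ℝ) : Prop :=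
  MemLp e 2 (sphereMeasure n a) ∧
    ∃ T : USphere n → Amb n, IsTangentialGradient e T ∧ MemLp T 2 (sphereMeasure n a) ∧
      ∀ (η : USphere n → ℝ) (S : USphere n → Amb n), MemLp η 2 (sphereMeasure n a) →
        IsTangentialGradient η S → MemLp S 2 (sphereMeasure n a) →
        ∫ θ, inner ℝ (T θ) (S θ) ∂(sphereMeasure n a)
          = l * ∫ θ, e θ * η θ ∂(sphereMeasure n a)

/-- The eigenvalue `λ^a(α) = α (α + n + a - 1)` that belongs to the homogeneity `α`. -/
def homEigenvalue (n : ℕ) (a α : ℝ) : ℝ := α * (α + n + a - 1)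

/-- `φ` is the part of `c` of homogeneities `> α`: `c - φ` is a combination of eigenfunctions of
`-L_a^S` with eigenvalues `≤ λ^a(α)`, and `φ` is orthogonal in `L²(∂B₁, a)` to all of these. -/
def IsHighModePart {n : ℕ} (a α : ℝ) (c φ : USphere n → ℝ) : Prop :=
  (∃ P ∈ Submodule.span ℝ
      {e : USphere n → ℝ | ∃ l ≤ homEigenvalue n a α, IsSphereEigenfunction a l e},
      c =ᵐ[sphereMeasure n a] P + φ) ∧
    ∀ (l : ℝ) (e : USphere n → ℝ), l ≤ homEigenvalue n a α → IsSphereEigenfunction a l e →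
      ∫ θ, φ θ * e θ ∂(sphereMeasure n a) = 0

end

/-! The competitor raises the homogeneity of the high modes. Even functions on the sphere are
`L²`-limits of restrictions of `L_a`-harmonic polynomials in `(x, y²)`, and those of degree `k` have
eigenvalue `λ(k) = k (k + n + a - 1)`. Write `c = P + φ` with `P` the modes of degree at most `2m`,
`E = ‖∇φ‖²`, `I = ‖φ‖²`, `Q = E - λ(2m) I`, `d = n + a - 1 + 4m`. In `d W(z)` the low modes
contribute a nonpositive term and `φ` contributes `Q`, and the spectral gap gives `Q ≥ γ E` with `γ
> 0` (`gap_inequality`). Passing from `r^{2m} φ` to `r^{2m+κ} φ` gains a term linear in `κ` and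
proportional to `Q`, at a cost of order `κ² I`.

The obstacle is the sign condition, since `P` alone may be negative on the thin sphere. Let `M` be
the depth of its negative part there and `h` the even harmonic extension of `|x|^{2m}`, which is `1`
on the thin sphere. The competitor is `ζ = r^{2m} (P + M h) + r^{2m+κ} (φ - M h)`. It equals `r^κ z
+ (1 - r^κ) r^{2m} (P + M h)`, a convex combination of functions with nonnegative thin traces, so it
is admissible (`add_homExt_mem_admissibleClass`). Because `h` has eigenvalue exactly `λ(2m)`, moving
`M h` costs nothing to first order in `κ`; only a term of order `κ² M²` remains (`weiss_algebra`,
`ModeSplitting.weissEnergy_sub`).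

It remains to bound `M` by `E` (`exists_low_mode_bound`). The low modes have Lipschitz constant at
most `C √Θ`, so near a minimum point on the thin sphere they stay below `-M/2` for directions within
a distance of order `M/√Θ`. As `z ≥ 0` on the thin ball, the extension of `φ` must be at least of
order `M` there, and a trace inequality on a box with `n - 1` short thin sides gives `M²
(M/√Θ)^{n-1} ≤ C E`, that is `M² ≤ C Θ^β E^{1-β}`. With `κ = δ Θ^{-β} E^β` and `δ` small, `κ (I + C
M²)` is absorbed by half of the gain. A decrease of order `Θ^{-β} E^{1+β}` is left: one half is the
gradient term, the other controls `Θ^{-β} W(z) |W(z)|^β` because `d W(z) ≤ E`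
(`exists_epiperimetric_rates`).

No abstract spectral theorem is used. Completeness comes from Stone-Weierstrass and averaging under
the reflection, and the gap from pairing `∇φ` with gradients of finite-dimensional projections of
`φ`. -/

noncomputable section

variable {n : ℕ}

/-! ### Polynomials in `(x, y²)` and `L_a`-harmonic polynomials -/

open MvPolynomial in
/-- The weights of the variables `(x, y²)`. -/
def evenWeight (n : ℕ) : Fin (n + 1) → ℕ := fun i => if i = Fin.last n then 2 else 1

/-- Polynomials in `(x, y²)`; the last variable stands for `y²`. -/
abbrev EvenPoly (n : ℕ) : Type := MvPolynomial (Fin (n + 1)) ℝ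

namespace EvenPoly

open MvPolynomial


lemma evenWeight_castSucc (i : Fin n) : evenWeight n i.castSucc = 1 := by
  simp [evenWeight, Fin.castSucc_ne_last]

lemma evenWeight_last : evenWeight n (Fin.last n) = 2 := by simp [evenWeight]

lemma evenWeight_ne_zero (i : Fin (n + 1)) : evenWeight n i ≠ 0 := by
  unfold evenWeight; split <;> simp

/-- The operator `L_a` on polynomials in `(x, y²)`. -/
def lap (a : ℝ) (p : EvenPoly n) : EvenPoly n :=
  ∑ i : Fin n, pderiv i.castSucc (pderiv i.castSucc p)
    + 4 * (X (Fin.last n) * pderiv (Fin.last n) (pderiv (Fin.last n) p))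
    + C (2 * (1 + a)) * pderiv (Fin.last n) p

/-- The carré du champ of `lap`. -/
def gradDot (p q : EvenPoly n) : EvenPoly n :=
  ∑ i : Fin n, pderiv i.castSucc p * pderiv i.castSucc q
    + 4 * (X (Fin.last n) * (pderiv (Fin.last n) p * pderiv (Fin.last n) q))

lemma lap_add (a : ℝ) (p q : EvenPoly n) : lap a (p + q) = lap a p + lap a q := by
  simp only [lap, map_add, Finset.sum_add_distrib]; ring

lemma lap_smul (a c : ℝ) (p : EvenPoly n) : lap a (c • p) = c • lap a p := by
  simp only [lap, Derivation.map_smul, ← Finset.smul_sum, smul_add, mul_smul_comm]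

lemma lap_zero (a : ℝ) : lap a (0 : EvenPoly n) = 0 := by simp [lap]

/-- With `t = y²`, the operator `∂_y² + (a/y) ∂_y` becomes `4 t ∂_t² + 2 (1 + a) ∂_t`, so `L_a` acts
on polynomials and obeys the second-order Leibniz rule. All later computations with products go
through it. -/
lemma lap_mul (a : ℝ) (p q : EvenPoly n) :
    lap a (p * q) = lap a p * q + p * lap a q + 2 * gradDot p q := by
  have h : ∀ i : Fin n, pderiv i.castSucc (pderiv i.castSucc (p * q))
      = pderiv i.castSucc (pderiv i.castSucc p) * q + p * pderiv i.castSucc (pderiv i.castSucc q)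
        + 2 * (pderiv i.castSucc p * pderiv i.castSucc q) := by
    intro i
    simp only [Derivation.leibniz, map_add, smul_eq_mul]; ring
  simp only [lap, gradDot, h, Finset.sum_add_distrib, ← Finset.mul_sum, ← Finset.sum_mul]
  simp only [Derivation.leibniz, map_add, smul_eq_mul]
  ring

/-- The polynomial `|x|²`. -/
def xSq (n : ℕ) : EvenPoly n := ∑ i : Fin n, X i.castSucc ^ 2

/-- The polynomial `|X|²`. -/
def rSq (n : ℕ) : EvenPoly n := xSq n + X (Fin.last n)

lemma pderiv_xSq_castSucc (i : Fin n) : pderiv i.castSucc (xSq n) = 2 * X i.castSucc := by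
  classical
  simp only [xSq, map_sum, Derivation.leibniz_pow, pderiv_X]
  rw [Finset.sum_eq_single i]
  · simp [nsmul_eq_mul]
  · intro j _ hj
    rw [Pi.single_eq_of_ne (by simpa using hj)]; simp
  · simp

lemma pderiv_xSq_last : pderiv (Fin.last n) (xSq n) = 0 := by
  classical
  simp only [xSq, map_sum, Derivation.leibniz_pow, pderiv_X]
  refine Finset.sum_eq_zero fun j _ => ?_
  rw [Pi.single_eq_of_ne (Fin.castSucc_ne_last j)]; simp

lemma pderiv_X_castSucc_last (i : Fin n) :
    pderiv (Fin.last n) (X i.castSucc : EvenPoly n) = 0 :=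
  pderiv_X_of_ne (Fin.castSucc_ne_last i)

lemma pderiv_X_last_castSucc (i : Fin n) :
    pderiv i.castSucc (X (Fin.last n) : EvenPoly n) = 0 :=
  pderiv_X_of_ne (Fin.castSucc_ne_last i).symm

lemma lap_X_castSucc (a : ℝ) (i : Fin n) : lap a (X i.castSucc : EvenPoly n) = 0 := by
  classical
  simp only [lap, pderiv_X_castSucc_last, map_zero, mul_zero, add_zero]
  refine Finset.sum_eq_zero fun j _ => ?_
  by_cases h : i = j
  · subst h; simp
  · rw [pderiv_X_of_ne (by simpa using h)]; simp

lemma lap_X_last (a : ℝ) : lap a (X (Fin.last n) : EvenPoly n) = C (2 * (1 + a)) := by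
  simp [lap]

lemma lap_xSq (a : ℝ) : lap a (xSq n) = C (2 * n : ℝ) := by
  simp only [lap, pderiv_xSq_castSucc, pderiv_xSq_last, map_zero, mul_zero, add_zero]
  have : ∀ i : Fin n, pderiv i.castSucc (2 * X i.castSucc : EvenPoly n) = 2 := by
    intro i
    rw [Derivation.leibniz, pderiv_X_self, show (2 : EvenPoly n) = C 2 from rfl, pderiv_C]
    simp
  simp only [this, Finset.sum_const, Finset.card_univ, Fintype.card_fin, nsmul_eq_mul]
  rw [map_mul, map_natCast, mul_comm]; rfl

lemma lap_rSq (a : ℝ) : lap a (rSq n) = C (2 * (n + 1 + a)) := by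
  rw [rSq, lap_add, lap_xSq, lap_X_last, ← map_add]; congr 1; ring

lemma gradDot_X_castSucc (i : Fin n) (p : EvenPoly n) :
    gradDot (X i.castSucc) p = pderiv i.castSucc p := by
  classical
  simp only [gradDot, pderiv_X_castSucc_last, zero_mul, mul_zero, add_zero]
  rw [Finset.sum_eq_single i]
  · simp
  · intro j _ hj
    rw [pderiv_X_of_ne (by simpa using hj.symm), zero_mul]
  · simp

lemma euler {p : EvenPoly n} {k : ℕ} (hp : p.IsWeightedHomogeneous (evenWeight n) k) :
    ∑ i : Fin n, X i.castSucc * pderiv i.castSucc p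
      + 2 * (X (Fin.last n) * pderiv (Fin.last n) p) = (k : EvenPoly n) * p := by
  have := hp.sum_weight_X_mul_pderiv
  rw [Fin.sum_univ_castSucc] at this
  simp only [evenWeight_castSucc, evenWeight_last, one_smul, nsmul_eq_mul] at this
  exact_mod_cast this

/-- `∇|X|² = 2 X`, and Euler's identity evaluates `X · ∇p`. -/
lemma gradDot_rSq {p : EvenPoly n} {k : ℕ} (hp : p.IsWeightedHomogeneous (evenWeight n) k) :
    gradDot (rSq n) p = 2 * ((k : EvenPoly n) * p) := by
  rw [← euler hp]
  simp only [gradDot, rSq, map_add, pderiv_xSq_castSucc, pderiv_xSq_last, pderiv_X_last_castSucc,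
    pderiv_X_self, add_zero, zero_add, one_mul, mul_add, Finset.mul_sum, mul_assoc]
  congr 1; ring

/-- The commutator of two derivations is a derivation, and this one vanishes on the variables. -/
lemma pderiv_comm (i j : Fin (n + 1)) (p : EvenPoly n) :
    pderiv i (pderiv j p) = pderiv j (pderiv i p) := by
  have h : ⁅(pderiv i : Derivation ℝ (EvenPoly n) (EvenPoly n)),
      (pderiv j : Derivation ℝ (EvenPoly n) (EvenPoly n))⁆ = 0 := by
    classical
    refine MvPolynomial.derivation_ext fun k => ?_
    simp only [Derivation.commutator_apply, pderiv_X, Derivation.zero_apply, Pi.single_apply]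
    split <;> split <;> simp
  have := congrArg (fun D => D p) h
  simp only [Derivation.commutator_apply, Derivation.zero_apply] at this
  exact sub_eq_zero.mp this

/-- The coefficients of `lap` involve only the last variable, so derivatives in the `x` directions
commute with it. -/
lemma lap_pderiv_castSucc (a : ℝ) (i : Fin n) (p : EvenPoly n) :
    lap a (pderiv i.castSucc p) = pderiv i.castSucc (lap a p) := by
  simp only [lap, map_add, map_sum, Derivation.leibniz, pderiv_X_last_castSucc, pderiv_C,
    smul_eq_mul]
  rw [show (4 : EvenPoly n) = C 4 from rfl, pderiv_C]
  simp only [pderiv_comm _ i.castSucc, mul_zero, add_zero]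

/-- The `L_a`-harmonic polynomials in `(x, y²)`, homogeneous of degree `k` in `(x, y)`. -/
def harm (n : ℕ) (a : ℝ) (k : ℕ) : Submodule ℝ (EvenPoly n) where
  carrier := {p | p.IsWeightedHomogeneous (evenWeight n) k ∧ lap a p = 0}
  add_mem' := fun hp hq => ⟨hp.1.add hq.1, by rw [lap_add, hp.2, hq.2, add_zero]⟩
  zero_mem' := ⟨isWeightedHomogeneous_zero _ _ _, lap_zero a⟩
  smul_mem' := fun c p hp =>
    ⟨(weightedHomogeneousSubmodule ℝ (evenWeight n) k).smul_mem c hp.1, by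
      rw [lap_smul, hp.2, smul_zero]⟩

instance (a : ℝ) (k : ℕ) : FiniteDimensional ℝ (harm n a k) := by
  have : FiniteDimensional ℝ (weightedHomogeneousSubmodule ℝ (evenWeight n) k) :=
    Module.Finite.iff_fg.mpr (weightedHomogeneousSubmodule_fg ℝ _ evenWeight_ne_zero k)
  exact Submodule.finiteDimensional_of_le
    (S₂ := weightedHomogeneousSubmodule ℝ (evenWeight n) k) fun p hp => hp.1

lemma isWeightedHomogeneous_xSq : (xSq n).IsWeightedHomogeneous (evenWeight n) 2 := by
  refine (weightedHomogeneousSubmodule ℝ (evenWeight n) 2).sum_mem fun i _ => ?_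
  have := (isWeightedHomogeneous_X ℝ (evenWeight n) i.castSucc).pow 2
  rw [evenWeight_castSucc] at this
  simpa using this

lemma isWeightedHomogeneous_X_last :
    (X (Fin.last n) : EvenPoly n).IsWeightedHomogeneous (evenWeight n) 2 := by
  have := isWeightedHomogeneous_X ℝ (evenWeight n) (Fin.last n)
  rwa [evenWeight_last] at this

lemma isWeightedHomogeneous_rSq : (rSq n).IsWeightedHomogeneous (evenWeight n) 2 :=
  isWeightedHomogeneous_xSq.add isWeightedHomogeneous_X_last

lemma one_mem_harm (a : ℝ) : (1 : EvenPoly n) ∈ harm n a 0 :=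
  ⟨isWeightedHomogeneous_one _ _, by simp [lap]⟩

/-- All weights are positive, so weighted degree zero forces a constant. -/
lemma pderiv_eq_zero_of_degree_zero {p : EvenPoly n}
    (hp : p.IsWeightedHomogeneous (evenWeight n) 0) (i : Fin (n + 1)) : pderiv i p = 0 := by
  have h : p = C (coeff 0 p) := by
    ext d
    rw [coeff_C]
    split_ifs with hd
    · rw [hd]
    · by_contra hne
      have := hp hne
      apply hd
      ext j
      have hj := Finsupp.le_weight (evenWeight n) (evenWeight_ne_zero j) d
      rw [this] at hj
      simp at hj
      simp [hj]
  rw [h, pderiv_C]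

/-- Multiplication of a harmonic polynomial by a coordinate, corrected to be harmonic. -/
lemma exists_harm_X_mul {a : ℝ} (ha : -1 < a) {k : ℕ} {h : EvenPoly n}
    (hh : h ∈ harm n a k) (i : Fin n) :
    ∃ h₁ ∈ harm n a (k + 1), ∃ l, ∃ h₂ ∈ harm n a l, X i.castSucc * h = h₁ + rSq n * h₂ := by
  rcases Nat.eq_zero_or_pos k with rfl | hk
  · refine ⟨X i.castSucc * h, ⟨?_, ?_⟩, 0, 0, Submodule.zero_mem _, by simp⟩
    · have := (isWeightedHomogeneous_X ℝ (evenWeight n) i.castSucc).mul hh.1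
      rw [evenWeight_castSucc] at this
      exact this
    · rw [lap_mul, lap_X_castSucc, hh.2, gradDot_X_castSucc,
        pderiv_eq_zero_of_degree_zero hh.1]
      simp
  · obtain ⟨j, rfl⟩ : ∃ j, k = j + 1 := ⟨k - 1, by omega⟩
    have hn : (1 : ℝ) ≤ n := by exact_mod_cast i.pos
    have hpos : 0 < n + 1 + a + 2 * j := by
      have : (0 : ℝ) ≤ j := j.cast_nonneg
      linarith
    set q := pderiv i.castSucc h with hq
    have hqm : q ∈ harm n a j :=
      ⟨hh.1.pderiv (by rw [evenWeight_castSucc]), by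
        rw [hq, lap_pderiv_castSucc, hh.2, map_zero]⟩
    -- Here `lap (x_i h) = 2 q` while `lap (|X|² q) = 2 (n + 1 + a + 2 j) q`, so this multiple of
    -- `|X|² q` is the harmonic correction.
    set c : ℝ := (n + 1 + a + 2 * j)⁻¹ with hc
    refine ⟨X i.castSucc * h - rSq n * (c • q), ⟨?_, ?_⟩, j, c • q,
      Submodule.smul_mem _ _ hqm, by ring⟩
    · have h1 := (isWeightedHomogeneous_X ℝ (evenWeight n) i.castSucc).mul hh.1
      rw [evenWeight_castSucc] at h1
      have h2 := isWeightedHomogeneous_rSq.mul ((harm n a j).smul_mem c hqm).1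
      rw [show 1 + (j + 1) = j + 1 + 1 by ring] at h1
      rw [show 2 + j = j + 1 + 1 by ring] at h2
      exact (weightedHomogeneousSubmodule ℝ (evenWeight n) _).sub_mem h1 h2
    · rw [sub_eq_add_neg, ← neg_one_smul ℝ (rSq n * (c • q)), lap_add, lap_smul, lap_mul, lap_mul,
        lap_X_castSucc, hh.2, gradDot_X_castSucc, ← hq, lap_rSq,
        gradDot_rSq ((harm n a j).smul_mem c hqm).1, lap_smul, hqm.2]
      have : 2 * q = C (2 * (n + 1 + a + 2 * j) * c) * q := by
        rw [hc, mul_assoc, mul_inv_cancel₀ hpos.ne', mul_one]; rfl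
      rw [zero_mul, mul_zero, zero_add, zero_add, this, smul_zero, mul_zero, add_zero]
      simp only [smul_eq_C_mul, map_mul, map_add, map_neg, map_one, map_natCast,
        show (C 2 : EvenPoly n) = 2 from rfl]
      ring

/-- Every polynomial in `(x, y²)` is a sum of terms `|X|^{2j} h` with `h` harmonic. -/
lemma span_rSq_mul_harm {a : ℝ} (ha : -1 < a) :
    Submodule.span ℝ {p : EvenPoly n | ∃ j k, ∃ h ∈ harm n a k, p = rSq n ^ j * h} = ⊤ := by
  set S := Submodule.span ℝ {p : EvenPoly n | ∃ j k, ∃ h ∈ harm n a k, p = rSq n ^ j * h} with hS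
  have hR : ∀ p ∈ S, rSq n * p ∈ S := by
    intro p hp
    induction hp using Submodule.span_induction with
    | mem p hp =>
      obtain ⟨j, k, h, hh, rfl⟩ := hp
      exact Submodule.subset_span ⟨j + 1, k, h, hh, by ring⟩
    | zero => simp
    | add p q _ _ hp hq => rw [mul_add]; exact S.add_mem hp hq
    | smul c p _ hp => rw [mul_smul_comm]; exact S.smul_mem c hp
  have hX : ∀ i : Fin n, ∀ p ∈ S, X i.castSucc * p ∈ S := by
    intro i p hp
    induction hp using Submodule.span_induction with
    | mem p hp =>
      obtain ⟨j, k, h, hh, rfl⟩ := hp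
      obtain ⟨h₁, hh₁, l, h₂, hh₂, e⟩ := exists_harm_X_mul ha hh i
      have : X i.castSucc * (rSq n ^ j * h) = rSq n ^ j * h₁ + rSq n ^ (j + 1) * h₂ := by
        rw [mul_left_comm, e]; ring
      rw [this]
      exact S.add_mem (Submodule.subset_span ⟨j, _, h₁, hh₁, rfl⟩)
        (Submodule.subset_span ⟨j + 1, _, h₂, hh₂, rfl⟩)
    | zero => simp
    | add p q _ _ hp hq => rw [mul_add]; exact S.add_mem hp hq
    | smul c p _ hp => rw [mul_smul_comm]; exact S.smul_mem c hp
  -- Multiplication by `y²` reduces to the previous two cases through `y² = |X|² - ∑ x_i²`.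
  have hT : ∀ p ∈ S, X (Fin.last n) * p ∈ S := by
    intro p hp
    have : X (Fin.last n) * p = rSq n * p - ∑ i : Fin n, X i.castSucc * (X i.castSucc * p) := by
      simp only [rSq, xSq, add_mul, Finset.sum_mul, ← mul_assoc, ← sq]; ring
    rw [this]
    exact S.sub_mem (hR p hp) (S.sum_mem fun i _ => hX i _ (hX i p hp))
  rw [eq_top_iff]
  intro p _
  induction p using MvPolynomial.induction_on with
  | C c =>
    rw [← mul_one (C c), ← smul_eq_C_mul]
    exact S.smul_mem c (Submodule.subset_span ⟨0, 0, 1, one_mem_harm a, by simp⟩)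
  | add p q hp hq => exact S.add_mem (hp trivial) (hq trivial)
  | mul_X p i hp =>
    rw [mul_comm]
    refine Fin.lastCases ?_ (fun i => ?_) i
    · exact hT p (hp trivial)
    · exact hX i p (hp trivial)

lemma gradDot_xSq_self : gradDot (xSq n) (xSq n) = 4 * xSq n := by
  simp only [gradDot, pderiv_xSq_castSucc, pderiv_xSq_last, mul_zero, add_zero]
  rw [xSq, Finset.mul_sum]
  exact Finset.sum_congr rfl fun i _ => by ring

lemma gradDot_mul_right (p q r : EvenPoly n) :
    gradDot p (q * r) = q * gradDot p r + r * gradDot p q := by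
  simp only [gradDot, Derivation.leibniz, smul_eq_mul, mul_add, Finset.mul_sum,
    Finset.sum_add_distrib]
  have h1 : ∀ i : Fin n, pderiv i.castSucc p * (q * pderiv i.castSucc r)
      = q * (pderiv i.castSucc p * pderiv i.castSucc r) := fun i => by ring
  have h2 : ∀ i : Fin n, pderiv i.castSucc p * (r * pderiv i.castSucc q)
      = r * (pderiv i.castSucc p * pderiv i.castSucc q) := fun i => by ring
  simp only [h1, h2]; ring

lemma gradDot_comm (p q : EvenPoly n) : gradDot p q = gradDot q p := by
  simp only [gradDot, mul_comm]

lemma gradDot_one (p : EvenPoly n) : gradDot p 1 = 0 := by simp [gradDot]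

lemma gradDot_pow {p q r : EvenPoly n} (h : gradDot p q = r) (k : ℕ) :
    gradDot p (q ^ (k + 1)) = (k + 1 : ℝ) • (q ^ k * r) := by
  induction k with
  | zero => simp [h]
  | succ k ih =>
    rw [pow_succ', gradDot_mul_right, ih, h]
    simp only [smul_eq_C_mul, map_add, map_natCast, map_one, Nat.cast_add, Nat.cast_one]
    ring

lemma lap_xSq_pow (a : ℝ) (k : ℕ) :
    lap a (xSq n ^ (k + 1)) = (2 * (k + 1) * (2 * k + n) : ℝ) • xSq n ^ k := by
  induction k with
  | zero => simp [lap_xSq, smul_eq_C_mul]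
  | succ k ih =>
    rw [pow_succ', lap_mul, ih, lap_xSq, gradDot_pow gradDot_xSq_self]
    simp only [smul_eq_C_mul, map_add, map_mul, map_natCast, map_one, Nat.cast_add, Nat.cast_one,
      show (C 2 : EvenPoly n) = 2 from rfl]
    ring

lemma gradDot_X_last_self :
    gradDot (X (Fin.last n)) (X (Fin.last n)) = 4 * (X (Fin.last n) : EvenPoly n) := by
  simp [gradDot]

lemma lap_X_last_pow (a : ℝ) (k : ℕ) :
    lap a ((X (Fin.last n) : EvenPoly n) ^ (k + 1))
      = (2 * (k + 1) * (2 * k + 1 + a) : ℝ) • X (Fin.last n) ^ k := by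
  induction k with
  | zero => simp [lap_X_last, smul_eq_C_mul]
  | succ k ih =>
    rw [pow_succ', lap_mul, ih, lap_X_last, gradDot_pow gradDot_X_last_self]
    simp only [smul_eq_C_mul, map_add, map_mul, map_natCast, map_one, Nat.cast_add, Nat.cast_one,
      show (C 2 : EvenPoly n) = 2 from rfl]
    ring

/-- The gradients of `|x|²` and `y²` are orthogonal, so `lap` acts on the factors of `|x|^{2j}
y^{2k}` separately. -/
lemma gradDot_xSq_pow_X_last_pow (j k : ℕ) :
    gradDot (xSq n ^ j) ((X (Fin.last n) : EvenPoly n) ^ k) = 0 := by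
  have h1 : gradDot (xSq n) (X (Fin.last n)) = 0 := by
    simp [gradDot, pderiv_xSq_last]
  have h2 : gradDot (X (Fin.last n)) (xSq n ^ j) = 0 := by
    cases j with
    | zero => rw [pow_zero, gradDot_one]
    | succ j => rw [gradDot_pow ((gradDot_comm _ _).trans h1)]; simp
  cases k with
  | zero => rw [pow_zero, gradDot_one]
  | succ k => rw [gradDot_pow ((gradDot_comm _ _).trans h2)]; simp

/-- The even harmonic extension of `|x|^{2m}`. -/
lemma exists_harm_extension {a : ℝ} (ha : -1 < a) (m : ℕ) :
    ∃ h ∈ harm n a (2 * m), ∃ q, h = xSq n ^ m + X (Fin.last n) * q := by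
  -- Induction on `j`: applying `lap` to `|x|^{2j+2} y^{2k+2}` gives a nonzero multiple of
  -- `|x|^{2j+2} y^{2k}` plus a multiple of `|x|^{2j} y^{2k+2}`, which has a smaller power of `|x|`
  -- and is already solved for.
  have key : ∀ j k : ℕ, ∃ q : EvenPoly n, q.IsWeightedHomogeneous (evenWeight n) (2 * (j + k)) ∧
      lap a (X (Fin.last n) * q) = xSq n ^ j * X (Fin.last n) ^ k := by
    intro j
    induction j with
    | zero =>
      intro k
      refine ⟨(2 * (k + 1) * (2 * k + 1 + a) : ℝ)⁻¹ • X (Fin.last n) ^ k, ?_, ?_⟩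
      · refine (weightedHomogeneousSubmodule ℝ (evenWeight n) _).smul_mem _ ?_
        have := (isWeightedHomogeneous_X_last (n := n)).pow k
        rw [mem_weightedHomogeneousSubmodule]
        convert this using 1
        simp; ring
      · have : (2 * (k + 1) * (2 * k + 1 + a) : ℝ) ≠ 0 := by
          have : 0 < 2 * k + 1 + a := by have : (0:ℝ) ≤ k := k.cast_nonneg; linarith
          positivity
        rw [mul_smul_comm, lap_smul, ← pow_succ', lap_X_last_pow, smul_smul,
          inv_mul_cancel₀ this, one_smul, pow_zero, one_mul]
    | succ j ih =>
      intro k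
      obtain ⟨q, hq, hq'⟩ := ih (k + 1)
      set c : ℝ := 2 * (k + 1) * (2 * k + 1 + a) with hc
      set d : ℝ := 2 * (j + 1) * (2 * j + n) with hd
      have hc0 : c ≠ 0 := by
        have : 0 < 2 * k + 1 + a := by have : (0:ℝ) ≤ k := k.cast_nonneg; linarith
        positivity
      refine ⟨c⁻¹ • (xSq n ^ (j + 1) * X (Fin.last n) ^ k - d • q), ?_, ?_⟩
      · refine (weightedHomogeneousSubmodule ℝ (evenWeight n) _).smul_mem _
          (Submodule.sub_mem _ ?_ (Submodule.smul_mem _ _ ?_))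
        · rw [mem_weightedHomogeneousSubmodule]
          convert (isWeightedHomogeneous_xSq.pow (j + 1)).mul
            ((isWeightedHomogeneous_X_last (n := n)).pow k) using 1
          simp; ring
        · rw [mem_weightedHomogeneousSubmodule]
          convert hq using 1; ring
      · have e : X (Fin.last n) * (c⁻¹ • (xSq n ^ (j + 1) * X (Fin.last n) ^ k - d • q))
            = c⁻¹ • (xSq n ^ (j + 1) * X (Fin.last n) ^ (k + 1)
              + (-d) • (X (Fin.last n) * q)) := by
          simp only [smul_eq_C_mul, map_neg]; ring
        rw [e, lap_smul, lap_add, lap_smul, hq', lap_mul, gradDot_xSq_pow_X_last_pow,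
          lap_xSq_pow, lap_X_last_pow, ← hc, ← hd, smul_mul_assoc, mul_smul_comm, mul_zero,
          add_zero, neg_smul, add_comm (d • _), add_neg_cancel_right, smul_smul,
          inv_mul_cancel₀ hc0, one_smul]
  cases m with
  | zero => exact ⟨1, one_mem_harm a, 0, by simp⟩
  | succ m =>
    -- `lap |x|^{2m+2}` is a multiple of `|x|^{2m}`; it is cancelled by a term divisible by `y²`,
    -- which vanishes on the thin set.
    obtain ⟨q, hq, hq'⟩ := key m 0
    set d : ℝ := 2 * (m + 1) * (2 * m + n) with hd
    have e : xSq n ^ (m + 1) + X (Fin.last n) * (-d • q)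
        = xSq n ^ (m + 1) + (-d) • (X (Fin.last n) * q) := by rw [mul_smul_comm]
    refine ⟨xSq n ^ (m + 1) + X (Fin.last n) * ((-d) • q), ⟨?_, ?_⟩, _, rfl⟩
    · refine IsWeightedHomogeneous.add ?_ ?_
      · convert isWeightedHomogeneous_xSq.pow (m + 1) using 1
        simp; ring
      · convert isWeightedHomogeneous_X_last.mul
          ((weightedHomogeneousSubmodule ℝ (evenWeight n) _).smul_mem (-d) hq) using 1
        simp; ring
    · rw [e, lap_add, lap_smul, hq', lap_xSq_pow, ← hd]; simp

end EvenPoly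

/-! ### Polar coordinates for the weighted measures -/

/-- Polar coordinates `(θ, r) ↦ r θ`. -/
def polarMap (n : ℕ) (p : USphere n × Ioi (0 : ℝ)) : Amb n := (p.2 : ℝ) • (p.1 : Amb n)

/-- The radial measure `r^{n+a} dr`. -/
def radialMeasure (n : ℕ) (a : ℝ) : Measure (Ioi (0 : ℝ)) :=
  (Measure.volumeIoiPow n).withDensity (fun r => ENNReal.ofReal ((r : ℝ) ^ a))

lemma continuous_yCoord : Continuous (yCoord : Amb n → ℝ) := by
  unfold yCoord; fun_prop

lemma measurable_abs_yCoord_rpow (a : ℝ) :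
    Measurable (fun X : Amb n => ENNReal.ofReal (|yCoord X| ^ a)) := by
  have := continuous_yCoord (n := n).measurable
  fun_prop

lemma measurable_abs_yCoord_rpow_sphere (a : ℝ) :
    Measurable (fun θ : USphere n => ENNReal.ofReal (|yCoord (θ : Amb n)| ^ a)) :=
  (measurable_abs_yCoord_rpow a).comp measurable_subtype_coe

lemma measurable_ofReal_rpow (a : ℝ) :
    Measurable (fun r : Ioi (0 : ℝ) => ENNReal.ofReal ((r : ℝ) ^ a)) := by fun_prop

lemma bulkMeasure_zero : bulkMeasure n 0 = volume := by
  simp only [bulkMeasure, Real.rpow_zero, ENNReal.ofReal_one]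
  exact withDensity_one

lemma yCoord_smul (r : ℝ) (X : Amb n) : yCoord (r • X) = r * yCoord X := by simp [yCoord]

lemma norm_polarMap (p : USphere n × Ioi (0 : ℝ)) : ‖polarMap n p‖ = p.2 := by
  have : ‖(p.1 : Amb n)‖ = 1 := by simp
  rw [polarMap, norm_smul, this, mul_one, Real.norm_of_nonneg (le_of_lt p.2.2)]

lemma polarMap_ne_zero (p : USphere n × Ioi (0 : ℝ)) : polarMap n p ≠ 0 := by
  rw [← norm_ne_zero_iff, norm_polarMap]; exact (ne_of_gt p.2.2)

lemma homExt_polarMap {F : Type*} [AddCommGroup F] [Module ℝ F] (μ : ℝ) (c : USphere n → F)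
    (p : USphere n × Ioi (0 : ℝ)) : homExt μ c (polarMap n p) = ((p.2 : ℝ) ^ μ) • c p.1 := by
  rw [homExt, dif_neg (polarMap_ne_zero p)]
  have h : ∀ h', (⟨‖polarMap n p‖⁻¹ • polarMap n p, h'⟩ : USphere n) = p.1 := fun h' =>
    Subtype.ext <| by
      simp only [norm_polarMap]
      rw [polarMap, smul_smul, inv_mul_cancel₀ (ne_of_gt p.2.2), one_smul]
  rw [h, norm_polarMap]

lemma polarMap_eq (p : USphere n × Ioi (0 : ℝ)) :
    polarMap n p = ((homeomorphUnitSphereProd (Amb n)).symm p : Amb n) := by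
  simp [polarMap]

/-- As a measurable embedding, the polar map transfers integrals and integrability without
measurability assumptions on the integrand. -/
lemma measurableEmbedding_polarMap : MeasurableEmbedding (polarMap n) := by
  have : polarMap n = Subtype.val ∘ (homeomorphUnitSphereProd (Amb n)).symm :=
    funext polarMap_eq
  rw [this]
  exact (MeasurableEmbedding.subtype_coe (measurableSet_singleton _).compl).comp
    (Homeomorph.measurableEmbedding _)

lemma exists_polarMap {X : Amb n} (hX : X ≠ 0) : ∃ p, polarMap n p = X :=
  ⟨homeomorphUnitSphereProd (Amb n) ⟨X, hX⟩, by rw [polarMap_eq]; simp⟩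

lemma finrank_amb : Module.finrank ℝ (Amb n) = n + 1 := by simp

lemma measurePreserving_polarMap_volume :
    MeasurePreserving (polarMap n)
      ((volume : Measure (Amb n)).toSphere.prod (Measure.volumeIoiPow n)) volume := by
  have h1 := (volume : Measure (Amb n)).measurePreserving_homeomorphUnitSphereProd
  rw [finrank_amb, Nat.add_sub_cancel] at h1
  have h2 := h1.symm (homeomorphUnitSphereProd (Amb n)).toMeasurableEquiv
  refine ⟨measurableEmbedding_polarMap.measurable, ?_⟩
  have : polarMap n = Subtype.val ∘ (homeomorphUnitSphereProd (Amb n)).toMeasurableEquiv.symm :=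
    funext polarMap_eq
  rw [this, ← Measure.map_map measurable_subtype_coe h2.measurable, h2.map_eq,
    (MeasurableEmbedding.subtype_coe (measurableSet_singleton (0 : Amb n)).compl).map_comap,
    Subtype.range_coe, restrict_compl_singleton]

instance : SFinite (radialMeasure n 0) := by unfold radialMeasure; infer_instance
instance (a : ℝ) : SFinite (radialMeasure n a) := by unfold radialMeasure; infer_instance
instance (a : ℝ) : SFinite (sphereMeasure n a) := by unfold sphereMeasure; infer_instance

lemma withDensity_map_of_measurableEmbedding {α β : Type*} [MeasurableSpace α]
    [MeasurableSpace β] {f : α → β} (hf : MeasurableEmbedding f) (μ : Measure α)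
    {g : β → ℝ≥0∞} (hg : Measurable g) :
    (μ.withDensity (g ∘ f)).map f = (μ.map f).withDensity g := by
  ext s hs
  rw [hf.map_apply, withDensity_apply _ (hf.measurable hs), withDensity_apply _ hs,
    setLIntegral_map hs hg hf.measurable]
  rfl

/-- Integration in polar coordinates for the weight `|y|^a`. -/
lemma measurePreserving_polarMap (a : ℝ) :
    MeasurePreserving (polarMap n) ((sphereMeasure n a).prod (radialMeasure n a))
      (bulkMeasure n a) := by
  refine ⟨measurableEmbedding_polarMap.measurable, ?_⟩
  rw [bulkMeasure, ← measurePreserving_polarMap_volume.map_eq,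
    ← withDensity_map_of_measurableEmbedding measurableEmbedding_polarMap _
      (measurable_abs_yCoord_rpow a), sphereMeasure, radialMeasure,
    prod_withDensity (measurable_abs_yCoord_rpow_sphere a) (measurable_ofReal_rpow a)]
  congr 2
  funext p
  have hr : (0 : ℝ) < p.2 := p.2.2
  -- The weight separates: `|y|^a = r^a |θ_y|^a`.
  rw [Function.comp_apply, polarMap, yCoord_smul, abs_mul, abs_of_pos hr,
    Real.mul_rpow hr.le (abs_nonneg _), ENNReal.ofReal_mul (by positivity), mul_comm]

lemma ae_volume_yCoord_ne_zero : ∀ᵐ X : Amb n, yCoord X ≠ 0 := by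
  let f : Amb n →ₗ[ℝ] ℝ := (EuclideanSpace.proj (Fin.last n) : Amb n →L[ℝ] ℝ).toLinearMap
  have h := Measure.addHaar_submodule (volume : Measure (Amb n)) (LinearMap.ker f) (by
    intro htop
    have : (EuclideanSpace.single (Fin.last n) (1 : ℝ) : Amb n) ∈ LinearMap.ker f := by
      rw [htop]; trivial
    simp [f] at this)
  rw [ae_iff]
  convert h using 2
  ext X
  simp [f, yCoord]

/-- The weight is positive off the null set `y = 0`. With the converse below, Lebesgue and weighted
measure have the same null sets, for every `a`. -/
lemma volume_ac_bulkMeasure (a : ℝ) : (volume : Measure (Amb n)) ≪ bulkMeasure n a := by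
  refine withDensity_absolutelyContinuous' (measurable_abs_yCoord_rpow a).aemeasurable ?_
  filter_upwards [ae_volume_yCoord_ne_zero] with X hX
  have : 0 < |yCoord X| := abs_pos.mpr hX
  simp only [ne_eq, ENNReal.ofReal_eq_zero, not_le]
  positivity

lemma bulkMeasure_ac_volume (a : ℝ) : bulkMeasure n a ≪ (volume : Measure (Amb n)) :=
  withDensity_absolutelyContinuous _ _

/-- Needed to pass from a property of the direction holding almost everywhere in the product to one
holding almost everywhere on the sphere. -/
lemma radialMeasure_ne_zero (a : ℝ) : radialMeasure n a ≠ 0 := by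
  intro h
  have h1 : Measure.volumeIoiPow n = 0 := by
    have : Measure.volumeIoiPow n ≪ radialMeasure n a := by
      refine withDensity_absolutelyContinuous' (measurable_ofReal_rpow a).aemeasurable ?_
      refine .of_forall fun r => ?_
      have : (0 : ℝ) < r := r.2
      simp only [ne_eq, ENNReal.ofReal_eq_zero, not_le]
      positivity
    rw [h] at this
    exact Measure.absolutelyContinuous_zero_iff.mp this
  have := Measure.volumeIoiPow_apply_Iio n ⟨1, mem_Ioi.2 one_pos⟩
  rw [h1] at this
  simp only [Measure.coe_zero, Pi.zero_apply, one_pow] at this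
  have h2 : 0 < (1 : ℝ) / (n + 1) := by positivity
  exact absurd (ENNReal.ofReal_eq_zero.mp this.symm) (not_le.mpr h2)

/-- A property of the direction holds almost everywhere in space iff it holds almost everywhere on
the sphere. -/
lemma ae_sphere_of_ae_polar {a : ℝ} {p : USphere n → Prop}
    (h : ∀ᵐ q ∂((sphereMeasure n a).prod (radialMeasure n a)), p q.1) :
    ∀ᵐ θ ∂(sphereMeasure n a), p θ := by
  have h1 := Measure.ae_ae_of_ae_prod h
  have : NeZero (radialMeasure n a) := ⟨radialMeasure_ne_zero a⟩
  filter_upwards [h1] with θ hθ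
  exact (hθ.exists).choose_spec

lemma ae_polar_of_ae_volume {a : ℝ} {p : Amb n → Prop} (h : ∀ᵐ X : Amb n, p X) :
    ∀ᵐ q ∂((sphereMeasure n a).prod (radialMeasure n a)), p (polarMap n q) :=
  (measurePreserving_polarMap a).quasiMeasurePreserving.ae ((bulkMeasure_ac_volume a).ae_le h)

lemma ae_volume_of_ae_polar {a : ℝ} {p : Amb n → Prop}
    (h : ∀ᵐ q ∂((sphereMeasure n a).prod (radialMeasure n a)), p (polarMap n q)) :
    ∀ᵐ X : Amb n, p X := by
  have h1 : ∀ᵐ X ∂(bulkMeasure n a), p X := by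
    rw [← (measurePreserving_polarMap a).map_eq]
    exact measurableEmbedding_polarMap.ae_map_iff.mpr h
  exact (volume_ac_bulkMeasure a).ae_le h1

lemma ae_homExt_eq {F : Type*} [AddCommGroup F] [Module ℝ F] {a : ℝ} (μ : ℝ)
    {c c' : USphere n → F} (h : c =ᵐ[sphereMeasure n a] c') :
    homExt μ c =ᵐ[volume] homExt μ c' := by
  refine ae_volume_of_ae_polar (a := a) ?_
  have := Measure.quasiMeasurePreserving_fst (μ := sphereMeasure n a)
    (ν := radialMeasure n a) |>.ae h
  filter_upwards [this] with q hq
  rw [homExt_polarMap, homExt_polarMap, hq]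

lemma integral_radialMeasure (a : ℝ) (u : ℝ → ℝ) :
    ∫ r, u r ∂(radialMeasure n a) = ∫ r in Ioi (0 : ℝ), r ^ (n + a) * u r := by
  simp only [radialMeasure, Measure.volumeIoiPow, ENNReal.ofReal]
  rw [integral_withDensity_eq_integral_smul (by fun_prop),
    integral_withDensity_eq_integral_smul (by fun_prop),
    integral_subtype_comap measurableSet_Ioi
      (fun r : ℝ => Real.toNNReal (r ^ n) • Real.toNNReal (r ^ a) • u r)]
  refine setIntegral_congr_fun measurableSet_Ioi fun r hr => ?_
  have hr : 0 < r := hr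
  simp only [NNReal.smul_def, Real.coe_toNNReal _ (pow_nonneg hr.le n),
    Real.coe_toNNReal _ (Real.rpow_nonneg hr.le a), smul_eq_mul]
  rw [Real.rpow_add hr, Real.rpow_natCast, mul_assoc]

lemma integrable_radialMeasure (a : ℝ) (u : ℝ → ℝ) :
    Integrable (fun r : Ioi (0 : ℝ) => u r) (radialMeasure n a)
      ↔ IntegrableOn (fun r => r ^ (n + a) * u r) (Ioi 0) := by
  simp only [radialMeasure, Measure.volumeIoiPow]
  rw [integrable_withDensity_iff_integrable_smul' (by fun_prop) (by simp),
    integrable_withDensity_iff_integrable_smul' (by fun_prop) (by simp),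
    integrableOn_iff_comap_subtypeVal measurableSet_Ioi]
  refine integrable_congr (.of_forall fun r => ?_)
  have hr : (0 : ℝ) < r := r.2
  simp only [ENNReal.toReal_ofReal (pow_nonneg hr.le n),
    ENNReal.toReal_ofReal (Real.rpow_nonneg hr.le a), smul_eq_mul, Function.comp_apply]
  rw [Real.rpow_add hr, Real.rpow_natCast, mul_assoc]

section Integration

variable {F : Type*} [NormedAddCommGroup F]

lemma integrable_bulk_iff {a : ℝ} {f : Amb n → F} :
    Integrable f (bulkMeasure n a)
      ↔ Integrable (fun q => f (polarMap n q)) ((sphereMeasure n a).prod (radialMeasure n a)) :=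
  ((measurePreserving_polarMap a).integrable_comp_emb measurableEmbedding_polarMap).symm

lemma aestronglyMeasurable_bulk_iff {a : ℝ} {f : Amb n → F} :
    AEStronglyMeasurable f (bulkMeasure n a)
      ↔ AEStronglyMeasurable (fun q => f (polarMap n q))
        ((sphereMeasure n a).prod (radialMeasure n a)) := by
  rw [← (measurePreserving_polarMap (n := n) a).map_eq]
  exact measurableEmbedding_polarMap.aestronglyMeasurable_map_iff

variable [NormedSpace ℝ F]

lemma integral_bulk_eq (a : ℝ) (f : Amb n → F) :
    ∫ X, f X ∂(bulkMeasure n a)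
      = ∫ q, f (polarMap n q) ∂((sphereMeasure n a).prod (radialMeasure n a)) :=
  ((measurePreserving_polarMap a).integral_comp measurableEmbedding_polarMap f).symm

lemma aestronglyMeasurable_homExt {a : ℝ} (μ : ℝ) {c : USphere n → F}
    (hc : AEStronglyMeasurable c (sphereMeasure n a)) :
    AEStronglyMeasurable (homExt μ c) (bulkMeasure n a) := by
  rw [aestronglyMeasurable_bulk_iff]
  simp only [homExt_polarMap]
  refine AEStronglyMeasurable.smul ?_ hc.comp_fst
  have : Measurable fun q : USphere n × Ioi (0 : ℝ) => (q.2 : ℝ) ^ μ := by fun_prop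
  exact this.aestronglyMeasurable

/-- The product formula for separated integrands needs no integrability: both sides take the default
value zero together. -/
lemma integral_bulk_separated (a : ℝ) (u : ℝ → ℝ) (c : USphere n → F) {f : Amb n → F}
    (hf : ∀ q, f (polarMap n q) = u q.2 • c q.1) :
    ∫ X, f X ∂(bulkMeasure n a)
      = (∫ r in Ioi (0 : ℝ), r ^ (n + a) * u r) • ∫ θ, c θ ∂(sphereMeasure n a) := by
  rw [integral_bulk_eq, ← integral_radialMeasure, ← Measure.prod_swap,
    show (Prod.swap : Ioi (0 : ℝ) × USphere n → _) = MeasurableEquiv.prodComm from rfl,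
    integral_map_equiv MeasurableEquiv.prodComm, ← integral_prod_smul]
  exact integral_congr_ae (.of_forall fun q => hf (q.2, q.1))

lemma integrable_bulk_separated {a : ℝ} {u : ℝ → ℝ} {c : USphere n → F} {f : Amb n → F}
    (hf : ∀ q, f (polarMap n q) = u q.2 • c q.1)
    (hu : IntegrableOn (fun r => r ^ (n + a) * u r) (Ioi 0))
    (hc : Integrable c (sphereMeasure n a)) : Integrable f (bulkMeasure n a) := by
  rw [integrable_bulk_iff]
  have := ((integrable_radialMeasure a u).mpr hu).smul_prod hc
  refine this.swap.congr (.of_forall fun q => ?_)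
  simp [hf]

end Integration

/-! ### Local integrability of the weight -/

lemma integrableOn_rpow_Ioo {s : ℝ} (hs : -1 < s) (R : ℝ) :
    IntegrableOn (fun r : ℝ => r ^ s) (Ioo 0 R) := by
  rcases le_or_gt R 0 with h | h
  · simp [Ioo_eq_empty (not_lt.mpr h)]
  · exact (intervalIntegral.integrableOn_Ioo_rpow_iff h).mpr hs

lemma integrableOn_abs_rpow {a : ℝ} (ha : -1 < a) (R : ℝ) :
    IntegrableOn (fun y : ℝ => |y| ^ a) (Icc (-R) R) := by
  have h1 : IntegrableOn (fun y : ℝ => |y| ^ a) (Ioo 0 R) :=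
    (integrableOn_rpow_Ioo ha R).congr_fun (fun r hr => by simp only [abs_of_pos hr.1])
      measurableSet_Ioo
  have h2 : IntegrableOn (fun y : ℝ => |y| ^ a) (Ioo (-R) 0) := by
    have := h1.comp_neg
    simpa using this
  have h3 : IntegrableOn (fun y : ℝ => |y| ^ a) (Ioo (-R) 0 ∪ Ioo 0 R) := h2.union h1
  refine h3.congr_set_ae ?_
  have : ∀ᵐ y : ℝ, y ∉ ({0, R, -R} : Set ℝ) :=
    measure_eq_zero_iff_ae_notMem.mp (Set.Finite.measure_zero (by simp) _)
  filter_upwards [this] with y hy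
  simp only [mem_insert_iff, mem_singleton_iff, not_or] at hy
  apply propext
  change y ∈ Icc (-R) R ↔ y ∈ Ioo (-R) 0 ∪ Ioo 0 R
  simp only [mem_Icc, mem_union, mem_Ioo]
  constructor
  · rintro ⟨h1, h2⟩
    rcases lt_or_gt_of_ne hy.1 with h | h
    · exact Or.inl ⟨lt_of_le_of_ne h1 (Ne.symm hy.2.2), h⟩
    · exact Or.inr ⟨h, lt_of_le_of_ne h2 hy.2.1⟩
  · rintro (⟨h1, h2⟩ | ⟨h1, h2⟩) <;> constructor <;> linarith

/-- The weight `|y|^a` is integrable on bounded sets. -/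
lemma integrableOn_abs_yCoord_rpow {a : ℝ} (ha : -1 < a) {s : Set (Amb n)}
    (hs : Bornology.IsBounded s) : IntegrableOn (fun X : Amb n => |yCoord X| ^ a) s := by
  obtain ⟨R, hR⟩ := hs.subset_closedBall 0
  -- On a ball the weight agrees with a product function supported in a cube, whose only singular
  -- factor is `|y|^a`, integrable since `a > -1`.
  have h1 : Integrable (fun x : Fin (n + 1) → ℝ => ∏ i,
      (Icc (-R) R).indicator (fun y : ℝ => if i = Fin.last n then |y| ^ a else 1) (x i)) := by
    refine Integrable.fintype_prod
      (f := fun i => (Icc (-R) R).indicator (fun y : ℝ => if i = Fin.last n then |y| ^ a else 1))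
      fun i => ?_
    rw [integrable_indicator_iff measurableSet_Icc]
    by_cases hi : i = Fin.last n
    · simpa [hi] using integrableOn_abs_rpow ha R
    · simp [hi]
  have h2 := (EuclideanSpace.volume_preserving_symm_measurableEquiv_toLp
    (Fin (n + 1))).integrable_comp_emb (MeasurableEquiv.measurableEmbedding _) |>.mpr h1
  refine IntegrableOn.mono_set ?_ hR
  refine (h2.integrableOn (s := Metric.closedBall 0 R)).congr_fun (fun X hX => ?_)
    Metric.isClosed_closedBall.measurableSet
  have hX' : ∀ i, X i ∈ Icc (-R) R := fun i => by
    rw [mem_Icc, ← abs_le]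
    exact (PiLp.norm_apply_le X i).trans (by simpa using hX)
  simp only [Function.comp_apply]
  have : ∀ i, (Icc (-R) R).indicator (fun y : ℝ => if i = Fin.last n then |y| ^ a else 1)
      (X i) = if i = Fin.last n then |X i| ^ a else 1 := fun i => indicator_of_mem (hX' i) _
  simp [this, yCoord]

lemma bulkMeasure_lt_top {a : ℝ} (ha : -1 < a) {s : Set (Amb n)} (hs : Bornology.IsBounded s) :
    bulkMeasure n a s < ⊤ := by
  obtain ⟨R, hR⟩ := hs.subset_closedBall 0
  refine (measure_mono hR).trans_lt ?_
  rw [bulkMeasure, withDensity_apply _ Metric.isClosed_closedBall.measurableSet]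
  have := (integrableOn_abs_yCoord_rpow (n := n) ha (Metric.isBounded_closedBall
    (x := (0 : Amb n)) (r := R))).lintegral_lt_top
  exact this

/-- The weighted mass of the unit ball is finite, and it is the mass of the sphere times the nonzero
radial mass of `(0, 1)`. -/
lemma isFiniteMeasure_sphereMeasure {a : ℝ} (ha : -1 < a) :
    IsFiniteMeasure (sphereMeasure n a) := by
  have h1 := bulkMeasure_lt_top (n := n) ha (Metric.isBounded_ball (x := 0) (r := 1))
  rw [← (measurePreserving_polarMap a).map_eq,
    measurableEmbedding_polarMap.map_apply] at h1
  have h2 : polarMap n ⁻¹' Metric.ball 0 1 = univ ×ˢ {r : Ioi (0 : ℝ) | (r : ℝ) < 1} := by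
    ext q; simp [norm_polarMap]
  rw [h2, Measure.prod_prod] at h1
  refine ⟨?_⟩
  by_contra hne
  rw [not_lt, top_le_iff] at hne
  rw [hne] at h1
  have h0 : radialMeasure n a {r : Ioi (0 : ℝ) | (r : ℝ) < 1} ≠ 0 := by
    intro h0
    have hac : Measure.volumeIoiPow n ≪ radialMeasure n a := by
      refine withDensity_absolutelyContinuous' (measurable_ofReal_rpow a).aemeasurable ?_
      refine .of_forall fun r => ?_
      have : (0 : ℝ) < r := r.2
      simp only [ne_eq, ENNReal.ofReal_eq_zero, not_le]
      positivity
    have h3 := hac h0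
    have h4 := Measure.volumeIoiPow_apply_Iio n ⟨1, mem_Ioi.2 one_pos⟩
    have h5 : Iio (⟨1, mem_Ioi.2 one_pos⟩ : Ioi (0 : ℝ)) = {r : Ioi (0 : ℝ) | (r : ℝ) < 1} := by
      ext r; simp [← Subtype.coe_lt_coe]
    rw [h5, h3] at h4
    simp only [one_pow] at h4
    have h2 : 0 < (1 : ℝ) / (n + 1) := by positivity
    exact absurd (ENNReal.ofReal_eq_zero.mp h4.symm) (not_le.mpr h2)
  rw [ENNReal.top_mul h0] at h1
  exact lt_irrefl _ h1

/-! ### Weak gradients: calculus rules and removability of a point -/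

section Calculus

variable {F : Type*} [NormedAddCommGroup F] [NormedSpace ℝ F]

lemma integrable_smul_of_tsupport_subset {Ω : Set (Amb n)} {μ : Measure (Amb n)} {f : Amb n → F}
    {k : Amb n → ℝ} (hf : LocallyIntegrableOn f Ω μ) (hk : Continuous k)
    (hc : HasCompactSupport k) (hs : tsupport k ⊆ Ω) : Integrable (fun X => k X • f X) μ := by
  have h1 : IntegrableOn f (tsupport k) μ := hf.integrableOn_compact_subset hs hc
  have h2 : IntegrableOn (fun X => k X • f X) (tsupport k) μ :=
    h1.continuousOn_smul hk.continuousOn hc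
  refine (integrableOn_iff_integrable_of_support_subset ?_).mp h2
  intro X hX
  by_contra h
  exact hX (by simp [image_eq_zero_of_notMem_tsupport h])

lemma integrable_mul_of_tsupport_subset {Ω : Set (Amb n)} {μ : Measure (Amb n)} {f : Amb n → ℝ}
    {k : Amb n → ℝ} (hf : LocallyIntegrableOn f Ω μ) (hk : Continuous k)
    (hc : HasCompactSupport k) (hs : tsupport k ⊆ Ω) : Integrable (fun X => f X * k X) μ := by
  simpa [mul_comm] using integrable_smul_of_tsupport_subset hf hk hc hs

lemma tsupport_fderiv_test_subset (ψ : Amb n → ℝ) (w : Amb n) :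
    tsupport (fun X => fderiv ℝ ψ X w) ⊆ tsupport ψ := by
  refine closure_minimal (fun X hX => ?_) (isClosed_tsupport ψ)
  refine tsupport_fderiv_subset (𝕜 := ℝ) (subset_tsupport _ ?_)
  intro h
  exact hX (by simp [h])

lemma continuous_fderiv_apply {ψ : Amb n → ℝ} (hψ : ContDiff ℝ ∞ ψ) (w : Amb n) :
    Continuous (fun X => fderiv ℝ ψ X w) :=
  (hψ.continuous_fderiv (by simp)).clm_apply continuous_const

lemma hasCompactSupport_fderiv_apply' {ψ : Amb n → ℝ} (hψ : HasCompactSupport ψ) (w : Amb n) :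
    HasCompactSupport (fun X => fderiv ℝ ψ X w) :=
  hψ.of_isClosed_subset (isClosed_tsupport _) (tsupport_fderiv_test_subset ψ w)

lemma _root_.MeasureTheory.LocallyIntegrableOn.inner_const {Ω : Set (Amb n)} {G : Amb n → Amb n}
    (hG : LocallyIntegrableOn G Ω) (w : Amb n) :
    LocallyIntegrableOn (fun X => inner ℝ (G X) w) Ω := by
  intro X hX
  obtain ⟨s, hs, hi⟩ := hG X hX
  refine ⟨s, hs, ?_⟩
  have := (innerSL ℝ w).integrable_comp hi
  simpa [IntegrableOn, real_inner_comm] using this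

lemma contDiff_mul_of_tsupport_subset {Ω : Set (Amb n)} (hΩ : IsOpen Ω) {g ψ : Amb n → ℝ}
    (hg : ContDiffOn ℝ ∞ g Ω) (hψ : ContDiff ℝ ∞ ψ) (hs : tsupport ψ ⊆ Ω) :
    ContDiff ℝ ∞ (fun X => g X * ψ X) := by
  rw [contDiff_iff_contDiffAt]
  intro X
  by_cases hX : X ∈ tsupport ψ
  · exact (hg.contDiffAt (hΩ.mem_nhds (hs hX))).mul hψ.contDiffAt
  · have : (fun X => g X * ψ X) =ᶠ[𝓝 X] fun _ => 0 := by
      filter_upwards [(isClosed_tsupport ψ).isOpen_compl.mem_nhds hX] with Y hY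
      rw [image_eq_zero_of_notMem_tsupport hY, mul_zero]
    exact contDiffAt_const.congr_of_eventuallyEq this

lemma tsupport_mul_subset_right' (g ψ : Amb n → ℝ) :
    tsupport (fun X => g X * ψ X) ⊆ tsupport ψ :=
  tsupport_mul_subset_right

end Calculus

namespace HasWeakGradientOn

variable {Ω : Set (Amb n)} {v v' : Amb n → ℝ} {G G' : Amb n → Amb n}

/-- Test integrands vanish off `Ω`, so weak gradients can be handled with integrals over the whole
space; `integral_eq` and `of_integral_eq` rest on this. -/
lemma setIntegral_test {f : Amb n → ℝ} {ψ : Amb n → ℝ} (hs : tsupport ψ ⊆ Ω)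
    (hf : ∀ X, X ∉ tsupport ψ → f X = 0) : ∫ X in Ω, f X = ∫ X, f X :=
  setIntegral_eq_integral_of_forall_compl_eq_zero fun X hX => hf X fun h => hX (hs h)

lemma fderiv_eq_zero_of_notMem {ψ : Amb n → ℝ} {X : Amb n} (h : X ∉ tsupport ψ) (w : Amb n) :
    fderiv ℝ ψ X w = 0 := by
  by_contra hne
  exact h (tsupport_fderiv_test_subset ψ w (subset_tsupport _ hne))

lemma integral_eq (h : HasWeakGradientOn Ω v G) {ψ : Amb n → ℝ} (hψ : ContDiff ℝ ∞ ψ)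
    (hc : HasCompactSupport ψ) (hs : tsupport ψ ⊆ Ω) (w : Amb n) :
    ∫ X, v X * fderiv ℝ ψ X w = - ∫ X, inner ℝ (G X) w * ψ X := by
  rw [← setIntegral_test hs fun X hX => by rw [fderiv_eq_zero_of_notMem hX, mul_zero],
    ← setIntegral_test hs fun X hX => by rw [image_eq_zero_of_notMem_tsupport hX, mul_zero]]
  exact h.2.2 ψ hψ hc hs w

lemma of_integral_eq (hv : LocallyIntegrableOn v Ω) (hG : LocallyIntegrableOn G Ω)
    (h : ∀ ψ : Amb n → ℝ, ContDiff ℝ ∞ ψ → HasCompactSupport ψ → tsupport ψ ⊆ Ω →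
      ∀ w : Amb n, ∫ X, v X * fderiv ℝ ψ X w = - ∫ X, inner ℝ (G X) w * ψ X) :
    HasWeakGradientOn Ω v G := by
  refine ⟨hv, hG, fun ψ hψ hc hs w => ?_⟩
  rw [setIntegral_test hs fun X hX => by rw [fderiv_eq_zero_of_notMem hX, mul_zero],
    setIntegral_test hs fun X hX => by rw [image_eq_zero_of_notMem_tsupport hX, mul_zero]]
  exact h ψ hψ hc hs w

lemma mono (h : HasWeakGradientOn Ω v G) {Ω' : Set (Amb n)} (hΩ : Ω' ⊆ Ω) :
    HasWeakGradientOn Ω' v G :=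
  of_integral_eq (h.1.mono_set hΩ) (h.2.1.mono_set hΩ)
    fun _ hψ hc hs w => h.integral_eq hψ hc (hs.trans hΩ) w

lemma congr (h : HasWeakGradientOn Ω v G) (hv : v =ᵐ[volume.restrict Ω] v')
    (hG : G =ᵐ[volume.restrict Ω] G') : HasWeakGradientOn Ω v' G' := by
  refine ⟨h.1.congr hv, h.2.1.congr hG, fun ψ hψ hc hs w => ?_⟩
  have h1 := h.2.2 ψ hψ hc hs w
  have e1 : ∫ X in Ω, v' X * fderiv ℝ ψ X w = ∫ X in Ω, v X * fderiv ℝ ψ X w :=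
    integral_congr_ae (by filter_upwards [hv] with X hX; rw [hX])
  have e2 : ∫ X in Ω, inner ℝ (G' X) w * ψ X = ∫ X in Ω, inner ℝ (G X) w * ψ X :=
    integral_congr_ae (by filter_upwards [hG] with X hX; rw [hX])
  rw [e1, e2, h1]

lemma add (h : HasWeakGradientOn Ω v G) (h' : HasWeakGradientOn Ω v' G') :
    HasWeakGradientOn Ω (fun X => v X + v' X) (fun X => G X + G' X) := by
  refine of_integral_eq (h.1.add h'.1) (h.2.1.add h'.2.1) fun ψ hψ hc hs w => ?_
  have hd := continuous_fderiv_apply hψ w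
  have hdc := hasCompactSupport_fderiv_apply' hc w
  have hds := (tsupport_fderiv_test_subset ψ w).trans hs
  simp only [add_mul, inner_add_left]
  rw [integral_add (integrable_mul_of_tsupport_subset h.1 hd hdc hds)
      (integrable_mul_of_tsupport_subset h'.1 hd hdc hds),
    integral_add (integrable_mul_of_tsupport_subset (h.2.1.inner_const w) hψ.continuous hc hs)
      (integrable_mul_of_tsupport_subset (h'.2.1.inner_const w) hψ.continuous hc hs),
    h.integral_eq hψ hc hs w, h'.integral_eq hψ hc hs w]
  ring

lemma const_smul (h : HasWeakGradientOn Ω v G) (c : ℝ) :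
    HasWeakGradientOn Ω (fun X => c * v X) (fun X => c • G X) := by
  refine of_integral_eq (h.1.smul c) (h.2.1.smul c) fun ψ hψ hc hs w => ?_
  simp only [mul_assoc, real_inner_smul_left, integral_const_mul, h.integral_eq hψ hc hs w]
  ring

/-- The weak gradient is unique. -/
lemma ae_eq (hΩ : IsOpen Ω) (h : HasWeakGradientOn Ω v G) (h' : HasWeakGradientOn Ω v G') :
    G =ᵐ[volume.restrict Ω] G' := by
  have key : ∀ i : Fin (n + 1), ∀ᵐ X, X ∈ Ω →
      inner ℝ (G X - G' X) (EuclideanSpace.single i (1 : ℝ)) = 0 := by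
    intro i
    refine hΩ.ae_eq_zero_of_integral_contDiff_smul_eq_zero
      ((h.2.1.sub h'.2.1).inner_const _) fun ψ hψ hc hs => ?_
    set w : Amb n := EuclideanSpace.single i 1
    have e : ∀ X, ψ X • inner ℝ ((G - G') X) w
        = inner ℝ (G X) w * ψ X - inner ℝ (G' X) w * ψ X := fun X => by
      simp only [Pi.sub_apply, inner_sub_left, smul_eq_mul]; ring
    have e' : ∀ X, ψ X • inner ℝ (G X - G' X) w
        = inner ℝ (G X) w * ψ X - inner ℝ (G' X) w * ψ X := fun X => by
      simp only [inner_sub_left, smul_eq_mul]; ring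
    simp only [e']
    rw [integral_sub (integrable_mul_of_tsupport_subset (h.2.1.inner_const w) hψ.continuous hc hs)
      (integrable_mul_of_tsupport_subset (h'.2.1.inner_const w) hψ.continuous hc hs)]
    have h1 := h.integral_eq hψ hc hs w
    have h2 := h'.integral_eq hψ hc hs w
    linarith
  rw [Filter.EventuallyEq, ae_restrict_iff' hΩ.measurableSet]
  filter_upwards [ae_all_iff.mpr key] with X hX hXΩ
  ext i
  have := hX i hXΩ
  simp only [EuclideanSpace.inner_single_right, one_mul] at this
  simpa [sub_eq_zero] using this

lemma of_contDiffOn (hΩ : IsOpen Ω) {u : Amb n → ℝ} (hu : ContDiffOn ℝ ∞ u Ω) :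
    HasWeakGradientOn Ω u (gradient u) := by
  have hcu : ContinuousOn u Ω := hu.continuousOn
  have hcg : ContinuousOn (gradient u) Ω :=
    (InnerProductSpace.toDual ℝ (Amb n)).symm.continuous.comp_continuousOn
      (hu.continuousOn_fderiv_of_isOpen hΩ (by simp))
  have hlu := hcu.locallyIntegrableOn (μ := volume) hΩ.measurableSet
  have hlg := hcg.locallyIntegrableOn (μ := volume) hΩ.measurableSet
  refine of_integral_eq hlu hlg fun ψ hψ hc hs w => ?_
  have hd : ∀ X, inner ℝ (gradient u X) w = fderiv ℝ u X w := fun X => by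
    simp [gradient, InnerProductSpace.toDual_symm_apply]
  simp only [hd]
  have i1 := integrable_mul_of_tsupport_subset (hlg.inner_const w) hψ.continuous hc hs
  simp only [hd] at i1
  exact integral_mul_fderiv_eq_neg_fderiv_mul_of_integrable i1
    (integrable_mul_of_tsupport_subset hlu (continuous_fderiv_apply hψ w)
      (hasCompactSupport_fderiv_apply' hc w) ((tsupport_fderiv_test_subset ψ w).trans hs))
    (integrable_mul_of_tsupport_subset hlu hψ.continuous hc hs)
    (fun X hX => (hu.contDiffAt (hΩ.mem_nhds (hs hX))).differentiableAt (by simp))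
    (fun X _ => (hψ.differentiable (by simp)) X)

lemma inner_gradient (u : Amb n → ℝ) (X w : Amb n) :
    inner ℝ (gradient u X) w = fderiv ℝ u X w := by
  simp [gradient, InnerProductSpace.toDual_symm_apply]

/-- The product rule for a smooth factor. -/
lemma mul_contDiffOn (hΩ : IsOpen Ω) (h : HasWeakGradientOn Ω v G) {g : Amb n → ℝ}
    (hg : ContDiffOn ℝ ∞ g Ω) :
    HasWeakGradientOn Ω (fun X => g X * v X) (fun X => g X • G X + v X • gradient g X) := by
  have hcg : ContinuousOn (gradient g) Ω :=
    (InnerProductSpace.toDual ℝ (Amb n)).symm.continuous.comp_continuousOn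
      (hg.continuousOn_fderiv_of_isOpen hΩ (by simp))
  have hl1 : LocallyIntegrableOn (fun X => g X * v X) Ω :=
    h.1.continuousOn_mul hg.continuousOn hΩ.isLocallyClosed
  have hl2 : LocallyIntegrableOn (fun X => g X • G X) Ω :=
    h.2.1.continuousOn_smul hΩ.isLocallyClosed hg.continuousOn
  have hl3 : LocallyIntegrableOn (fun X => v X • gradient g X) Ω :=
    h.1.smul_continuousOn hΩ.isLocallyClosed hcg
  refine of_integral_eq hl1 (hl2.add hl3) fun ψ hψ hc hs w => ?_
  -- `g ψ` is an admissible test function: it is smooth everywhere because `ψ` is supported where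
  -- `g` is smooth.
  have hgψ := contDiff_mul_of_tsupport_subset hΩ hg hψ hs
  have hts := tsupport_mul_subset_right' g ψ
  have hcgψ : HasCompactSupport (fun X => g X * ψ X) :=
    hc.of_isClosed_subset (isClosed_tsupport _) hts
  have h1 := h.integral_eq hgψ hcgψ (hts.trans hs) w
  have e1 : ∀ X, v X * fderiv ℝ (fun X => g X * ψ X) X w
      = g X * v X * fderiv ℝ ψ X w + inner ℝ (v X • gradient g X) w * ψ X := by
    intro X
    rw [real_inner_smul_left, inner_gradient]
    by_cases hX : X ∈ tsupport ψ
    · rw [fderiv_fun_mul ((hg.contDiffAt (hΩ.mem_nhds (hs hX))).differentiableAt (by simp))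
        ((hψ.differentiable (by simp)) X)]
      simp only [add_apply, smul_apply, smul_eq_mul]
      ring
    · rw [fderiv_eq_zero_of_notMem (fun hX' => hX (hts hX')),
        fderiv_eq_zero_of_notMem hX, image_eq_zero_of_notMem_tsupport hX]
      ring
  have i1 := integrable_mul_of_tsupport_subset hl1 (continuous_fderiv_apply hψ w)
      (hasCompactSupport_fderiv_apply' hc w) ((tsupport_fderiv_test_subset ψ w).trans hs)
  have i2 := integrable_mul_of_tsupport_subset (hl3.inner_const w) hψ.continuous hc hs
  have i3 := integrable_mul_of_tsupport_subset (hl2.inner_const w) hψ.continuous hc hs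
  simp only [e1] at h1
  rw [integral_add i1 i2] at h1
  simp only [inner_add_left, add_mul]
  rw [integral_add i3 i2]
  have e2 : ∀ X, inner ℝ (G X) w * (g X * ψ X) = inner ℝ (g X • G X) w * ψ X := fun X => by
    rw [real_inner_smul_left]; ring
  simp only [e2] at h1
  linarith

/-- A point is removable for the weak gradient of a function of small mass near the point. -/
lemma of_compl_zero (h : HasWeakGradientOn (Ω \ {0}) v G) (hv : LocallyIntegrableOn v Ω)
    (hG : LocallyIntegrableOn G Ω)
    (hi : ∀ᶠ k : ℕ in atTop, IntegrableOn v (Metric.ball 0 (2 / (k + 1 : ℝ))))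
    (hm : Tendsto (fun k : ℕ => (k + 1 : ℝ) * ∫ X in Metric.ball 0 (2 / (k + 1 : ℝ)), ‖v X‖)
      atTop (𝓝 0)) : HasWeakGradientOn Ω v G := by
  refine of_integral_eq hv hG fun ψ hψ hc hs w => ?_
  let χ : ContDiffBump (0 : Amb n) := ⟨1, 2, one_pos, one_lt_two⟩
  -- Cutoffs vanishing for `|X| ≤ 1/(k+1)` and equal to one for `|X| ≥ 2/(k+1)`.
  let θ : ℕ → Amb n → ℝ := fun k X => 1 - χ ((k + 1 : ℝ) • X)
  have hθs : ∀ k, ContDiff ℝ ∞ (θ k) := fun k =>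
    contDiff_const.sub (χ.contDiff.comp (contDiff_const_smul _))
  have hθb : ∀ k X, |θ k X| ≤ 1 := fun k X => by
    rw [abs_le]; constructor <;> simp only [θ] <;>
      linarith [χ.nonneg (x := (k + 1 : ℝ) • X), χ.le_one (x := (k + 1 : ℝ) • X)]
  have hpos : ∀ k : ℕ, (0 : ℝ) < k + 1 := fun k => by positivity
  have hθ1 : ∀ (k : ℕ) X, 2 / (k + 1 : ℝ) ≤ ‖X‖ → θ k X = 1 := fun k X hX => by
    have : χ ((k + 1 : ℝ) • X) = 0 := by
      apply χ.zero_of_le_dist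
      rw [dist_zero_right, norm_smul, Real.norm_of_nonneg (hpos k).le]
      rwa [div_le_iff₀' (hpos k)] at hX
    simp [θ, this]
  have hθ0 : ∀ (k : ℕ) X, ‖X‖ ≤ 1 / (k + 1 : ℝ) → θ k X = 0 := fun k X hX => by
    have : χ ((k + 1 : ℝ) • X) = 1 := by
      apply χ.one_of_mem_closedBall
      rw [mem_closedBall_zero_iff, norm_smul, Real.norm_of_nonneg (hpos k).le]
      rwa [le_div_iff₀' (hpos k)] at hX
    simp [θ, this]
  have hθlim : ∀ X : Amb n, X ≠ 0 → ∀ᶠ k in atTop, θ k X = 1 := fun X hX => by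
    have hX' : 0 < ‖X‖ := norm_pos_iff.mpr hX
    have : Tendsto (fun k : ℕ => 2 / (k + 1 : ℝ)) atTop (𝓝 0) :=
      tendsto_const_nhds.div_atTop (tendsto_atTop_add_const_right _ _ tendsto_natCast_atTop_atTop)
    filter_upwards [this.eventually (gt_mem_nhds hX')] with k hk using hθ1 k X hk.le
  obtain ⟨D, hD⟩ : ∃ D, ∀ X, |fderiv ℝ χ X w| ≤ D := by
    have hcont : Continuous (fun X => fderiv ℝ χ X w) := continuous_fderiv_apply χ.contDiff w
    obtain ⟨D, hD⟩ := hcont.bounded_above_of_compact_support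
      (hasCompactSupport_fderiv_apply' χ.hasCompactSupport w)
    exact ⟨D, hD⟩
  obtain ⟨B, hB⟩ := hψ.continuous.bounded_above_of_compact_support hc
  have hne : ∀ᵐ X : Amb n, X ≠ 0 := by
    rw [ae_iff]; simp
  have hψk : ∀ k, ContDiff ℝ ∞ (fun X => θ k X * ψ X) := fun k => (hθs k).mul hψ
  have hck : ∀ k, HasCompactSupport (fun X => θ k X * ψ X) := fun k =>
    hc.of_isClosed_subset (isClosed_tsupport _) (tsupport_mul_subset_right' _ _)
  have hsk : ∀ k, tsupport (fun X => θ k X * ψ X) ⊆ Ω \ {0} := by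
    intro k X hX
    refine ⟨hs (tsupport_mul_subset_right' _ _ hX), ?_⟩
    rintro rfl
    have : (fun X => θ k X * ψ X) =ᶠ[𝓝 0] 0 := by
      filter_upwards [Metric.ball_mem_nhds (0 : Amb n) (show 0 < 1 / (k + 1 : ℝ) by positivity)]
        with X hX
      rw [hθ0 k X (by simpa using (mem_ball_zero_iff.mp hX).le)]; simp
    exact (notMem_tsupport_iff_eventuallyEq.mpr this) hX
  have hdθ : ∀ k X, fderiv ℝ (θ k) X w = -((k + 1 : ℝ) * fderiv ℝ χ ((k + 1 : ℝ) • X) w) := by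
    intro k X
    have h1 : HasFDerivAt (fun X : Amb n => χ ((k + 1 : ℝ) • X))
        ((fderiv ℝ χ ((k + 1 : ℝ) • X)).comp ((k + 1 : ℝ) • ContinuousLinearMap.id ℝ (Amb n)))
        X := by
      have hχ : HasFDerivAt χ (fderiv ℝ χ ((k + 1 : ℝ) • X)) ((k + 1 : ℝ) • X) :=
        ((χ.contDiff : ContDiff ℝ (1 : ℕ∞) χ).differentiable (by simp) _).hasFDerivAt
      exact hχ.comp X
        (ContinuousLinearMap.hasFDerivAt ((k + 1 : ℝ) • ContinuousLinearMap.id ℝ (Amb n)))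
    have h2 := (h1.const_sub 1).fderiv
    change fderiv ℝ (fun X => 1 - χ ((k + 1 : ℝ) • X)) X w = _
    rw [h2]
    simp
  have hdsupp : ∀ (k : ℕ) X, 2 / (k + 1 : ℝ) ≤ ‖X‖ → fderiv ℝ (θ k) X w = 0 := by
    intro k X hX
    rw [hdθ]
    have : fderiv ℝ χ ((k + 1 : ℝ) • X) w = 0 := by
      have hmin : ∀ Y : Amb n, 2 ≤ ‖Y‖ → fderiv ℝ χ Y = 0 := by
        intro Y hY
        refine IsLocalMin.fderiv_eq_zero (.of_forall fun Z => ?_)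
        rw [χ.zero_of_le_dist (by simpa using hY)]
        exact χ.nonneg
      rw [hmin]
      · simp
      · rw [norm_smul, Real.norm_of_nonneg (hpos k).le]
        rwa [div_le_iff₀' (hpos k)] at hX
    rw [this]; simp
  have hd := continuous_fderiv_apply hψ w
  have hdc := hasCompactSupport_fderiv_apply' hc w
  have hds := (tsupport_fderiv_test_subset ψ w).trans hs
  have iv := integrable_mul_of_tsupport_subset hv hd hdc hds
  have iG := integrable_mul_of_tsupport_subset (hG.inner_const w) hψ.continuous hc hs
  have ivψ := integrable_mul_of_tsupport_subset hv hψ.continuous hc hs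
  have iθ : ∀ k {f : Amb n → ℝ}, Integrable f → Integrable (fun X => θ k X * f X) := fun k f hf =>
    hf.bdd_mul (c := 1) (hθs k).continuous.aestronglyMeasurable (.of_forall fun X => hθb k X)
  have lim : ∀ f : Amb n → ℝ, Integrable f →
      Tendsto (fun k => ∫ X, θ k X * f X) atTop (𝓝 (∫ X, f X)) := by
    intro f hf
    refine tendsto_integral_of_dominated_convergence (fun X => ‖f X‖)
      (fun k => (iθ k hf).aestronglyMeasurable) hf.norm (fun k => .of_forall fun X => ?_) ?_
    · rw [norm_mul]
      exact mul_le_of_le_one_left (norm_nonneg _) (hθb k X)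
    · filter_upwards [hne] with X hX
      refine tendsto_const_nhds.congr' ?_
      filter_upwards [hθlim X hX] with k hk
      rw [hk, one_mul]
  have idθ : ∀ k, Integrable (fun X => v X * ψ X * fderiv ℝ (θ k) X w) := fun k => by
    obtain ⟨D', hD'⟩ : ∃ D', ∀ X, ‖fderiv ℝ (θ k) X w‖ ≤ D' :=
      ⟨(k + 1) * D, fun X => by
        rw [hdθ, norm_neg, norm_mul, Real.norm_of_nonneg (hpos k).le]
        exact mul_le_mul_of_nonneg_left (hD _) (hpos k).le⟩
    exact ivψ.mul_bdd (c := D') (continuous_fderiv_apply (hθs k) w).aestronglyMeasurable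
      (.of_forall hD')
  -- The cutoff has gradient of size `k + 1` on a ball of radius `2/(k+1)`; `hm` is the statement
  -- that this error vanishes.
  have err : Tendsto (fun k => ∫ X, v X * ψ X * fderiv ℝ (θ k) X w) atTop (𝓝 0) := by
    have hm' := hm.const_mul (B * D)
    rw [mul_zero] at hm'
    refine squeeze_zero_norm' ?_ hm'
    filter_upwards [hi] with k hk
    have hB0 : 0 ≤ B := (norm_nonneg _).trans (hB 0)
    have hD0 : 0 ≤ D := (abs_nonneg _).trans (hD 0)
    have e : ∫ X, v X * ψ X * fderiv ℝ (θ k) X w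
        = ∫ X in Metric.ball 0 (2 / (k + 1 : ℝ)), v X * ψ X * fderiv ℝ (θ k) X w := by
      refine (setIntegral_eq_integral_of_forall_compl_eq_zero fun X hX => ?_).symm
      rw [hdsupp k X (by simpa using hX), mul_zero]
    rw [e]
    refine (norm_integral_le_integral_norm _).trans ?_
    have : ∫ X in Metric.ball 0 (2 / (k + 1 : ℝ)), ‖v X * ψ X * fderiv ℝ (θ k) X w‖
        ≤ ∫ X in Metric.ball 0 (2 / (k + 1 : ℝ)), B * D * (k + 1) * ‖v X‖ := by
      refine integral_mono_of_nonneg (.of_forall fun X => norm_nonneg _)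
        (hk.norm.const_mul _) (.of_forall fun X => ?_)
      simp only [norm_mul, hdθ, norm_neg, Real.norm_of_nonneg (hpos k).le]
      have h1 := hB X
      have h2 : ‖fderiv ℝ χ ((k + 1 : ℝ) • X) w‖ ≤ D := hD _
      calc ‖v X‖ * ‖ψ X‖ * ((k + 1) * ‖fderiv ℝ χ ((k + 1 : ℝ) • X) w‖)
          ≤ ‖v X‖ * B * ((k + 1) * D) := by gcongr
        _ = _ := by ring
    refine this.trans (le_of_eq ?_)
    rw [integral_const_mul]; ring
  have eq : ∀ k, (∫ X, θ k X * (v X * fderiv ℝ ψ X w)) + ∫ X, v X * ψ X * fderiv ℝ (θ k) X w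
      = - ∫ X, θ k X * (inner ℝ (G X) w * ψ X) := by
    intro k
    have h1 := h.integral_eq (hψk k) (hck k) (hsk k) w
    have e1 : ∀ X, v X * fderiv ℝ (fun X => θ k X * ψ X) X w
        = θ k X * (v X * fderiv ℝ ψ X w) + v X * ψ X * fderiv ℝ (θ k) X w := fun X => by
      rw [fderiv_fun_mul ((hθs k).differentiable (by simp) X) (hψ.differentiable (by simp) X)]
      simp only [add_apply, smul_apply, smul_eq_mul]
      ring
    have e2 : ∀ X, inner ℝ (G X) w * (θ k X * ψ X) = θ k X * (inner ℝ (G X) w * ψ X) :=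
      fun X => by ring
    simp only [e1, e2] at h1
    rwa [integral_add (iθ k iv) (idθ k)] at h1
  have l1 := (lim _ iv).add err
  have l2 := (lim _ iG).neg
  rw [add_zero] at l1
  exact tendsto_nhds_unique (l1.congr eq) l2

end HasWeakGradientOn

/-! ### Homogeneous extensions and tangential gradients -/

lemma isOpen_ne_zero : IsOpen {X : Amb n | X ≠ 0} := isOpen_ne

lemma contDiffOn_norm_rpow (α : ℝ) : ContDiffOn ℝ ∞ (fun X : Amb n => ‖X‖ ^ α) {X | X ≠ 0} :=
  fun _ hX => ((contDiffAt_norm ℝ hX).rpow_const_of_ne (norm_ne_zero_iff.mpr hX)).contDiffWithinAt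

lemma gradient_norm_rpow (α : ℝ) {X : Amb n} (hX : X ≠ 0) :
    gradient (fun X : Amb n => ‖X‖ ^ α) X = (α * ‖X‖ ^ (α - 2)) • X := by
  have hX' : 0 < ‖X‖ := norm_pos_iff.mpr hX
  have h1 : HasFDerivAt (fun X : Amb n => ‖X‖ ^ 2) (2 • (innerSL ℝ X)) X :=
    (hasStrictFDerivAt_norm_sq X).hasFDerivAt
  have h2 := h1.rpow_const (p := α / 2) (Or.inl (by positivity))
  have e : (fun X : Amb n => (‖X‖ ^ 2) ^ (α / 2)) = fun X => ‖X‖ ^ α := by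
    funext Y
    rw [← Real.rpow_natCast, ← Real.rpow_mul (norm_nonneg _)]
    congr 1; push_cast; ring
  rw [e] at h2
  refine ext_inner_right ℝ fun w => ?_
  rw [HasWeakGradientOn.inner_gradient, h2.fderiv, real_inner_smul_left]
  have e2 : (‖X‖ ^ 2) ^ (α / 2 - 1) = ‖X‖ ^ (α - 2) := by
    rw [← Real.rpow_natCast, ← Real.rpow_mul (norm_nonneg _)]
    congr 1; push_cast; ring
  rw [e2]
  simp
  ring

lemma homExt_add {F : Type*} [AddCommGroup F] [Module ℝ F] (μ : ℝ) (c d : USphere n → F) :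
    homExt μ (fun θ => c θ + d θ) = fun X => homExt μ c X + homExt μ d X := by
  funext X
  unfold homExt
  split_ifs <;> simp

lemma homExt_smul {F : Type*} [AddCommGroup F] [Module ℝ F] (μ k : ℝ) (c : USphere n → F) :
    homExt μ (fun θ => k • c θ) = fun X => k • homExt μ c X := by
  funext X
  unfold homExt
  split_ifs
  · simp
  · rw [smul_comm]

lemma ext_polar {F : Type*} {f g : Amb n → F} (h : ∀ q, f (polarMap n q) = g (polarMap n q))
    {X : Amb n} (hX : X ≠ 0) : f X = g X := by
  obtain ⟨q, rfl⟩ := exists_polarMap hX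
  exact h q

lemma ae_ne_zero : ∀ᵐ X : Amb n, X ≠ 0 := by
  rw [ae_iff]; simp

section LocalIntegrability

variable {F : Type*} [NormedAddCommGroup F] [NormedSpace ℝ F]

lemma integrableOn_homExt_annulus {a : ℝ} (α : ℝ) {c : USphere n → F}
    (hc : Integrable c (sphereMeasure n a)) {r R : ℝ} (hr : 0 < r) :
    IntegrableOn (homExt α c) {X | r < ‖X‖ ∧ ‖X‖ < R} (bulkMeasure n a) := by
  have hm : MeasurableSet {X : Amb n | r < ‖X‖ ∧ ‖X‖ < R} :=
    (isOpen_lt continuous_const continuous_norm).inter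
      (isOpen_lt continuous_norm continuous_const) |>.measurableSet
  rw [← integrable_indicator_iff hm]
  refine integrable_bulk_separated (u := (Ioo r R).indicator fun s => s ^ α) (c := c) ?_ ?_ hc
  · intro q
    by_cases h : r < (q.2 : ℝ) ∧ (q.2 : ℝ) < R
    · rw [indicator_of_mem (by simpa [norm_polarMap] using h), indicator_of_mem (by exact h),
        homExt_polarMap]
    · rw [indicator_of_notMem (by simpa [norm_polarMap] using h), indicator_of_notMem (by exact h),
        zero_smul]
  · have h1 : ContinuousOn (fun s : ℝ => s ^ (n + a) * s ^ α) (Icc r R) := by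
      have : ∀ s ∈ Icc r R, s ≠ 0 := fun s hs => (hr.trans_le hs.1).ne'
      exact (continuousOn_id.rpow_const fun s hs => Or.inl (this s hs)).mul
        (continuousOn_id.rpow_const fun s hs => Or.inl (this s hs))
    have h2 := (h1.integrableOn_Icc (μ := volume)).mono_set Ioo_subset_Icc_self
    have h3 := (integrable_indicator_iff measurableSet_Ioo).mpr h2
    refine (h3.congr (.of_forall fun s => ?_)).integrableOn
    by_cases h : s ∈ Ioo r R
    · simp [h]
    · simp [h]

lemma locallyIntegrableOn_homExt {a : ℝ} (α : ℝ) {c : USphere n → F}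
    (hc : Integrable c (sphereMeasure n a)) :
    LocallyIntegrableOn (homExt α c) {X : Amb n | X ≠ 0} (bulkMeasure n a) := by
  intro X hX
  have hX' : 0 < ‖X‖ := norm_pos_iff.mpr hX
  refine ⟨{Y | ‖X‖ / 2 < ‖Y‖ ∧ ‖Y‖ < 2 * ‖X‖}, mem_nhdsWithin_of_mem_nhds ?_,
    integrableOn_homExt_annulus α hc (half_pos hX')⟩
  exact ((isOpen_lt continuous_const continuous_norm).inter
    (isOpen_lt continuous_norm continuous_const)).mem_nhds
      ⟨half_lt_self hX', by change ‖X‖ < 2 * ‖X‖; linarith⟩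

/-- By Fubini on an annulus, the slices at almost all radii are integrable, and each slice is a
nonzero multiple of `c`. -/
lemma integrable_of_locallyIntegrableOn_homExt {a α : ℝ} {c : USphere n → F}
    (h : LocallyIntegrableOn (homExt α c) {X : Amb n | X ≠ 0} (bulkMeasure n a)) :
    Integrable c (sphereMeasure n a) := by
  have hK : IsCompact {X : Amb n | 1 / 2 ≤ ‖X‖ ∧ ‖X‖ ≤ 1} := by
    refine Metric.isCompact_of_isClosed_isBounded
      ((isClosed_le continuous_const continuous_norm).inter
        (isClosed_le continuous_norm continuous_const)) ?_
    refine (Metric.isBounded_closedBall (x := (0 : Amb n)) (r := 1)).subset fun X hX => ?_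
    simpa using hX.2
  have h1 := h.integrableOn_compact_subset (fun X hX h0 => by
    have := hX.1; rw [h0, norm_zero] at this; norm_num at this) hK
  rw [← integrable_indicator_iff hK.measurableSet, integrable_bulk_iff] at h1
  have h2 := h1.prod_left_ae
  have h3 : radialMeasure n a (Subtype.val ⁻¹' (Ioo (1 / 2) 1)) ≠ 0 := by
    intro h0
    have hac : Measure.volumeIoiPow n ≪ radialMeasure n a := by
      refine withDensity_absolutelyContinuous' (measurable_ofReal_rpow a).aemeasurable ?_
      refine .of_forall fun r => ?_
      have : (0 : ℝ) < r := r.2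
      simp only [ne_eq, ENNReal.ofReal_eq_zero, not_le]
      positivity
    have hac2 : Measure.comap Subtype.val volume ≪ Measure.volumeIoiPow n := by
      refine withDensity_absolutelyContinuous' (by fun_prop) ?_
      refine .of_forall fun r => ?_
      have : (0 : ℝ) < r := r.2
      simp only [ne_eq, ENNReal.ofReal_eq_zero, not_le]
      positivity
    have h4 := hac2 (hac h0)
    rw [comap_subtype_coe_apply measurableSet_Ioi, Subtype.image_preimage_coe,
      inter_eq_right.mpr (fun x hx => by
        have : (1 / 2 : ℝ) < x := hx.1
        exact mem_Ioi.mpr (by linarith)), Real.volume_Ioo] at h4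
    norm_num at h4
  -- A good radius exists in `(1/2, 1)` because that interval has positive radial measure.
  obtain ⟨r, hr, hi⟩ : ∃ r : Ioi (0 : ℝ), (r : ℝ) ∈ Ioo (1 / 2) 1 ∧ Integrable (fun θ =>
      indicator {X : Amb n | 1 / 2 ≤ ‖X‖ ∧ ‖X‖ ≤ 1} (homExt α c) (polarMap n (θ, r)))
        (sphereMeasure n a) := by
    by_contra hne
    push Not at hne
    apply h3
    refine measure_mono_null (fun r hr => ?_) (ae_iff.mp h2)
    exact hne r hr
  have hr0 : (0 : ℝ) < r := r.2
  have e : ∀ θ, indicator {X : Amb n | 1 / 2 ≤ ‖X‖ ∧ ‖X‖ ≤ 1} (homExt α c) (polarMap n (θ, r))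
      = ((r : ℝ) ^ α) • c θ := fun θ => by
    rw [indicator_of_mem, homExt_polarMap]
    simp only [mem_ofPred_eq, norm_polarMap]
    exact ⟨hr.1.le, hr.2.le⟩
  simp only [e] at hi
  exact (integrable_smul_iff (by positivity) c).mp hi

end LocalIntegrability

namespace IsTangentialGradient

variable {c d : USphere n → ℝ} {T S : USphere n → Amb n}

lemma add (h : IsTangentialGradient c T) (h' : IsTangentialGradient d S) :
    IsTangentialGradient (fun θ => c θ + d θ) (fun θ => T θ + S θ) := by
  unfold IsTangentialGradient
  rw [homExt_add, homExt_add]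
  exact HasWeakGradientOn.add h h'

lemma const_smul (h : IsTangentialGradient c T) (k : ℝ) :
    IsTangentialGradient (fun θ => k * c θ) (fun θ => k • T θ) := by
  unfold IsTangentialGradient
  have := HasWeakGradientOn.const_smul h k
  rw [show (fun θ => k * c θ) = fun θ => k • c θ from rfl, homExt_smul, homExt_smul]
  exact this

lemma zero : IsTangentialGradient (fun _ : USphere n => 0) (fun _ => 0) := by
  have h1 : ∀ μ : ℝ, homExt μ (fun _ : USphere n => (0 : ℝ)) = fun _ => 0 := fun μ => by
    funext X; simp [homExt]
  have h2 : ∀ μ : ℝ, homExt μ (fun _ : USphere n => (0 : Amb n)) = fun _ => 0 := fun μ => by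
    funext X; simp [homExt]
  unfold IsTangentialGradient
  rw [h1, h2]
  exact HasWeakGradientOn.of_integral_eq locallyIntegrableOn_zero locallyIntegrableOn_zero
    fun ψ _ _ _ w => by simp

lemma sum {ι : Type*} (s : Finset ι) {c : ι → USphere n → ℝ} {T : ι → USphere n → Amb n}
    (h : ∀ i ∈ s, IsTangentialGradient (c i) (T i)) :
    IsTangentialGradient (fun θ => ∑ i ∈ s, c i θ) (fun θ => ∑ i ∈ s, T i θ) := by
  classical
  induction s using Finset.induction_on with
  | empty => simpa using zero
  | insert j s hj ih =>
    simp only [Finset.sum_insert hj]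
    exact (h j (Finset.mem_insert_self _ _)).add
      (ih fun i hi => h i (Finset.mem_insert_of_mem hi))

/-- The weak gradient of a homogeneous extension. -/
lemma homExt_gradient (h : IsTangentialGradient c T) (α : ℝ) :
    HasWeakGradientOn {X : Amb n | X ≠ 0} (homExt α c)
      (homExt (α - 1) fun θ => T θ + (α * c θ) • (θ : Amb n)) := by
  -- The `α`-homogeneous extension is `|X|^α` times the `0`-homogeneous one, so the product rule
  -- applies away from the origin.
  have h1 := HasWeakGradientOn.mul_contDiffOn isOpen_ne_zero h (contDiffOn_norm_rpow α)
  have hpos : ∀ q : USphere n × Ioi (0 : ℝ), (0 : ℝ) < q.2 := fun q => q.2.2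
  refine h1.congr ?_ ?_
  · refine (ae_restrict_iff' isOpen_ne_zero.measurableSet).mpr (.of_forall fun X hX => ?_)
    refine ext_polar (f := fun X => ‖X‖ ^ α * homExt 0 c X) (fun q => ?_) hX
    simp [homExt_polarMap, norm_polarMap]
  · refine (ae_restrict_iff' isOpen_ne_zero.measurableSet).mpr (.of_forall fun X hX => ?_)
    refine ext_polar (f := fun X => ‖X‖ ^ α • homExt (-1) T X + homExt 0 c X •
      gradient (fun X : Amb n => ‖X‖ ^ α) X) (fun q => ?_) hX
    simp only [gradient_norm_rpow α (polarMap_ne_zero q), homExt_polarMap, norm_polarMap]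
    rw [polarMap]
    simp only [smul_add, smul_smul]
    congr 2
    · rw [← Real.rpow_add (hpos q)]; rfl
    · have e : ((q.2 : ℝ)) ^ (α - 1) = (q.2 : ℝ) ^ (α - 2) * q.2 := by
        rw [← Real.rpow_add_one (hpos q).ne']; congr 1; ring
      rw [e, Real.rpow_zero, smul_eq_mul]; ring

end IsTangentialGradient

/-- The coordinate vectors. -/
abbrev coordVec (i : Fin (n + 1)) : Amb n := EuclideanSpace.single i 1

lemma inner_eq_sum_coord (v w : Amb n) :
    inner ℝ v w = ∑ i, inner ℝ v (coordVec i) * w i := by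
  simp [PiLp.inner_apply, mul_comm]

lemma contDiff_coord (i : Fin (n + 1)) : ContDiff ℝ ∞ (fun X : Amb n => X i) :=
  (EuclideanSpace.proj (𝕜 := ℝ) i).contDiff

lemma hasFDerivAt_coord (i : Fin (n + 1)) (X : Amb n) :
    HasFDerivAt (fun X : Amb n => X i) (EuclideanSpace.proj (𝕜 := ℝ) i) X :=
  (EuclideanSpace.proj (𝕜 := ℝ) i).hasFDerivAt

/-- The divergence theorem along a ray. -/
lemma integral_ray_divergence {ψ : Amb n → ℝ} (hψ : ContDiff ℝ ∞ ψ) (hc : HasCompactSupport ψ)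
    (θ : USphere n) :
    ∫ r : Ioi (0 : ℝ), ((n + 1) * ψ ((r : ℝ) • (θ : Amb n))
        + fderiv ℝ ψ ((r : ℝ) • (θ : Amb n)) ((r : ℝ) • (θ : Amb n))) ∂(radialMeasure n 0) = 0 := by
  have hθ : ‖(θ : Amb n)‖ = 1 := by simp
  rw [integral_radialMeasure 0 (fun r : ℝ => (n + 1) * ψ (r • (θ : Amb n))
        + fderiv ℝ ψ (r • (θ : Amb n)) (r • (θ : Amb n)))]
  have hray : ContDiff ℝ ∞ (fun r : ℝ => r • (θ : Amb n)) := by fun_prop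
  have hg : ContDiff ℝ ∞ (fun r : ℝ => r ^ (n + 1) * ψ (r • (θ : Amb n))) :=
    (contDiff_id.pow _).mul (hψ.comp hray)
  have hcray : HasCompactSupport (fun r : ℝ => ψ (r • (θ : Amb n))) := by
    refine hc.comp_isClosedEmbedding (g := fun r : ℝ => r • (θ : Amb n)) ?_
    refine (Isometry.isClosedEmbedding ?_)
    refine Isometry.of_dist_eq fun r s => ?_
    rw [dist_eq_norm, ← sub_smul, norm_smul, hθ, mul_one, dist_eq_norm]
  have h1 := (hcray.mul_left (f := fun r : ℝ => r ^ (n + 1))).integral_Ioi_deriv_eq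
    (hg.of_le (by simp)) 0
  -- With the Jacobian `r^n`, the integrand is the derivative of `r^{n+1} ψ(r θ)`, which vanishes at
  -- both ends.
  have e : ∀ r : ℝ, deriv ((fun r : ℝ => r ^ (n + 1)) * fun r : ℝ => ψ (r • (θ : Amb n))) r
      = r ^ n * ((n + 1) * ψ (r • (θ : Amb n))
        + fderiv ℝ ψ (r • (θ : Amb n)) (r • (θ : Amb n))) := by
    intro r
    have d1 : HasDerivAt (fun r : ℝ => r ^ (n + 1)) ((n + 1 : ℕ) * r ^ n) r := by
      simpa using hasDerivAt_pow (n + 1) r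
    have d2 : HasDerivAt (fun r : ℝ => ψ (r • (θ : Amb n)))
        (fderiv ℝ ψ (r • (θ : Amb n)) (θ : Amb n)) r := by
      have := (hψ.differentiable (by simp) (r • (θ : Amb n))).hasFDerivAt.comp_hasDerivAt r
        ((hasDerivAt_id r).smul_const (θ : Amb n))
      simp only [one_smul] at this
      exact this
    rw [(d1.mul d2).deriv, map_smul, smul_eq_mul]
    push_cast
    ring
  have h2 : ∫ r in Ioi (0 : ℝ), deriv ((fun r : ℝ => r ^ (n + 1)) *
      fun r : ℝ => ψ (r • (θ : Amb n))) r = 0 := by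
    refine Eq.trans h1 ?_
    simp
  refine Eq.trans ?_ h2
  refine setIntegral_congr_fun measurableSet_Ioi fun r hr => ?_
  simp only [e, add_zero, Real.rpow_natCast]

lemma locallyIntegrableOn_finset_sum {Ω : Set (Amb n)} {ι : Type*} (s : Finset ι)
    {f : ι → Amb n → ℝ} (h : ∀ i, LocallyIntegrableOn (f i) Ω) :
    LocallyIntegrableOn (fun X => ∑ i ∈ s, f i X) Ω := by
  classical
  induction s using Finset.induction_on with
  | empty => simpa using locallyIntegrableOn_zero
  | insert j s hj ih =>
    simp only [Finset.sum_insert hj]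
    exact (h j).add ih

lemma locallyIntegrableOn_inner_id {Ω : Set (Amb n)} (hΩ : IsOpen Ω) {G : Amb n → Amb n}
    (hG : LocallyIntegrableOn G Ω) : LocallyIntegrableOn (fun X => inner ℝ (G X) X) Ω := by
  have h1 : ∀ i : Fin (n + 1), LocallyIntegrableOn
      (fun X : Amb n => X i * inner ℝ (G X) (coordVec i)) Ω := fun i => by
    have hco : ContinuousOn (fun X : Amb n => X i) Ω := (contDiff_coord i).continuous.continuousOn
    exact (hG.inner_const (coordVec i)).continuousOn_mul hco hΩ.isLocallyClosed
  refine (locallyIntegrableOn_finset_sum Finset.univ h1).congr (.of_forall fun X => ?_)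
  simp only []
  rw [inner_eq_sum_coord (G X) X]
  exact Finset.sum_congr rfl fun i _ => mul_comm _ _

/-- The tangential gradient is tangential. -/
lemma IsTangentialGradient.inner_self_eq_zero {c : USphere n → ℝ} {T : USphere n → Amb n}
    (h : IsTangentialGradient c T) (a : ℝ) :
    ∀ᵐ θ ∂(sphereMeasure n a), inner ℝ (T θ) (θ : Amb n) = 0 := by
  have hl := locallyIntegrableOn_inner_id isOpen_ne_zero h.2.1
  have key := isOpen_ne_zero.ae_eq_zero_of_integral_contDiff_smul_eq_zero hl
    fun ψ hψ hc hs => ?_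
  · have h1 : ∀ᵐ X : Amb n, inner ℝ (homExt (-1) T X) X = 0 := by
      filter_upwards [key, ae_ne_zero] with X hX h0 using hX h0
    refine ae_sphere_of_ae_polar (a := a) ?_
    filter_upwards [ae_polar_of_ae_volume (a := a) h1] with q hq
    have hr : (0 : ℝ) < q.2 := q.2.2
    rw [homExt_polarMap, polarMap, real_inner_smul_left, real_inner_smul_right, ← mul_assoc] at hq
    exact (mul_eq_zero.mp hq).resolve_left (by positivity)
  -- Testing the `i`-th component with `x_i ψ` and summing turns the radial part of the gradient
  -- into `div (ψ X) = (n + 1) ψ + X · ∇ψ` against a `0`-homogeneous function, and this integrates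
  -- to zero along each ray.
  · have hi : ∀ i, ContDiff ℝ ∞ (fun X : Amb n => X i * ψ X) := fun i => (contDiff_coord i).mul hψ
    have hts : ∀ i, tsupport (fun X : Amb n => X i * ψ X) ⊆ tsupport ψ := fun i =>
      tsupport_mul_subset_right' _ _
    have hci : ∀ i, HasCompactSupport (fun X : Amb n => X i * ψ X) := fun i =>
      hc.of_isClosed_subset (isClosed_tsupport _) (hts i)
    have test := fun i => HasWeakGradientOn.integral_eq h (hi i) (hci i) ((hts i).trans hs)
      (coordVec i)
    have i1 : ∀ i, Integrable (fun X : Amb n => homExt 0 c X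
        * fderiv ℝ (fun X : Amb n => X i * ψ X) X (coordVec i)) := fun i =>
      integrable_mul_of_tsupport_subset h.1 (continuous_fderiv_apply (hi i) _)
        (hasCompactSupport_fderiv_apply' (hci i) _)
        ((tsupport_fderiv_test_subset _ _).trans ((hts i).trans hs))
    have i2 : ∀ i, Integrable (fun X : Amb n => inner ℝ (homExt (-1) T X) (coordVec i)
        * (X i * ψ X)) := fun i =>
      integrable_mul_of_tsupport_subset (h.2.1.inner_const _) (hi i).continuous (hci i)
        ((hts i).trans hs)
    have e1 : ∀ X : Amb n, ψ X • inner ℝ (homExt (-1) T X) X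
        = ∑ i, inner ℝ (homExt (-1) T X) (coordVec i) * (X i * ψ X) := fun X => by
      rw [inner_eq_sum_coord, smul_eq_mul, Finset.mul_sum]
      exact Finset.sum_congr rfl fun i _ => by ring
    have e2 : ∀ X : Amb n, ∑ i, homExt 0 c X
        * fderiv ℝ (fun X : Amb n => X i * ψ X) X (coordVec i)
        = homExt 0 c X * ((n + 1) * ψ X + fderiv ℝ ψ X X) := fun X => by
      rw [← Finset.mul_sum]
      congr 1
      have : ∀ i, fderiv ℝ (fun X : Amb n => X i * ψ X) X (coordVec i)
          = ψ X + X i * fderiv ℝ ψ X (coordVec i) := fun i => by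
        rw [fderiv_fun_mul (hasFDerivAt_coord i X).differentiableAt
          (hψ.differentiable (by simp) X), (hasFDerivAt_coord i X).fderiv]
        simp [coordVec]; ring
      simp only [this, Finset.sum_add_distrib, Finset.sum_const, Finset.card_univ,
        Fintype.card_fin, nsmul_eq_mul]
      push_cast
      congr 1
      conv_rhs => rw [← HasWeakGradientOn.inner_gradient, inner_eq_sum_coord]
      exact Finset.sum_congr rfl fun i _ => by
        rw [HasWeakGradientOn.inner_gradient, mul_comm]
    simp only [e1]
    rw [integral_finsetSum _ fun i _ => i2 i]
    have e3 : ∑ i, ∫ X : Amb n, inner ℝ (homExt (-1) T X) (coordVec i) * (X i * ψ X)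
        = - ∫ X : Amb n, homExt 0 c X * ((n + 1) * ψ X + fderiv ℝ ψ X X) := by
      simp only [← e2]
      rw [integral_finsetSum _ fun i _ => i1 i, ← Finset.sum_neg_distrib]
      exact Finset.sum_congr rfl fun i _ => by rw [test i, neg_neg]
    rw [e3, neg_eq_zero]
    have i3 : Integrable (fun X : Amb n => homExt 0 c X * ((n + 1) * ψ X + fderiv ℝ ψ X X)) := by
      simp only [← e2]; exact integrable_finsetSum _ fun i _ => i1 i
    rw [← bulkMeasure_zero] at i3 ⊢
    rw [integral_bulk_eq, integral_prod _ (integrable_bulk_iff.mp i3)]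
    refine integral_eq_zero_of_ae (.of_forall fun θ => ?_)
    simp only [homExt_polarMap, Real.rpow_zero, one_smul, integral_const_mul, Pi.zero_apply]
    rw [mul_eq_zero]
    exact Or.inr (integral_ray_divergence hψ hc θ)

/-! ### Weak gradients tested against the weight `|y|^a` -/

section Weight

lemma integrable_bulk_iff_mul {a : ℝ} {g : Amb n → ℝ} :
    Integrable g (bulkMeasure n a) ↔ Integrable (fun X => |yCoord X| ^ a * g X) := by
  rw [bulkMeasure, integrable_withDensity_iff_integrable_smul' (measurable_abs_yCoord_rpow a)
    (by simp)]
  refine integrable_congr (.of_forall fun X => ?_)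
  simp only [ENNReal.toReal_ofReal (Real.rpow_nonneg (abs_nonneg (yCoord X)) a), smul_eq_mul]

lemma integral_bulk_eq_mul (a : ℝ) (g : Amb n → ℝ) :
    ∫ X, g X ∂(bulkMeasure n a) = ∫ X, |yCoord X| ^ a * g X := by
  rw [bulkMeasure, integral_withDensity_eq_integral_toReal_smul (measurable_abs_yCoord_rpow a)
    (by simp)]
  refine integral_congr_ae (.of_forall fun X => ?_)
  simp only [ENNReal.toReal_ofReal (Real.rpow_nonneg (abs_nonneg (yCoord X)) a), smul_eq_mul]

/-- The smooth regularization `(y² + t)^{a/2}` of `|y|^a`. -/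
def regWeight (a t : ℝ) (X : Amb n) : ℝ := (yCoord X ^ 2 + t) ^ (a / 2)

lemma contDiff_yCoord : ContDiff ℝ ∞ (yCoord : Amb n → ℝ) := contDiff_coord (Fin.last n)

lemma hasFDerivAt_yCoord (X : Amb n) :
    HasFDerivAt (yCoord : Amb n → ℝ) (EuclideanSpace.proj (𝕜 := ℝ) (Fin.last n)) X :=
  hasFDerivAt_coord (Fin.last n) X

lemma contDiff_regWeight (a : ℝ) {t : ℝ} (ht : 0 < t) :
    ContDiff ℝ ∞ (regWeight a t : Amb n → ℝ) :=
  ((contDiff_yCoord.pow 2).add contDiff_const).rpow_const_of_ne fun X => by positivity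

lemma hasFDerivAt_regWeight (a : ℝ) {t : ℝ} (ht : 0 < t) (X : Amb n) :
    HasFDerivAt (regWeight a t) ((a * (yCoord X / (yCoord X ^ 2 + t)) * regWeight a t X) •
      (EuclideanSpace.proj (𝕜 := ℝ) (Fin.last n) : Amb n →L[ℝ] ℝ)) X := by
  have hpos : 0 < yCoord X ^ 2 + t := by positivity
  have := (((hasFDerivAt_yCoord X).pow 2).add_const t).rpow_const (p := a / 2) (Or.inl hpos.ne')
  refine this.congr_fderiv ?_
  rw [Real.rpow_sub_one hpos.ne', smul_smul, ← regWeight]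
  congr 1
  field_simp
  simp
  ring

/-- A majorant uniform in `t`: the regularized weight is monotone in `t`, increasing for `a ≥ 0` and
decreasing for `a < 0`, hence below the sum of its end values. -/
lemma regWeight_le {a t : ℝ} (ht : 0 < t) (ht1 : t ≤ 1) {X : Amb n} (hX : yCoord X ≠ 0) :
    regWeight a t X ≤ |yCoord X| ^ a + regWeight a 1 X := by
  unfold regWeight
  have h2 : (yCoord X ^ 2) ^ (a / 2) = |yCoord X| ^ a := by
    rw [← sq_abs, ← Real.rpow_natCast, ← Real.rpow_mul (abs_nonneg _)]
    congr 1; push_cast; ring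
  have hy : 0 < yCoord X ^ 2 := by positivity
  rcases le_or_gt 0 a with ha | ha
  · have := Real.rpow_le_rpow (by positivity) (show yCoord X ^ 2 + t ≤ yCoord X ^ 2 + 1 by linarith)
      (show 0 ≤ a / 2 by linarith)
    have h3 : 0 ≤ |yCoord X| ^ a := by positivity
    linarith
  · have := Real.rpow_le_rpow_of_nonpos hy (show yCoord X ^ 2 ≤ yCoord X ^ 2 + t by linarith)
      (show a / 2 ≤ 0 by linarith)
    rw [h2] at this
    have h3 : 0 ≤ (yCoord X ^ 2 + 1) ^ (a / 2) := by positivity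
    linarith

lemma tendsto_regWeight (a : ℝ) {X : Amb n} (hX : yCoord X ≠ 0) :
    Tendsto (fun k : ℕ => regWeight a (1 / (k + 1 : ℝ)) X) atTop (𝓝 (|yCoord X| ^ a)) := by
  have h2 : (yCoord X ^ 2 + 0) ^ (a / 2) = |yCoord X| ^ a := by
    rw [add_zero, ← sq_abs, ← Real.rpow_natCast, ← Real.rpow_mul (abs_nonneg _)]
    congr 1; push_cast; ring
  rw [← h2]
  refine (tendsto_const_nhds.add tendsto_one_div_add_atTop_nhds_zero_nat).rpow_const ?_
  left; positivity

/-- The extra factor `s k` makes room for `y²/(y² + t)`, which appears when the regularized weight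
is differentiated in `y`. -/
lemma tendsto_integral_regWeight {a : ℝ} {h : Amb n → ℝ} (h0 : Integrable h)
    (h1 : Integrable h (bulkMeasure n a)) (h2 : Integrable fun X => regWeight a 1 X * h X)
    {s : ℕ → Amb n → ℝ} (hs : ∀ k, Continuous (s k)) (hb : ∀ k X, |s k X| ≤ 1)
    (hl : ∀ X, yCoord X ≠ 0 → Tendsto (fun k => s k X) atTop (𝓝 1)) :
    Tendsto (fun k : ℕ => ∫ X, regWeight a (1 / (k + 1 : ℝ)) X * (s k X * h X)) atTop
      (𝓝 (∫ X, h X ∂(bulkMeasure n a))) := by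
  rw [integral_bulk_eq_mul]
  rw [integrable_bulk_iff_mul] at h1
  have ht : ∀ k : ℕ, (0 : ℝ) < 1 / (k + 1 : ℝ) := fun k => by positivity
  have ht1 : ∀ k : ℕ, 1 / (k + 1 : ℝ) ≤ 1 := fun k => by
    rw [div_le_one (by positivity)]; linarith [(k.cast_nonneg : (0 : ℝ) ≤ k)]
  refine tendsto_integral_of_dominated_convergence
    (fun X => ‖|yCoord X| ^ a * h X‖ + ‖regWeight a 1 X * h X‖) (fun k => ?_)
    (h1.norm.add h2.norm) (fun k => ?_) ?_
  · exact (contDiff_regWeight a (ht k)).continuous.aestronglyMeasurable.mul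
      ((hs k).aestronglyMeasurable.mul h0.aestronglyMeasurable)
  · filter_upwards [ae_volume_yCoord_ne_zero] with X hX
    have hr := regWeight_le (a := a) (ht k) (ht1 k) hX
    have hp : ∀ {t : ℝ}, 0 < t → 0 ≤ regWeight a t X := fun ht => by
      unfold regWeight; positivity
    rw [norm_mul, norm_mul, norm_mul, norm_mul, Real.norm_of_nonneg (hp (ht k)),
      Real.norm_of_nonneg (hp one_pos),
      Real.norm_of_nonneg (Real.rpow_nonneg (abs_nonneg (yCoord X)) a), ← add_mul]
    refine mul_le_mul hr ?_ (by positivity) (add_nonneg (by positivity) (hp one_pos))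
    exact mul_le_of_le_one_left (norm_nonneg _) (hb k X)
  · filter_upwards [ae_volume_yCoord_ne_zero] with X hX
    have := (tendsto_regWeight a hX).mul ((hl X hX).mul_const (h X))
    rwa [one_mul] at this

end Weight

section WeightedTest

variable {Ω : Set (Amb n)} {v : Amb n → ℝ} {G : Amb n → Amb n} {a : ℝ} {f : Amb n → ℝ}

lemma integrable_bulk_inner_const_mul (hG : LocallyIntegrableOn G Ω (bulkMeasure n a))
    (hf : Continuous f) (hc : HasCompactSupport f) (hs : tsupport f ⊆ Ω) (w : Amb n) :
    Integrable (fun X => inner ℝ (G X) w * f X) (bulkMeasure n a) := by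
  have := (innerSL ℝ w).integrable_comp (integrable_smul_of_tsupport_subset hG hf hc hs)
  refine this.congr (.of_forall fun X => ?_)
  simp only [innerSL_apply_apply, real_inner_smul_right]
  rw [real_inner_comm, mul_comm]

lemma tendsto_integral_regWeight_mul_test (hv : LocallyIntegrableOn v Ω)
    (hva : LocallyIntegrableOn v Ω (bulkMeasure n a)) (hf : Continuous f)
    (hc : HasCompactSupport f) (hs : tsupport f ⊆ Ω)
    {s : ℕ → Amb n → ℝ} (hsc : ∀ k, Continuous (s k)) (hb : ∀ k X, |s k X| ≤ 1)
    (hl : ∀ X, yCoord X ≠ 0 → Tendsto (fun k => s k X) atTop (𝓝 1)) :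
    Tendsto (fun k : ℕ => ∫ X, regWeight a (1 / (k + 1 : ℝ)) X * (s k X * (v X * f X))) atTop
      (𝓝 (∫ X, v X * f X ∂(bulkMeasure n a))) := by
  refine tendsto_integral_regWeight (integrable_mul_of_tsupport_subset hv hf hc hs)
    (integrable_mul_of_tsupport_subset hva hf hc hs) ?_ hsc hb hl
  have hr := (contDiff_regWeight (n := n) a one_pos).continuous
  have hts := tsupport_mul_subset_right' (regWeight a 1) f
  have := integrable_mul_of_tsupport_subset hv (hr.mul hf)
    (hc.of_isClosed_subset (isClosed_tsupport _) hts) (hts.trans hs)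
  refine this.congr (.of_forall fun X => ?_)
  simp only [Pi.mul_apply]; ring

lemma locallyIntegrableOn_inner_const_bulk
    (hGa : LocallyIntegrableOn G Ω (bulkMeasure n a)) (w : Amb n) :
    LocallyIntegrableOn (fun X => inner ℝ (G X) w) Ω (bulkMeasure n a) := by
  intro X hX
  obtain ⟨s, hs, hi⟩ := hGa X hX
  refine ⟨s, hs, ?_⟩
  have := (innerSL ℝ w).integrable_comp hi
  simpa [IntegrableOn, real_inner_comm] using this

/-- The weak gradient is defined without weight and `|y|^a` is not smooth. Testing with the
regularized weight times `f` and removing the regularization gives the weighted formula; the weight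
does not depend on `x`. -/
lemma HasWeakGradientOn.weighted_test_castSucc (h : HasWeakGradientOn Ω v G)
    (hva : LocallyIntegrableOn v Ω (bulkMeasure n a))
    (hGa : LocallyIntegrableOn G Ω (bulkMeasure n a)) (hf : ContDiff ℝ ∞ f)
    (hc : HasCompactSupport f) (hs : tsupport f ⊆ Ω) (i : Fin n) :
    ∫ X, v X * fderiv ℝ f X (coordVec i.castSucc) ∂(bulkMeasure n a)
      = - ∫ X, inner ℝ (G X) (coordVec i.castSucc) * f X ∂(bulkMeasure n a) := by
  have ht : ∀ k : ℕ, (0 : ℝ) < 1 / (k + 1 : ℝ) := fun k => by positivity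
  have l1 := tendsto_integral_regWeight_mul_test h.1 hva
    (continuous_fderiv_apply hf (coordVec i.castSucc)) (hasCompactSupport_fderiv_apply' hc _)
    ((tsupport_fderiv_test_subset _ _).trans hs) (s := fun _ _ => 1)
    (fun _ => continuous_const) (by simp) (fun _ _ => tendsto_const_nhds)
  have l2 := (tendsto_integral_regWeight_mul_test (h.2.1.inner_const (coordVec i.castSucc))
    (locallyIntegrableOn_inner_const_bulk hGa _) hf.continuous hc hs (s := fun _ _ => 1)
    (fun _ => continuous_const) (by simp) (fun _ _ => tendsto_const_nhds)).neg
  refine tendsto_nhds_unique (l1.congr fun k => ?_) l2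
  have hr := contDiff_regWeight (n := n) a (ht k)
  have hts := tsupport_mul_subset_right' (regWeight a (1 / (k + 1 : ℝ))) f
  have key := h.integral_eq (hr.mul hf) (hc.of_isClosed_subset (isClosed_tsupport _) hts)
    (hts.trans hs) (coordVec i.castSucc)
  have e1 : ∀ X, fderiv ℝ (fun X => regWeight a (1 / (k + 1 : ℝ)) X * f X) X
      (coordVec i.castSucc)
      = regWeight a (1 / (k + 1 : ℝ)) X * fderiv ℝ f X (coordVec i.castSucc) := fun X => by
    rw [fderiv_fun_mul (hr.differentiable (by simp) X) (hf.differentiable (by simp) X),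
      (hasFDerivAt_regWeight a (ht k) X).fderiv]
    simp [coordVec, Fin.castSucc_ne_last]
  simp only [e1] at key
  calc _ = ∫ X, v X * (regWeight a (1 / (k + 1 : ℝ)) X * fderiv ℝ f X (coordVec i.castSucc)) :=
        integral_congr_ae (.of_forall fun X => by simp only []; ring)
    _ = _ := key
    _ = _ := by
        congr 1
        exact integral_congr_ae (.of_forall fun X => by simp only []; ring)

/-- In the normal direction the test function carries a factor `y`, which tames the derivative of
the weight: `y ∂_y |y|^a = a |y|^a`. This suffices, since the `y`-derivative of a polynomial in `(x,
y²)` is divisible by `y`. -/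
lemma HasWeakGradientOn.weighted_test_last (h : HasWeakGradientOn Ω v G)
    (hva : LocallyIntegrableOn v Ω (bulkMeasure n a))
    (hGa : LocallyIntegrableOn G Ω (bulkMeasure n a)) (hf : ContDiff ℝ ∞ f)
    (hc : HasCompactSupport f) (hs : tsupport f ⊆ Ω) :
    ∫ X, v X * (yCoord X * fderiv ℝ f X (coordVec (Fin.last n)) + (1 + a) * f X)
        ∂(bulkMeasure n a)
      = - ∫ X, inner ℝ (G X) (coordVec (Fin.last n)) * (yCoord X * f X) ∂(bulkMeasure n a) := by
  have ht : ∀ k : ℕ, (0 : ℝ) < 1 / (k + 1 : ℝ) := fun k => by positivity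
  set e := coordVec (Fin.last n) with he
  have hy := contDiff_yCoord (n := n)
  have hyf : ContDiff ℝ ∞ (fun X => yCoord X * f X) := hy.mul hf
  have hyfs := tsupport_mul_subset_right' yCoord f
  have hyfc : HasCompactSupport (fun X => yCoord X * f X) :=
    hc.of_isClosed_subset (isClosed_tsupport _) hyfs
  have hdyf : ∀ X, fderiv ℝ (fun X => yCoord X * f X) X e = yCoord X * fderiv ℝ f X e + f X :=
    fun X => by
      rw [fderiv_fun_mul (hasFDerivAt_yCoord X).differentiableAt (hf.differentiable (by simp) X),
        (hasFDerivAt_yCoord X).fderiv]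
      simp [e, coordVec]
  have hg0 : Continuous fun X => yCoord X * fderiv ℝ f X e + f X := by
    simp only [← hdyf]; exact continuous_fderiv_apply hyf e
  have hgc : HasCompactSupport fun X => yCoord X * fderiv ℝ f X e + f X := by
    simp only [← hdyf]; exact hasCompactSupport_fderiv_apply' hyfc e
  have hgs : tsupport (fun X => yCoord X * fderiv ℝ f X e + f X) ⊆ Ω := by
    simp only [← hdyf]; exact (tsupport_fderiv_test_subset _ _).trans (hyfs.trans hs)
  let s : ℕ → Amb n → ℝ := fun k X => yCoord X ^ 2 / (yCoord X ^ 2 + 1 / (k + 1 : ℝ))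
  have hsc : ∀ k, Continuous (s k) := fun k =>
    (hy.continuous.pow 2).div ((hy.continuous.pow 2).add continuous_const) fun X => by
      have := ht k; positivity
  have hsb : ∀ k X, |s k X| ≤ 1 := fun k X => by
    have := ht k
    rw [abs_of_nonneg (by positivity), div_le_one (by positivity)]
    linarith
  have hsl : ∀ X, yCoord X ≠ 0 → Tendsto (fun k => s k X) atTop (𝓝 1) := fun X hX => by
    have hX2 : yCoord X ^ 2 ≠ 0 := by positivity
    have h1 : Tendsto (fun k : ℕ => yCoord X ^ 2 + 1 / (k + 1 : ℝ)) atTop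
        (𝓝 (yCoord X ^ 2 + 0)) := tendsto_const_nhds.add tendsto_one_div_add_atTop_nhds_zero_nat
    have h2 := (tendsto_const_nhds (x := yCoord X ^ 2)).div h1 (by rwa [add_zero])
    rwa [add_zero, div_self hX2] at h2
  have l1 := tendsto_integral_regWeight_mul_test h.1 hva hg0 hgc hgs (s := fun _ _ => 1)
    (fun _ => continuous_const) (by simp) (fun _ _ => tendsto_const_nhds)
  have l1' := tendsto_integral_regWeight_mul_test h.1 hva hf.continuous hc hs hsc hsb hsl
  have l2 := (tendsto_integral_regWeight_mul_test (h.2.1.inner_const e)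
    (locallyIntegrableOn_inner_const_bulk hGa _) hyf.continuous hyfc (hyfs.trans hs)
    (s := fun _ _ => 1)
    (fun _ => continuous_const) (by simp) (fun _ _ => tendsto_const_nhds)).neg
  have l3 := l1.add (l1'.const_mul a)
  have ig := integrable_mul_of_tsupport_subset hva hg0 hgc hgs
  have if' := integrable_mul_of_tsupport_subset hva hf.continuous hc hs
  have elim : (∫ X, v X * (yCoord X * fderiv ℝ f X e + f X) ∂(bulkMeasure n a))
      + a * ∫ X, v X * f X ∂(bulkMeasure n a)
      = ∫ X, v X * (yCoord X * fderiv ℝ f X e + (1 + a) * f X) ∂(bulkMeasure n a) := by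
    rw [← integral_const_mul, ← integral_add ig (if'.const_mul a)]
    exact integral_congr_ae (.of_forall fun X => by simp only []; ring)
  rw [elim] at l3
  refine tendsto_nhds_unique (l3.congr fun k => ?_) l2
  have hr := contDiff_regWeight (n := n) a (ht k)
  have hts := tsupport_mul_subset_right' (regWeight a (1 / (k + 1 : ℝ)))
    (fun X => yCoord X * f X)
  have key := h.integral_eq (hr.mul hyf) (hyfc.of_isClosed_subset (isClosed_tsupport _) hts)
    (hts.trans (hyfs.trans hs)) e
  have e1 : ∀ X, fderiv ℝ (fun X => regWeight a (1 / (k + 1 : ℝ)) X * (yCoord X * f X)) X e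
      = regWeight a (1 / (k + 1 : ℝ)) X * (yCoord X * fderiv ℝ f X e + f X)
        + a * (regWeight a (1 / (k + 1 : ℝ)) X * (s k X * f X)) := fun X => by
    rw [fderiv_fun_mul (hr.differentiable (by simp) X) (hyf.differentiable (by simp) X),
      (hasFDerivAt_regWeight a (ht k) X).fderiv]
    simp only [add_apply, smul_apply, hdyf, smul_eq_mul]
    simp [e, coordVec, s]
    ring
  simp only [e1] at key
  have hR : Continuous (regWeight a (1 / (k + 1 : ℝ)) : Amb n → ℝ) := hr.continuous
  have j1 : Integrable fun X => v X * (regWeight a (1 / (k + 1 : ℝ)) X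
      * (yCoord X * fderiv ℝ f X e + f X)) :=
    integrable_mul_of_tsupport_subset h.1 (hR.mul hg0)
      (hgc.of_isClosed_subset (isClosed_tsupport _) (tsupport_mul_subset_right' _ _))
      ((tsupport_mul_subset_right' _ _).trans hgs)
  have j2 : Integrable fun X => v X * ((regWeight a (1 / (k + 1 : ℝ)) X * s k X) * f X) :=
    integrable_mul_of_tsupport_subset h.1 ((hR.mul (hsc k)).mul hf.continuous)
      (hc.of_isClosed_subset (isClosed_tsupport _)
        (tsupport_mul_subset_right' (fun X => regWeight a (1 / (k + 1 : ℝ)) X * s k X) f))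
      ((tsupport_mul_subset_right' (fun X => regWeight a (1 / (k + 1 : ℝ)) X * s k X) f).trans hs)
  calc _ = (∫ X, v X * (regWeight a (1 / (k + 1 : ℝ)) X
      * (yCoord X * fderiv ℝ f X e + f X)))
        + ∫ X, a * (v X * ((regWeight a (1 / (k + 1 : ℝ)) X * s k X) * f X)) := by
        rw [integral_const_mul]
        congr 1
        · exact integral_congr_ae (.of_forall fun X => by simp only []; ring)
        · congr 1
          exact integral_congr_ae (.of_forall fun X => by simp only []; ring)
    _ = ∫ X, v X * (regWeight a (1 / (k + 1 : ℝ)) X * (yCoord X * fderiv ℝ f X e + f X)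
        + a * (regWeight a (1 / (k + 1 : ℝ)) X * (s k X * f X))) := by
        rw [← integral_add j1 (j2.const_mul a)]
        exact integral_congr_ae (.of_forall fun X => by simp only []; ring)
    _ = _ := key
    _ = _ := by
        congr 1
        exact integral_congr_ae (.of_forall fun X => by simp only []; ring)

end WeightedTest

/-! ### Even polynomials as functions of `(x, y)` -/

namespace EvenPoly

open MvPolynomial

/-- The coordinates `(x, y²)`. -/
def evenCoord (X : Amb n) (i : Fin (n + 1)) : ℝ := if i = Fin.last n then X i ^ 2 else X i

/-- The function of `(x, y)` represented by a polynomial in `(x, y²)`. -/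
def fn (p : EvenPoly n) (X : Amb n) : ℝ := eval (evenCoord X) p

lemma fn_add (p q : EvenPoly n) (X : Amb n) : fn (p + q) X = fn p X + fn q X := by simp [fn]
lemma fn_mul (p q : EvenPoly n) (X : Amb n) : fn (p * q) X = fn p X * fn q X := by simp [fn]
lemma fn_smul (c : ℝ) (p : EvenPoly n) (X : Amb n) : fn (c • p) X = c * fn p X := by
  simp [fn, smul_eval]
lemma fn_zero (X : Amb n) : fn (0 : EvenPoly n) X = 0 := by simp [fn]
lemma fn_sum {ι : Type*} (s : Finset ι) (p : ι → EvenPoly n) (X : Amb n) :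
    fn (∑ i ∈ s, p i) X = ∑ i ∈ s, fn (p i) X := by simp [fn]
lemma fn_C (c : ℝ) (X : Amb n) : fn (C c : EvenPoly n) X = c := by simp [fn]
lemma fn_pow (p : EvenPoly n) (k : ℕ) (X : Amb n) : fn (p ^ k) X = fn p X ^ k := by simp [fn]
lemma fn_X_castSucc (i : Fin n) (X : Amb n) :
    fn (MvPolynomial.X i.castSucc : EvenPoly n) X = X i.castSucc := by
  simp [fn, evenCoord, Fin.castSucc_ne_last]
lemma fn_X_last (X : Amb n) : fn (MvPolynomial.X (Fin.last n) : EvenPoly n) X = yCoord X ^ 2 := by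
  simp [fn, evenCoord, yCoord]

lemma fn_rSq (X : Amb n) : fn (rSq n) X = ‖X‖ ^ 2 := by
  rw [EuclideanSpace.norm_sq_eq, Fin.sum_univ_castSucc]
  simp [rSq, xSq, fn_add, fn_sum, fn_pow, fn_X_castSucc, fn_X_last, yCoord]

lemma contDiff_evenCoord (i : Fin (n + 1)) : ContDiff ℝ ∞ (fun X : Amb n => evenCoord X i) := by
  unfold evenCoord
  split_ifs
  · exact (contDiff_coord i).pow 2
  · exact contDiff_coord i

lemma contDiff_fn (p : EvenPoly n) : ContDiff ℝ ∞ (fn p) := by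
  induction p using MvPolynomial.induction_on with
  | C c => simp only [funext (fn_C (n := n) c)]; exact contDiff_const
  | add p q hp hq => simp only [funext (fn_add p q)]; exact hp.add hq
  | mul_X p i hp =>
    simp only [funext (fn_mul p (MvPolynomial.X i))]
    refine hp.mul ?_
    have : fn (MvPolynomial.X i : EvenPoly n) = fun X => evenCoord X i := by
      funext X; simp [fn]
    rw [this]
    exact contDiff_evenCoord i

lemma fderiv_fn_coordVec (p : EvenPoly n) (X : Amb n) (j : Fin (n + 1)) :
    fderiv ℝ (fn p) X (coordVec j)
      = (if j = Fin.last n then 2 * yCoord X else 1) * fn (pderiv j p) X := by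
  classical
  induction p using MvPolynomial.induction_on with
  | C c => simp [funext (fn_C (n := n) c), fn_zero]
  | add p q hp hq =>
    simp only [funext (fn_add p q)]
    rw [fderiv_fun_add ((contDiff_fn p).differentiable (by simp) X)
      ((contDiff_fn q).differentiable (by simp) X), add_apply, hp, hq, map_add, fn_add]
    ring
  | mul_X p i hp =>
    simp only [funext (fn_mul p (MvPolynomial.X i))]
    rw [fderiv_fun_mul ((contDiff_fn p).differentiable (by simp) X)
      ((contDiff_fn _).differentiable (by simp) X), Derivation.leibniz, pderiv_X]
    simp only [add_apply, smul_apply, smul_eq_mul, hp, fn_add, fn_mul]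
    have : fderiv ℝ (fn (MvPolynomial.X i : EvenPoly n)) X (coordVec j)
        = (if j = Fin.last n then 2 * yCoord X else 1)
          * fn (Pi.single (M := fun _ => EvenPoly n) j 1 i) X := by
      refine Fin.lastCases ?_ (fun i => ?_) i
      · simp only [funext (fn_X_last (n := n))]
        have hd : HasFDerivAt (fun X : Amb n => yCoord X ^ 2) _ X := (hasFDerivAt_yCoord X).pow 2
        rw [hd.fderiv]
        by_cases hj : j = Fin.last n
        · subst hj; simp [coordVec, fn]
        · rw [Pi.single_eq_of_ne (Ne.symm hj)]; simp [coordVec, fn, Ne.symm hj]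
      · simp only [funext (fn_X_castSucc (n := n) i)]
        rw [(hasFDerivAt_coord i.castSucc X).fderiv]
        by_cases hj : j = i.castSucc
        · subst hj; simp [coordVec, fn, Fin.castSucc_ne_last]
        · rw [Pi.single_eq_of_ne (Ne.symm hj)]; simp [coordVec, fn, Ne.symm hj]
    rw [this]; ring

lemma fderiv_fn_castSucc (p : EvenPoly n) (X : Amb n) (i : Fin n) :
    fderiv ℝ (fn p) X (coordVec i.castSucc) = fn (pderiv i.castSucc p) X := by
  rw [fderiv_fn_coordVec, if_neg (Fin.castSucc_ne_last i), one_mul]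

lemma fderiv_fn_last (p : EvenPoly n) (X : Amb n) :
    fderiv ℝ (fn p) X (coordVec (Fin.last n)) = 2 * yCoord X * fn (pderiv (Fin.last n) p) X := by
  rw [fderiv_fn_coordVec, if_pos rfl]

lemma fn_smul_point {p : EvenPoly n} {k : ℕ} (hp : p.IsWeightedHomogeneous (evenWeight n) k)
    (r : ℝ) (X : Amb n) : fn p (r • X) = r ^ k * fn p X := by
  have h : ∀ i, evenCoord (r • X) i = r ^ evenWeight n i * evenCoord X i := fun i => by
    unfold evenCoord evenWeight
    split_ifs <;> simp [mul_pow]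
  unfold fn
  rw [eval_eq', eval_eq', Finset.mul_sum]
  refine Finset.sum_congr rfl fun d hd => ?_
  have hw : ∏ i, (r ^ evenWeight n i) ^ d i = r ^ k := by
    have := hp (mem_support_iff.mp hd)
    rw [Finsupp.weight_apply, Finsupp.sum_fintype _ _ (by simp)] at this
    rw [← this, ← Finset.prod_pow_eq_pow_sum]
    exact Finset.prod_congr rfl fun i _ => by rw [← pow_mul, smul_eq_mul, mul_comm]
  simp only [h, mul_pow, Finset.prod_mul_distrib, hw]
  ring

/-- Differentiate the scaling identity `fn_smul_point`. The exponent is the real number `k - 1`, so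
`k = 0` is covered without truncation. -/
lemma gradient_fn_smul_point {p : EvenPoly n} {k : ℕ}
    (hp : p.IsWeightedHomogeneous (evenWeight n) k) {r : ℝ} (hr : 0 < r) (X : Amb n) :
    gradient (fn p) (r • X) = r ^ (k - 1 : ℝ) • gradient (fn p) X := by
  refine ext_inner_right ℝ fun w => ?_
  rw [real_inner_smul_left, HasWeakGradientOn.inner_gradient, HasWeakGradientOn.inner_gradient]
  have h1 : HasFDerivAt (fun X : Amb n => fn p (r • X))
      ((fderiv ℝ (fn p) (r • X)).comp (r • ContinuousLinearMap.id ℝ (Amb n))) X :=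
    ((contDiff_fn p).differentiable (by simp) (r • X)).hasFDerivAt.comp X
      (ContinuousLinearMap.hasFDerivAt (r • ContinuousLinearMap.id ℝ (Amb n)))
  have h2 : HasFDerivAt (fun X : Amb n => fn p (r • X)) (r ^ k • fderiv ℝ (fn p) X) X := by
    simp only [fn_smul_point hp]
    exact ((contDiff_fn p).differentiable (by simp) X).hasFDerivAt.const_mul _
  have h3 := congrArg (fun L => L w) (h1.unique h2)
  simp only [ContinuousLinearMap.comp_apply, smul_apply, ContinuousLinearMap.id_apply,
    map_smul, smul_eq_mul] at h3
  rw [Real.rpow_sub_one hr.ne', Real.rpow_natCast]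
  field_simp
  linarith [h3]

/-- The normal component is written as `y` times a smooth function, the form required by
`HasWeakGradientOn.weighted_test_last`. -/
lemma inner_gradient_fn (p : EvenPoly n) (X w : Amb n) :
    inner ℝ w (gradient (fn p) X) = ∑ i : Fin n, inner ℝ w (coordVec i.castSucc)
      * fn (pderiv i.castSucc p) X
      + inner ℝ w (coordVec (Fin.last n)) * (yCoord X * (2 * fn (pderiv (Fin.last n) p) X)) := by
  rw [real_inner_comm, inner_eq_sum_coord, Fin.sum_univ_castSucc]
  simp only [HasWeakGradientOn.inner_gradient, fderiv_fn_castSucc, fderiv_fn_last]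
  congr 1
  · refine Finset.sum_congr rfl fun i _ => ?_
    rw [EuclideanSpace.inner_single_right, mul_comm]; simp
  · simp only [coordVec, EuclideanSpace.inner_single_right]; simp; ring

/-- The tangential gradient of a homogeneous polynomial function on the sphere. -/
def sphGrad (k : ℕ) (p : EvenPoly n) (θ : USphere n) : Amb n :=
  gradient (fn p) (θ : Amb n) - (k * fn p (θ : Amb n)) • (θ : Amb n)

lemma isTangentialGradient_fn {p : EvenPoly n} {k : ℕ}
    (hp : p.IsWeightedHomogeneous (evenWeight n) k) :
    IsTangentialGradient (fun θ : USphere n => fn p θ) (sphGrad k p) := by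
  have h0 := HasWeakGradientOn.of_contDiffOn isOpen_ne_zero (contDiff_fn p).contDiffOn
  have h1 := HasWeakGradientOn.mul_contDiffOn isOpen_ne_zero h0 (contDiffOn_norm_rpow (-(k : ℝ)))
  refine h1.congr ?_ ?_
  · refine (ae_restrict_iff' isOpen_ne_zero.measurableSet).mpr (.of_forall fun X hX => ?_)
    refine ext_polar (f := fun X => ‖X‖ ^ (-(k : ℝ)) * fn p X) (fun q => ?_) hX
    have hr : (0 : ℝ) < q.2 := q.2.2
    simp only [norm_polarMap, homExt_polarMap]
    rw [polarMap, fn_smul_point hp, ← mul_assoc, ← Real.rpow_natCast, ← Real.rpow_add hr]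
    simp
  · refine (ae_restrict_iff' isOpen_ne_zero.measurableSet).mpr (.of_forall fun X hX => ?_)
    refine ext_polar (f := fun X => ‖X‖ ^ (-(k : ℝ)) • gradient (fn p) X
      + fn p X • gradient (fun X : Amb n => ‖X‖ ^ (-(k : ℝ))) X) (fun q => ?_) hX
    have hr : (0 : ℝ) < q.2 := q.2.2
    simp only [gradient_norm_rpow _ (polarMap_ne_zero q), norm_polarMap, homExt_polarMap]
    rw [polarMap, gradient_fn_smul_point hp hr, fn_smul_point hp, sphGrad, smul_sub]
    simp only [smul_smul]
    rw [sub_eq_add_neg (((q.2 : ℝ) ^ (-1 : ℝ)) • _), ← neg_smul, ← Real.rpow_add hr]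
    have e : (q.2 : ℝ) ^ (-1 : ℝ) = (q.2 : ℝ) ^ k * (q.2 : ℝ) ^ (-(k : ℝ) - 2) * q.2 := by
      rw [← Real.rpow_natCast, ← Real.rpow_add hr, ← Real.rpow_add_one hr.ne']
      congr 1; ring
    congr 2
    · congr 1; ring
    · rw [e]; ring

end EvenPoly

/-! ### Radial cutoffs and the eigenvalue identity for harmonic polynomials -/

/-- A cutoff function on the line, equal to one near `1`. -/
def lineCutoff : ContDiffBump (1 : ℝ) := ⟨1 / 4, 1 / 2, by norm_num, by norm_num⟩

/-- A radial cutoff function supported in an annulus. -/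
def radialCutoff (X : Amb n) : ℝ := lineCutoff (‖X‖ ^ 2)

lemma contDiff_radialCutoff : ContDiff ℝ ∞ (radialCutoff : Amb n → ℝ) :=
  lineCutoff.contDiff.comp (contDiff_norm_sq ℝ)

lemma fderiv_radialCutoff (X w : Amb n) :
    fderiv ℝ radialCutoff X w = 2 * deriv lineCutoff (‖X‖ ^ 2) * inner ℝ X w := by
  have h1 : HasFDerivAt (fun X : Amb n => ‖X‖ ^ 2) (2 • (innerSL ℝ X)) X :=
    (hasStrictFDerivAt_norm_sq X).hasFDerivAt
  have h2 : HasDerivAt lineCutoff (deriv lineCutoff (‖X‖ ^ 2)) (‖X‖ ^ 2) :=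
    ((lineCutoff.contDiff : ContDiff ℝ (1 : ℕ∞) lineCutoff).differentiable (by simp) _).hasDerivAt
  have h3 := h2.comp_hasFDerivAt X h1
  have h4 : fderiv ℝ radialCutoff X = _ := h3.fderiv
  rw [h4]
  simp
  ring

lemma tsupport_radialCutoff_subset :
    tsupport (radialCutoff : Amb n → ℝ) ⊆ {X | 1 / 2 ≤ ‖X‖ ^ 2 ∧ ‖X‖ ^ 2 ≤ 3 / 2} := by
  have hcl : IsClosed {X : Amb n | 1 / 2 ≤ ‖X‖ ^ 2 ∧ ‖X‖ ^ 2 ≤ 3 / 2} :=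
    (isClosed_le continuous_const (continuous_norm.pow 2)).inter
      (isClosed_le (continuous_norm.pow 2) continuous_const)
  refine closure_minimal (fun X hX => ?_) hcl
  by_contra h
  apply hX
  refine lineCutoff.zero_of_le_dist ?_
  have h' : ¬ (1 / 2 ≤ ‖X‖ ^ 2 ∧ ‖X‖ ^ 2 ≤ 3 / 2) := h
  change 1 / 2 ≤ dist (‖X‖ ^ 2) 1
  rw [Real.dist_eq]
  by_contra h2
  push Not at h2
  rw [abs_lt] at h2
  exact h' ⟨by linarith, by linarith⟩

lemma hasCompactSupport_radialCutoff : HasCompactSupport (radialCutoff : Amb n → ℝ) := by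
  refine (isCompact_closedBall (0 : Amb n) 2).of_isClosed_subset (isClosed_tsupport _)
    fun X hX => ?_
  have := (tsupport_radialCutoff_subset hX).2
  rw [mem_closedBall_zero_iff]
  nlinarith [norm_nonneg X]

lemma tsupport_radialCutoff_subset_ne_zero :
    tsupport (radialCutoff : Amb n → ℝ) ⊆ {X | X ≠ 0} := by
  intro X hX h0
  have := (tsupport_radialCutoff_subset hX).1
  rw [h0, norm_zero] at this
  norm_num at this

lemma lineCutoff_sq_eq_zero {r : ℝ} (hr : 0 < r) (h : r ∉ Ioo (1 / 2 : ℝ) 2) :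
    lineCutoff (r ^ 2) = 0 := by
  refine lineCutoff.zero_of_le_dist ?_
  change 1 / 2 ≤ dist (r ^ 2) 1
  rw [Real.dist_eq]
  by_contra h2
  push Not at h2
  rw [abs_lt] at h2
  exact h ⟨by nlinarith, by nlinarith⟩

lemma deriv_lineCutoff_sq_eq_zero {r : ℝ} (hr : 0 < r) (h : r ∉ Ioo (1 / 2 : ℝ) 2) :
    deriv lineCutoff (r ^ 2) = 0 := by
  refine IsLocalMin.deriv_eq_zero (.of_forall fun s => ?_)
  rw [lineCutoff_sq_eq_zero hr h]
  exact lineCutoff.nonneg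

lemma setIntegral_Ioi_eq_intervalIntegral {g : ℝ → ℝ}
    (hg : ∀ r, 0 < r → r ∉ Ioo (1 / 2 : ℝ) 2 → g r = 0) :
    ∫ r in Ioi (0 : ℝ), g r = ∫ r in (1 / 2 : ℝ)..2, g r := by
  rw [intervalIntegral.integral_of_le (by norm_num)]
  have hsub : Ioc (1 / 2 : ℝ) 2 ⊆ Ioi 0 := fun r hr =>
    mem_Ioi.mpr (by have : (1 / 2 : ℝ) < r := hr.1; linarith)
  refine setIntegral_eq_of_subset_of_forall_sdiff_eq_zero measurableSet_Ioi hsub fun r hr => ?_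
  exact hg r hr.1 fun h => hr.2 ⟨h.1, h.2.le⟩

/-- Positivity allows the radial factor to be cancelled at the end of the eigenvalue computation. -/
lemma integral_lineCutoff_pos (s : ℝ) :
    0 < ∫ r in Ioi (0 : ℝ), lineCutoff (r ^ 2) * r ^ s := by
  rw [setIntegral_Ioi_eq_intervalIntegral fun r hr h => by
    rw [lineCutoff_sq_eq_zero hr h, zero_mul]]
  refine intervalIntegral.integral_pos (by norm_num) ?_ (fun r hr => ?_) ⟨1, by norm_num, ?_⟩
  · exact (lineCutoff.continuous.comp (continuous_pow 2)).continuousOn.mul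
      (continuousOn_id.rpow_const fun r hr => Or.inl (by
        have : (1 / 2 : ℝ) ≤ r := hr.1
        change r ≠ 0; positivity))
  · have : (0 : ℝ) < r := by have : (1 / 2 : ℝ) < r := hr.1; linarith
    exact mul_nonneg lineCutoff.nonneg (by positivity)
  · have : lineCutoff ((1 : ℝ) ^ 2) = 1 :=
      lineCutoff.one_of_mem_closedBall (by simp [lineCutoff])
    rw [this]; simp

/-- Integration by parts in `r` for `lineCutoff (r²) r^s`, which vanishes near both ends of `[1/2,
2]`. -/
lemma integral_deriv_lineCutoff (s : ℝ) :
    ∫ r in Ioi (0 : ℝ), 2 * deriv lineCutoff (r ^ 2) * r ^ (s + 1)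
      = - s * ∫ r in Ioi (0 : ℝ), lineCutoff (r ^ 2) * r ^ (s - 1) := by
  rw [setIntegral_Ioi_eq_intervalIntegral fun r hr h => by
      rw [deriv_lineCutoff_sq_eq_zero hr h]; simp,
    setIntegral_Ioi_eq_intervalIntegral fun r hr h => by
      rw [lineCutoff_sq_eq_zero hr h, zero_mul]]
  have hpos : ∀ r ∈ uIcc (1 / 2 : ℝ) 2, 0 < r := fun r hr => by
    rw [uIcc_of_le (by norm_num)] at hr
    have : (1 / 2 : ℝ) ≤ r := hr.1
    linarith
  have hd : ∀ r ∈ uIcc (1 / 2 : ℝ) 2, HasDerivAt (fun r : ℝ => lineCutoff (r ^ 2) * r ^ s)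
      (2 * deriv lineCutoff (r ^ 2) * r ^ (s + 1) + s * (lineCutoff (r ^ 2) * r ^ (s - 1))) r := by
    intro r hr
    have h2 : HasDerivAt lineCutoff (deriv lineCutoff (r ^ 2)) (r ^ 2) :=
      ((lineCutoff.contDiff : ContDiff ℝ (1 : ℕ∞) lineCutoff).differentiable (by simp)
        _).hasDerivAt
    have hp : HasDerivAt (fun r : ℝ => r ^ 2) (2 * r) r := by simpa using hasDerivAt_pow 2 r
    have h2c : HasDerivAt (fun r : ℝ => lineCutoff (r ^ 2))
      (deriv lineCutoff (r ^ 2) * (2 * r)) r := 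
      HasDerivAt.comp (h₂ := lineCutoff) (h := fun r : ℝ => r ^ 2) r h2 hp
    have h3 := h2c.mul
      (Real.hasDerivAt_rpow_const (p := s) (Or.inl (hpos r hr).ne'))
    refine h3.congr_deriv ?_
    rw [Real.rpow_add_one (hpos r hr).ne']
    ring
  have c1 : ContinuousOn (fun r : ℝ => 2 * deriv lineCutoff (r ^ 2) * r ^ (s + 1))
      (uIcc (1 / 2 : ℝ) 2) := by
    have : Continuous (deriv lineCutoff) :=
      (lineCutoff.contDiff : ContDiff ℝ (1 : ℕ∞) lineCutoff).continuous_deriv (by simp)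
    exact (continuousOn_const.mul (this.comp (continuous_pow 2)).continuousOn).mul
      (continuousOn_id.rpow_const fun r hr => Or.inl (hpos r hr).ne')
  have c2 : ContinuousOn (fun r : ℝ => s * (lineCutoff (r ^ 2) * r ^ (s - 1)))
      (uIcc (1 / 2 : ℝ) 2) :=
    continuousOn_const.mul ((lineCutoff.continuous.comp (continuous_pow 2)).continuousOn.mul
      (continuousOn_id.rpow_const fun r hr => Or.inl (hpos r hr).ne'))
  have key := intervalIntegral.integral_eq_sub_of_hasDerivAt hd (c1.add c2).intervalIntegrable
  rw [intervalIntegral.integral_add c1.intervalIntegrable c2.intervalIntegrable,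
    lineCutoff_sq_eq_zero (by norm_num) (by simp), lineCutoff_sq_eq_zero (by norm_num) (by simp),
    intervalIntegral.integral_const_mul] at key
  linarith

namespace EvenPoly

open MvPolynomial

lemma fn_euler {p : EvenPoly n} {k : ℕ} (hp : p.IsWeightedHomogeneous (evenWeight n) k)
    (X : Amb n) : ∑ i : Fin n, X i.castSucc * fn (pderiv i.castSucc p) X
      + 2 * yCoord X ^ 2 * fn (pderiv (Fin.last n) p) X = k * fn p X := by
  have := congrArg (fun q => fn q X) (euler hp)
  simp only [fn_add, fn_sum, fn_mul, fn_X_castSucc, fn_X_last] at this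
  have h2 : fn (2 : EvenPoly n) X = 2 := fn_C 2 X
  have hk : fn (k : EvenPoly n) X = k := by simp [fn]
  rw [h2, hk] at this
  linarith

lemma fn_lap {a : ℝ} (p : EvenPoly n) (X : Amb n) :
    fn (lap a p) X = ∑ i : Fin n, fn (pderiv i.castSucc (pderiv i.castSucc p)) X
      + 4 * yCoord X ^ 2 * fn (pderiv (Fin.last n) (pderiv (Fin.last n) p)) X
      + 2 * (1 + a) * fn (pderiv (Fin.last n) p) X := by
  have h4 : fn (4 : EvenPoly n) X = 4 := fn_C 4 X
  simp only [lap, fn_add, fn_sum, fn_mul, fn_X_last, fn_C, h4]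
  ring

/-- Harmonic polynomials restrict to eigenfunctions on the sphere. -/
lemma integral_inner_gradient_harm {a : ℝ} {k : ℕ} {p : EvenPoly n}
    (hp : p ∈ harm n a k) {η : USphere n → ℝ} {S : USphere n → Amb n}
    (h : IsTangentialGradient η S) (hη : Integrable η (sphereMeasure n a))
    (hS : Integrable S (sphereMeasure n a)) :
    ∫ θ, inner ℝ (S θ) (gradient (fn p) (θ : Amb n)) ∂(sphereMeasure n a)
      = homEigenvalue n a k * ∫ θ, η θ * fn p (θ : Amb n) ∂(sphereMeasure n a) := by
  have hva := locallyIntegrableOn_homExt 0 hη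
  have hGa := locallyIntegrableOn_homExt (-1) hS
  set v := homExt 0 η with hv
  set G := homExt (-1) S with hG
  have hχ := contDiff_radialCutoff (n := n)
  have hts : ∀ q : EvenPoly n, tsupport (fun X => fn q X * radialCutoff X)
      ⊆ tsupport radialCutoff :=
    fun q => tsupport_mul_subset_right' (fn q) radialCutoff
  have hcd : ∀ q : EvenPoly n, ContDiff ℝ ∞ (fun X => fn q X * radialCutoff X) :=
    fun q => (contDiff_fn q).mul hχ
  have hcs : ∀ q : EvenPoly n, HasCompactSupport (fun X => fn q X * radialCutoff X) :=
    fun q => hasCompactSupport_radialCutoff.of_isClosed_subset (isClosed_tsupport _) (hts q)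
  have hsu : ∀ q : EvenPoly n, tsupport (fun X => fn q X * radialCutoff X) ⊆ {X | X ≠ 0} :=
    fun q => (hts q).trans tsupport_radialCutoff_subset_ne_zero
  have hfd : ∀ (q : EvenPoly n) (X : Amb n) (j : Fin (n + 1)),
      fderiv ℝ (fun X => fn q X * radialCutoff X) X (coordVec j)
        = fderiv ℝ (fn q) X (coordVec j) * radialCutoff X
          + fn q X * (2 * deriv lineCutoff (‖X‖ ^ 2) * X j) := fun q X j => by
    rw [fderiv_fun_mul ((contDiff_fn q).differentiable (by simp) X)
      (hχ.differentiable (by simp) X)]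
    simp only [add_apply, smul_apply, smul_eq_mul, fderiv_radialCutoff]
    rw [EuclideanSpace.inner_single_right]
    simp
    ring
  -- The test field is the gradient of `p` times a radial cutoff. Since `p` is harmonic, its
  -- weighted divergence only sees the derivative of the cutoff.
  have t1 := fun i : Fin n => HasWeakGradientOn.weighted_test_castSucc h hva hGa
    (hcd (pderiv i.castSucc p)) (hcs _) (hsu _) i
  have t2 := HasWeakGradientOn.weighted_test_last h hva hGa (hcd (2 * pderiv (Fin.last n) p))
    (hcs _) (hsu _)
  have i1 : ∀ i : Fin n, Integrable (fun X => v X * fderiv ℝ (fun X =>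
      fn (pderiv i.castSucc p) X * radialCutoff X) X (coordVec i.castSucc)) (bulkMeasure n a) :=
    fun i => integrable_mul_of_tsupport_subset hva (continuous_fderiv_apply (hcd _) _)
      (hasCompactSupport_fderiv_apply' (hcs _) _) ((tsupport_fderiv_test_subset _ _).trans (hsu _))
  have j1 : ∀ i : Fin n, Integrable (fun X => inner ℝ (G X) (coordVec i.castSucc) *
      (fn (pderiv i.castSucc p) X * radialCutoff X)) (bulkMeasure n a) :=
    fun i => integrable_bulk_inner_const_mul hGa (hcd _).continuous (hcs _) (hsu _) _
  have hy := contDiff_yCoord (n := n)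
  have i2 : Integrable (fun X => v X * (yCoord X * fderiv ℝ (fun X =>
      fn (2 * pderiv (Fin.last n) p) X * radialCutoff X) X (coordVec (Fin.last n))
      + (1 + a) * (fn (2 * pderiv (Fin.last n) p) X * radialCutoff X))) (bulkMeasure n a) := by
    have hss := tsupport_fderiv_test_subset (fun X =>
      fn (2 * pderiv (Fin.last n) p) X * radialCutoff X) (coordVec (Fin.last n))
    have a1 := integrable_mul_of_tsupport_subset hva (hy.continuous.mul
      (continuous_fderiv_apply (hcd (2 * pderiv (Fin.last n) p)) (coordVec (Fin.last n))))
      ((hcs _).of_isClosed_subset (isClosed_tsupport _) ((tsupport_mul_subset_right' yCoord _).trans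
        hss)) (((tsupport_mul_subset_right' yCoord _).trans hss).trans (hsu _))
    have a2 := integrable_mul_of_tsupport_subset hva (hcd (2 * pderiv (Fin.last n) p)).continuous
      (hcs _) (hsu _)
    refine (a1.add (a2.const_mul (1 + a))).congr (.of_forall fun X => ?_)
    simp only [Pi.add_apply, Pi.mul_apply]
    ring
  have j2 : Integrable (fun X => inner ℝ (G X) (coordVec (Fin.last n)) *
      (yCoord X * (fn (2 * pderiv (Fin.last n) p) X * radialCutoff X))) (bulkMeasure n a) :=
    integrable_bulk_inner_const_mul hGa (hy.continuous.mul (hcd _).continuous)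
      ((hcs _).of_isClosed_subset (isClosed_tsupport _) (tsupport_mul_subset_right' yCoord _))
      ((tsupport_mul_subset_right' yCoord _).trans (hsu _)) _
  have h2 : ∀ X : Amb n, fn (2 : EvenPoly n) X = 2 := fn_C 2
  have h2d : pderiv (Fin.last n) (2 : EvenPoly n) = 0 := pderiv_C
  have L : ∫ X, v X * (2 * deriv lineCutoff (‖X‖ ^ 2) * (k * fn p X)) ∂(bulkMeasure n a)
      = - ∫ X, radialCutoff X * inner ℝ (G X) (gradient (fn p) X) ∂(bulkMeasure n a) := by
    calc _ = ∑ i : Fin n, (∫ X, v X * fderiv ℝ (fun X =>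
          fn (pderiv i.castSucc p) X * radialCutoff X) X (coordVec i.castSucc) ∂(bulkMeasure n a))
        + ∫ X, v X * (yCoord X * fderiv ℝ (fun X =>
          fn (2 * pderiv (Fin.last n) p) X * radialCutoff X) X (coordVec (Fin.last n))
          + (1 + a) * (fn (2 * pderiv (Fin.last n) p) X * radialCutoff X)) ∂(bulkMeasure n a) := by
          rw [← integral_finsetSum _ fun i _ => i1 i,
            ← integral_add (integrable_finsetSum _ fun i _ => i1 i) i2]
          refine integral_congr_ae (.of_forall fun X => ?_)
          simp only [← Finset.mul_sum, ← mul_add]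
          congr 1
          have hl := fn_lap (a := a) p X
          rw [hp.2, fn_zero] at hl
          have hd2 : pderiv (Fin.last n) (2 * pderiv (Fin.last n) p)
              = 2 * pderiv (Fin.last n) (pderiv (Fin.last n) p) := by
            rw [Derivation.leibniz, h2d]; simp
          rw [hfd (2 * pderiv (Fin.last n) p) X (Fin.last n), fderiv_fn_last, hd2]
          simp only [hfd, fderiv_fn_castSucc, Finset.sum_add_distrib,
            ← Finset.sum_mul, fn_mul, h2]
          have e : ∑ i : Fin n, fn (pderiv i.castSucc p) X
              * (2 * deriv lineCutoff (‖X‖ ^ 2) * X i.castSucc)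
              = 2 * deriv lineCutoff (‖X‖ ^ 2)
                * ∑ i : Fin n, X i.castSucc * fn (pderiv i.castSucc p) X := by
            rw [Finset.mul_sum]
            exact Finset.sum_congr rfl fun i _ => by ring
          rw [e, ← fn_euler hp.1 X]
          have hyl : X (Fin.last n) = yCoord X := rfl
          rw [hyl]
          linear_combination (radialCutoff X) * hl
      _ = - (∑ i : Fin n, (∫ X, inner ℝ (G X) (coordVec i.castSucc) *
          (fn (pderiv i.castSucc p) X * radialCutoff X) ∂(bulkMeasure n a))
          + ∫ X, inner ℝ (G X) (coordVec (Fin.last n)) *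
          (yCoord X * (fn (2 * pderiv (Fin.last n) p) X * radialCutoff X)) ∂(bulkMeasure n a)) := by
          rw [t2, Finset.sum_congr rfl fun i _ => t1 i, Finset.sum_neg_distrib]
          ring
      _ = _ := by
          rw [← integral_finsetSum _ fun i _ => j1 i,
            ← integral_add (integrable_finsetSum _ fun i _ => j1 i) j2]
          congr 1
          refine integral_congr_ae (.of_forall fun X => ?_)
          simp only []
          rw [inner_gradient_fn, mul_add, Finset.mul_sum, fn_mul, h2]
          congr 1
          · exact Finset.sum_congr rfl fun i _ => by ring
          · ring
  -- Both sides separate. Integrating by parts in `r` turns the left radial factor into `-k (k + n +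
  -- a - 1)` times the right one: this is the eigenvalue.
  rw [integral_bulk_separated a (fun r => k * (2 * deriv lineCutoff (r ^ 2) * r ^ (k : ℝ)))
      (fun θ => η θ * fn p (θ : Amb n)) (fun q => by
        rw [hv, homExt_polarMap, norm_polarMap, polarMap, fn_smul_point hp.1, Real.rpow_zero,
          Real.rpow_natCast]
        simp only [smul_eq_mul]
        ring),
    integral_bulk_separated a (fun r => lineCutoff (r ^ 2) * (r ^ (-1 : ℝ) * r ^ (k - 1 : ℝ)))
      (fun θ => inner ℝ (S θ) (gradient (fn p) (θ : Amb n))) (fun q => by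
        have hr : (0 : ℝ) < q.2 := q.2.2
        rw [hG, homExt_polarMap, radialCutoff, norm_polarMap, polarMap,
          gradient_fn_smul_point hp.1 hr, real_inner_smul_left, real_inner_smul_right]
        simp only [smul_eq_mul]
        ring)] at L
  have R1 : ∫ r in Ioi (0 : ℝ), r ^ (n + a) * (k * (2 * deriv lineCutoff (r ^ 2) * r ^ (k : ℝ)))
      = k * (- (n + a + k - 1) *
        ∫ r in Ioi (0 : ℝ), lineCutoff (r ^ 2) * r ^ ((n + a + k - 1) - 1)) := by
    rw [← integral_deriv_lineCutoff, ← integral_const_mul]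
    refine setIntegral_congr_fun measurableSet_Ioi fun r hr => ?_
    have hr : (0 : ℝ) < r := hr
    have : r ^ ((n + a + k - 1) + 1) = r ^ (n + a) * r ^ (k : ℝ) := by
      rw [← Real.rpow_add hr]; congr 1; ring
    simp only [this]
    ring
  have R2 : ∫ r in Ioi (0 : ℝ), r ^ (n + a) *
      (lineCutoff (r ^ 2) * (r ^ (-1 : ℝ) * r ^ (k - 1 : ℝ)))
      = ∫ r in Ioi (0 : ℝ), lineCutoff (r ^ 2) * r ^ ((n + a + k - 1) - 1) := by
    refine setIntegral_congr_fun measurableSet_Ioi fun r hr => ?_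
    have hr : (0 : ℝ) < r := hr
    have : r ^ ((n + a + k - 1) - 1) = r ^ (n + a) * (r ^ (-1 : ℝ) * r ^ (k - 1 : ℝ)) := by
      rw [← Real.rpow_add hr, ← Real.rpow_add hr]; congr 1; ring
    simp only [this]
    ring
  rw [R1, R2, smul_eq_mul, smul_eq_mul] at L
  have hJ := integral_lineCutoff_pos ((n + a + k - 1) - 1)
  set J := ∫ r in Ioi (0 : ℝ), lineCutoff (r ^ 2) * r ^ ((n + a + k - 1) - 1)
  rw [homEigenvalue]
  refine mul_left_cancel₀ hJ.ne' ?_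
  linear_combination L

end EvenPoly

/-! ### Reflection in `y` and density of even polynomials -/

lemma reflY_apply (X : Amb n) (i : Fin (n + 1)) :
    reflY X i = if i = Fin.last n then - X i else X i := by
  unfold reflY yCoord
  by_cases h : i = Fin.last n
  · subst h; simp; ring
  · simp [h]

lemma reflY_reflY (X : Amb n) : reflY (reflY X) = X := by
  ext i; simp only [reflY_apply]; split_ifs <;> simp

lemma yCoord_reflY (X : Amb n) : yCoord (reflY X) = - yCoord X := by simp [yCoord, reflY_apply]

/-- The reflection `reflY` as a linear isometry. -/
def reflIso (n : ℕ) : Amb n ≃ₗᵢ[ℝ] Amb n where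
  toLinearEquiv := LinearEquiv.ofInvolutive
    { toFun := reflY
      map_add' := fun X Y => by
        ext i; simp only [reflY_apply, PiLp.add_apply]; split_ifs <;> ring
      map_smul' := fun c X => by
        ext i; simp only [reflY_apply, PiLp.smul_apply, RingHom.id_apply]
        split_ifs <;> simp }
    reflY_reflY
  norm_map' := fun X => by
    change ‖reflY X‖ = ‖X‖
    rw [EuclideanSpace.norm_eq, EuclideanSpace.norm_eq]
    congr 1
    refine Finset.sum_congr rfl fun i _ => ?_
    rw [reflY_apply]; split_ifs <;> simp

lemma norm_reflY (X : Amb n) : ‖reflY X‖ = ‖X‖ := (reflIso n).norm_map X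

lemma reflY_smul (r : ℝ) (X : Amb n) : reflY (r • X) = r • reflY X := (reflIso n).map_smul r X

lemma continuous_reflY : Continuous (reflY : Amb n → Amb n) := (reflIso n).continuous

/-- The reflection on the sphere. -/
def reflSphere (n : ℕ) : USphere n ≃ₜ USphere n where
  toFun θ := ⟨reflY θ, by rw [mem_sphere_zero_iff_norm, norm_reflY]; exact norm_eq_of_mem_sphere θ⟩
  invFun θ := ⟨reflY θ, by rw [mem_sphere_zero_iff_norm, norm_reflY]; exact norm_eq_of_mem_sphere θ⟩
  left_inv θ := Subtype.ext (reflY_reflY _)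
  right_inv θ := Subtype.ext (reflY_reflY _)
  continuous_toFun := (continuous_reflY.comp continuous_subtype_val).subtype_mk _
  continuous_invFun := (continuous_reflY.comp continuous_subtype_val).subtype_mk _

lemma coe_reflSphere (θ : USphere n) : (reflSphere n θ : Amb n) = reflY θ := rfl

/-- Surface measure is a multiple of the volume of the cone over a set, and the reflection is a
linear isometry mapping cones to cones. -/
lemma measurePreserving_reflSphere_toSphere :
    MeasurePreserving (reflSphere n) (volume : Measure (Amb n)).toSphere
      (volume : Measure (Amb n)).toSphere := by
  refine ⟨(reflSphere n).continuous.measurable, Measure.ext fun s hs => ?_⟩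
  rw [Measure.map_apply (reflSphere n).continuous.measurable hs, Measure.toSphere_apply' _ hs,
    Measure.toSphere_apply' _ ((reflSphere n).continuous.measurable hs)]
  congr 1
  rw [← (reflIso n).measurePreserving.measure_preimage_equiv (f := (reflIso n).toMeasurableEquiv)]
  congr 1
  ext X
  simp only [Set.mem_smul, mem_preimage, mem_image]
  constructor
  · rintro ⟨r, hr, _, ⟨θ, hθ, rfl⟩, h⟩
    have h' : r • (θ : Amb n) = reflY X := h
    refine ⟨r, hr, _, ⟨_, hθ, rfl⟩, ?_⟩
    rw [coe_reflSphere, ← reflY_smul, h', reflY_reflY]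
  · rintro ⟨r, hr, _, ⟨θ, hθ, rfl⟩, h⟩
    refine ⟨r, hr, _, ⟨reflSphere n θ, ?_, rfl⟩, ?_⟩
    · have : reflSphere n (reflSphere n θ) = θ := (reflSphere n).left_inv θ
      rwa [this]
    · change _ = reflY X
      rw [← h, reflY_smul, coe_reflSphere]

lemma measurePreserving_reflSphere (a : ℝ) :
    MeasurePreserving (reflSphere n) (sphereMeasure n a) (sphereMeasure n a) := by
  refine ⟨(reflSphere n).continuous.measurable, ?_⟩
  conv_rhs => rw [sphereMeasure, ← measurePreserving_reflSphere_toSphere.map_eq,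
    ← withDensity_map_of_measurableEmbedding (reflSphere n).measurableEmbedding _
      (measurable_abs_yCoord_rpow_sphere a)]
  simp only [Function.comp_def, coe_reflSphere, yCoord_reflY, abs_neg]
  rfl

lemma homExt_reflY (μ : ℝ) (c : USphere n → ℝ) (q : USphere n × Ioi (0 : ℝ)) :
    homExt μ c (reflY (polarMap n q)) = homExt μ (fun θ => c (reflSphere n θ)) (polarMap n q) := by
  have : reflY (polarMap n q) = polarMap n (reflSphere n q.1, q.2) := by
    rw [polarMap, polarMap, reflY_smul, coe_reflSphere]
  rw [this, homExt_polarMap, homExt_polarMap]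

namespace EvenPoly

open MvPolynomial

lemma fn_reflY (p : EvenPoly n) (X : Amb n) : fn p (reflY X) = fn p X := by
  unfold fn
  congr 2
  funext i
  unfold evenCoord
  rw [reflY_apply]
  split_ifs <;> simp

/-- Functions `f + y g` on the sphere with `f`, `g` polynomials in `(x, y²)`. -/
def spherePoly (n : ℕ) : Subalgebra ℝ C(USphere n, ℝ) where
  carrier := {f | ∃ p q : EvenPoly n, ∀ θ,
    f θ = fn p (θ : Amb n) + yCoord (θ : Amb n) * fn q (θ : Amb n)}
  mul_mem' := by
    rintro f g ⟨p, q, h⟩ ⟨p', q', h'⟩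
    refine ⟨p * p' + X (Fin.last n) * (q * q'), p * q' + q * p', fun θ => ?_⟩
    simp only [ContinuousMap.mul_apply, h, h', fn_add, fn_mul, fn_X_last]
    ring
  add_mem' := by
    rintro f g ⟨p, q, h⟩ ⟨p', q', h'⟩
    refine ⟨p + p', q + q', fun θ => ?_⟩
    simp only [ContinuousMap.add_apply, h, h', fn_add]
    ring
  algebraMap_mem' c := ⟨C c, 0, fun θ => by simp [fn_C, fn_zero]⟩

lemma spherePoly_separatesPoints : (spherePoly n).SeparatesPoints := by
  intro θ η hne
  have : ∃ i, (θ : Amb n) i ≠ (η : Amb n) i := by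
    by_contra! h
    exact hne (Subtype.ext (by ext i; exact h i))
  obtain ⟨i, hi⟩ := this
  refine ⟨fun θ : USphere n => (θ : Amb n) i, ⟨⟨fun θ : USphere n => (θ : Amb n) i,
    (contDiff_coord i).continuous.comp continuous_subtype_val⟩, ?_, rfl⟩, hi⟩
  refine Fin.lastCases ?_ (fun j => ?_) i
  · exact ⟨0, 1, fun θ => by simp [fn, yCoord]⟩
  · exact ⟨X j.castSucc, 0, fun θ => by simp [fn_zero, fn_X_castSucc]⟩

/-- The restriction of a polynomial in `(x, y²)` to the sphere. -/
def toSphereMap (n : ℕ) : EvenPoly n →ₗ[ℝ] C(USphere n, ℝ) where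
  toFun p := ⟨fun θ => fn p θ, (contDiff_fn p).continuous.comp continuous_subtype_val⟩
  map_add' p q := by ext θ; exact fn_add p q θ
  map_smul' c p := by ext θ; exact fn_smul c p θ

/-- The restriction of a polynomial in `(x, y²)` to the sphere, as an element of `L²`. -/
def toL2 (n : ℕ) (a : ℝ) [IsFiniteMeasure (sphereMeasure n a)] :
    EvenPoly n →ₗ[ℝ] Lp ℝ 2 (sphereMeasure n a) :=
  (ContinuousMap.toLp 2 (sphereMeasure n a) ℝ).toLinearMap ∘ₗ toSphereMap n

variable {a : ℝ} [IsFiniteMeasure (sphereMeasure n a)]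

lemma coeFn_toL2 (p : EvenPoly n) :
    toL2 n a p =ᵐ[sphereMeasure n a] fun θ => fn p (θ : Amb n) :=
  ContinuousMap.coeFn_toLp (sphereMeasure n a) (𝕜 := ℝ) (toSphereMap n p)

lemma memLp_fn (p : EvenPoly n) : MemLp (fun θ : USphere n => fn p θ) 2 (sphereMeasure n a) :=
  (memLp_congr_ae (coeFn_toL2 p)).mp (Lp.memLp _)

lemma toL2_eq (p : EvenPoly n) : toL2 n a p = (memLp_fn p).toLp _ :=
  Lp.ext ((coeFn_toL2 p).trans (MemLp.coeFn_toLp _).symm)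

/-- Even functions in `L²` are limits of polynomials in `(x, y²)`. -/
lemma mem_closure_range_toL2 {f : USphere n → ℝ} (hf : MemLp f 2 (sphereMeasure n a))
    (he : ∀ᵐ θ ∂(sphereMeasure n a), f (reflSphere n θ) = f θ) :
    hf.toLp f ∈ closure (LinearMap.range (toL2 n a) : Set (Lp ℝ 2 (sphereMeasure n a))) := by
  have hd : DenseRange (ContinuousMap.toLp 2 (sphereMeasure n a) ℝ :
      C(USphere n, ℝ) →L[ℝ] Lp ℝ 2 (sphereMeasure n a)) :=
    ContinuousMap.toLp_denseRange ℝ (sphereMeasure n a) ℝ (by simp)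
  have hsw : Dense (spherePoly n : Set C(USphere n, ℝ)) := by
    rw [dense_iff_closure_eq, ← Subalgebra.topologicalClosure_coe,
      ContinuousMap.subalgebra_topologicalClosure_eq_top_of_separatesPoints _
        spherePoly_separatesPoints]
    rfl
  have hd2 := hd.dense_image (ContinuousMap.toLp 2 (sphereMeasure n a) ℝ).continuous hsw
  rw [Metric.mem_closure_iff]
  intro ε hε
  obtain ⟨_, ⟨g, ⟨p, q, hg⟩, rfl⟩, hdist⟩ := Metric.mem_closure_iff.mp (hd2 (hf.toLp f)) ε hε
  refine ⟨toL2 n a p, ⟨p, rfl⟩, ?_⟩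
  set σ := sphereMeasure n a
  have hgL : MemLp g 2 σ := (memLp_congr_ae (ContinuousMap.coeFn_toLp σ (𝕜 := ℝ) g)).mp (Lp.memLp _)
  have e1 : ContinuousMap.toLp 2 σ ℝ g = hgL.toLp g :=
    Lp.ext ((ContinuousMap.coeFn_toLp σ (𝕜 := ℝ) g).trans (MemLp.coeFn_toLp _).symm)
  have hmp := measurePreserving_reflSphere (n := n) a
  rw [e1, dist_eq_norm, ← MemLp.toLp_sub, Lp.norm_toLp] at hdist
  rw [toL2_eq, dist_eq_norm, ← MemLp.toLp_sub, Lp.norm_toLp]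
  have hd1 := hf.sub hgL
  have hd2 := hd1.comp_measurePreserving hmp
  have e2 : eLpNorm ((f - ⇑g) ∘ reflSphere n) 2 σ = eLpNorm (f - ⇑g) 2 σ :=
    eLpNorm_comp_measurePreserving hd1.1 hmp
  -- Averaging `f - g` with its reflection removes the odd part `y q` of the approximant and does
  -- not increase the norm.
  have e3 : (f - fun θ : USphere n => fn p θ) =ᵐ[σ]
      (1 / 2 : ℝ) • ((f - ⇑g) + (f - ⇑g) ∘ reflSphere n) := by
    filter_upwards [he] with θ hθ
    simp only [Pi.sub_apply, Pi.smul_apply, Pi.add_apply, Function.comp_apply, hθ, hg,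
      coe_reflSphere, fn_reflY, yCoord_reflY, smul_eq_mul]
    ring
  refine lt_of_le_of_lt ?_ hdist
  refine ENNReal.toReal_mono hd1.2.ne ?_
  rw [eLpNorm_congr_ae e3, eLpNorm_const_smul]
  calc _ ≤ ‖(1 / 2 : ℝ)‖ₑ * (eLpNorm (f - ⇑g) 2 σ + eLpNorm (f - ⇑g) 2 σ) := by
        gcongr
        refine (eLpNorm_add_le hd1.1 hd2.1 (by norm_num)).trans (by rw [e2])
    _ = eLpNorm (f - ⇑g) 2 σ := by
        rw [← two_mul, ← mul_assoc]
        have : ‖(1 / 2 : ℝ)‖ₑ * 2 = 1 := by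
          rw [Real.enorm_eq_ofReal (by norm_num), show (2 : ℝ≥0∞) = ENNReal.ofReal 2 by simp,
            ← ENNReal.ofReal_mul (by norm_num)]
          norm_num
        rw [this, one_mul]

end EvenPoly

/-! ### Spectral decomposition of even functions on the sphere -/

/-- The difference factors as `(k - j) (k + j + n + a - 1)`, and `k + j ≥ 1`, `n + a > 0`. -/
lemma homEigenvalue_strictMono (hn : 1 ≤ n) {a : ℝ} (ha : -1 < a) {j k : ℕ} (hjk : j < k) :
    homEigenvalue n a j < homEigenvalue n a k := by
  have h1 : (j : ℝ) + 1 ≤ k := by exact_mod_cast hjk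
  have h2 : (1 : ℝ) ≤ n := by exact_mod_cast hn
  have h3 : (0 : ℝ) ≤ j := j.cast_nonneg
  have h4 : homEigenvalue n a k - homEigenvalue n a j = (k - j) * (k + j + (n + a - 1)) := by
    unfold homEigenvalue; ring
  have : 0 < ((k : ℝ) - j) * (k + j + (n + a - 1)) := mul_pos (by linarith) (by linarith)
  linarith

lemma homEigenvalue_mono (hn : 1 ≤ n) {a : ℝ} (ha : -1 < a) {j k : ℕ} (hjk : j ≤ k) :
    homEigenvalue n a j ≤ homEigenvalue n a k := by
  rcases hjk.eq_or_lt with h | h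
  · rw [h]
  · exact (homEigenvalue_strictMono hn ha h).le

lemma homEigenvalue_injective (hn : 1 ≤ n) {a : ℝ} (ha : -1 < a) {j k : ℕ} (hjk : j ≠ k) :
    homEigenvalue n a j ≠ homEigenvalue n a k := by
  rcases hjk.lt_or_gt with h | h
  · exact (homEigenvalue_strictMono hn ha h).ne
  · exact (homEigenvalue_strictMono hn ha h).ne'

lemma homEigenvalue_nonneg (hn : 1 ≤ n) {a : ℝ} (ha : -1 < a) (k : ℕ) :
    0 ≤ homEigenvalue n a k := by
  have := homEigenvalue_mono hn ha (Nat.zero_le k)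
  simpa [homEigenvalue] using this

lemma integrable_inner_of_memLp {α E : Type*} [MeasurableSpace α] [NormedAddCommGroup E]
    [InnerProductSpace ℝ E] {μ : Measure α} {f g : α → E} (hf : MemLp f 2 μ) (hg : MemLp g 2 μ) :
    Integrable (fun x => inner ℝ (f x) (g x)) μ := by
  refine (L2.integrable_inner (𝕜 := ℝ) (hf.toLp f) (hg.toLp g)).congr ?_
  filter_upwards [hf.coeFn_toLp, hg.coeFn_toLp] with x h1 h2
  rw [h1, h2]

lemma integral_inner_eq_inner_toLp {α E : Type*} [MeasurableSpace α] [NormedAddCommGroup E]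
    [InnerProductSpace ℝ E] {μ : Measure α} {f g : α → E} (hf : MemLp f 2 μ) (hg : MemLp g 2 μ) :
    ∫ x, inner ℝ (f x) (g x) ∂μ = inner ℝ (hf.toLp f) (hg.toLp g) := by
  rw [L2.inner_def]
  refine integral_congr_ae ?_
  filter_upwards [hf.coeFn_toLp, hg.coeFn_toLp] with x h1 h2
  rw [h1, h2]

lemma integral_mul_eq_inner_toLp {α : Type*} [MeasurableSpace α] {μ : Measure α} {f g : α → ℝ}
    (hf : MemLp f 2 μ) (hg : MemLp g 2 μ) :
    ∫ x, f x * g x ∂μ = inner ℝ (hf.toLp f) (hg.toLp g) := by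
  rw [← integral_inner_eq_inner_toLp]
  refine integral_congr_ae (.of_forall fun x => ?_)
  simp [mul_comm]

lemma integral_norm_sq_eq_norm_toLp {α E : Type*} [MeasurableSpace α] [NormedAddCommGroup E]
    [InnerProductSpace ℝ E] {μ : Measure α} {f : α → E} (hf : MemLp f 2 μ) :
    ∫ x, ‖f x‖ ^ 2 ∂μ = ‖hf.toLp f‖ ^ 2 := by
  rw [← real_inner_self_eq_norm_sq, ← integral_inner_eq_inner_toLp]
  simp only [real_inner_self_eq_norm_sq]

lemma sq_integral_inner_le {α E : Type*} [MeasurableSpace α] [NormedAddCommGroup E]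
    [InnerProductSpace ℝ E] {μ : Measure α} {f g : α → E} (hf : MemLp f 2 μ) (hg : MemLp g 2 μ) :
    (∫ x, inner ℝ (f x) (g x) ∂μ) ^ 2 ≤ (∫ x, ‖f x‖ ^ 2 ∂μ) * ∫ x, ‖g x‖ ^ 2 ∂μ := by
  rw [integral_inner_eq_inner_toLp hf hg, integral_norm_sq_eq_norm_toLp hf,
    integral_norm_sq_eq_norm_toLp hg, ← mul_pow]
  exact sq_le_sq' (neg_le_of_abs_le (abs_real_inner_le_norm _ _)) (real_inner_le_norm _ _)

/-- A tangential field does not see radial corrections, so the full gradient of a polynomial may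
replace its tangential gradient. -/
lemma IsTangentialGradient.integral_inner_smul_self {c : USphere n → ℝ} {T : USphere n → Amb n}
    (h : IsTangentialGradient c T) (a : ℝ) (S : USphere n → Amb n) (f : USphere n → ℝ) :
    ∫ θ, inner ℝ (T θ) (S θ - f θ • (θ : Amb n)) ∂(sphereMeasure n a)
      = ∫ θ, inner ℝ (T θ) (S θ) ∂(sphereMeasure n a) := by
  refine integral_congr_ae ?_
  filter_upwards [h.inner_self_eq_zero a] with θ hθ
  rw [inner_sub_right, real_inner_smul_right, hθ, mul_zero, sub_zero]

namespace EvenPoly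

open MvPolynomial

lemma continuous_sphGrad (k : ℕ) (p : EvenPoly n) : Continuous (sphGrad k p) := by
  have h1 : Continuous (gradient (fn p)) := by
    have : Continuous (fderiv ℝ (fn p)) := (contDiff_fn p).continuous_fderiv (by simp)
    exact (InnerProductSpace.toDual ℝ (Amb n)).symm.continuous.comp this
  unfold sphGrad
  have h2 := (contDiff_fn p).continuous
  fun_prop

variable {a : ℝ} [IsFiniteMeasure (sphereMeasure n a)]

lemma memLp_sphGrad (k : ℕ) (p : EvenPoly n) : MemLp (sphGrad k p) 2 (sphereMeasure n a) := by
  have h := (ContinuousMap.toLp 2 (sphereMeasure n a) ℝ ⟨_, continuous_sphGrad k p⟩)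
  exact (memLp_congr_ae (ContinuousMap.coeFn_toLp (sphereMeasure n a) (𝕜 := ℝ)
    ⟨_, continuous_sphGrad k p⟩)).mp (Lp.memLp _)

lemma integral_inner_sphGrad {k : ℕ} {p : EvenPoly n} (hp : p ∈ harm n a k) {η : USphere n → ℝ}
    {S : USphere n → Amb n} (hη : MemLp η 2 (sphereMeasure n a)) (h : IsTangentialGradient η S)
    (hS : MemLp S 2 (sphereMeasure n a)) :
    ∫ θ, inner ℝ (S θ) (sphGrad k p θ) ∂(sphereMeasure n a)
      = homEigenvalue n a k * ∫ θ, η θ * fn p (θ : Amb n) ∂(sphereMeasure n a) := by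
  rw [← integral_inner_gradient_harm hp h (hη.integrable (by norm_num))
    (hS.integrable (by norm_num))]
  exact h.integral_inner_smul_self a _ _

lemma isSphereEigenfunction_fn {k : ℕ} {p : EvenPoly n} (hp : p ∈ harm n a k) :
    IsSphereEigenfunction a (homEigenvalue n a k) (fun θ : USphere n => fn p (θ : Amb n)) := by
  refine ⟨memLp_fn p, sphGrad k p, isTangentialGradient_fn hp.1, memLp_sphGrad k p,
    fun η S hη h hS => ?_⟩
  rw [← integral_congr_ae (.of_forall fun θ => real_inner_comm (sphGrad k p θ) (S θ)),
    integral_inner_sphGrad hp hη h hS]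
  simp only [mul_comm]

/-- Testing the two weak equations against each other gives `(l - λ(k)) ∫ e p = 0`. The
eigenfunction `e` is arbitrary, neither even nor a polynomial. -/
lemma integral_eigenfunction_mul_harm {l : ℝ} {e : USphere n → ℝ}
    (he : IsSphereEigenfunction a l e) {k : ℕ} (hl : l ≠ homEigenvalue n a k) {p : EvenPoly n}
    (hp : p ∈ harm n a k) : ∫ θ, e θ * fn p (θ : Amb n) ∂(sphereMeasure n a) = 0 := by
  obtain ⟨hm, T, hT, hT2, h⟩ := he
  have h1 := h _ _ (memLp_fn p) (isTangentialGradient_fn hp.1) (memLp_sphGrad k p)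
  rw [integral_inner_sphGrad hp hm hT hT2] at h1
  have : (l - homEigenvalue n a k) * ∫ θ, e θ * fn p (θ : Amb n) ∂(sphereMeasure n a) = 0 := by
    linarith
  exact (mul_eq_zero.mp this).resolve_left (sub_ne_zero.mpr hl)

lemma inner_toLp_toL2 {f : USphere n → ℝ} (hf : MemLp f 2 (sphereMeasure n a)) (p : EvenPoly n) :
    inner ℝ (hf.toLp f) (toL2 n a p) = ∫ θ, f θ * fn p (θ : Amb n) ∂(sphereMeasure n a) := by
  rw [toL2_eq, integral_mul_eq_inner_toLp]

lemma inner_toL2_toL2 (hn : 1 ≤ n) (ha : -1 < a) {j k : ℕ} (hjk : j ≠ k) {p q : EvenPoly n}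
    (hp : p ∈ harm n a j) (hq : q ∈ harm n a k) : inner ℝ (toL2 n a p) (toL2 n a q) = 0 := by
  rw [toL2_eq p, inner_toLp_toL2]
  exact integral_eigenfunction_mul_harm (isSphereEigenfunction_fn hp)
    (homEigenvalue_injective hn ha hjk) hq

lemma inner_sum_toL2 (hn : 1 ≤ n) (ha : -1 < a) {g : ℕ → EvenPoly n} (hg : ∀ k, g k ∈ harm n a k)
    {s : Finset ℕ} {k : ℕ} (hk : k ∈ s) {q : EvenPoly n} (hq : q ∈ harm n a k) :
    inner ℝ (∑ j ∈ s, toL2 n a (g j)) (toL2 n a q) = inner ℝ (toL2 n a (g k)) (toL2 n a q) := by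
  rw [sum_inner]
  exact Finset.sum_eq_single_of_mem k hk fun j _ hj => inner_toL2_toL2 hn ha hj (hg j) hq

lemma norm_sum_toL2_sq (hn : 1 ≤ n) (ha : -1 < a) {g : ℕ → EvenPoly n}
    (hg : ∀ k, g k ∈ harm n a k) (s : Finset ℕ) :
    ‖∑ j ∈ s, toL2 n a (g j)‖ ^ 2 = ∑ j ∈ s, ‖toL2 n a (g j)‖ ^ 2 := by
  rw [← real_inner_self_eq_norm_sq, inner_sum]
  refine Finset.sum_congr rfl fun k hk => ?_
  rw [inner_sum_toL2 hn ha hg hk (hg k), real_inner_self_eq_norm_sq]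

/-- The span in `L²` of the harmonic polynomials with degrees in `s`. -/
def harmSpace (n : ℕ) (a : ℝ) [IsFiniteMeasure (sphereMeasure n a)] (s : Finset ℕ) :
    Submodule ℝ (Lp ℝ 2 (sphereMeasure n a)) :=
  (⨆ k ∈ s, harm n a k).map (toL2 n a)

lemma mem_harmSpace {s : Finset ℕ} {u : Lp ℝ 2 (sphereMeasure n a)} (hu : u ∈ harmSpace n a s) :
    ∃ g : ℕ → EvenPoly n, (∀ k, g k ∈ harm n a k) ∧ u = ∑ k ∈ s, toL2 n a (g k) := by
  obtain ⟨p, hp, rfl⟩ := hu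
  obtain ⟨g, rfl⟩ := (Submodule.mem_iSup_finset_iff_exists_sum _ _).mp hp
  exact ⟨fun k => g k, fun k => (g k).2, by rw [map_sum]⟩

lemma toL2_mem_harmSpace {s : Finset ℕ} {k : ℕ} (hk : k ∈ s) {p : EvenPoly n}
    (hp : p ∈ harm n a k) : toL2 n a p ∈ harmSpace n a s :=
  ⟨p, Submodule.mem_iSup_of_mem k (Submodule.mem_iSup_of_mem hk hp), rfl⟩

instance (s : Finset ℕ) : FiniteDimensional ℝ (⨆ k ∈ s, harm n a k : Submodule ℝ (EvenPoly n)) :=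
  Finset.sup_eq_iSup s (harm n a) ▸ Submodule.finiteDimensional_finset_sup s _

instance (s : Finset ℕ) : FiniteDimensional ℝ (harmSpace n a s) := by
  unfold harmSpace; infer_instance

/-- On the sphere `|X|² = 1`, so the powers of `|X|²` in `span_rSq_mul_harm` disappear and only
harmonic polynomials remain. -/
lemma toL2_rSq_pow_mul (j : ℕ) (p : EvenPoly n) : toL2 n a (rSq n ^ j * p) = toL2 n a p := by
  rw [toL2_eq, toL2_eq]
  refine (MemLp.toLp_eq_toLp_iff _ _).mpr (.of_forall fun θ => ?_)
  simp only [fn_mul, fn_pow, fn_rSq, norm_eq_of_mem_sphere]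
  simp

lemma exists_toL2_mem_harmSpace (ha : -1 < a) (p : EvenPoly n) :
    ∃ s : Finset ℕ, toL2 n a p ∈ harmSpace n a s := by
  have h : toL2 n a p ∈ ⨆ k, (harm n a k).map (toL2 n a) := by
    have hp : p ∈ Submodule.span ℝ
        {p : EvenPoly n | ∃ j k, ∃ h ∈ harm n a k, p = rSq n ^ j * h} := by
      rw [span_rSq_mul_harm ha]; trivial
    have := Submodule.mem_map_of_mem (f := toL2 n a) hp
    rw [Submodule.map_span] at this
    refine Submodule.span_le.mpr ?_ this
    rintro _ ⟨_, ⟨j, k, h, hh, rfl⟩, rfl⟩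
    rw [toL2_rSq_pow_mul]
    exact Submodule.mem_iSup_of_mem k (Submodule.mem_map_of_mem hh)
  obtain ⟨s, hs⟩ := Submodule.mem_iSup_iff_exists_finset.mp h
  refine ⟨s, ?_⟩
  rw [harmSpace]
  simp only [Submodule.map_iSup]
  exact hs

/-- Approximation of an even function without low modes by its higher modes. -/
lemma exists_high_mode_approx (hn : 1 ≤ n) (ha : -1 < a) {φ : USphere n → ℝ}
    (hφ : MemLp φ 2 (sphereMeasure n a))
    (he : ∀ᵐ θ ∂(sphereMeasure n a), φ (reflSphere n θ) = φ θ) {L : ℕ}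
    (hlow : ∀ k ≤ L, ∀ p ∈ harm n a k,
      ∫ θ, φ θ * fn p (θ : Amb n) ∂(sphereMeasure n a) = 0) {ε : ℝ} (hε : 0 < ε) :
    ∃ (s : Finset ℕ) (g : ℕ → EvenPoly n), (∀ k ∈ s, L < k) ∧ (∀ k, g k ∈ harm n a k) ∧
      ‖hφ.toLp φ - ∑ k ∈ s, toL2 n a (g k)‖ < ε ∧
      ∀ k ∈ s, inner ℝ (hφ.toLp φ) (toL2 n a (g k)) = ‖toL2 n a (g k)‖ ^ 2 := by
  obtain ⟨_, ⟨p, rfl⟩, hp⟩ := Metric.mem_closure_iff.mp (mem_closure_range_toL2 hφ he) ε hε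
  obtain ⟨s, hs⟩ := exists_toL2_mem_harmSpace (n := n) ha p
  set Φ := hφ.toLp φ
  set U := harmSpace n a s
  -- The projection onto finitely many harmonic degrees is at least as close as the given
  -- polynomial, and its degree-`k` component has the same pairing with `φ` as with itself.
  set u := U.starProjection Φ with hu
  obtain ⟨g, hg, hug⟩ := mem_harmSpace (U.starProjection_apply_mem Φ)
  have horth : ∀ w ∈ U, inner ℝ (Φ - u) w = 0 := fun w hw =>
    U.starProjection_inner_eq_zero Φ w hw
  have hk : ∀ k ∈ s, inner ℝ Φ (toL2 n a (g k)) = ‖toL2 n a (g k)‖ ^ 2 := fun k hk => by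
    have h1 := horth _ (toL2_mem_harmSpace hk (hg k))
    rw [inner_sub_left, hu, hug, inner_sum_toL2 hn ha hg hk (hg k),
      real_inner_self_eq_norm_sq] at h1
    linarith
  -- A low component has squared norm equal to its pairing with `φ`, which is zero by assumption.
  have hzero : ∀ k ∈ s, ¬ L < k → toL2 n a (g k) = 0 := fun k hks hkL => by
    have h1 := hk k hks
    rw [inner_toLp_toL2, hlow k (not_lt.mp hkL) _ (hg k)] at h1
    exact norm_eq_zero.mp (pow_eq_zero_iff two_ne_zero |>.mp h1.symm)
  refine ⟨s.filter (L < ·), g, fun k hk => (Finset.mem_filter.mp hk).2, hg, ?_,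
    fun k hks => hk k (Finset.mem_filter.mp hks).1⟩
  rw [Finset.sum_filter_of_ne fun k hks hne => by
    by_contra hcon; exact hne (hzero k hks hcon), ← hug]
  refine lt_of_le_of_lt ?_ hp
  rw [dist_eq_norm]
  have h1 : ‖Φ - toL2 n a p‖ ^ 2 = ‖Φ - u‖ ^ 2 + ‖u - toL2 n a p‖ ^ 2 := by
    have h2 := horth _ (U.sub_mem (U.starProjection_apply_mem Φ) hs)
    have h3 : Φ - toL2 n a p = (Φ - u) + (u - toL2 n a p) := by abel
    rw [h3, norm_add_sq_real, h2]; ring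
  refine le_of_sq_le_sq ?_ (norm_nonneg _)
  rw [h1]; nlinarith [sq_nonneg ‖u - toL2 n a p‖]

/-- The eigenvalue gap for even functions without low modes. -/
lemma gap_inequality (hn : 1 ≤ n) (ha : -1 < a) {φ : USphere n → ℝ} {T : USphere n → Amb n}
    (hφ : MemLp φ 2 (sphereMeasure n a)) (h : IsTangentialGradient φ T)
    (hT : MemLp T 2 (sphereMeasure n a))
    (he : ∀ᵐ θ ∂(sphereMeasure n a), φ (reflSphere n θ) = φ θ) {L : ℕ}
    (hlow : ∀ k ≤ L, ∀ p ∈ harm n a k,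
      ∫ θ, φ θ * fn p (θ : Amb n) ∂(sphereMeasure n a) = 0) :
    homEigenvalue n a (L + 1 : ℕ) * sphereNormSq a φ ≤ sphereNormSq a T := by
  set lam := homEigenvalue n a (L + 1 : ℕ) with hlam
  have hlam0 : 0 < lam := by
    have := homEigenvalue_strictMono hn ha (Nat.succ_pos L)
    rw [homEigenvalue, Nat.cast_zero, zero_mul] at this
    exact this
  have key : ∀ ε > 0, ‖hφ.toLp φ‖ ≤ √(sphereNormSq a T / lam) + ε := by
    intro ε hε
    obtain ⟨s, g, hsL, hg, happ, hin⟩ := exists_high_mode_approx hn ha hφ he hlow hε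
    -- `S` is the gradient of the projection of `φ`. Both `∫ T · S` and `∫ |S|²` equal the same
    -- spectral sum `A`, so Cauchy-Schwarz gives `A ≤ ∫ |T|²`, and `A` dominates the lowest
    -- eigenvalue times the squared norm of the projection.
    set S : USphere n → Amb n := fun θ => ∑ k ∈ s, sphGrad k (g k) θ with hS
    have hS2 : MemLp S 2 (sphereMeasure n a) := memLp_finsetSum s fun k _ => memLp_sphGrad k (g k)
    have hpair : ∀ (η : USphere n → ℝ) (R : USphere n → Amb n) (hη : MemLp η 2 (sphereMeasure n a)),
        IsTangentialGradient η R → MemLp R 2 (sphereMeasure n a) →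
        ∫ θ, inner ℝ (R θ) (S θ) ∂(sphereMeasure n a)
          = ∑ k ∈ s, homEigenvalue n a k * inner ℝ (hη.toLp η) (toL2 n a (g k)) := by
      intro η R hη hR hR2
      simp only [hS, inner_sum]
      rw [integral_finsetSum _ fun k _ => integrable_inner_of_memLp hR2 (memLp_sphGrad k (g k))]
      refine Finset.sum_congr rfl fun k _ => ?_
      rw [integral_inner_sphGrad (hg k) hη hR hR2, inner_toLp_toL2]
    set A := ∑ k ∈ s, homEigenvalue n a k * ‖toL2 n a (g k)‖ ^ 2 with hA
    have h1 : ∫ θ, inner ℝ (T θ) (S θ) ∂(sphereMeasure n a) = A := by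
      rw [hpair φ T hφ h hT]
      exact Finset.sum_congr rfl fun k hk => by rw [hin k hk]
    have h2 : ∫ θ, ‖S θ‖ ^ 2 ∂(sphereMeasure n a) = A := by
      have hP : MemLp (fun θ : USphere n => ∑ k ∈ s, fn (g k) (θ : Amb n)) 2 (sphereMeasure n a) :=
        memLp_finsetSum s fun k _ => memLp_fn (g k)
      have h3 := hpair _ S hP (IsTangentialGradient.sum s fun k _ =>
        isTangentialGradient_fn (hg k).1) hS2
      simp only [real_inner_self_eq_norm_sq] at h3
      rw [h3]
      refine Finset.sum_congr rfl fun k hk => ?_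
      have h4 : hP.toLp _ = ∑ k ∈ s, toL2 n a (g k) := by
        rw [← map_sum, toL2_eq]
        refine (MemLp.toLp_eq_toLp_iff _ _).mpr (.of_forall fun θ => ?_)
        simp only [fn_sum]
      rw [h4, inner_sum_toL2 hn ha hg hk (hg k), real_inner_self_eq_norm_sq]
    have h5 := sq_integral_inner_le hT hS2
    rw [h1, h2] at h5
    have hA0 : lam * ‖∑ k ∈ s, toL2 n a (g k)‖ ^ 2 ≤ A := by
      rw [norm_sum_toL2_sq hn ha hg, Finset.mul_sum]
      refine Finset.sum_le_sum fun k hk => ?_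
      gcongr
      exact homEigenvalue_mono hn ha (hsL k hk)
    have hAT : A ≤ sphereNormSq a T := by
      rcases (le_trans (by positivity) hA0 : (0 : ℝ) ≤ A).eq_or_lt with h0 | h0
      · rw [← h0]; exact integral_nonneg fun θ => by positivity
      · rw [sq] at h5
        exact le_of_mul_le_mul_right h5 h0
    have h6 : ‖∑ k ∈ s, toL2 n a (g k)‖ ≤ √(sphereNormSq a T / lam) := by
      refine Real.le_sqrt_of_sq_le ?_
      rw [le_div_iff₀ hlam0, mul_comm]
      linarith
    calc ‖hφ.toLp φ‖ ≤ ‖∑ k ∈ s, toL2 n a (g k)‖ + ‖hφ.toLp φ - ∑ k ∈ s, toL2 n a (g k)‖ :=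
          norm_le_norm_add_norm_sub' _ _
      _ ≤ _ := by gcongr
  have h1 := le_of_forall_pos_le_add key
  rw [sphereNormSq, integral_norm_sq_eq_norm_toLp hφ]
  have h2 : ‖hφ.toLp φ‖ ^ 2 ≤ sphereNormSq a T / lam := by
    have h0 : 0 ≤ sphereNormSq a T / lam :=
      div_nonneg (integral_nonneg fun θ => by positivity) hlam0.le
    calc _ ≤ √(sphereNormSq a T / lam) ^ 2 := by gcongr
      _ = _ := Real.sq_sqrt h0
  rw [le_div_iff₀ hlam0] at h2
  linarith

/-- An even function without low modes is orthogonal to all low eigenfunctions. -/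
lemma integral_mul_eigenfunction_eq_zero (hn : 1 ≤ n) (ha : -1 < a) {φ : USphere n → ℝ}
    (hφ : MemLp φ 2 (sphereMeasure n a))
    (he : ∀ᵐ θ ∂(sphereMeasure n a), φ (reflSphere n θ) = φ θ) {L : ℕ}
    (hlow : ∀ k ≤ L, ∀ p ∈ harm n a k,
      ∫ θ, φ θ * fn p (θ : Amb n) ∂(sphereMeasure n a) = 0) {l : ℝ} {e : USphere n → ℝ}
    (hl : l ≤ homEigenvalue n a L) (h : IsSphereEigenfunction a l e) :
    ∫ θ, φ θ * e θ ∂(sphereMeasure n a) = 0 := by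
  rw [integral_mul_eq_inner_toLp hφ h.1]
  set E := h.1.toLp e with hE
  refine norm_le_zero_iff.mp (le_of_forall_pos_le_add fun ε hε => ?_)
  have hpos : 0 < ε / (‖E‖ + 1) := by positivity
  obtain ⟨s, g, hsL, hg, happ, -⟩ := exists_high_mode_approx hn ha hφ he hlow hpos
  -- The approximants of `φ` have eigenvalues strictly above `l`, hence are orthogonal to `e`
  -- whatever its parity.
  have h1 : inner ℝ (∑ k ∈ s, toL2 n a (g k)) E = 0 := by
    rw [sum_inner]
    refine Finset.sum_eq_zero fun k hk => ?_
    rw [real_inner_comm, hE, inner_toLp_toL2]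
    exact integral_eigenfunction_mul_harm h
      (hl.trans_lt (homEigenvalue_strictMono hn ha (hsL k hk))).ne (hg k)
  have h2 : inner ℝ (hφ.toLp φ) E = inner ℝ (hφ.toLp φ - ∑ k ∈ s, toL2 n a (g k)) E := by
    rw [inner_sub_left, h1, sub_zero]
  rw [h2, zero_add]
  calc _ ≤ ‖hφ.toLp φ - ∑ k ∈ s, toL2 n a (g k)‖ * ‖E‖ := norm_inner_le_norm _ _
    _ ≤ ε / (‖E‖ + 1) * (‖E‖ + 1) := by gcongr; linarith
    _ = ε := by field_simp

lemma toLp_sum_fn (s : Finset ℕ) (g : ℕ → EvenPoly n)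
    (h : MemLp (fun θ : USphere n => ∑ k ∈ s, fn (g k) (θ : Amb n)) 2 (sphereMeasure n a)) :
    h.toLp _ = ∑ k ∈ s, toL2 n a (g k) := by
  rw [← map_sum, toL2_eq]
  refine (MemLp.toLp_eq_toLp_iff _ _).mpr (.of_forall fun θ => ?_)
  simp only [fn_sum]

/-- Compactness of the closed ball bounds the value and the derivative; convexity turns the latter
into a Lipschitz bound. -/
lemma exists_lipschitz_fn (p : EvenPoly n) : ∃ C : ℝ, 0 ≤ C ∧
    (∀ X ∈ Metric.closedBall (0 : Amb n) 1, |fn p X| ≤ C) ∧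
    ∀ X ∈ Metric.closedBall (0 : Amb n) 1, ∀ Y ∈ Metric.closedBall (0 : Amb n) 1,
      |fn p X - fn p Y| ≤ C * ‖X - Y‖ := by
  obtain ⟨K, hK⟩ := (isCompact_closedBall (0 : Amb n) 1).exists_bound_of_continuousOn
    ((contDiff_fn p).continuous_fderiv (by simp)).continuousOn
  obtain ⟨K', hK'⟩ := (isCompact_closedBall (0 : Amb n) 1).exists_bound_of_continuousOn
    (contDiff_fn p).continuous.continuousOn
  refine ⟨max K K', ((norm_nonneg _).trans (hK 0 (by simp))).trans (le_max_left _ _),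
    fun X hX => (hK' X hX).trans (le_max_right _ _), fun X hX Y hY => ?_⟩
  refine ((convex_closedBall (0 : Amb n) 1).norm_image_sub_le_of_norm_fderiv_le
    (fun Z _ => (contDiff_fn p).differentiable (by simp) Z) hK hY hX).trans ?_
  gcongr
  exact le_max_left _ _

/-- The low modes of a function in `L²`, with a Lipschitz bound. -/
lemma exists_low_modes (n : ℕ) (a : ℝ) [IsFiniteMeasure (sphereMeasure n a)] (L : ℕ) :
    ∃ C : ℝ, 0 ≤ C ∧ ∀ (c : USphere n → ℝ) (hc : MemLp c 2 (sphereMeasure n a)),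
    ∃ g : ℕ → EvenPoly n, (∀ k, g k ∈ harm n a k) ∧
      ‖∑ k ∈ Finset.range (L + 1), toL2 n a (g k)‖ ≤ ‖hc.toLp c‖ ∧
      (∀ k ≤ L, ∀ p ∈ harm n a k,
        ∫ θ, (c θ - ∑ k ∈ Finset.range (L + 1), fn (g k) (θ : Amb n)) * fn p (θ : Amb n)
          ∂(sphereMeasure n a) = 0) ∧
      (∀ X ∈ Metric.closedBall (0 : Amb n) 1,
        |∑ k ∈ Finset.range (L + 1), fn (g k) X| ≤ C * ‖hc.toLp c‖) ∧
      ∀ X ∈ Metric.closedBall (0 : Amb n) 1, ∀ Y ∈ Metric.closedBall (0 : Amb n) 1,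
        |∑ k ∈ Finset.range (L + 1), fn (g k) X - ∑ k ∈ Finset.range (L + 1), fn (g k) Y|
          ≤ C * ‖hc.toLp c‖ * ‖X - Y‖ := by
  set U := harmSpace n a (Finset.range (L + 1)) with hU
  set E : Submodule ℝ (EvenPoly n) := ⨆ k ∈ Finset.range (L + 1), harm n a k with hE
  -- A linear right inverse of the restriction map lifts `L²` modes to polynomials. Expanding in a
  -- finite basis, with bounded coordinate functionals, makes the constants depend linearly on the
  -- norm and uniform in `c`.
  let f : E →ₗ[ℝ] U := (toL2 n a).submoduleMap E
  obtain ⟨τ, hτ⟩ := f.exists_rightInverse_of_surjective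
    (LinearMap.range_eq_top.mpr ((toL2 n a).submoduleMap_surjective E))
  let b := Module.finBasis ℝ U
  choose K hK0 hKs hK using fun i => exists_lipschitz_fn (n := n) (τ (b i) : EvenPoly n)
  let ℓ : ∀ i, U →L[ℝ] ℝ := fun i => LinearMap.toContinuousLinearMap (b.coord i)
  refine ⟨∑ i, ‖ℓ i‖ * K i, Finset.sum_nonneg fun i _ => mul_nonneg (norm_nonneg (ℓ i)) (hK0 i),
    fun c hc => ?_⟩
  set u : U := U.orthogonalProjectionOnto (hc.toLp c) with hu
  obtain ⟨g, hgs⟩ := (Submodule.mem_iSup_finset_iff_exists_sum _ _).mp (τ u).2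
  have hsum : ∑ k ∈ Finset.range (L + 1), toL2 n a (g k) = (u : Lp ℝ 2 (sphereMeasure n a)) := by
    rw [← map_sum, hgs]
    exact congrArg Subtype.val (LinearMap.congr_fun hτ u)
  have hun : ‖u‖ ≤ ‖hc.toLp c‖ := U.norm_orthogonalProjectionOnto_apply_le _
  have hexp : (τ u : EvenPoly n) = ∑ i, ℓ i u • (τ (b i) : EvenPoly n) := by
    conv_lhs => rw [← b.sum_repr u]
    simp only [map_sum, map_smul, Submodule.coe_sum, Submodule.coe_smul]
    rfl
  have hℓ : ∀ i, |ℓ i u| ≤ ‖ℓ i‖ * ‖hc.toLp c‖ := fun i => ((ℓ i).le_opNorm u).trans (by gcongr)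
  refine ⟨fun k => g k, fun k => (g k).2, ?_, fun k hk p hp => ?_, fun X hX => ?_,
    fun X hX Y hY => ?_⟩
  · rw [hsum]; exact hun
  · have h1 := U.starProjection_inner_eq_zero (hc.toLp c) _
      (toL2_mem_harmSpace (Finset.mem_range.mpr (Nat.lt_succ_of_le hk)) hp)
    have h2 : U.starProjection (hc.toLp c) = (u : Lp ℝ 2 (sphereMeasure n a)) := rfl
    rw [h2, ← hsum, ← toLp_sum_fn _ _ (memLp_finsetSum _ fun k _ => memLp_fn (g k : EvenPoly n)),
      ← MemLp.toLp_sub, inner_toLp_toL2] at h1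
    exact h1
  · rw [← fn_sum, hgs, hexp, fn_sum, Finset.sum_mul]
    refine (Finset.abs_sum_le_sum_abs _ _).trans (Finset.sum_le_sum fun i _ => ?_)
    rw [fn_smul, abs_mul]
    calc |ℓ i u| * |fn (τ (b i) : EvenPoly n) X| ≤ (‖ℓ i‖ * ‖hc.toLp c‖) * K i :=
          mul_le_mul (hℓ i) (hKs i X hX) (abs_nonneg _) (by positivity)
      _ = _ := by ring
  · rw [← fn_sum, ← fn_sum, hgs, hexp, fn_sum, fn_sum, ← Finset.sum_sub_distrib, Finset.sum_mul,
      Finset.sum_mul]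
    refine (Finset.abs_sum_le_sum_abs _ _).trans (Finset.sum_le_sum fun i _ => ?_)
    rw [fn_smul, fn_smul, ← mul_sub, abs_mul]
    calc |ℓ i u| * |fn (τ (b i) : EvenPoly n) X - fn (τ (b i) : EvenPoly n) Y|
        ≤ (‖ℓ i‖ * ‖hc.toLp c‖) * (K i * ‖X - Y‖) :=
          mul_le_mul (hℓ i) (hK i X hX Y hY) (abs_nonneg _) (by positivity)
      _ = _ := by ring

end EvenPoly

/-! ### Ball integrals and homogeneous extensions across the origin -/

section BallIntegrals

variable {F : Type*} [NormedAddCommGroup F] [NormedSpace ℝ F]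

lemma indicator_ball_polarMap {s R : ℝ} {c : USphere n → F} {f : Amb n → F}
    (hf : ∀ q, f (polarMap n q) = ((q.2 : ℝ) ^ s) • c q.1) (q : USphere n × Ioi (0 : ℝ)) :
    (Metric.ball (0 : Amb n) R).indicator f (polarMap n q)
      = (Ioo 0 R).indicator (fun r => r ^ s) (q.2 : ℝ) • c q.1 := by
  have hr : (0 : ℝ) < q.2 := q.2.2
  by_cases h : (q.2 : ℝ) < R
  · rw [indicator_of_mem (by simpa [norm_polarMap] using h),
      indicator_of_mem (mem_Ioo.mpr ⟨hr, h⟩), hf]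
  · rw [indicator_of_notMem (by simpa [norm_polarMap] using h),
      indicator_of_notMem (fun h' => h h'.2), zero_smul]

lemma rpow_mul_indicator (t s R : ℝ) {r : ℝ} (hr : 0 < r) :
    r ^ t * (Ioo 0 R).indicator (fun r => r ^ s) r
      = (Ioo 0 R).indicator (fun r => r ^ (t + s)) r := by
  by_cases h : r ∈ Ioo 0 R
  · rw [indicator_of_mem h, indicator_of_mem h, Real.rpow_add hr]
  · rw [indicator_of_notMem h, indicator_of_notMem h, mul_zero]

lemma integrableOn_ball_separated {a s R : ℝ} (hs : -1 < n + a + s) {c : USphere n → F}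
    {f : Amb n → F} (hf : ∀ q, f (polarMap n q) = ((q.2 : ℝ) ^ s) • c q.1)
    (hc : Integrable c (sphereMeasure n a)) :
    IntegrableOn f (Metric.ball 0 R) (bulkMeasure n a) := by
  rw [← integrable_indicator_iff Metric.isOpen_ball.measurableSet]
  refine integrable_bulk_separated (u := (Ioo 0 R).indicator fun r => r ^ s)
    (indicator_ball_polarMap hf) ?_ hc
  refine IntegrableOn.congr_fun (f := (Ioo 0 R).indicator fun r => r ^ (n + a + s)) ?_
    (fun r hr => (rpow_mul_indicator _ _ _ hr).symm) measurableSet_Ioi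
  exact ((integrable_indicator_iff measurableSet_Ioo).mpr
    (integrableOn_rpow_Ioo hs R)).integrableOn

lemma integral_ball_separated {a s R : ℝ} (hs : -1 < n + a + s) (hR : 0 < R) {c : USphere n → F}
    {f : Amb n → F} (hf : ∀ q, f (polarMap n q) = ((q.2 : ℝ) ^ s) • c q.1) :
    ∫ X in Metric.ball 0 R, f X ∂(bulkMeasure n a)
      = (R ^ (n + a + s + 1) / (n + a + s + 1)) • ∫ θ, c θ ∂(sphereMeasure n a) := by
  rw [← integral_indicator Metric.isOpen_ball.measurableSet,
    integral_bulk_separated a ((Ioo 0 R).indicator fun r => r ^ s) c (indicator_ball_polarMap hf),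
    setIntegral_congr_fun measurableSet_Ioi fun r hr => rpow_mul_indicator (n + a) s R hr,
    setIntegral_indicator measurableSet_Ioo, inter_eq_right.mpr fun r hr => hr.1,
    ← integral_Ioc_eq_integral_Ioo, ← intervalIntegral.integral_of_le hR.le,
    integral_rpow (Or.inl hs), Real.zero_rpow (by linarith), sub_zero]

end BallIntegrals

lemma norm_homExt_polarMap {F : Type*} [NormedAddCommGroup F] [NormedSpace ℝ F] (α : ℝ)
    (c : USphere n → F) (q : USphere n × Ioi (0 : ℝ)) :
    ‖homExt α c (polarMap n q)‖ = (q.2 : ℝ) ^ α • ‖c q.1‖ := by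
  have hr : (0 : ℝ) < q.2 := q.2.2
  rw [homExt_polarMap, norm_smul, Real.norm_of_nonneg (by positivity), smul_eq_mul]

lemma norm_sq_homExt_polarMap {F : Type*} [NormedAddCommGroup F] [NormedSpace ℝ F] (α : ℝ)
    (c : USphere n → F) (q : USphere n × Ioi (0 : ℝ)) :
    ‖homExt α c (polarMap n q)‖ ^ 2 = (q.2 : ℝ) ^ (2 * α) • ‖c q.1‖ ^ 2 := by
  have hr : (0 : ℝ) < q.2 := q.2.2
  rw [norm_homExt_polarMap, smul_eq_mul, smul_eq_mul, mul_pow, mul_comm 2 α,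
    Real.rpow_mul hr.le, Real.rpow_two]

lemma memLp_homExt {F : Type*} [NormedAddCommGroup F] [NormedSpace ℝ F] {a α : ℝ}
    (hα : -1 < n + a + 2 * α) {c : USphere n → F} (hc : MemLp c 2 (sphereMeasure n a)) :
    MemLp (homExt α c) 2 ((bulkMeasure n a).restrict (unitBall n)) := by
  rw [memLp_two_iff_integrable_sq_norm (aestronglyMeasurable_homExt α hc.1).restrict]
  exact integrableOn_ball_separated hα (norm_sq_homExt_polarMap α c)
    ((memLp_two_iff_integrable_sq_norm hc.1).mp hc)

namespace IsTangentialGradient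

variable {c : USphere n → ℝ} {T : USphere n → Amb n}

lemma integrable_left (h : IsTangentialGradient c T) : Integrable c (sphereMeasure n 0) :=
  integrable_of_locallyIntegrableOn_homExt (α := 0) (by rw [bulkMeasure_zero]; exact h.1)

lemma integrable_right (h : IsTangentialGradient c T) : Integrable T (sphereMeasure n 0) :=
  integrable_of_locallyIntegrableOn_homExt (α := -1) (by rw [bulkMeasure_zero]; exact h.2.1)

/-- The weak gradient of a homogeneous extension, across the origin. -/
lemma homExt_gradient_unitBall (hn : 1 ≤ n) (h : IsTangentialGradient c T) {α : ℝ} (hα : 0 ≤ α) :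
    HasWeakGradientOn (unitBall n) (homExt α c)
      (homExt (α - 1) fun θ => T θ + (α * c θ) • (θ : Amb n)) := by
  have hn' : (1 : ℝ) ≤ n := by exact_mod_cast hn
  have hi : ∀ R : ℝ, IntegrableOn (homExt α c) (Metric.ball 0 R) := fun R => by
    rw [← bulkMeasure_zero]
    exact integrableOn_ball_separated (s := α) (by linarith) (homExt_polarMap α c) h.integrable_left
  refine HasWeakGradientOn.of_compl_zero ((h.homExt_gradient α).mono fun X hX => hX.2)
    (hi 1).locallyIntegrableOn ?_ (.of_forall fun k => hi _) ?_
  · have h1 : Integrable (fun θ : USphere n => T θ + (α * c θ) • (θ : Amb n))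
        (sphereMeasure n 0) := by
      refine h.integrable_right.add ?_
      refine (h.integrable_left.const_mul α).smul_bdd 1
        continuous_subtype_val.aestronglyMeasurable (.of_forall fun θ => ?_)
      exact (norm_eq_of_mem_sphere θ).le
    have : IntegrableOn (homExt (α - 1) fun θ : USphere n => T θ + (α * c θ) • (θ : Amb n))
        (Metric.ball 0 1) := by
      rw [← bulkMeasure_zero]
      exact integrableOn_ball_separated (s := α - 1) (by linarith) (homExt_polarMap _ _) h1
    exact this.locallyIntegrableOn
  -- The mass in a ball of radius `ρ` scales like `ρ^{n+α+1}`; after division by `ρ` a positive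
  -- power remains, so the origin is removable.
  · have h2 : ∀ k : ℕ, (k + 1 : ℝ) * ∫ X in Metric.ball (0 : Amb n) (2 / (k + 1 : ℝ)),
        ‖homExt α c X‖ = (2 / (k + 1 : ℝ)) ^ (n + α) *
          (2 / (n + α + 1) * ∫ θ, ‖c θ‖ ∂(sphereMeasure n 0)) := fun k => by
      have hk : (0 : ℝ) < k + 1 := by positivity
      rw [← bulkMeasure_zero, integral_ball_separated (s := α) (c := fun θ => ‖c θ‖)
        (by linarith) (by positivity) (norm_homExt_polarMap α c), add_zero,
        Real.rpow_add_one (by positivity), smul_eq_mul]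
      field_simp
    simp only [h2]
    have h3 : Tendsto (fun k : ℕ => 2 / (k + 1 : ℝ)) atTop (𝓝 0) :=
      tendsto_const_div_atTop_nhds_zero_nat 2 |>.comp (tendsto_add_atTop_nat 1) |>.congr
        fun k => by simp
    have h4 := (h3.rpow_const (p := n + α) (Or.inr (by linarith))).mul_const
      (2 / (n + α + 1) * ∫ θ, ‖c θ‖ ∂(sphereMeasure n 0))
    rwa [Real.zero_rpow (by linarith), zero_mul] at h4

end IsTangentialGradient

/-! ### Traces on the sphere -/

/-- The layer `{1 - δ < |X| < 1}`. -/
def sphereLayer (n : ℕ) (δ : ℝ) : Set (Amb n) := {X : Amb n | 1 - δ < ‖X‖ ∧ ‖X‖ < 1}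

lemma measurableSet_sphereLayer (δ : ℝ) : MeasurableSet (sphereLayer n δ) :=
  ((isOpen_lt continuous_const continuous_norm).inter
    (isOpen_lt continuous_norm continuous_const)).measurableSet

lemma lintegral_bulk_polar (a : ℝ) (f : Amb n → ℝ≥0∞) :
    ∫⁻ X, f X ∂(bulkMeasure n a)
      = ∫⁻ q, f (polarMap n q) ∂((sphereMeasure n a).prod (radialMeasure n a)) := by
  rw [← (measurePreserving_polarMap a).map_eq, measurableEmbedding_polarMap.lintegral_map]

section SphereLayer

variable {a : ℝ}

lemma lintegral_sphereLayer_homExt_zero {F : Type*} [NormedAddCommGroup F] [NormedSpace ℝ F]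
    (δ : ℝ) {c : USphere n → F} (hc : AEStronglyMeasurable c (sphereMeasure n a)) :
    ∫⁻ X in sphereLayer n δ, ‖homExt 0 c X‖ₑ ^ 2 ∂(bulkMeasure n a)
      = (∫⁻ θ, ‖c θ‖ₑ ^ 2 ∂(sphereMeasure n a))
        * radialMeasure n a {r | 1 - δ < (r : ℝ) ∧ (r : ℝ) < 1} := by
  have hm : MeasurableSet {r : Ioi (0 : ℝ) | 1 - δ < (r : ℝ) ∧ (r : ℝ) < 1} :=
    measurableSet_Ioo.preimage measurable_subtype_coe
  rw [← lintegral_indicator (measurableSet_sphereLayer δ), lintegral_bulk_polar,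
    ← lintegral_indicator_one hm, ← lintegral_prod_mul (hc.enorm.pow_const 2)
      (measurable_one.indicator hm).aemeasurable]
  refine lintegral_congr fun q => ?_
  by_cases h : 1 - δ < (q.2 : ℝ) ∧ (q.2 : ℝ) < 1
  · rw [indicator_of_mem (by simpa [sphereLayer, norm_polarMap] using h),
      indicator_of_mem (by exact h), homExt_polarMap]
    simp
  · rw [indicator_of_notMem (by simpa [sphereLayer, norm_polarMap] using h),
      indicator_of_notMem (by exact h), mul_zero]

lemma radialMeasure_layer (hna : 0 ≤ (n : ℝ) + a) {δ : ℝ} (hδ : 0 < δ) (hδ' : δ ≤ 1 / 2) :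
    radialMeasure n a {r | 1 - δ < (r : ℝ) ∧ (r : ℝ) < 1}
      = ENNReal.ofReal (∫ r in Ioo (1 - δ) 1, r ^ (n + a)) ∧
    IntegrableOn (fun r : ℝ => r ^ (n + a)) (Ioo (1 - δ) 1) := by
  have hm : MeasurableSet {r : Ioi (0 : ℝ) | 1 - δ < (r : ℝ) ∧ (r : ℝ) < 1} :=
    measurableSet_Ioo.preimage measurable_subtype_coe
  have hsub : Ioo (1 - δ) 1 ⊆ Ioi (0 : ℝ) := fun r hr => by
    have := hr.1; exact mem_Ioi.mpr (by linarith)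
  have hint : IntegrableOn (fun r : ℝ => r ^ (n + a)) (Ioo (1 - δ) 1) :=
    (integrableOn_rpow_Ioo (by linarith) 1).mono_set fun r hr => ⟨hsub hr, hr.2⟩
  refine ⟨?_, hint⟩
  set u : ℝ → ℝ := (Ioo (1 - δ) 1).indicator 1 with hu
  have hru : (fun r : ℝ => r ^ (n + a) * u r) = (Ioo (1 - δ) 1).indicator fun r => r ^ (n + a) := by
    funext r
    by_cases h : r ∈ Ioo (1 - δ) 1 <;> simp [hu, h]
  have hi : Integrable (fun r : Ioi (0 : ℝ) => u r) (radialMeasure n a) := by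
    rw [integrable_radialMeasure, hru]
    exact ((integrable_indicator_iff measurableSet_Ioo).mpr hint).integrableOn
  have h1 := ofReal_integral_eq_lintegral_ofReal hi
    (.of_forall fun r => indicator_nonneg (fun _ _ => zero_le_one) _)
  rw [integral_radialMeasure, hru, setIntegral_indicator measurableSet_Ioo,
    inter_eq_right.mpr hsub] at h1
  rw [h1, ← lintegral_indicator_one hm]
  refine lintegral_congr fun r => ?_
  by_cases h : 1 - δ < (r : ℝ) ∧ (r : ℝ) < 1
  · rw [indicator_of_mem (by exact h), hu, indicator_of_mem (by exact h)]; simp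
  · rw [indicator_of_notMem (by exact h), hu, indicator_of_notMem (by exact h)]; simp

lemma radialMeasure_layer_le (hna : 0 ≤ (n : ℝ) + a) {δ : ℝ} (hδ : 0 < δ) (hδ' : δ ≤ 1 / 2) :
    radialMeasure n a {r | 1 - δ < (r : ℝ) ∧ (r : ℝ) < 1} ≤ ENNReal.ofReal δ := by
  obtain ⟨h1, h2⟩ := radialMeasure_layer hna hδ hδ'
  rw [h1]
  refine ENNReal.ofReal_le_ofReal ?_
  have h3 := setIntegral_mono_on h2 (integrableOn_const (by simp) (by simp) (C := (1 : ℝ)))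
    measurableSet_Ioo fun r hr => Real.rpow_le_one (by linarith [hr.1]) hr.2.le hna
  simpa [hδ.le] using h3

/-- With `radialMeasure_layer_le`, the layer has mass comparable to `δ`. The upper bound serves
existence of traces, the lower bound uniqueness. -/
lemma le_radialMeasure_layer (hna : 0 ≤ (n : ℝ) + a) {δ : ℝ} (hδ : 0 < δ) (hδ' : δ ≤ 1 / 2) :
    ENNReal.ofReal ((1 / 2) ^ (n + a)) * ENNReal.ofReal δ
      ≤ radialMeasure n a {r | 1 - δ < (r : ℝ) ∧ (r : ℝ) < 1} := by
  obtain ⟨h1, h2⟩ := radialMeasure_layer hna hδ hδ'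
  rw [h1, ← ENNReal.ofReal_mul (by positivity)]
  refine ENNReal.ofReal_le_ofReal ?_
  have h3 := setIntegral_mono_on (integrableOn_const (by simp) (by simp)
      (C := ((1 : ℝ) / 2) ^ (n + a))) h2 measurableSet_Ioo fun r hr =>
      Real.rpow_le_rpow (by norm_num) (by linarith [hr.1]) hna
  simpa [hδ.le, mul_comm] using h3

lemma ENNReal.add_sq_le_two_mul (x y : ℝ≥0∞) : (x + y) ^ 2 ≤ 2 * (x ^ 2 + y ^ 2) := by
  have := ENNReal.rpow_add_le_mul_rpow_add_rpow x y (p := 2) (by norm_num)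
  norm_num at this
  exact_mod_cast this

lemma lintegral_enorm_add_sq_le {α F : Type*} [MeasurableSpace α] [NormedAddCommGroup F]
    {μ : Measure α} {f g : α → F} (hf : AEStronglyMeasurable f μ) :
    ∫⁻ x, ‖f x + g x‖ₑ ^ 2 ∂μ ≤ 2 * (∫⁻ x, ‖f x‖ₑ ^ 2 ∂μ + ∫⁻ x, ‖g x‖ₑ ^ 2 ∂μ) := by
  rw [← lintegral_add_left' (hf.enorm.pow_const 2), ← lintegral_const_mul' _ _ (by simp)]
  refine lintegral_mono fun x => ?_
  exact (pow_le_pow_left' (enorm_add_le _ _) 2).trans (ENNReal.add_sq_le_two_mul _ _)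

end SphereLayer

namespace IsSphereTrace

variable {a : ℝ} {v w : Amb n → ℝ} {c d : USphere n → ℝ}

lemma add (hv : AEStronglyMeasurable v (bulkMeasure n a)) (h : IsSphereTrace a v c)
    (h' : IsSphereTrace a w d) :
    IsSphereTrace a (fun X => v X + w X) (fun θ => c θ + d θ) := by
  refine ⟨h.1.add h'.1, ?_⟩
  have h1 := (ENNReal.Tendsto.const_mul (h.2.add h'.2) (Or.inr (ENNReal.ofNat_ne_top (n := 2))))
  rw [add_zero, mul_zero] at h1
  refine tendsto_of_tendsto_of_tendsto_of_le_of_le tendsto_const_nhds h1 (fun _ => zero_le)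
    fun δ => ?_
  simp only []
  rw [← ENNReal.add_div, ← mul_div_assoc]
  gcongr
  refine le_trans (le_of_eq ?_) (lintegral_enorm_add_sq_le
    (f := fun X => v X - homExt 0 c X) (g := fun X => w X - homExt 0 d X)
    (hv.sub (aestronglyMeasurable_homExt 0 h.1.1)).restrict)
  refine lintegral_congr fun X => ?_
  rw [homExt_add]
  congr 2
  ring

/-- The trace on the sphere is unique. -/
lemma ae_eq (hna : 0 ≤ (n : ℝ) + a) (hv : AEStronglyMeasurable v (bulkMeasure n a))
    (h : IsSphereTrace a v c) (h' : IsSphereTrace a v d) : c =ᵐ[sphereMeasure n a] d := by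
  have hm : AEStronglyMeasurable (fun θ => c θ - d θ) (sphereMeasure n a) := h.1.1.sub h'.1.1
  set I := ∫⁻ θ, ‖c θ - d θ‖ₑ ^ 2 ∂(sphereMeasure n a) with hI
  have h1 := (ENNReal.Tendsto.const_mul (h'.2.add h.2) (Or.inr (ENNReal.ofNat_ne_top (n := 2))))
  rw [add_zero, mul_zero] at h1
  have hp : (0 : ℝ) < (1 / 2) ^ (n + a) := by positivity
  -- The layer integral of `|c - d|²` is `I` times a mass of order `δ`, while the two trace
  -- conditions make it `o(δ)`.
  have key : I * ENNReal.ofReal ((1 / 2) ^ (n + a)) ≤ 0 := by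
    refine ge_of_tendsto h1 ?_
    filter_upwards [Ioc_mem_nhdsGT (show (0 : ℝ) < 1 / 2 by norm_num)] with δ hδ
    have hδ0 : ENNReal.ofReal δ ≠ 0 := by simpa using hδ.1
    rw [← ENNReal.add_div, ← mul_div_assoc,
      ENNReal.le_div_iff_mul_le (Or.inl hδ0) (Or.inl ENNReal.ofReal_ne_top), mul_assoc]
    refine (mul_le_mul_right (le_radialMeasure_layer hna hδ.1 hδ.2) I).trans ?_
    rw [hI, ← lintegral_sphereLayer_homExt_zero δ hm]
    refine le_trans (le_of_eq ?_) (lintegral_enorm_add_sq_le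
      (μ := (bulkMeasure n a).restrict (sphereLayer n δ)) (f := fun X => v X - homExt 0 d X)
      (g := fun X => -(v X - homExt 0 c X))
      (hv.sub (aestronglyMeasurable_homExt 0 h'.1.1)).restrict |>.trans (le_of_eq ?_))
    · refine lintegral_congr fun X => ?_
      have : homExt 0 (fun θ => c θ - d θ) X = homExt 0 c X - homExt 0 d X := by
        unfold homExt; split_ifs <;> simp
      rw [this]; congr 2; ring
    · simp only [enorm_neg]; rfl
  have hI0 : I = 0 := by
    rcases mul_eq_zero.mp (le_antisymm key (zero_le)) with h0 | h0
    · exact h0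
    · exact absurd (ENNReal.ofReal_eq_zero.mp h0) (not_le.mpr hp)
  rw [hI, lintegral_eq_zero_iff' (hm.enorm.pow_const 2)] at hI0
  filter_upwards [hI0] with θ hθ
  simpa [sub_eq_zero] using hθ

end IsSphereTrace

/-- The trace on the sphere of a homogeneous extension. -/
lemma isSphereTrace_homExt (hna : 0 ≤ (n : ℝ) + a) {α : ℝ} (hα : 0 ≤ α) {c : USphere n → ℝ}
    (hc : MemLp c 2 (sphereMeasure n a)) : IsSphereTrace a (homExt α c) c := by
  refine ⟨hc, ?_⟩
  set I := ∫⁻ θ, ‖c θ‖ₑ ^ 2 ∂(sphereMeasure n a) with hI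
  have hIfin : I ≠ ⊤ := by
    have := hc.eLpNorm_lt_top
    have h2 := (eLpNorm_lt_top_iff_lintegral_rpow_enorm_lt_top (p := 2) (by simp) (by simp)).mp this
    simpa using h2.ne
  have hlim : Tendsto (fun δ : ℝ => ENNReal.ofReal ((1 - (1 - δ) ^ α) ^ 2) * I) (𝓝[>] 0) (𝓝 0) := by
    have h1 : Tendsto (fun δ : ℝ => (1 - (1 - δ) ^ α) ^ 2) (𝓝[>] 0) (𝓝 0) := by
      have h2 : ContinuousAt (fun δ : ℝ => (1 - (1 - δ) ^ α) ^ 2) 0 := by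
        refine ContinuousAt.pow (continuousAt_const.sub ?_) 2
        exact (continuousAt_const.sub continuousAt_id).rpow_const (Or.inl (by norm_num))
      have h3 := h2.tendsto
      simp only [sub_zero, Real.one_rpow, sub_self] at h3
      rw [zero_pow two_ne_zero] at h3
      exact h3.mono_left nhdsWithin_le_nhds
    have h4 := ENNReal.Tendsto.mul_const (ENNReal.tendsto_ofReal h1) (Or.inr hIfin)
    rwa [ENNReal.ofReal_zero, zero_mul] at h4
  refine tendsto_of_tendsto_of_tendsto_of_le_of_le' tendsto_const_nhds hlim
    (.of_forall fun _ => zero_le) ?_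
  filter_upwards [Ioc_mem_nhdsGT (show (0 : ℝ) < 1 / 2 by norm_num)] with δ hδ
  refine ENNReal.div_le_of_le_mul ?_
  have hpt : ∀ X ∈ sphereLayer n δ, ‖homExt α c X - homExt 0 c X‖ₑ ^ 2
      ≤ ENNReal.ofReal ((1 - (1 - δ) ^ α) ^ 2) * ‖homExt 0 c X‖ₑ ^ 2 := by
    intro X hX
    have hX0 : X ≠ 0 := fun h => by
      have := hX.1; rw [h, norm_zero] at this; linarith [hδ.2]
    obtain ⟨q, rfl⟩ := exists_polarMap hX0
    have hq1 : 1 - δ < (q.2 : ℝ) := by simpa [norm_polarMap] using hX.1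
    have hq2 : (q.2 : ℝ) < 1 := by simpa [norm_polarMap] using hX.2
    have e : homExt α c (polarMap n q) - homExt 0 c (polarMap n q)
        = ((q.2 : ℝ) ^ α - 1) * homExt 0 c (polarMap n q) := by
      rw [homExt_polarMap, homExt_polarMap, Real.rpow_zero]; simp; ring
    rw [e, enorm_mul, mul_pow]
    gcongr
    rw [Real.enorm_eq_ofReal_abs, ← ENNReal.ofReal_pow (abs_nonneg _)]
    refine ENNReal.ofReal_le_ofReal ?_
    have h1 : (1 - δ) ^ α ≤ (q.2 : ℝ) ^ α := Real.rpow_le_rpow (by linarith [hδ.2]) hq1.le hα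
    have h2 : (q.2 : ℝ) ^ α ≤ 1 := Real.rpow_le_one (le_of_lt q.2.2) hq2.le hα
    rw [abs_of_nonpos (by linarith)]
    refine pow_le_pow_left₀ (by linarith) (by linarith) 2
  calc ∫⁻ X in sphereLayer n δ, ‖homExt α c X - homExt 0 c X‖ₑ ^ 2 ∂(bulkMeasure n a)
      ≤ ∫⁻ X in sphereLayer n δ, ENNReal.ofReal ((1 - (1 - δ) ^ α) ^ 2) * ‖homExt 0 c X‖ₑ ^ 2
        ∂(bulkMeasure n a) := setLIntegral_mono' (measurableSet_sphereLayer δ) hpt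
    _ = ENNReal.ofReal ((1 - (1 - δ) ^ α) ^ 2) * (I * radialMeasure n a
        {r | 1 - δ < (r : ℝ) ∧ (r : ℝ) < 1}) := by
      rw [lintegral_const_mul' _ _ ENNReal.ofReal_ne_top, lintegral_sphereLayer_homExt_zero δ hc.1]
    _ ≤ _ := by
      rw [mul_assoc]
      gcongr
      exact radialMeasure_layer_le hna hδ.1 hδ.2

/-! ### The Weiss energy of sums of homogeneous functions -/

/-- The Weiss energy in terms of any weak gradient and any trace. -/
lemma weissEnergy_eq {a : ℝ} (hna : 0 ≤ (n : ℝ) + a) (μ : ℝ) {v : Amb n → ℝ} {G : Amb n → Amb n}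
    {c : USphere n → ℝ} (hv : AEStronglyMeasurable v (bulkMeasure n a))
    (hG : HasWeakGradientOn (unitBall n) v G) (hc : IsSphereTrace a v c) :
    weissEnergy a μ v = (∫ X in unitBall n, ‖G X‖ ^ 2 ∂(bulkMeasure n a))
      - μ * ∫ θ, c θ ^ 2 ∂(sphereMeasure n a) := by
  have h1 : HasWeakGradientOn (unitBall n) v (weakGrad (unitBall n) v) := by
    have : ∃ G, HasWeakGradientOn (unitBall n) v G := ⟨G, hG⟩
    rw [weakGrad, dif_pos this]
    exact this.choose_spec
  have h2 : IsSphereTrace a v (sphereTrace a v) := by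
    have : ∃ c, IsSphereTrace a v c := ⟨c, hc⟩
    rw [sphereTrace, dif_pos this]
    exact this.choose_spec
  have h3 := HasWeakGradientOn.ae_eq Metric.isOpen_ball h1 hG
  have h4 := h2.ae_eq hna hv hc
  rw [weissEnergy, sphereNormSq]
  congr 1
  · refine integral_congr_ae ?_
    have hac : (bulkMeasure n a).restrict (unitBall n) ≪ volume.restrict (unitBall n) :=
      (bulkMeasure_ac_volume a).restrict _
    filter_upwards [hac.ae_le h3] with X hX
    rw [hX]
  · congr 1
    refine integral_congr_ae ?_
    filter_upwards [h4] with θ hθ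
    rw [hθ, Real.norm_eq_abs, sq_abs]

lemma integrable_mul_of_memLp {α : Type*} [MeasurableSpace α] {μ : Measure α} {f g : α → ℝ}
    (hf : MemLp f 2 μ) (hg : MemLp g 2 μ) : Integrable (fun x => f x * g x) μ :=
  hf.integrable_mul hg

/-- The square of the weak gradient of a sum of two homogeneous functions. -/
lemma integral_norm_sq_add_homExt {a μ α : ℝ} (hμ : 0 < n + a - 1 + 2 * μ)
    (hα : 0 < n + a - 1 + 2 * α) {U V : USphere n → Amb n}
    (hU : MemLp U 2 (sphereMeasure n a)) (hV : MemLp V 2 (sphereMeasure n a)) :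
    ∫ X in unitBall n, ‖homExt (μ - 1) U X + homExt (α - 1) V X‖ ^ 2 ∂(bulkMeasure n a)
      = (∫ θ, ‖U θ‖ ^ 2 ∂(sphereMeasure n a)) / (n + a - 1 + 2 * μ)
        + 2 * (∫ θ, inner ℝ (U θ) (V θ) ∂(sphereMeasure n a)) / (n + a - 1 + (μ + α))
        + (∫ θ, ‖V θ‖ ^ 2 ∂(sphereMeasure n a)) / (n + a - 1 + 2 * α) := by
  have e : ∀ X, ‖homExt (μ - 1) U X + homExt (α - 1) V X‖ ^ 2 = ‖homExt (μ - 1) U X‖ ^ 2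
      + 2 * inner ℝ (homExt (μ - 1) U X) (homExt (α - 1) V X) + ‖homExt (α - 1) V X‖ ^ 2 :=
    fun X => norm_add_sq_real _ _
  simp only [e]
  have hin : ∀ q : USphere n × Ioi (0 : ℝ), inner ℝ (homExt (μ - 1) U (polarMap n q))
      (homExt (α - 1) V (polarMap n q)) = (q.2 : ℝ) ^ (μ + α - 2) • inner ℝ (U q.1) (V q.1) :=
    fun q => by
      have hr : (0 : ℝ) < q.2 := q.2.2
      rw [homExt_polarMap, homExt_polarMap, real_inner_smul_left, real_inner_smul_right,
        ← mul_assoc, ← Real.rpow_add hr, smul_eq_mul]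
      congr 2; ring
  have i1 : IntegrableOn (fun X => ‖homExt (μ - 1) U X‖ ^ 2) (unitBall n) (bulkMeasure n a) :=
    integrableOn_ball_separated (by linarith) (norm_sq_homExt_polarMap (μ - 1) U)
      ((memLp_two_iff_integrable_sq_norm hU.1).mp hU)
  have i2 : IntegrableOn (fun X => ‖homExt (α - 1) V X‖ ^ 2) (unitBall n) (bulkMeasure n a) :=
    integrableOn_ball_separated (by linarith) (norm_sq_homExt_polarMap (α - 1) V)
      ((memLp_two_iff_integrable_sq_norm hV.1).mp hV)
  have i3 : IntegrableOn (fun X => inner ℝ (homExt (μ - 1) U X) (homExt (α - 1) V X)) (unitBall n)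
      (bulkMeasure n a) :=
    integrableOn_ball_separated (c := fun θ => inner ℝ (U θ) (V θ)) (by linarith) hin
      (integrable_inner_of_memLp hU hV)
  have i4 : IntegrableOn (fun X => 2 * inner ℝ (homExt (μ - 1) U X) (homExt (α - 1) V X))
      (unitBall n) (bulkMeasure n a) := i3.const_mul 2
  have i5 : IntegrableOn (fun X => ‖homExt (μ - 1) U X‖ ^ 2
      + 2 * inner ℝ (homExt (μ - 1) U X) (homExt (α - 1) V X)) (unitBall n) (bulkMeasure n a) :=
    i1.add i4
  rw [integral_add i5 i2, integral_add i1 i4, integral_const_mul]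
  have j1 : ∫ X in unitBall n, ‖homExt (μ - 1) U X‖ ^ 2 ∂(bulkMeasure n a) = _ :=
    integral_ball_separated (c := fun θ => ‖U θ‖ ^ 2) (by linarith) one_pos
      (norm_sq_homExt_polarMap (μ - 1) U)
  have j2 : ∫ X in unitBall n, ‖homExt (α - 1) V X‖ ^ 2 ∂(bulkMeasure n a) = _ :=
    integral_ball_separated (c := fun θ => ‖V θ‖ ^ 2) (by linarith) one_pos
      (norm_sq_homExt_polarMap (α - 1) V)
  have j3 : ∫ X in unitBall n, inner ℝ (homExt (μ - 1) U X) (homExt (α - 1) V X)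
      ∂(bulkMeasure n a) = _ :=
    integral_ball_separated (c := fun θ => inner ℝ (U θ) (V θ)) (by linarith) one_pos hin
  rw [j1, j2, j3]
  simp only [Real.one_rpow, smul_eq_mul]
  have e1 : (n : ℝ) + a + 2 * (μ - 1) + 1 = n + a - 1 + 2 * μ := by ring
  have e2 : (n : ℝ) + a + 2 * (α - 1) + 1 = n + a - 1 + 2 * α := by ring
  have e3 : (n : ℝ) + a + (μ + α - 2) + 1 = n + a - 1 + (μ + α) := by ring
  rw [e1, e2, e3]
  ring

/-- Tangential and radial parts are orthogonal, so no mixed terms survive. -/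
lemma IsTangentialGradient.integral_inner_add_smul {a : ℝ} {A D : USphere n → ℝ}
    {S T : USphere n → Amb n} (hA : IsTangentialGradient A S) (hD : IsTangentialGradient D T)
    (hA2 : MemLp A 2 (sphereMeasure n a)) (hD2 : MemLp D 2 (sphereMeasure n a))
    (hS2 : MemLp S 2 (sphereMeasure n a)) (hT2 : MemLp T 2 (sphereMeasure n a)) (μ α : ℝ) :
    ∫ θ, inner ℝ (S θ + (μ * A θ) • (θ : Amb n)) (T θ + (α * D θ) • (θ : Amb n))
        ∂(sphereMeasure n a)
      = ∫ θ, inner ℝ (S θ) (T θ) ∂(sphereMeasure n a)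
        + μ * α * ∫ θ, A θ * D θ ∂(sphereMeasure n a) := by
  rw [← integral_const_mul, ← integral_add (integrable_inner_of_memLp hS2 hT2)
    ((integrable_mul_of_memLp hA2 hD2).const_mul _)]
  refine integral_congr_ae ?_
  filter_upwards [hA.inner_self_eq_zero a, hD.inner_self_eq_zero a] with θ h1 h2
  have h3 : inner ℝ (θ : Amb n) (T θ) = 0 := by rw [real_inner_comm, h2]
  have h4 : inner ℝ (θ : Amb n) (θ : Amb n) = (1 : ℝ) := by
    rw [real_inner_self_eq_norm_sq, norm_eq_of_mem_sphere]; norm_num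
  simp only [inner_add_left, inner_add_right, real_inner_smul_left, real_inner_smul_right, h1, h3,
    h4]
  ring

lemma memLp_smul_sphere {a : ℝ} {D : USphere n → ℝ} (h : MemLp D 2 (sphereMeasure n a)) (α : ℝ) :
    MemLp (fun θ : USphere n => (α * D θ) • (θ : Amb n)) 2 (sphereMeasure n a) := by
  refine (h.const_mul α).of_le
    ((h.1.const_mul α).smul continuous_subtype_val.aestronglyMeasurable) (.of_forall fun θ => ?_)
  rw [norm_smul, norm_eq_of_mem_sphere, mul_one]

section TwoHomogeneities

variable {a μ α : ℝ} {A D : USphere n → ℝ}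
  {S T : USphere n → Amb n}

lemma hasWeakGradientOn_add_homExt (hn : 1 ≤ n) (hμ : 0 ≤ μ) (hα : 0 ≤ α)
    (hA : IsTangentialGradient A S) (hD : IsTangentialGradient D T) :
    HasWeakGradientOn (unitBall n) (fun X => homExt μ A X + homExt α D X)
      (fun X => homExt (μ - 1) (fun θ => S θ + (μ * A θ) • (θ : Amb n)) X
        + homExt (α - 1) (fun θ => T θ + (α * D θ) • (θ : Amb n)) X) :=
  (hA.homExt_gradient_unitBall hn hμ).add (hD.homExt_gradient_unitBall hn hα)

lemma memH1_add_homExt (hn : 1 ≤ n) (ha : -1 < a) (hμ : 1 ≤ μ) (hα : 1 ≤ α)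
    (hA : IsTangentialGradient A S) (hD : IsTangentialGradient D T)
    (hA2 : MemLp A 2 (sphereMeasure n a)) (hD2 : MemLp D 2 (sphereMeasure n a))
    (hS2 : MemLp S 2 (sphereMeasure n a)) (hT2 : MemLp T 2 (sphereMeasure n a)) :
    MemH1 (unitBall n) a (fun X => homExt μ A X + homExt α D X) := by
  have hn' : (1 : ℝ) ≤ n := by exact_mod_cast hn
  refine ⟨(memLp_homExt (by linarith) hA2).add (memLp_homExt (by linarith) hD2), _,
    hasWeakGradientOn_add_homExt hn (by linarith) (by linarith) hA hD, ?_⟩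
  exact (memLp_homExt (by linarith) (hS2.add (memLp_smul_sphere hA2 μ))).add
    (memLp_homExt (by linarith) (hT2.add (memLp_smul_sphere hD2 α)))

lemma isSphereTrace_add_homExt (hna : 0 ≤ (n : ℝ) + a) (hμ : 0 ≤ μ) (hα : 0 ≤ α)
    (hA2 : MemLp A 2 (sphereMeasure n a)) (hD2 : MemLp D 2 (sphereMeasure n a)) :
    IsSphereTrace a (fun X => homExt μ A X + homExt α D X) (fun θ => A θ + D θ) :=
  IsSphereTrace.add (aestronglyMeasurable_homExt μ hA2.1) (isSphereTrace_homExt hna hμ hA2)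
    (isSphereTrace_homExt hna hα hD2)

/-- The Weiss energy of a sum of two homogeneous functions. -/
lemma weissEnergy_add_homExt [IsFiniteMeasure (sphereMeasure n a)] (hn : 1 ≤ n) (ha : -1 < a)
    (hμ : 1 ≤ μ) (hα : 1 ≤ α)
    (hA : IsTangentialGradient A S) (hD : IsTangentialGradient D T)
    (hA2 : MemLp A 2 (sphereMeasure n a)) (hD2 : MemLp D 2 (sphereMeasure n a))
    (hS2 : MemLp S 2 (sphereMeasure n a)) (hT2 : MemLp T 2 (sphereMeasure n a)) :
    weissEnergy a μ (fun X => homExt μ A X + homExt α D X)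
      = (‖hS2.toLp S‖ ^ 2 + μ ^ 2 * ‖hA2.toLp A‖ ^ 2) / (n + a - 1 + 2 * μ)
        + 2 * (inner ℝ (hS2.toLp S) (hT2.toLp T) + μ * α * inner ℝ (hA2.toLp A) (hD2.toLp D))
          / (n + a - 1 + (μ + α))
        + (‖hT2.toLp T‖ ^ 2 + α ^ 2 * ‖hD2.toLp D‖ ^ 2) / (n + a - 1 + 2 * α)
        - μ * (‖hA2.toLp A‖ ^ 2 + 2 * inner ℝ (hA2.toLp A) (hD2.toLp D) + ‖hD2.toLp D‖ ^ 2) := by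
  have hn' : (1 : ℝ) ≤ n := by exact_mod_cast hn
  rw [weissEnergy_eq (v := fun X => homExt μ A X + homExt α D X) (by linarith) μ
    ((aestronglyMeasurable_homExt μ hA2.1).add
      (aestronglyMeasurable_homExt α hD2.1))
    (hasWeakGradientOn_add_homExt hn (by linarith) (by linarith) hA hD)
    (isSphereTrace_add_homExt (by linarith) (by linarith) (by linarith) hA2 hD2),
    integral_norm_sq_add_homExt (U := fun θ => S θ + (μ * A θ) • (θ : Amb n))
      (V := fun θ => T θ + (α * D θ) • (θ : Amb n)) (by linarith) (by linarith)
      (hS2.add (memLp_smul_sphere hA2 μ))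
      (hT2.add (memLp_smul_sphere hD2 α))]
  simp only [← real_inner_self_eq_norm_sq]
  rw [hA.integral_inner_add_smul hD hA2 hD2 hS2 hT2, hA.integral_inner_add_smul hA hA2 hA2 hS2 hS2,
    hD.integral_inner_add_smul hD hD2 hD2 hT2 hT2]
  have e : ∀ θ, (A θ + D θ) ^ 2 = (A θ + D θ) * (A θ + D θ) := fun θ => sq _
  simp only [e]
  rw [show ∫ θ, (A θ + D θ) * (A θ + D θ) ∂(sphereMeasure n a) = _ from
      integral_mul_eq_inner_toLp (hA2.add hD2) (hA2.add hD2), MemLp.toLp_add hA2 hD2,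
    real_inner_add_add_self]
  simp only [integral_mul_eq_inner_toLp hA2 hA2, integral_mul_eq_inner_toLp hA2 hD2,
    integral_mul_eq_inner_toLp hD2 hD2, integral_inner_eq_inner_toLp hS2 hS2,
    integral_inner_eq_inner_toLp hS2 hT2, integral_inner_eq_inner_toLp hT2 hT2]
  ring

end TwoHomogeneities

/-- The algebra behind the comparison of energies. -/
lemma weiss_algebra {N μ κ GA IA GD ID IAD : ℝ} (hμ : 0 < N + 2 * μ) (hκ : 0 ≤ κ) :
    ((GA + μ ^ 2 * IA) / (N + 2 * μ)
        + 2 * (μ * (μ + N) * IAD + μ * (μ + κ) * IAD) / (N + (μ + (μ + κ)))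
        + (GD + (μ + κ) ^ 2 * ID) / (N + 2 * (μ + κ)) - μ * (IA + 2 * IAD + ID))
      - ((GA + μ ^ 2 * IA) / (N + 2 * μ)
        + 2 * (μ * (μ + N) * IAD + μ * μ * IAD) / (N + (μ + μ))
        + (GD + μ ^ 2 * ID) / (N + 2 * μ) - μ * (IA + 2 * IAD + ID))
      = κ / (N + 2 * (μ + κ)) * (κ * ID - 2 * (GD - μ * (μ + N) * ID) / (N + 2 * μ)) := by
  have h1 : N + 2 * μ ≠ 0 := hμ.ne'
  have h2 : N + 2 * (μ + κ) ≠ 0 := (by linarith : 0 < N + 2 * (μ + κ)).ne'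
  -- The numerator is `2 μ (N + 2 μ + t) IAD`, whose factor cancels the denominator. The cross term
  -- is therefore independent of the raised homogeneity and drops out of the comparison.
  have cross : ∀ t, 0 ≤ t →
      2 * (μ * (μ + N) * IAD + μ * (μ + t) * IAD) / (N + (μ + (μ + t))) = 2 * μ * IAD := by
    intro t ht
    have h3 : N + (μ + (μ + t)) ≠ 0 := (by linarith : 0 < N + (μ + (μ + t))).ne'
    field_simp
    ring
  have c0 := cross 0 le_rfl
  rw [add_zero] at c0
  rw [cross κ hκ, c0]
  obtain ⟨d, rfl⟩ : ∃ d, N = d - 2 * μ := ⟨N + 2 * μ, by ring⟩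
  have e1 : d - 2 * μ + 2 * μ = d := by ring
  have e2 : d - 2 * μ + 2 * (μ + κ) = d + 2 * κ := by ring
  rw [e1] at h1
  rw [e2] at h2
  rw [e1, e2]
  field_simp
  ring

/-! ### Splitting into low and high modes -/

open EvenPoly

/-- A splitting of a function on the sphere into low modes `P`, with gradient `S`, and high modes
`φ`, with gradient `T`. -/
structure ModeSplitting (a : ℝ) (L : ℕ) (P φ : USphere n → ℝ) (S T : USphere n → Amb n) :
    Prop where
  memLp_low : MemLp P 2 (sphereMeasure n a)
  memLp_high : MemLp φ 2 (sphereMeasure n a)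
  memLp_grad_low : MemLp S 2 (sphereMeasure n a)
  memLp_grad_high : MemLp T 2 (sphereMeasure n a)
  grad_low : IsTangentialGradient P S
  grad_high : IsTangentialGradient φ T
  integral_mul : ∫ θ, P θ * φ θ ∂(sphereMeasure n a) = 0
  integral_inner : ∫ θ, inner ℝ (S θ) (T θ) ∂(sphereMeasure n a) = 0
  integral_harm : ∀ h ∈ harm n a L, ∫ θ, φ θ * fn h (θ : Amb n) ∂(sphereMeasure n a) = 0
  low_le : ∫ θ, ‖S θ‖ ^ 2 ∂(sphereMeasure n a)
    ≤ homEigenvalue n a L * ∫ θ, ‖P θ‖ ^ 2 ∂(sphereMeasure n a)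
  gap : homEigenvalue n a (L + 1 : ℕ) * ∫ θ, ‖φ θ‖ ^ 2 ∂(sphereMeasure n a)
    ≤ ∫ θ, ‖T θ‖ ^ 2 ∂(sphereMeasure n a)

lemma exists_modeSplitting (hn : 1 ≤ n) {a : ℝ} (ha : -1 < a) [IsFiniteMeasure (sphereMeasure n a)]
    (L : ℕ) :
    ∃ C : ℝ, 0 ≤ C ∧ ∀ (c : USphere n → ℝ) (R : USphere n → Amb n),
      MemLp c 2 (sphereMeasure n a) → IsTangentialGradient c R → MemLp R 2 (sphereMeasure n a) →
      (∀ᵐ θ ∂(sphereMeasure n a), c (reflSphere n θ) = c θ) →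
      ∃ (p : EvenPoly n) (φ : USphere n → ℝ) (S T : USphere n → Amb n),
        ModeSplitting a L (fun θ => fn p (θ : Amb n)) φ S T ∧
        (∀ θ, c θ = fn p (θ : Amb n) + φ θ) ∧ IsHighModePart a L c φ ∧
        ∫ θ : USphere n, ‖fn p (θ : Amb n)‖ ^ 2 ∂(sphereMeasure n a) ≤ sphereNormSq a c ∧
        (∀ X ∈ Metric.closedBall (0 : Amb n) 1, |fn p X| ≤ C * √(sphereNormSq a c)) ∧
        ∀ X ∈ Metric.closedBall (0 : Amb n) 1, ∀ Y ∈ Metric.closedBall (0 : Amb n) 1,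
          |fn p X - fn p Y| ≤ C * √(sphereNormSq a c) * ‖X - Y‖ := by
  obtain ⟨C, hC, hmain⟩ := exists_low_modes n a L
  refine ⟨C, hC, fun c R hc hR hR2 hce => ?_⟩
  obtain ⟨g, hg, hnorm, horth, hsup, hlip⟩ := hmain c hc
  set s := Finset.range (L + 1) with hs
  have hcn : ‖hc.toLp c‖ = √(sphereNormSq a c) := by
    rw [sphereNormSq, integral_norm_sq_eq_norm_toLp hc, Real.sqrt_sq (norm_nonneg _)]
  set P : USphere n → ℝ := fun θ => ∑ k ∈ s, fn (g k) (θ : Amb n) with hPdef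
  set S : USphere n → Amb n := fun θ => ∑ k ∈ s, sphGrad k (g k) θ with hSdef
  have hP : IsTangentialGradient P S :=
    IsTangentialGradient.sum s fun k _ => isTangentialGradient_fn (hg k).1
  have hP2 : MemLp P 2 (sphereMeasure n a) := memLp_finsetSum s fun k _ => memLp_fn (g k)
  have hS2 : MemLp S 2 (sphereMeasure n a) := memLp_finsetSum s fun k _ => memLp_sphGrad k (g k)
  have hPL : hP2.toLp P = ∑ k ∈ s, toL2 n a (g k) := toLp_sum_fn s g hP2
  -- The difference is written as a sum with a scalar multiple so that the sum and scaling rules for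
  -- tangential gradients apply directly.
  set φ : USphere n → ℝ := fun θ => c θ + (-1) * P θ with hφdef
  set T : USphere n → Amb n := fun θ => R θ + (-1 : ℝ) • S θ with hTdef
  have hφ : IsTangentialGradient φ T := hR.add (hP.const_smul (-1))
  have hφ2 : MemLp φ 2 (sphereMeasure n a) := hc.add (hP2.const_mul (-1))
  have hT2 : MemLp T 2 (sphereMeasure n a) := hR2.add (hS2.const_smul (-1 : ℝ))
  have hlow : ∀ k ≤ L, ∀ p ∈ harm n a k,
      ∫ θ, φ θ * fn p (θ : Amb n) ∂(sphereMeasure n a) = 0 := fun k hk p hp => by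
    rw [← horth k hk p hp]
    refine integral_congr_ae (.of_forall fun θ => ?_)
    simp only [hφdef, hPdef]; ring
  have hφe : ∀ᵐ θ ∂(sphereMeasure n a), φ (reflSphere n θ) = φ θ := by
    filter_upwards [hce] with θ hθ
    simp only [hφdef, hPdef, hθ, coe_reflSphere, fn_reflY]
  have hmul : ∀ k ∈ s, ∫ θ, φ θ * fn (g k) (θ : Amb n) ∂(sphereMeasure n a) = 0 := fun k hk =>
    hlow k (Nat.lt_succ_iff.mp (Finset.mem_range.mp hk)) _ (hg k)
  have hpair : ∀ (η : USphere n → ℝ) (Q : USphere n → Amb n) (hη : MemLp η 2 (sphereMeasure n a)),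
      IsTangentialGradient η Q → MemLp Q 2 (sphereMeasure n a) →
      ∫ θ, inner ℝ (Q θ) (S θ) ∂(sphereMeasure n a)
        = ∑ k ∈ s, homEigenvalue n a k * inner ℝ (hη.toLp η) (toL2 n a (g k)) := by
    intro η Q hη hQ hQ2
    simp only [hSdef, inner_sum]
    rw [integral_finsetSum _ fun k _ => integrable_inner_of_memLp hQ2 (memLp_sphGrad k (g k))]
    refine Finset.sum_congr rfl fun k _ => ?_
    rw [integral_inner_sphGrad (hg k) hη hQ hQ2, inner_toLp_toL2]
  refine ⟨∑ k ∈ s, g k, φ, S, T, ?_, fun θ => ?_, ⟨⟨P, ?_, ?_⟩, fun l e hl he => ?_⟩, ?_, ?_, ?_⟩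
  · have hPfn : (fun θ : USphere n => fn (∑ k ∈ s, g k) (θ : Amb n)) = P := by
      funext θ; rw [fn_sum]
    rw [hPfn]
    refine ⟨hP2, hφ2, hS2, hT2, hP, hφ, ?_, ?_, hlow L le_rfl, ?_,
      gap_inequality hn ha hφ2 hφ hT2 hφe hlow⟩
    · have h1 : ∀ θ, P θ * φ θ = ∑ k ∈ s, φ θ * fn (g k) (θ : Amb n) := fun θ => by
        rw [← Finset.mul_sum, mul_comm]
      simp only [h1]
      rw [integral_finsetSum _ fun k _ => integrable_mul_of_memLp hφ2 (memLp_fn (g k))]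
      exact Finset.sum_eq_zero hmul
    · simp only [real_inner_comm (T _) (S _)]
      rw [hpair φ T hφ2 hφ hT2]
      refine Finset.sum_eq_zero fun k hk => ?_
      rw [inner_toLp_toL2, hmul k hk, mul_zero]
    · have h1 := hpair P S hP2 hP hS2
      simp only [real_inner_self_eq_norm_sq] at h1
      rw [h1, integral_norm_sq_eq_norm_toLp hP2, hPL, norm_sum_toL2_sq hn ha hg, Finset.mul_sum]
      refine Finset.sum_le_sum fun k hk => ?_
      rw [inner_sum_toL2 hn ha hg hk (hg k), real_inner_self_eq_norm_sq]
      gcongr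
      exact homEigenvalue_mono hn ha (Nat.lt_succ_iff.mp (Finset.mem_range.mp hk))
  · simp only [hφdef, hPdef, fn_sum]; ring
  · have hPsum : P = ∑ k ∈ s, fun θ : USphere n => fn (g k) (θ : Amb n) := by
      funext θ; simp [hPdef]
    rw [hPsum]
    refine Submodule.sum_mem _ fun k hk => Submodule.subset_span
      ⟨_, homEigenvalue_mono hn ha (Nat.lt_succ_iff.mp (Finset.mem_range.mp hk)),
        isSphereEigenfunction_fn (hg k)⟩
  · exact .of_forall fun θ => by simp only [Pi.add_apply, hφdef]; ring
  · exact integral_mul_eigenfunction_eq_zero hn ha hφ2 hφe hlow hl he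
  · simp only [fn_sum]
    rw [integral_norm_sq_eq_norm_toLp hP2, hPL, sphereNormSq, integral_norm_sq_eq_norm_toLp hc]
    gcongr
  · rw [← hcn]
    simpa only [fn_sum] using hsup
  · rw [← hcn]
    simpa only [fn_sum] using hlip

namespace ModeSplitting

variable {a : ℝ} {L : ℕ} {P φ : USphere n → ℝ} {S T : USphere n → Amb n}

/-- The comparison of the energies of `r^μ P + r^μ φ` and of
`r^μ (P + M h) + r^(μ + κ) (φ - M h)`. -/
lemma weissEnergy_sub (hs : ModeSplitting a L P φ S T) (hn : 1 ≤ n) (ha : -1 < a) (hL : 1 ≤ L)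
    [IsFiniteMeasure (sphereMeasure n a)]
    {h : EvenPoly n} (hh : h ∈ harm n a L) (M : ℝ) {κ : ℝ} (hκ : 0 ≤ κ) :
    weissEnergy a L (fun X => homExt L (fun θ => P θ + M * fn h (θ : Amb n)) X
        + homExt (L + κ) (fun θ => φ θ + (-M) * fn h (θ : Amb n)) X)
      - weissEnergy a L (homExt L fun θ => P θ + φ θ)
      = κ / (n + a - 1 + 2 * (L + κ)) * (κ * (∫ θ, ‖φ θ‖ ^ 2 ∂(sphereMeasure n a)
          + M ^ 2 * ∫ θ : USphere n, ‖fn h (θ : Amb n)‖ ^ 2 ∂(sphereMeasure n a))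
        - 2 * (∫ θ, ‖T θ‖ ^ 2 ∂(sphereMeasure n a)
          - homEigenvalue n a L * ∫ θ, ‖φ θ‖ ^ 2 ∂(sphereMeasure n a)) / (n + a - 1 + 2 * L)) := by
  have hn' : (1 : ℝ) ≤ n := by exact_mod_cast hn
  have hL' : (1 : ℝ) ≤ L := by exact_mod_cast hL
  obtain ⟨hP2, hφ2, hS2, hT2, hP, hφ, hPφ, hST, hφh, -, -⟩ := hs
  set H : USphere n → ℝ := fun θ => fn h (θ : Amb n)
  have hH2 : MemLp H 2 (sphereMeasure n a) := memLp_fn h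
  have hH : IsTangentialGradient H (sphGrad L h) := isTangentialGradient_fn hh.1
  have hK2 : MemLp (sphGrad L h) 2 (sphereMeasure n a) := memLp_sphGrad L h
  set lam := homEigenvalue n a L with hlam
  have hlam' : lam = L * (L + (n + a - 1)) := by rw [hlam, homEigenvalue]; ring
  rw [integral_mul_eq_inner_toLp hP2 hφ2] at hPφ
  rw [integral_inner_eq_inner_toLp hS2 hT2] at hST
  have hφH : inner ℝ (hφ2.toLp φ) (hH2.toLp H) = 0 := by
    rw [← integral_mul_eq_inner_toLp]; exact hφh h hh
  have hTK : inner ℝ (hT2.toLp T) (hK2.toLp _) = 0 := by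
    rw [← integral_inner_eq_inner_toLp, integral_inner_sphGrad hh hφ2 hφ hT2,
      integral_mul_eq_inner_toLp hφ2 hH2, hφH, mul_zero]
  have hSK : inner ℝ (hS2.toLp S) (hK2.toLp _) = lam * inner ℝ (hP2.toLp P) (hH2.toLp H) := by
    rw [← integral_inner_eq_inner_toLp, integral_inner_sphGrad hh hP2 hP hS2,
      integral_mul_eq_inner_toLp hP2 hH2]
  have hKK : ‖hK2.toLp (sphGrad L h)‖ ^ 2 = lam * ‖hH2.toLp H‖ ^ 2 := by
    rw [← real_inner_self_eq_norm_sq, ← real_inner_self_eq_norm_sq,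
      ← integral_inner_eq_inner_toLp, integral_inner_sphGrad hh hH2 hH hK2,
      integral_mul_eq_inner_toLp hH2 hH2]
  have hA : ∀ t : ℝ, IsTangentialGradient (fun θ => P θ + t * H θ)
      (fun θ => S θ + t • sphGrad L h θ) := fun t => hP.add (hH.const_smul t)
  have hD : ∀ t : ℝ, IsTangentialGradient (fun θ => φ θ + t * H θ)
      (fun θ => T θ + t • sphGrad L h θ) := fun t => hφ.add (hH.const_smul t)
  have hA2 : ∀ t : ℝ, MemLp (fun θ => P θ + t * H θ) 2 (sphereMeasure n a) :=
    fun t => hP2.add (hH2.const_mul t)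
  have hD2 : ∀ t : ℝ, MemLp (fun θ => φ θ + t * H θ) 2 (sphereMeasure n a) :=
    fun t => hφ2.add (hH2.const_mul t)
  have hAS2 : ∀ t : ℝ, MemLp (fun θ => S θ + t • sphGrad L h θ) 2 (sphereMeasure n a) :=
    fun t => hS2.add (hK2.const_smul t)
  have hDT2 : ∀ t : ℝ, MemLp (fun θ => T θ + t • sphGrad L h θ) 2 (sphereMeasure n a) :=
    fun t => hT2.add (hK2.const_smul t)
  have eA : ∀ t, (hA2 t).toLp _ = hP2.toLp P + t • hH2.toLp H := fun t => by
    rw [← MemLp.toLp_const_smul t hH2, ← MemLp.toLp_add hP2]; rfl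
  have eD : ∀ t, (hD2 t).toLp _ = hφ2.toLp φ + t • hH2.toLp H := fun t => by
    rw [← MemLp.toLp_const_smul t hH2, ← MemLp.toLp_add hφ2]; rfl
  have eS : ∀ t, (hAS2 t).toLp _ = hS2.toLp S + t • hK2.toLp _ := fun t => by
    rw [← MemLp.toLp_const_smul t hK2, ← MemLp.toLp_add hS2]; rfl
  have eT : ∀ t, (hDT2 t).toLp _ = hT2.toLp T + t • hK2.toLp _ := fun t => by
    rw [← MemLp.toLp_const_smul t hK2, ← MemLp.toLp_add hT2]; rfl
  -- Both functions are built from the same pair `P + M h`, `φ - M h`; they differ only in the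
  -- homogeneity of the second part.
  have hz : (homExt L fun θ => P θ + φ θ)
      = fun X => homExt L (fun θ => P θ + M * H θ) X + homExt L (fun θ => φ θ + (-M) * H θ) X := by
    rw [← homExt_add]
    congr 1
    funext θ; ring
  -- `P` and `φ` are orthogonal together with their gradients, and `h` is an eigenfunction for
  -- exactly `λ(L)`, so gradient pairings are `λ(L)` times `L²` pairings, as `weiss_algebra`
  -- requires.
  have hcross : inner ℝ ((hAS2 M).toLp _) ((hDT2 (-M)).toLp _)
      = lam * inner ℝ ((hA2 M).toLp _) ((hD2 (-M)).toLp _) := by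
    rw [eA, eD, eS, eT]
    simp only [inner_add_left, inner_add_right, real_inner_smul_left, real_inner_smul_right, hST,
      hPφ, hSK, real_inner_self_eq_norm_sq, hKK]
    rw [real_inner_comm, hTK, real_inner_comm _ (hH2.toLp H), hφH]
    ring
  have hIDH : ‖(hD2 (-M)).toLp _‖ ^ 2 = ‖hφ2.toLp φ‖ ^ 2 + M ^ 2 * ‖hH2.toLp H‖ ^ 2 := by
    rw [eD, norm_add_sq_real, real_inner_smul_right, hφH, norm_smul, mul_pow, Real.norm_eq_abs,
      sq_abs]
    ring
  -- The contribution of `M h` to the gradient is cancelled in the excess over `λ(L)`; hence `M`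
  -- enters only at second order in `κ`.
  have hGDH : ‖(hDT2 (-M)).toLp _‖ ^ 2 = ‖hT2.toLp T‖ ^ 2 + M ^ 2 * (lam * ‖hH2.toLp H‖ ^ 2) := by
    rw [eT, norm_add_sq_real, real_inner_smul_right, hTK, norm_smul, mul_pow, Real.norm_eq_abs,
      sq_abs, hKK]
    ring
  rw [hz, weissEnergy_add_homExt hn ha hL' (by linarith) (hA M) (hD (-M)) (hA2 M) (hD2 (-M))
      (hAS2 M) (hDT2 (-M)),
    weissEnergy_add_homExt hn ha hL' hL' (hA M) (hD (-M)) (hA2 M) (hD2 (-M)) (hAS2 M)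
      (hDT2 (-M)), hcross, hlam', weiss_algebra (by linarith) hκ, hIDH, hGDH,
    integral_norm_sq_eq_norm_toLp hφ2, integral_norm_sq_eq_norm_toLp hT2,
    integral_norm_sq_eq_norm_toLp hH2, hlam']
  ring

/-- The energy of a homogeneous function. -/
lemma weissEnergy_homExt (hs : ModeSplitting a L P φ S T) (hn : 1 ≤ n) (ha : -1 < a) (hL : 1 ≤ L)
    [IsFiniteMeasure (sphereMeasure n a)] :
    (n + a - 1 + 2 * L) * weissEnergy a L (homExt L fun θ => P θ + φ θ)
      = (∫ θ, ‖S θ‖ ^ 2 ∂(sphereMeasure n a)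
          - homEigenvalue n a L * ∫ θ, ‖P θ‖ ^ 2 ∂(sphereMeasure n a))
        + (∫ θ, ‖T θ‖ ^ 2 ∂(sphereMeasure n a)
          - homEigenvalue n a L * ∫ θ, ‖φ θ‖ ^ 2 ∂(sphereMeasure n a)) := by
  have hn' : (1 : ℝ) ≤ n := by exact_mod_cast hn
  have hL' : (1 : ℝ) ≤ L := by exact_mod_cast hL
  obtain ⟨hP2, hφ2, hS2, hT2, hP, hφ, hPφ, hST, -, -, -⟩ := hs
  rw [integral_mul_eq_inner_toLp hP2 hφ2] at hPφ
  rw [integral_inner_eq_inner_toLp hS2 hT2] at hST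
  have hpos : (n : ℝ) + a - 1 + 2 * L ≠ 0 := by
    have : 0 < (n : ℝ) + a - 1 + 2 * L := by linarith
    exact this.ne'
  rw [homExt_add, weissEnergy_add_homExt hn ha hL' hL' hP hφ hP2 hφ2 hS2 hT2, hPφ, hST,
    integral_norm_sq_eq_norm_toLp hφ2, integral_norm_sq_eq_norm_toLp hT2,
    integral_norm_sq_eq_norm_toLp hP2, integral_norm_sq_eq_norm_toLp hS2, homEigenvalue]
  field_simp
  ring

end ModeSplitting

/-! ### Traces on the thin ball -/

/-- The decomposition `ℝⁿ⁺¹ = ℝ × ℝⁿ`. -/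
lemma measurePreserving_yCoord_xPart :
    MeasurePreserving (fun X : Amb n => (yCoord X, xPart X)) volume
      ((volume : Measure ℝ).prod (volume : Measure (EuclideanSpace ℝ (Fin n)))) := by
  have h1 := (EuclideanSpace.volume_preserving_symm_measurableEquiv_toLp (Fin (n + 1)))
  have h2 := volume_preserving_piFinSuccAbove (fun _ : Fin (n + 1) => ℝ) (Fin.last n)
  have h3 := (MeasurePreserving.id (volume : Measure ℝ)).prod
    (EuclideanSpace.volume_preserving_symm_measurableEquiv_toLp (Fin n)).symm
  have e : (fun X : Amb n => (yCoord X, xPart X))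
      = (Prod.map id (MeasurableEquiv.toLp 2 (Fin n → ℝ)).symm.symm ∘
        MeasurableEquiv.piFinSuccAbove (fun _ => ℝ) (Fin.last n)) ∘
          (MeasurableEquiv.toLp 2 (Fin (n + 1) → ℝ)).symm := by
    funext X
    refine Prod.ext rfl ?_
    ext i
    simp [xPart, Fin.insertNthEquiv, Fin.init, MeasurableEquiv.piFinSuccAbove]
  rw [e]
  exact (h3.comp h2).comp h1

/-- The point `(x, 0)`. -/
def inclX (x : EuclideanSpace ℝ (Fin n)) : Amb n := WithLp.toLp 2 (Fin.snoc (fun i => x i) 0)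

lemma norm_sq_eq_xPart_add (X : Amb n) : ‖X‖ ^ 2 = ‖xPart X‖ ^ 2 + yCoord X ^ 2 := by
  rw [EuclideanSpace.norm_sq_eq, EuclideanSpace.norm_sq_eq, Fin.sum_univ_castSucc]
  simp [xPart, yCoord]

lemma xPart_inclX (x : EuclideanSpace ℝ (Fin n)) : xPart (inclX x) = x := by
  ext i; simp [xPart, inclX]

lemma yCoord_inclX (x : EuclideanSpace ℝ (Fin n)) : yCoord (inclX x) = 0 := by
  simp [yCoord, inclX]

lemma norm_inclX (x : EuclideanSpace ℝ (Fin n)) : ‖inclX x‖ = ‖x‖ := by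
  have := norm_sq_eq_xPart_add (inclX x)
  rw [xPart_inclX, yCoord_inclX] at this
  rw [← sq_eq_sq₀ (norm_nonneg _) (norm_nonneg _)]
  linarith

lemma norm_sub_inclX (X : Amb n) : ‖X - inclX (xPart X)‖ = |yCoord X| := by
  have h := norm_sq_eq_xPart_add (X - inclX (xPart X))
  have h1 : xPart (X - inclX (xPart X)) = 0 := by ext i; simp [xPart, inclX]
  have h2 : yCoord (X - inclX (xPart X)) = yCoord X := by simp [yCoord, inclX]
  rw [h1, h2, norm_zero, ← sq_abs (yCoord X)] at h
  rw [← sq_eq_sq₀ (norm_nonneg _) (abs_nonneg _)]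
  linarith

lemma norm_xPart_le (X : Amb n) : ‖xPart X‖ ≤ ‖X‖ := by
  have := norm_sq_eq_xPart_add X
  refine le_of_sq_le_sq ?_ (norm_nonneg _)
  nlinarith [sq_nonneg (yCoord X)]

lemma measurable_xPart : Measurable (xPart : Amb n → EuclideanSpace ℝ (Fin n)) :=
  measurable_snd.comp measurePreserving_yCoord_xPart.measurable

lemma continuous_inclX : Continuous (inclX : EuclideanSpace ℝ (Fin n) → Amb n) := by
  have : Isometry (inclX : EuclideanSpace ℝ (Fin n) → Amb n) := by
    refine Isometry.of_dist_eq fun x y => ?_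
    have : inclX x - inclX y = inclX (x - y) := by
      ext i
      refine Fin.lastCases ?_ (fun j => ?_) i <;> simp [inclX]
    rw [dist_eq_norm, dist_eq_norm, this, norm_inclX]
  exact this.continuous

lemma ae_xPart {p : EuclideanSpace ℝ (Fin n) → Prop}
    (h : ∀ᵐ x ∂(volume.restrict (thinBall n)), p x) :
    ∀ᵐ X ∂(volume.restrict (unitBall n)), p (xPart X) := by
  have h1 := (ae_restrict_iff' (measurableSet_ball : MeasurableSet (thinBall n))).mp h
  have h2 : ∀ᵐ q ∂((volume : Measure ℝ).prod (volume : Measure (EuclideanSpace ℝ (Fin n)))),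
      q.2 ∈ thinBall n → p q.2 := Measure.quasiMeasurePreserving_snd.ae h1
  refine (ae_restrict_iff' (measurableSet_ball : MeasurableSet (unitBall n))).mpr ?_
  filter_upwards [measurePreserving_yCoord_xPart.quasiMeasurePreserving.ae h2] with X hX hb
  refine hX ?_
  rw [thinBall, mem_ball_zero_iff]
  exact (norm_xPart_le X).trans_lt (mem_ball_zero_iff.mp hb)

/-- The layer `B₁ ∩ {|y| < δ}`. -/
def thinLayer (n : ℕ) (δ : ℝ) : Set (Amb n) := unitBall n ∩ {X : Amb n | |yCoord X| < δ}

lemma measurableSet_thinLayer (δ : ℝ) : MeasurableSet (thinLayer n δ) :=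
  (measurableSet_ball : MeasurableSet (unitBall n)).inter
    (isOpen_lt continuous_yCoord.abs continuous_const).measurableSet

/-- The layer lies in the product of `(-δ, δ)` with the thin ball, where Fubini applies. -/
lemma lintegral_thinLayer_le {δ : ℝ} (f : EuclideanSpace ℝ (Fin n) → ℝ)
    (hf : AEStronglyMeasurable f (volume.restrict (thinBall n))) :
    ∫⁻ X in thinLayer n δ, ‖f (xPart X)‖ₑ ^ 2
      ≤ ENNReal.ofReal (2 * δ) * ∫⁻ x in thinBall n, ‖f x‖ₑ ^ 2 := by
  have hm : MeasurableSet (Ioo (-δ) δ ×ˢ thinBall n) := measurableSet_Ioo.prod measurableSet_ball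
  set g := (Ioo (-δ) δ ×ˢ thinBall n).indicator fun q : ℝ × EuclideanSpace ℝ (Fin n) =>
    ‖f q.2‖ₑ ^ 2 with hg
  have hgm : AEMeasurable g
      ((volume : Measure ℝ).prod (volume : Measure (EuclideanSpace ℝ (Fin n)))) := by
    rw [hg, aemeasurable_indicator_iff hm, ← Measure.prod_restrict]
    exact (hf.comp_snd).enorm.pow_const 2
  calc ∫⁻ X in thinLayer n δ, ‖f (xPart X)‖ₑ ^ 2
      ≤ ∫⁻ X : Amb n, g (yCoord X, xPart X) := by
        rw [← lintegral_indicator (measurableSet_thinLayer δ)]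
        refine lintegral_mono fun X => ?_
        by_cases h : X ∈ thinLayer n δ
        · rw [indicator_of_mem h, hg, indicator_of_mem]
          refine ⟨abs_lt.mp h.2, ?_⟩
          rw [thinBall, mem_ball_zero_iff]
          exact (norm_xPart_le X).trans_lt (mem_ball_zero_iff.mp h.1)
        · rw [indicator_of_notMem h]; exact zero_le
    _ = ∫⁻ q, g q ∂((volume : Measure ℝ).prod (volume : Measure (EuclideanSpace ℝ (Fin n)))) := by
        rw [← measurePreserving_yCoord_xPart.map_eq,
          lintegral_map' (by rwa [measurePreserving_yCoord_xPart.map_eq])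
            measurePreserving_yCoord_xPart.measurable.aemeasurable]
    _ = _ := by
        have h1 := lintegral_prod_mul (μ := volume.restrict (Ioo (-δ) δ))
          (ν := (volume : Measure (EuclideanSpace ℝ (Fin n))).restrict (thinBall n))
          (f := fun _ => 1) (g := fun x => ‖f x‖ₑ ^ 2) aemeasurable_const (hf.enorm.pow_const 2)
        simp only [one_mul] at h1
        rw [hg, lintegral_indicator hm, ← Measure.prod_restrict, h1]
        simp only [lintegral_const, Measure.restrict_apply_univ, Real.volume_Ioo, one_mul]
        congr 2; ring

namespace IsThinTrace

variable {v w : Amb n → ℝ} {f g : EuclideanSpace ℝ (Fin n) → ℝ}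

lemma add (hv : AEStronglyMeasurable v (volume.restrict (unitBall n))) (h : IsThinTrace v f)
    (h' : IsThinTrace w g) : IsThinTrace (fun X => v X + w X) (fun x => f x + g x) := by
  refine ⟨h.1.add h'.1, ?_⟩
  have h1 := (ENNReal.Tendsto.const_mul (h.2.add h'.2) (Or.inr (ENNReal.ofNat_ne_top (n := 2))))
  rw [add_zero, mul_zero] at h1
  refine tendsto_of_tendsto_of_tendsto_of_le_of_le tendsto_const_nhds h1 (fun _ => zero_le)
    fun δ => ?_
  simp only []
  rw [← ENNReal.add_div, ← mul_div_assoc]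
  gcongr
  have hfm : AEStronglyMeasurable (fun X => f (xPart X)) (volume.restrict (unitBall n)) := by
    obtain ⟨f', hf', hff⟩ := h.1.1
    exact ⟨fun X => f' (xPart X), hf'.comp_measurable measurable_xPart, ae_xPart hff⟩
  refine le_trans (le_of_eq ?_) (lintegral_enorm_add_sq_le
    (f := fun X => v X - f (xPart X)) (g := fun X => w X - g (xPart X))
    ((hv.sub hfm).mono_measure (Measure.restrict_mono inter_subset_left le_rfl)))
  refine lintegral_congr fun X => ?_
  congr 2
  ring

/-- Multiplication of a trace by a continuous function. -/
lemma continuous_mul (hv : AEStronglyMeasurable v (volume.restrict (unitBall n)))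
    (h : IsThinTrace v f) {k : Amb n → ℝ} (hk : Continuous k) :
    IsThinTrace (fun X => k X * v X) (fun x => k (inclX x) * f x) := by
  have hK := isCompact_closedBall (0 : Amb n) 1
  obtain ⟨C, hC⟩ := hK.exists_bound_of_continuousOn hk.continuousOn
  have hC0 : 0 ≤ C := (norm_nonneg _).trans (hC 0 (by simp))
  have hin : ∀ x ∈ thinBall n, inclX x ∈ Metric.closedBall (0 : Amb n) 1 := fun x hx => by
    rw [mem_closedBall_zero_iff, norm_inclX]; exact (mem_ball_zero_iff.mp hx).le
  have hfm : AEStronglyMeasurable (fun X => f (xPart X)) (volume.restrict (unitBall n)) := by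
    obtain ⟨f', hf', hff⟩ := h.1.1
    exact ⟨fun X => f' (xPart X), hf'.comp_measurable measurable_xPart, ae_xPart hff⟩
  set I := ∫⁻ x in thinBall n, ‖f x‖ₑ ^ 2 with hI
  have hIfin : I ≠ ⊤ := by
    have h2 := (eLpNorm_lt_top_iff_lintegral_rpow_enorm_lt_top (p := 2) (by simp) (by simp)).mp
      h.1.eLpNorm_lt_top
    simpa using h2.ne
  refine ⟨?_, ?_⟩
  · refine (h.1.const_mul C).of_le
      ((hk.comp continuous_inclX).aestronglyMeasurable.mul h.1.1) ?_
    filter_upwards [ae_restrict_mem (measurableSet_ball : MeasurableSet (thinBall n))] with x hx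
    rw [norm_mul, norm_mul, Real.norm_of_nonneg hC0]
    gcongr
    exact hC _ (hin x hx)
  rw [ENNReal.tendsto_nhds_zero]
  intro ε hε
  by_cases hεt : ε = ⊤
  · rw [hεt]; exact .of_forall fun _ => le_top
  -- The error splits as `k (v - f) + (k - k(x, 0)) f`. The trace condition handles the first term;
  -- `η` is the oscillation of `k` allowed in the second, supplied by uniform continuity.
  obtain ⟨η, hη, hηε⟩ : ∃ η : ℝ, 0 < η ∧
      2 * (ENNReal.ofReal (η ^ 2) * (2 * I)) ≤ ε / 2 := by
    have h1 : Tendsto (fun η : ℝ => 2 * (ENNReal.ofReal (η ^ 2) * (2 * I))) (𝓝[>] 0) (𝓝 0) := by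
      have h2 : Tendsto (fun η : ℝ => η ^ 2) (𝓝[>] 0) (𝓝 0) := by
        have := (continuous_pow 2 (M := ℝ)).tendsto 0
        rw [zero_pow two_ne_zero] at this
        exact this.mono_left nhdsWithin_le_nhds
      have h3 := ENNReal.Tendsto.const_mul (ENNReal.Tendsto.mul_const (ENNReal.tendsto_ofReal h2)
        (b := 2 * I) (Or.inr (ENNReal.mul_ne_top (by simp) hIfin)))
        (Or.inr (ENNReal.ofNat_ne_top (n := 2)))
      rw [ENNReal.ofReal_zero, zero_mul, mul_zero] at h3
      exact h3
    have h4 := (ENNReal.tendsto_nhds_zero.mp h1) (ε / 2) (ENNReal.half_pos hε.ne')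
    obtain ⟨η, hη1, hη2⟩ := (h4.and self_mem_nhdsWithin).exists
    exact ⟨η, hη2, hη1⟩
  obtain ⟨τ, hτ, hτk⟩ := Metric.uniformContinuousOn_iff.mp
    (hK.uniformContinuousOn_of_continuous hk.continuousOn) η hη
  have hfirst : ∀ᶠ δ in 𝓝[>] (0 : ℝ), 2 * (ENNReal.ofReal (C ^ 2) *
      ((∫⁻ X in thinLayer n δ, ‖v X - f (xPart X)‖ₑ ^ 2) / ENNReal.ofReal δ)) ≤ ε / 2 := by
    have h3 := ENNReal.Tendsto.const_mul (ENNReal.Tendsto.const_mul h.2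
      (a := ENNReal.ofReal (C ^ 2)) (Or.inr ENNReal.ofReal_ne_top))
      (Or.inr (ENNReal.ofNat_ne_top (n := 2)))
    rw [mul_zero, mul_zero] at h3
    exact (ENNReal.tendsto_nhds_zero.mp h3) (ε / 2) (ENNReal.half_pos hε.ne')
  filter_upwards [hfirst, Ioo_mem_nhdsGT hτ] with δ h1 hδ
  have hδ0 : ENNReal.ofReal δ ≠ 0 := by simpa using hδ.1
  have hms := measurableSet_thinLayer (n := n) δ
  have hp1 : ∀ X ∈ thinLayer n δ, ‖k X * (v X - f (xPart X))‖ₑ ^ 2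
      ≤ ENNReal.ofReal (C ^ 2) * ‖v X - f (xPart X)‖ₑ ^ 2 := fun X hX => by
    rw [enorm_mul, mul_pow]
    gcongr
    rw [Real.enorm_eq_ofReal_abs, ← ENNReal.ofReal_pow (abs_nonneg _)]
    refine ENNReal.ofReal_le_ofReal (pow_le_pow_left₀ (abs_nonneg _) ?_ 2)
    exact hC X (Metric.ball_subset_closedBall hX.1)
  have hp2 : ∀ X ∈ thinLayer n δ, ‖(k X - k (inclX (xPart X))) * f (xPart X)‖ₑ ^ 2
      ≤ ENNReal.ofReal (η ^ 2) * ‖f (xPart X)‖ₑ ^ 2 := fun X hX => by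
    rw [enorm_mul, mul_pow]
    gcongr
    rw [Real.enorm_eq_ofReal_abs, ← ENNReal.ofReal_pow (abs_nonneg _)]
    refine ENNReal.ofReal_le_ofReal (pow_le_pow_left₀ (abs_nonneg _) ?_ 2)
    have h2 : dist (k X) (k (inclX (xPart X))) < η := by
      refine hτk X (Metric.ball_subset_closedBall hX.1) _ (hin _ ?_) ?_
      · rw [thinBall, mem_ball_zero_iff]
        exact (norm_xPart_le X).trans_lt (mem_ball_zero_iff.mp hX.1)
      · rw [dist_eq_norm, norm_sub_inclX]
        exact (show |yCoord X| < δ from hX.2).trans hδ.2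
    exact h2.le
  have hmeas : AEStronglyMeasurable (fun X => k X * (v X - f (xPart X)))
      (volume.restrict (thinLayer n δ)) :=
    (hk.aestronglyMeasurable.mul (hv.sub hfm)).mono_measure
      (Measure.restrict_mono inter_subset_left le_rfl)
  refine ENNReal.div_le_of_le_mul ?_
  calc ∫⁻ X in thinLayer n δ, ‖k X * v X - k (inclX (xPart X)) * f (xPart X)‖ₑ ^ 2
      = ∫⁻ X in thinLayer n δ, ‖k X * (v X - f (xPart X))
          + (k X - k (inclX (xPart X))) * f (xPart X)‖ₑ ^ 2 := by
        refine lintegral_congr fun X => ?_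
        congr 2; ring
    _ ≤ 2 * ((∫⁻ X in thinLayer n δ, ‖k X * (v X - f (xPart X))‖ₑ ^ 2)
          + ∫⁻ X in thinLayer n δ, ‖(k X - k (inclX (xPart X))) * f (xPart X)‖ₑ ^ 2) :=
        lintegral_enorm_add_sq_le hmeas
    _ ≤ 2 * (ENNReal.ofReal (C ^ 2) * (∫⁻ X in thinLayer n δ, ‖v X - f (xPart X)‖ₑ ^ 2)
          + ENNReal.ofReal (η ^ 2) * (ENNReal.ofReal (2 * δ) * I)) := by
        gcongr
        · rw [← lintegral_const_mul' _ _ ENNReal.ofReal_ne_top]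
          exact setLIntegral_mono' hms hp1
        · refine (setLIntegral_mono' hms hp2).trans ?_
          rw [lintegral_const_mul' _ _ ENNReal.ofReal_ne_top]
          gcongr
          exact lintegral_thinLayer_le f h.1.1
    _ = (2 * (ENNReal.ofReal (C ^ 2) * ((∫⁻ X in thinLayer n δ, ‖v X - f (xPart X)‖ₑ ^ 2)
          / ENNReal.ofReal δ)) + 2 * (ENNReal.ofReal (η ^ 2) * (2 * I))) * ENNReal.ofReal δ := by
        rw [add_mul, mul_add]
        congr 1
        · rw [mul_assoc, mul_assoc, ENNReal.div_mul_cancel hδ0 ENNReal.ofReal_ne_top]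
        · rw [ENNReal.ofReal_mul (by norm_num), ENNReal.ofReal_ofNat]; ring
    _ ≤ (ε / 2 + ε / 2) * ENNReal.ofReal δ := by gcongr
    _ = ε * ENNReal.ofReal δ := by rw [ENNReal.add_halves]

/-- The trace of a continuous function. -/
lemma of_continuous {k : Amb n → ℝ} (hk : Continuous k) :
    IsThinTrace k (fun x => k (inclX x)) := by
  have h1 : IsThinTrace (fun _ : Amb n => (1 : ℝ)) (fun _ => 1) := by
    have : IsFiniteMeasure ((volume : Measure (EuclideanSpace ℝ (Fin n))).restrict (thinBall n)) :=
      ⟨by rw [Measure.restrict_apply_univ]; exact measure_ball_lt_top⟩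
    refine ⟨memLp_const 1, ?_⟩
    simp
  simpa using h1.continuous_mul aestronglyMeasurable_const hk

end IsThinTrace

/-! ### Admissibility of the competitor -/

open EvenPoly

lemma homExt_fn {μ : ℝ} (hμ : 0 < μ) (q : EvenPoly n) :
    homExt μ (fun θ : USphere n => fn q (θ : Amb n)) = fun X => ‖X‖ ^ μ * fn q (‖X‖⁻¹ • X) := by
  funext X
  unfold homExt
  split_ifs with h
  · rw [h, norm_zero, Real.zero_rpow hμ.ne', zero_mul]
  · rfl

lemma norm_inv_smul_self_le (X : Amb n) : ‖‖X‖⁻¹ • X‖ ≤ 1 := by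
  rw [norm_smul, norm_inv, norm_norm]
  exact inv_mul_le_one

/-- At the origin the factor `|X|^μ` with `μ > 0` beats the bounded angular part. -/
lemma continuous_homExt_fn {μ : ℝ} (hμ : 0 < μ) (q : EvenPoly n) :
    Continuous (homExt μ (fun θ : USphere n => fn q (θ : Amb n))) := by
  rw [homExt_fn hμ, continuous_iff_continuousAt]
  intro X
  by_cases hX : X = 0
  · subst hX
    obtain ⟨C, hC0, hC, -⟩ := exists_lipschitz_fn q
    have h1 : Tendsto (fun X : Amb n => ‖X‖ ^ μ * C) (𝓝 0) (𝓝 0) := by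
      have : ContinuousAt (fun X : Amb n => ‖X‖ ^ μ * C) 0 :=
        (continuous_norm.continuousAt.rpow_const (Or.inr hμ.le)).mul continuousAt_const
      have h2 := this.tendsto
      rwa [norm_zero, Real.zero_rpow hμ.ne', zero_mul] at h2
    have h3 : Tendsto (fun X : Amb n => ‖X‖ ^ μ * fn q (‖X‖⁻¹ • X)) (𝓝 0) (𝓝 0) := by
      refine squeeze_zero_norm (fun X => ?_) h1
      rw [norm_mul, Real.norm_of_nonneg (by positivity)]
      gcongr
      exact hC _ (by rw [mem_closedBall_zero_iff]; exact norm_inv_smul_self_le X)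
    rw [ContinuousAt, norm_zero, Real.zero_rpow hμ.ne', zero_mul]
    exact h3
  · have h0 : ‖X‖ ≠ 0 := norm_ne_zero_iff.mpr hX
    refine (continuous_norm.continuousAt.rpow_const (Or.inl h0)).mul ?_
    exact ((contDiff_fn q).continuous.continuousAt).comp
      ((continuous_norm.continuousAt.inv₀ h0).smul continuousAt_id)

lemma homExt_rpow_mul (μ κ : ℝ) (c : USphere n → ℝ) (X : Amb n) :
    homExt (μ + κ) c X = ‖X‖ ^ κ * homExt μ c X := by
  unfold homExt
  split_ifs with h
  · rw [mul_zero]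
  · rw [Real.rpow_add (norm_pos_iff.mpr h), smul_eq_mul, smul_eq_mul]; ring

/-- Functions on the sphere with even homogeneous extensions are even. -/
lemma ae_reflSphere_eq {a μ : ℝ} (hna : 0 ≤ (n : ℝ) + a) {c : USphere n → ℝ}
    (h : ∀ᵐ X ∂(volume.restrict (unitBall n)), homExt μ c (reflY X) = homExt μ c X) :
    ∀ᵐ θ ∂(sphereMeasure n a), c (reflSphere n θ) = c θ := by
  have h1 := (ae_restrict_iff' (measurableSet_ball : MeasurableSet (unitBall n))).mp h
  have h2 := Measure.ae_ae_of_ae_prod (ae_polar_of_ae_volume (a := a) h1)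
  have hpos : radialMeasure n a {r | 1 - 1 / 2 < (r : ℝ) ∧ (r : ℝ) < 1} ≠ 0 := by
    have h3 := le_radialMeasure_layer (n := n) hna (δ := 1 / 2) (by norm_num) le_rfl
    have h4 : 0 < ENNReal.ofReal ((1 / 2) ^ (n + a)) * ENNReal.ofReal (1 / 2) := by
      rw [← ENNReal.ofReal_mul (by positivity), ENNReal.ofReal_pos]
      positivity
    exact (h4.trans_le h3).ne'
  filter_upwards [h2] with θ hθ
  by_contra hne
  refine hpos (measure_mono_null (fun r hr => ?_) hθ)
  intro hcon
  have hr0 : (0 : ℝ) < r := r.2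
  have h5 := hcon (mem_ball_zero_iff.mpr (by rw [norm_polarMap]; exact hr.2))
  rw [homExt_reflY, homExt_polarMap, homExt_polarMap, smul_eq_mul, smul_eq_mul] at h5
  exact hne (mul_left_cancel₀ (by positivity) h5)

lemma ae_homExt_reflY_eq {a : ℝ} (μ : ℝ) {c : USphere n → ℝ}
    (h : ∀ᵐ θ ∂(sphereMeasure n a), c (reflSphere n θ) = c θ) :
    ∀ᵐ X : Amb n, homExt μ c (reflY X) = homExt μ c X := by
  filter_upwards [ae_homExt_eq μ h, ae_ne_zero] with X hX h0
  obtain ⟨q, rfl⟩ := exists_polarMap h0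
  rw [homExt_reflY, hX]

lemma IsTangentialGradient.aestronglyMeasurable_homExt {c : USphere n → ℝ}
    {T : USphere n → Amb n} (h : IsTangentialGradient c T) (μ : ℝ) :
    AEStronglyMeasurable (homExt μ c) volume := by
  rw [← bulkMeasure_zero]
  exact _root_.aestronglyMeasurable_homExt μ h.integrable_left.1

/-- Raising the homogeneity of a part of the boundary values keeps a function admissible, if the
remaining part is nonnegative on the thin sphere. -/
lemma add_homExt_mem_admissibleClass (hn : 1 ≤ n) {a : ℝ} (ha : -1 < a)
    {μ κ : ℝ} (hμ : 1 ≤ μ) (hκ : 0 ≤ κ) {c D : USphere n → ℝ} {S T : USphere n → Amb n}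
    {q : EvenPoly n} (hz : homExt μ c ∈ admissibleClass a c)
    (hc : ∀ θ, c θ = fn q (θ : Amb n) + D θ)
    (hA : IsTangentialGradient (fun θ : USphere n => fn q (θ : Amb n)) S)
    (hD : IsTangentialGradient D T)
    (hA2 : MemLp (fun θ : USphere n => fn q (θ : Amb n)) 2 (sphereMeasure n a))
    (hD2 : MemLp D 2 (sphereMeasure n a))
    (hS2 : MemLp S 2 (sphereMeasure n a)) (hT2 : MemLp T 2 (sphereMeasure n a))
    (hq : ∀ θ : USphere n, yCoord (θ : Amb n) = 0 → 0 ≤ fn q (θ : Amb n)) :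
    (fun X => homExt μ (fun θ : USphere n => fn q (θ : Amb n)) X + homExt (μ + κ) D X)
      ∈ admissibleClass a c := by
  have hn' : (1 : ℝ) ≤ n := by exact_mod_cast hn
  obtain ⟨-, ⟨f, hf, hf0⟩, -, hzr⟩ := hz
  set A : USphere n → ℝ := fun θ => fn q (θ : Amb n) with hAdef
  have hcA : c = fun θ => A θ + D θ := funext hc
  have hce := ae_reflSphere_eq (n := n) (a := a) (by linarith) hzr
  have hDe : ∀ᵐ θ ∂(sphereMeasure n a), D (reflSphere n θ) = D θ := by
    filter_upwards [hce] with θ hθ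
    rw [hc, hc, coe_reflSphere, fn_reflY] at hθ
    linarith
  have hAe : ∀ᵐ θ ∂(sphereMeasure n a), A (reflSphere n θ) = A θ :=
    .of_forall fun θ => by simp only [hAdef, coe_reflSphere, fn_reflY]
  have hg : Continuous fun X : Amb n => ‖X‖ ^ κ := continuous_norm.rpow_const fun _ => Or.inr hκ
  have hAc : Continuous (homExt μ A) := continuous_homExt_fn (by linarith) q
  -- The competitor is `|X|^κ z + (1 - |X|^κ) r^μ A`. In the ball this is a convex combination, so
  -- nonnegativity on the thin set follows from that of `z` and `A`, with no sign condition on `D`.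
  have hform : (fun X => homExt μ A X + homExt (μ + κ) D X)
      = fun X => ‖X‖ ^ κ * homExt μ c X + (1 - ‖X‖ ^ κ) * homExt μ A X := by
    funext X
    rw [homExt_rpow_mul, hcA, homExt_add]
    ring
  have hzm : AEStronglyMeasurable (homExt μ c) volume := by
    rw [hcA, homExt_add]
    exact (hA.aestronglyMeasurable_homExt μ).add (hD.aestronglyMeasurable_homExt μ)
  refine ⟨memH1_add_homExt hn ha hμ (by linarith) hA hD hA2 hD2 hS2 hT2, ?_, ?_, ?_⟩
  · rw [hform]
    refine ⟨_, (hf.continuous_mul hzm.restrict hg).add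
      (hg.aestronglyMeasurable.mul hzm).restrict
      (IsThinTrace.of_continuous ((continuous_const.sub hg).mul hAc)), ?_⟩
    filter_upwards [hf0, ae_restrict_mem (measurableSet_ball : MeasurableSet (thinBall n))]
      with x hx hxb
    have hx1 : ‖inclX x‖ ≤ 1 := by rw [norm_inclX]; exact (mem_ball_zero_iff.mp hxb).le
    have h1 : ‖inclX x‖ ^ κ ≤ 1 := Real.rpow_le_one (norm_nonneg _) hx1 hκ
    have h2 : 0 ≤ homExt μ A (inclX x) := by
      by_cases h0 : inclX x = 0
      · simp [homExt, h0]
      · obtain ⟨p, hp⟩ := exists_polarMap h0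
        have hr : (0 : ℝ) < p.2 := p.2.2
        have hy : yCoord (p.1 : Amb n) = 0 := by
          have := yCoord_inclX x
          rw [← hp, polarMap, yCoord_smul] at this
          exact (mul_eq_zero.mp this).resolve_left hr.ne'
        rw [← hp, homExt_polarMap]
        exact mul_nonneg (by positivity) (hq _ hy)
    have h3 : 0 ≤ ‖inclX x‖ ^ κ * f x := mul_nonneg (by positivity) hx
    have h4 : 0 ≤ (1 - ‖inclX x‖ ^ κ) * homExt μ A (inclX x) := mul_nonneg (by linarith) h2
    exact add_nonneg h3 h4
  · rw [hcA]
    exact isSphereTrace_add_homExt (by linarith) (by linarith) (by linarith) hA2 hD2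
  · refine ae_restrict_of_ae ?_
    filter_upwards [ae_homExt_reflY_eq μ hAe, ae_homExt_reflY_eq (μ + κ) hDe] with X h1 h2
    rw [h1, h2]

/-! ### Smooth steps and mollifiers in the normal variable -/

/-- A smooth step, equal to `0` left of `-1` and to `1` right of `1`. -/
def smoothStep (t : ℝ) : ℝ := Real.smoothTransition ((t + 1) / 2)

lemma contDiff_smoothStep : ContDiff ℝ ∞ smoothStep :=
  Real.smoothTransition.contDiff.comp ((contDiff_id.add contDiff_const).div_const 2)

lemma smoothStep_of_le {t : ℝ} (h : t ≤ -1) : smoothStep t = 0 :=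
  Real.smoothTransition.zero_of_nonpos (by linarith)

lemma smoothStep_of_ge {t : ℝ} (h : 1 ≤ t) : smoothStep t = 1 :=
  Real.smoothTransition.one_of_one_le (by linarith)

lemma smoothStep_mem (t : ℝ) : smoothStep t ∈ Icc (0 : ℝ) 1 :=
  ⟨Real.smoothTransition.nonneg _, Real.smoothTransition.le_one _⟩

lemma continuous_deriv_smoothStep : Continuous (deriv smoothStep) :=
  contDiff_smoothStep.continuous_deriv (by simp)

lemma hasDerivAt_smoothStep (t : ℝ) : HasDerivAt smoothStep (deriv smoothStep t) t :=
  (contDiff_smoothStep.differentiable (by simp) t).hasDerivAt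

lemma deriv_smoothStep_eq_zero {t : ℝ} (h : 1 ≤ |t|) : deriv smoothStep t = 0 := by
  rcases le_abs.mp h with h | h
  · refine IsLocalMax.deriv_eq_zero (.of_forall fun s => ?_)
    rw [smoothStep_of_ge h]; exact (smoothStep_mem s).2
  · refine IsLocalMin.deriv_eq_zero (.of_forall fun s => ?_)
    rw [smoothStep_of_le (by linarith)]; exact (smoothStep_mem s).1

lemma deriv_smoothStep_nonneg (t : ℝ) : 0 ≤ deriv smoothStep t := by
  have : Monotone smoothStep := fun s t h => Real.smoothTransition.monotone (by linarith)
  exact this.deriv_nonneg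

lemma exists_deriv_smoothStep_le : ∃ C : ℝ, 0 < C ∧ ∀ t, deriv smoothStep t ≤ C := by
  obtain ⟨C, hC⟩ := (isCompact_Icc (a := (-1 : ℝ)) (b := 1)).exists_bound_of_continuousOn
    continuous_deriv_smoothStep.continuousOn
  refine ⟨max C 1, by positivity, fun t => ?_⟩
  by_cases h : 1 ≤ |t|
  · rw [deriv_smoothStep_eq_zero h]; positivity
  · exact ((le_abs_self _).trans (hC t (abs_le.mp (not_le.mp h).le))).trans (le_max_left _ _)

lemma integral_deriv_smoothStep : ∫ t, deriv smoothStep t = 1 := by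
  have h1 : ∫ t in (-1 : ℝ)..1, deriv smoothStep t = 1 := by
    rw [intervalIntegral.integral_eq_sub_of_hasDerivAt (fun t _ => hasDerivAt_smoothStep t)
      (continuous_deriv_smoothStep.intervalIntegrable _ _), smoothStep_of_ge le_rfl,
      smoothStep_of_le le_rfl, sub_zero]
  rw [← h1, intervalIntegral.integral_of_le (by norm_num)]
  refine (setIntegral_eq_integral_of_forall_compl_eq_zero fun t ht => ?_).symm
  refine deriv_smoothStep_eq_zero ?_
  by_contra hcon
  have := abs_lt.mp (not_le.mp hcon)
  exact ht ⟨this.1, this.2.le⟩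

/-- The mollifier `δ⁻¹ K'(y / δ)`. -/
def thinMollifier (δ y : ℝ) : ℝ := δ⁻¹ * deriv smoothStep (y / δ)

lemma thinMollifier_nonneg {δ : ℝ} (hδ : 0 < δ) (y : ℝ) : 0 ≤ thinMollifier δ y :=
  mul_nonneg (by positivity) (deriv_smoothStep_nonneg _)

lemma continuous_thinMollifier (δ : ℝ) : Continuous (thinMollifier δ) :=
  continuous_const.mul (continuous_deriv_smoothStep.comp (continuous_id.div_const δ))

lemma thinMollifier_eq_zero {δ y : ℝ} (hδ : 0 < δ) (h : δ ≤ |y|) : thinMollifier δ y = 0 := by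
  rw [thinMollifier, deriv_smoothStep_eq_zero, mul_zero]
  rwa [abs_div, abs_of_pos hδ, one_le_div hδ]

lemma integral_thinMollifier {δ : ℝ} (hδ : 0 < δ) : ∫ y, thinMollifier δ y = 1 := by
  simp only [thinMollifier]
  rw [integral_const_mul, Measure.integral_comp_div, integral_deriv_smoothStep, abs_of_pos hδ,
    smul_eq_mul, mul_one, inv_mul_cancel₀ hδ.ne']

lemma integrable_thinMollifier {δ : ℝ} (hδ : 0 < δ) : Integrable (thinMollifier δ) :=
  Integrable.of_integral_ne_zero (by rw [integral_thinMollifier hδ]; norm_num)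

lemma hasDerivAt_smoothStep_div (δ y : ℝ) :
    HasDerivAt (fun y => smoothStep (y / δ)) (thinMollifier δ y) y := by
  have h1 : HasDerivAt (fun y : ℝ => y / δ) δ⁻¹ y := by
    simpa using (hasDerivAt_id y).div_const δ
  have h2 := HasDerivAt.comp (h₂ := smoothStep) (h := fun y : ℝ => y / δ) y
    (hasDerivAt_smoothStep (y / δ)) h1
  rw [thinMollifier, mul_comm]
  exact h2

/-- The primitive of `thinMollifier δ - thinMollifier (1 / 4)`. -/
def thinKernel (δ y : ℝ) : ℝ := smoothStep (y / δ) - smoothStep (y / (1 / 4))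

lemma hasDerivAt_thinKernel (δ y : ℝ) :
    HasDerivAt (thinKernel δ) (thinMollifier δ y - thinMollifier (1 / 4) y) y :=
  (hasDerivAt_smoothStep_div δ y).sub (hasDerivAt_smoothStep_div (1 / 4) y)

lemma contDiff_thinKernel (δ : ℝ) : ContDiff ℝ ∞ (thinKernel δ) :=
  (contDiff_smoothStep.comp (contDiff_id.div_const δ)).sub
    (contDiff_smoothStep.comp (contDiff_id.div_const (1 / 4)))

lemma abs_thinKernel_le (δ y : ℝ) : |thinKernel δ y| ≤ 1 := by
  have h1 := smoothStep_mem (y / δ)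
  have h2 := smoothStep_mem (y / (1 / 4))
  rw [thinKernel, abs_le]
  constructor <;> linarith [h1.1, h1.2, h2.1, h2.2]

/-- Both mollifiers have unit mass, so their primitives agree beyond `1/4`. Compact support in `y`
makes the kernel usable in a test function. -/
lemma thinKernel_eq_zero {δ y : ℝ} (hδ : 0 < δ) (hδ' : δ ≤ 1 / 4) (h : 1 / 4 ≤ |y|) :
    thinKernel δ y = 0 := by
  rw [thinKernel, sub_eq_zero]
  rcases le_abs.mp h with h | h
  · rw [smoothStep_of_ge, smoothStep_of_ge]
    · rw [le_div_iff₀ (by norm_num)]; linarith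
    · rw [le_div_iff₀ hδ]; linarith
  · rw [smoothStep_of_le, smoothStep_of_le]
    · rw [div_le_iff₀ (by norm_num)]; linarith
    · rw [div_le_iff₀ hδ]; linarith

/-! ### Box test functions in an orthonormal frame -/

/-- A bump function on the line. -/
def unitBump : ContDiffBump (0 : ℝ) := ⟨1, 2, one_pos, one_lt_two⟩

/-- The factors of a test function concentrated near a segment. -/
def boxProfile (n : ℕ) (ρ : ℝ) (w : ℝ → ℝ) (i : Fin (n + 1)) (t : ℝ) : ℝ :=
  if i = Fin.last n then w t else
    -- `unitBump` is supported in `[-2, 2]`: the first coordinate is confined to `[1/4, 1/2]`, away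
    -- from the origin, and the remaining thin ones to `[-ρ, ρ]`.
    if i = 0 then unitBump (16 * (t - 3 / 8)) else unitBump (2 / ρ * t)

/-- A product test function in an orthonormal frame. -/
def boxFn (b : OrthonormalBasis (Fin (n + 1)) ℝ (Amb n)) (ρ : ℝ) (w : ℝ → ℝ) (X : Amb n) : ℝ :=
  ∏ i, boxProfile n ρ w i (b.repr X i)

/-- The mass of the `x`-factors of `boxFn`. -/
def boxMass (n : ℕ) (ρ : ℝ) : ℝ :=
  ∏ i : Fin n, ∫ t, boxProfile n ρ (fun _ => 1) i.castSucc t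

lemma boxProfile_castSucc (ρ : ℝ) (w w' : ℝ → ℝ) (i : Fin n) (t : ℝ) :
    boxProfile n ρ w i.castSucc t = boxProfile n ρ w' i.castSucc t := by
  simp [boxProfile, Fin.castSucc_ne_last]

lemma boxProfile_castSucc_mem (ρ : ℝ) (w : ℝ → ℝ) (i : Fin n) (t : ℝ) :
    boxProfile n ρ w i.castSucc t ∈ Icc (0 : ℝ) 1 := by
  simp only [boxProfile, Fin.castSucc_ne_last, if_false]
  split_ifs <;> exact ⟨unitBump.nonneg, unitBump.le_one⟩

lemma contDiff_unitBump : ContDiff ℝ ∞ unitBump := unitBump.contDiff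

lemma contDiff_boxProfile_castSucc (ρ : ℝ) (w : ℝ → ℝ) (i : Fin n) :
    ContDiff ℝ ∞ (boxProfile n ρ w i.castSucc) := by
  unfold boxProfile
  simp only [Fin.castSucc_ne_last, if_false]
  split_ifs
  · exact contDiff_unitBump.comp (contDiff_const.mul (contDiff_id.sub contDiff_const))
  · exact contDiff_unitBump.comp (contDiff_const.mul contDiff_id)

lemma integral_boxProfile_zero (hn : 1 ≤ n) (ρ : ℝ) (i : Fin n) (hi : (i : ℕ) = 0) :
    ∫ t, boxProfile n ρ (fun _ => 1) i.castSucc t = 16⁻¹ * ∫ t, unitBump t := by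
  have h0 : i.castSucc = 0 := Fin.ext hi
  simp only [boxProfile, h0, if_true]
  have : (0 : Fin (n + 1)) ≠ Fin.last n := by
    intro h; have := congrArg Fin.val h; simp at this; omega
  simp only [this, if_false]
  rw [integral_sub_right_eq_self (fun t => unitBump (16 * t)), Measure.integral_comp_mul_left]
  norm_num

lemma integral_boxProfile_succ {ρ : ℝ} (hρ : 0 < ρ) (i : Fin n) (hi : (i : ℕ) ≠ 0) :
    ∫ t, boxProfile n ρ (fun _ => 1) i.castSucc t = ρ * (2⁻¹ * ∫ t, unitBump t) := by
  have h0 : i.castSucc ≠ 0 := fun h => hi (congrArg Fin.val h)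
  simp only [boxProfile, Fin.castSucc_ne_last, if_false, h0]
  rw [Measure.integral_comp_mul_left, abs_of_pos (by positivity), inv_div, smul_eq_mul]
  ring

/-- One thin coordinate runs along the ray at unit scale and the other `n - 1` have scale `ρ`. The
power `ρ^{n-1}` is the source of the exponent `β`. -/
lemma boxMass_eq (hn : 1 ≤ n) {ρ : ℝ} (hρ : 0 < ρ) :
    boxMass n ρ = 16⁻¹ * (∫ t, unitBump t) * (2⁻¹ * ∫ t, unitBump t) ^ (n - 1) * ρ ^ (n - 1) := by
  obtain ⟨k, rfl⟩ : ∃ k, n = k + 1 := ⟨n - 1, by omega⟩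
  rw [boxMass, Fin.prod_univ_succ, integral_boxProfile_zero hn ρ 0 rfl,
    Finset.prod_congr rfl fun i _ => integral_boxProfile_succ hρ (Fin.succ i) (by simp),
    Finset.prod_const]
  simp only [Finset.card_univ, Fintype.card_fin, mul_pow, Nat.add_sub_cancel]
  ring

lemma boxMass_pos (hn : 1 ≤ n) {ρ : ℝ} (hρ : 0 < ρ) : 0 < boxMass n ρ := by
  have : 0 < ∫ t, unitBump t := unitBump.integral_pos
  rw [boxMass_eq hn hρ]; positivity

section Frame

variable (b : OrthonormalBasis (Fin (n + 1)) ℝ (Amb n))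

lemma measurePreserving_repr_ofLp :
    MeasurePreserving (fun X : Amb n => (b.repr X).ofLp) volume volume :=
  (EuclideanSpace.volume_preserving_symm_measurableEquiv_toLp (Fin (n + 1))).comp
    b.measurePreserving_repr

lemma measurableEmbedding_repr_ofLp : MeasurableEmbedding (fun X : Amb n => (b.repr X).ofLp) :=
  (MeasurableEquiv.toLp 2 (Fin (n + 1) → ℝ)).symm.measurableEmbedding.comp
    b.repr.toHomeomorph.measurableEmbedding

variable {b}

lemma integral_boxFn (ρ : ℝ) (w : ℝ → ℝ) :
    ∫ X, boxFn b ρ w X = boxMass n ρ * ∫ t, w t := by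
  have h1 := (measurePreserving_repr_ofLp b).integral_comp (measurableEmbedding_repr_ofLp b)
    (fun x : Fin (n + 1) → ℝ => ∏ i, boxProfile n ρ w i (x i))
  have h2 : ∫ X, boxFn b ρ w X = _ := h1
  rw [h2, integral_fintype_prod_volume_eq_prod, Fin.prod_univ_castSucc, boxMass]
  congr 1
  · simp [boxProfile]
  · simp [boxProfile]

lemma integrable_boxFn {ρ : ℝ} (hρ : 0 < ρ) (hn : 1 ≤ n) {w : ℝ → ℝ} (hw : Integrable w) :
    Integrable (boxFn b ρ w) := by
  have h1 : Integrable fun x : Fin (n + 1) → ℝ => ∏ i, boxProfile n ρ w i (x i) := by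
    refine Integrable.fintype_prod fun i => ?_
    refine Fin.lastCases ?_ (fun j => ?_) i
    · refine hw.congr (.of_forall fun t => ?_)
      simp [boxProfile]
    · refine Integrable.of_integral_ne_zero ?_
      have hpos : 0 < ∫ t, unitBump t := unitBump.integral_pos
      simp only [boxProfile_castSucc ρ w (fun _ => 1)]
      by_cases hj : (j : ℕ) = 0
      · rw [integral_boxProfile_zero hn ρ j hj]; positivity
      · rw [integral_boxProfile_succ hρ j hj]; positivity
  exact ((measurePreserving_repr_ofLp b).integrable_comp_emb (measurableEmbedding_repr_ofLp b)).mpr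
    h1

lemma repr_last (hb : b (Fin.last n) = coordVec (Fin.last n)) (X : Amb n) :
    b.repr X (Fin.last n) = yCoord X := by
  rw [OrthonormalBasis.repr_apply_apply, hb, coordVec, EuclideanSpace.inner_single_left]
  simp [yCoord]

lemma boxFn_eq_mul (hb : b (Fin.last n) = coordVec (Fin.last n)) (ρ : ℝ) (w : ℝ → ℝ) (X : Amb n) :
    boxFn b ρ w X = boxFn b ρ (fun _ => 1) X * w (yCoord X) := by
  rw [boxFn, boxFn, Fin.prod_univ_castSucc, Fin.prod_univ_castSucc, repr_last hb]
  simp only [boxProfile_castSucc ρ w (fun _ => 1)]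
  simp [boxProfile]

lemma boxFn_one_eq (ρ : ℝ) (X : Amb n) : boxFn b ρ (fun _ => 1) X
    = ∏ i : Fin n, boxProfile n ρ (fun _ => 1) i.castSucc (b.repr X i.castSucc) := by
  rw [boxFn, Fin.prod_univ_castSucc]
  simp [boxProfile]

lemma boxFn_one_mem (ρ : ℝ) (X : Amb n) : boxFn b ρ (fun _ => 1) X ∈ Icc (0 : ℝ) 1 := by
  rw [boxFn_one_eq]
  exact ⟨Finset.prod_nonneg fun i _ => (boxProfile_castSucc_mem _ _ i _).1,
    Finset.prod_le_one (fun i _ => (boxProfile_castSucc_mem _ _ i _).1)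
      fun i _ => (boxProfile_castSucc_mem _ _ i _).2⟩

lemma contDiff_boxFn_one (ρ : ℝ) : ContDiff ℝ ∞ (boxFn b ρ (fun _ => 1)) := by
  have : boxFn b ρ (fun _ => 1) = fun X => ∏ i : Fin n,
      boxProfile n ρ (fun _ => 1) i.castSucc (b.repr X i.castSucc) :=
    funext fun X => boxFn_one_eq ρ X
  rw [this]
  refine contDiff_prod fun i _ => (contDiff_boxProfile_castSucc ρ _ i).comp ?_
  exact (contDiff_coord i.castSucc).comp b.repr.contDiff

/-- The region on which `boxFn` is concentrated. -/
lemma boxFn_one_ne_zero (hn : 1 ≤ n) {ρ : ℝ} (hρ : 0 < ρ) {X : Amb n}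
    (h : boxFn b ρ (fun _ => 1) X ≠ 0) :
    b.repr X 0 ∈ Icc (1 / 4 : ℝ) (1 / 2) ∧
      ∀ i : Fin n, (i : ℕ) ≠ 0 → |b.repr X i.castSucc| ≤ ρ := by
  rw [boxFn_one_eq, Finset.prod_ne_zero_iff] at h
  constructor
  · have h0 := h ⟨0, hn⟩ (Finset.mem_univ _)
    have e0 : (⟨0, hn⟩ : Fin n).castSucc = 0 := rfl
    have e1 : (0 : Fin (n + 1)) ≠ Fin.last n := by
      intro h; have := congrArg Fin.val h; simp at this; omega
    rw [e0] at h0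
    simp only [boxProfile, e1, if_false, if_true] at h0
    by_contra hcon
    refine h0 (unitBump.zero_of_le_dist ?_)
    change 2 ≤ dist _ (0 : ℝ)
    rw [dist_zero_right, Real.norm_eq_abs]
    by_contra h2
    have h3 := abs_lt.mp (not_le.mp h2)
    exact hcon ⟨by linarith [h3.1], by linarith [h3.2]⟩
  · intro i hi
    have h0 := h i (Finset.mem_univ _)
    have hi' : i.castSucc ≠ 0 := fun h => hi (congrArg Fin.val h)
    simp only [boxProfile, Fin.castSucc_ne_last, if_false, hi'] at h0
    by_contra hcon
    refine h0 (unitBump.zero_of_le_dist ?_)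
    change 2 ≤ dist _ (0 : ℝ)
    rw [dist_zero_right, Real.norm_eq_abs, abs_mul, abs_of_pos (by positivity), div_mul_eq_mul_div,
      le_div_iff₀ hρ]
    nlinarith [not_le.mp hcon]

/-- The last frame vector is the normal, so the other frame coordinates, and with them the box, do
not depend on `y`. -/
lemma fderiv_boxFn_one_last (hb : b (Fin.last n) = coordVec (Fin.last n)) (ρ : ℝ) (X : Amb n) :
    fderiv ℝ (boxFn b ρ (fun _ => 1)) X (coordVec (Fin.last n)) = 0 := by
  have h1 : HasDerivAt (fun t : ℝ => X + t • coordVec (Fin.last n)) (coordVec (Fin.last n)) 0 := by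
    simpa using ((hasDerivAt_id (0 : ℝ)).smul_const (coordVec (Fin.last n))).const_add X
  have h2 : HasFDerivAt (boxFn b ρ (fun _ => 1)) (fderiv ℝ (boxFn b ρ (fun _ => 1)) X)
      (X + (0 : ℝ) • coordVec (Fin.last n)) := by
    rw [zero_smul, add_zero]
    exact ((contDiff_boxFn_one ρ).differentiable (by simp) X).hasFDerivAt
  have h3 := h2.comp_hasDerivAt (0 : ℝ) h1
  have h4 : (boxFn b ρ (fun _ => 1) ∘ fun t : ℝ => X + t • coordVec (Fin.last n))
      = fun _ => boxFn b ρ (fun _ => 1) X := by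
    funext t
    simp only [Function.comp_apply, boxFn_one_eq]
    refine Finset.prod_congr rfl fun i _ => ?_
    congr 1
    rw [OrthonormalBasis.repr_apply_apply, OrthonormalBasis.repr_apply_apply, inner_add_right,
      real_inner_smul_right, ← hb, b.orthonormal.2 (Fin.castSucc_ne_last i), mul_zero, add_zero]
  rw [h4] at h3
  exact h3.unique (hasDerivAt_const _ _)

lemma norm_sq_le_of_boxFn_one_ne_zero (hn : 1 ≤ n) (hb : b (Fin.last n) = coordVec (Fin.last n))
    {ρ : ℝ} (hρ : 0 < ρ) {X : Amb n} (h : boxFn b ρ (fun _ => 1) X ≠ 0) :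
    ‖X‖ ^ 2 ≤ 1 / 4 + n * ρ ^ 2 + yCoord X ^ 2 := by
  obtain ⟨h0, h1⟩ := boxFn_one_ne_zero hn hρ h
  rw [← b.repr.norm_map, EuclideanSpace.norm_sq_eq, Fin.sum_univ_castSucc, repr_last hb]
  obtain ⟨k, rfl⟩ : ∃ k, n = k + 1 := ⟨n - 1, by omega⟩
  rw [Fin.sum_univ_succ]
  have h2 : ∑ i : Fin k, ‖b.repr X i.succ.castSucc‖ ^ 2 ≤ ∑ _i : Fin k, ρ ^ 2 := by
    refine Finset.sum_le_sum fun i _ => ?_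
    rw [Real.norm_eq_abs]
    exact pow_le_pow_left₀ (abs_nonneg _) (h1 i.succ (by simp)) 2
  rw [Finset.sum_const, Finset.card_univ, Fintype.card_fin, nsmul_eq_mul] at h2
  have h3 : ‖b.repr X (Fin.castSucc 0)‖ ^ 2 ≤ 1 / 4 := by
    have h4 : b.repr X (Fin.castSucc 0) = b.repr X 0 := rfl
    rw [h4, Real.norm_eq_abs, sq_abs]
    nlinarith [h0.1, h0.2]
  have h5 : ‖yCoord X‖ ^ 2 = yCoord X ^ 2 := by rw [Real.norm_eq_abs, sq_abs]
  rw [h5]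
  push_cast
  nlinarith [sq_nonneg ρ]

end Frame

/-! ### A quantitative trace inequality on a box -/

lemma sq_integral_mul_le {α : Type*} [MeasurableSpace α] {μ : Measure α} {f g : α → ℝ}
    (hf : MemLp f 2 μ) (hg : MemLp g 2 μ) :
    (∫ x, f x * g x ∂μ) ^ 2 ≤ (∫ x, ‖f x‖ ^ 2 ∂μ) * ∫ x, ‖g x‖ ^ 2 ∂μ := by
  have h := sq_integral_inner_le hg hf
  simp only [RCLike.inner_apply, conj_trivial] at h
  linarith

/-- The mass of the weight `|y|^{-a}` near the thin set. -/
def weightMass (a : ℝ) : ℝ := ∫ t, (Icc (-(1 / 4) : ℝ) (1 / 4)).indicator (fun y => |y| ^ (-a)) t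

/-- This is where `a < 1` enters: the dual weight `|y|^{-a}` must be integrable across the thin set.
-/
lemma integrable_indicator_abs_rpow {a : ℝ} (ha : a < 1) :
    Integrable ((Icc (-(1 / 4) : ℝ) (1 / 4)).indicator fun y => |y| ^ (-a)) :=
  (integrable_indicator_iff measurableSet_Icc).mpr (integrableOn_abs_rpow (by linarith) (1 / 4))

lemma weightMass_nonneg (a : ℝ) : 0 ≤ weightMass a :=
  integral_nonneg fun t => indicator_nonneg (fun y _ => by positivity) _

section Frame

variable {b : OrthonormalBasis (Fin (n + 1)) ℝ (Amb n)}

/-- Pairing of an `L²(B₁, a)` function with a function dominated by a box function. -/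
lemma abs_integral_mul_le_boxMass (hn : 1 ≤ n) (hb : b (Fin.last n) = coordVec (Fin.last n))
    {a : ℝ} (ha : a < 1) {ρ : ℝ} (hρ : 0 < ρ) {C : ℝ} (hC : 0 ≤ C) {F k : Amb n → ℝ}
    (hF : MemLp F 2 ((bulkMeasure n a).restrict (unitBall n))) (hk : Continuous k)
    (hkb : ∀ X, |k X| ≤ C * boxFn b ρ (fun _ => 1) X) (hky : ∀ X, 1 / 4 < |yCoord X| → k X = 0)
    (hks : ∀ X, X ∉ unitBall n → k X = 0) :
    |∫ X, F X * k X| ≤ C * √(∫ X in unitBall n, ‖F X‖ ^ 2 ∂(bulkMeasure n a))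
      * √(boxMass n ρ * weightMass a) := by
  -- Dividing by the weight turns the unweighted pairing into a weighted one; the weighted norm of
  -- `h` is then an integral of `|y|^{-a} k²`.
  set h : Amb n → ℝ := fun X => |yCoord X| ^ (-a) * k X with hh
  set w : ℝ → ℝ := (Icc (-(1 / 4) : ℝ) (1 / 4)).indicator fun y => |y| ^ (-a) with hw
  have hwi := integrable_indicator_abs_rpow ha
  have hbi : Integrable (boxFn b ρ w) := integrable_boxFn hρ hn hwi
  have hym : Measurable fun X : Amb n => |yCoord X| ^ (-a) := by
    have := continuous_yCoord (n := n).measurable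
    fun_prop
  have hhm : Measurable h := hym.mul hk.measurable
  have hle : ∀ X, |yCoord X| ^ (-a) * k X ^ 2 ≤ C ^ 2 * boxFn b ρ w X := fun X => by
    rw [boxFn_eq_mul hb]
    have hχ := boxFn_one_mem (b := b) ρ X
    by_cases hy : 1 / 4 < |yCoord X|
    · rw [hky X hy]
      have : 0 ≤ w (yCoord X) := indicator_nonneg (fun y _ => by positivity) _
      have := mul_nonneg hχ.1 this
      simp only [ne_eq, OfNat.ofNat_ne_zero, not_false_eq_true, zero_pow, mul_zero]
      positivity
    · have hwy : w (yCoord X) = |yCoord X| ^ (-a) :=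
        indicator_of_mem (s := Icc (-(1 / 4) : ℝ) (1 / 4))
          (mem_Icc.mpr (abs_le.mp (not_lt.mp hy))) fun y => |y| ^ (-a)
      rw [hwy]
      have h1 : k X ^ 2 ≤ C ^ 2 * boxFn b ρ (fun _ => 1) X := by
        rw [← sq_abs]
        calc |k X| ^ 2 ≤ (C * boxFn b ρ (fun _ => 1) X) ^ 2 :=
              pow_le_pow_left₀ (abs_nonneg _) (hkb X) 2
          _ ≤ C ^ 2 * boxFn b ρ (fun _ => 1) X := by
              rw [mul_pow]
              gcongr
              nlinarith [hχ.1, hχ.2]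
      calc |yCoord X| ^ (-a) * k X ^ 2
          ≤ |yCoord X| ^ (-a) * (C ^ 2 * boxFn b ρ (fun _ => 1) X) := by gcongr
        _ = _ := by ring
  have hsqe : ∀ᵐ X : Amb n, |yCoord X| ^ a * ‖h X‖ ^ 2 = |yCoord X| ^ (-a) * k X ^ 2 := by
    filter_upwards [ae_volume_yCoord_ne_zero] with X hX
    have hp : 0 < |yCoord X| := abs_pos.mpr hX
    rw [Real.norm_eq_abs, sq_abs, hh]
    simp only [mul_pow]
    rw [← mul_assoc, ← Real.rpow_natCast (|yCoord X| ^ (-a)), ← Real.rpow_mul hp.le,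
      ← Real.rpow_add hp]
    congr 2
    push_cast; ring
  have hint0 : Integrable (fun X => |yCoord X| ^ (-a) * k X ^ 2) := by
    refine (hbi.const_mul (C ^ 2)).mono' (hym.mul (hk.measurable.pow_const 2)).aestronglyMeasurable
      (.of_forall fun X => ?_)
    rw [Real.norm_of_nonneg (by positivity)]
    exact hle X
  have hint : Integrable (fun X => ‖h X‖ ^ 2) (bulkMeasure n a) := by
    rw [integrable_bulk_iff_mul]
    exact hint0.congr (hsqe.mono fun X hX => hX.symm)
  have hh2 : MemLp h 2 ((bulkMeasure n a).restrict (unitBall n)) :=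
    ((memLp_two_iff_integrable_sq_norm hhm.aestronglyMeasurable).mpr hint).restrict _
  have e1 : ∫ X, F X * k X = ∫ X in unitBall n, F X * h X ∂(bulkMeasure n a) := by
    rw [setIntegral_eq_integral_of_forall_compl_eq_zero fun X hX => by
      simp only [hh, hks X hX, mul_zero], integral_bulk_eq_mul]
    refine integral_congr_ae ?_
    filter_upwards [ae_volume_yCoord_ne_zero] with X hX
    have hp : 0 < |yCoord X| := abs_pos.mpr hX
    have : |yCoord X| ^ a * |yCoord X| ^ (-a) = 1 := by
      rw [← Real.rpow_add hp, add_neg_cancel, Real.rpow_zero]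
    simp only [hh]
    calc F X * k X = (|yCoord X| ^ a * |yCoord X| ^ (-a)) * (F X * k X) := by rw [this, one_mul]
      _ = _ := by ring
  have e2 : ∫ X in unitBall n, ‖h X‖ ^ 2 ∂(bulkMeasure n a)
      ≤ C ^ 2 * (boxMass n ρ * weightMass a) := by
    calc ∫ X in unitBall n, ‖h X‖ ^ 2 ∂(bulkMeasure n a)
        ≤ ∫ X, ‖h X‖ ^ 2 ∂(bulkMeasure n a) :=
          setIntegral_le_integral hint (.of_forall fun X => by positivity)
      _ = ∫ X, |yCoord X| ^ (-a) * k X ^ 2 := by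
          rw [integral_bulk_eq_mul]; exact integral_congr_ae hsqe
      _ ≤ ∫ X, C ^ 2 * boxFn b ρ w X := integral_mono hint0 (hbi.const_mul _) hle
      _ = _ := by rw [integral_const_mul, integral_boxFn]; rfl
  have h3 := sq_integral_mul_le hF hh2
  rw [e1]
  refine abs_le_of_sq_le_sq ?_ (by positivity)
  calc _ ≤ _ := h3
    _ ≤ (∫ X in unitBall n, ‖F X‖ ^ 2 ∂(bulkMeasure n a)) *
        (C ^ 2 * (boxMass n ρ * weightMass a)) := by
        gcongr
    _ = _ := by
        rw [mul_pow, mul_pow, Real.sq_sqrt (integral_nonneg fun X => by positivity),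
          Real.sq_sqrt (mul_nonneg (boxMass_pos hn hρ).le (weightMass_nonneg a))]
        ring

lemma thinLayer_volume_le (δ : ℝ) : volume (thinLayer n δ)
    ≤ ENNReal.ofReal (2 * δ) * volume (thinBall n) := by
  have := lintegral_thinLayer_le (n := n) (δ := δ) (fun _ => 1) aestronglyMeasurable_const
  simpa using this

/-- The mean of `|v - f|` over a thin layer tends to zero. -/
lemma IsThinTrace.tendsto_mean {v : Amb n → ℝ} {f : EuclideanSpace ℝ (Fin n) → ℝ}
    (hv : AEStronglyMeasurable v (volume.restrict (unitBall n))) (h : IsThinTrace v f) :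
    (∀ᶠ δ in 𝓝[>] (0 : ℝ), IntegrableOn (fun X => v X - f (xPart X)) (thinLayer n δ)) ∧
    Tendsto (fun δ : ℝ => δ⁻¹ * ∫ X in thinLayer n δ, |v X - f (xPart X)|) (𝓝[>] 0) (𝓝 0) := by
  have hfm : AEStronglyMeasurable (fun X => f (xPart X)) (volume.restrict (unitBall n)) := by
    obtain ⟨f', hf', hff⟩ := h.1.1
    exact ⟨fun X => f' (xPart X), hf'.comp_measurable measurable_xPart, ae_xPart hff⟩
  have hm : ∀ δ, AEStronglyMeasurable (fun X => v X - f (xPart X))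
      (volume.restrict (thinLayer n δ)) := fun δ =>
    (hv.sub hfm).mono_measure (Measure.restrict_mono inter_subset_left le_rfl)
  have hfin : ∀ δ, IsFiniteMeasure ((volume : Measure (Amb n)).restrict (thinLayer n δ)) :=
    fun δ => ⟨by
      rw [Measure.restrict_apply_univ]
      exact (measure_mono inter_subset_left).trans_lt measure_ball_lt_top⟩
  set I : ℝ → ℝ≥0∞ := fun δ => ∫⁻ X in thinLayer n δ, ‖v X - f (xPart X)‖ₑ ^ 2 with hI
  have hlim : Tendsto (fun δ => I δ / ENNReal.ofReal δ) (𝓝[>] 0) (𝓝 0) := h.2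
  have hpos : ∀ᶠ δ in 𝓝[>] (0 : ℝ), 0 < δ := self_mem_nhdsWithin
  have hev : ∀ᶠ δ in 𝓝[>] (0 : ℝ), 0 < δ ∧ I δ / ENNReal.ofReal δ < 1 :=
    hpos.and (hlim.eventually_lt_const zero_lt_one)
  have hmem : ∀ δ, 0 < δ → I δ / ENNReal.ofReal δ < 1 →
      MemLp (fun X => v X - f (xPart X)) 2 (volume.restrict (thinLayer n δ)) := by
    intro δ hδ hlt
    refine ⟨hm δ, ?_⟩
    rw [eLpNorm_lt_top_iff_lintegral_rpow_enorm_lt_top (by simp) (by simp)]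
    have h1 : I δ < ⊤ := by
      by_contra hcon
      rw [not_lt, top_le_iff] at hcon
      rw [hcon, ENNReal.top_div_of_ne_top ENNReal.ofReal_ne_top] at hlt
      simp at hlt
    simpa [hI] using h1
  refine ⟨hev.mono fun δ hδ => (hmem δ hδ.1 hδ.2).integrable (by norm_num), ?_⟩
  set V := (volume (thinBall n)).toReal with hV
  have hVfin : volume (thinBall n) ≠ ⊤ := measure_ball_lt_top.ne
  have hlim2 : Tendsto (fun δ => √((I δ / ENNReal.ofReal δ).toReal * (2 * V))) (𝓝[>] 0) (𝓝 0) := by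
    have h1 := ((ENNReal.tendsto_toReal ENNReal.zero_ne_top).comp hlim).mul_const (2 * V)
    have h2 := (Real.continuous_sqrt.tendsto _).comp h1
    simpa [Function.comp_def] using h2
  refine squeeze_zero' (hev.mono fun δ hδ => mul_nonneg (by have := hδ.1; positivity)
    (integral_nonneg fun X => abs_nonneg _)) (hev.mono fun δ hδ => ?_) hlim2
  obtain ⟨hδ0, hδ1⟩ := hδ
  have hM := hmem δ hδ0 hδ1
  have := hfin δ
  -- Cauchy-Schwarz on a layer of volume at most `2 δ V`: the squared mean is at most `2 V` times `I
  -- δ / δ`.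
  have h3 := sq_integral_mul_le hM.norm (memLp_const (μ := volume.restrict (thinLayer n δ)) (1 : ℝ))
  have h4 : ∫ X in thinLayer n δ, ‖‖v X - f (xPart X)‖‖ ^ 2 = (I δ).toReal := by
    rw [hI, integral_eq_lintegral_of_nonneg_ae
      (f := fun X => ‖‖v X - f (xPart X)‖‖ ^ 2) (.of_forall fun X => by positivity)
      (hM.1.norm.norm.pow 2)]
    congr 1
    refine lintegral_congr fun X => ?_
    rw [norm_norm, ENNReal.ofReal_pow (norm_nonneg _), ofReal_norm]
  have h5 : ∫ X in thinLayer n δ, ‖(1 : ℝ)‖ ^ 2 ≤ 2 * δ * V := by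
    simp only [norm_one, one_pow, integral_const, measureReal_restrict_apply_univ, smul_eq_mul,
      mul_one]
    rw [Measure.real, hV, ← ENNReal.toReal_ofReal (by positivity : 0 ≤ 2 * δ), ← ENNReal.toReal_mul]
    exact ENNReal.toReal_mono (ENNReal.mul_ne_top ENNReal.ofReal_ne_top hVfin)
      (thinLayer_volume_le δ)
  refine Real.le_sqrt_of_sq_le ?_
  simp only [mul_one, Real.norm_eq_abs] at h3
  rw [mul_pow]
  simp only [Real.norm_eq_abs] at h4 h5
  rw [h4] at h3
  have h6 : (I δ / ENNReal.ofReal δ).toReal = (I δ).toReal / δ := by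
    rw [ENNReal.toReal_div, ENNReal.toReal_ofReal hδ0.le]
  rw [h6]
  calc (δ⁻¹) ^ 2 * (∫ X in thinLayer n δ, |v X - f (xPart X)|) ^ 2
      ≤ (δ⁻¹) ^ 2 * ((I δ).toReal * (2 * δ * V)) := by
        gcongr
        exact h3.trans (by gcongr)
    _ = (I δ).toReal / δ * (2 * V) := by field_simp

end Frame

section Frame

variable {b : OrthonormalBasis (Fin (n + 1)) ℝ (Amb n)}

/-- Functions dominated by a box function near the thin set are supported inside the ball. -/
lemma support_subset_of_box (hn : 1 ≤ n) (hb : b (Fin.last n) = coordVec (Fin.last n))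
    {ρ : ℝ} (hρ : 0 < ρ) (hρn : n * ρ ^ 2 ≤ 1 / 2) {k : Amb n → ℝ}
    (hk : ∀ X, boxFn b ρ (fun _ => 1) X = 0 → k X = 0)
    (hky : ∀ X, 1 / 4 < |yCoord X| → k X = 0) :
    HasCompactSupport k ∧ tsupport k ⊆ unitBall n := by
  -- On the support `|X|² ≤ 1/4 + 1/2 + 1/16`, which is below `(19/20)²`.
  have h1 : Function.support k ⊆ Metric.closedBall 0 (19 / 20) := fun X hX => by
    have h2 := norm_sq_le_of_boxFn_one_ne_zero hn hb hρ (fun h => hX (hk X h))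
    have h3 : |yCoord X| ≤ 1 / 4 := not_lt.mp fun h => hX (hky X h)
    have h4 : yCoord X ^ 2 ≤ (1 / 4) ^ 2 :=
      sq_le_sq.mpr (by rwa [abs_of_pos (by norm_num : (0 : ℝ) < 1 / 4)])
    rw [mem_closedBall_zero_iff]
    exact abs_le_of_sq_le_sq' (by nlinarith) (by norm_num) |>.2
  exact ⟨.of_support_subset_isCompact (isCompact_closedBall _ _) h1,
    (closure_minimal h1 Metric.isClosed_closedBall).trans
      (Metric.closedBall_subset_ball (by norm_num))⟩

lemma fderiv_boxFn_one_mul_last (hb : b (Fin.last n) = coordVec (Fin.last n)) (ρ : ℝ)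
    {k : ℝ → ℝ} {k' : ℝ} {X : Amb n} (hk : HasDerivAt k k' (yCoord X)) :
    fderiv ℝ (fun X => boxFn b ρ (fun _ => 1) X * k (yCoord X)) X (coordVec (Fin.last n))
      = boxFn b ρ (fun _ => 1) X * k' := by
  have h1 : HasFDerivAt (boxFn b ρ (fun _ => 1)) (fderiv ℝ (boxFn b ρ (fun _ => 1)) X) X :=
    ((contDiff_boxFn_one ρ).differentiable (by simp) X).hasFDerivAt
  have h2 : HasFDerivAt (fun X : Amb n => k (yCoord X)) _ X :=
    hk.comp_hasFDerivAt X (hasFDerivAt_coord (Fin.last n) X)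
  have h3 : HasFDerivAt (fun X => boxFn b ρ (fun _ => 1) X * k (yCoord X)) _ X := h1.mul h2
  rw [h3.fderiv]
  simp [fderiv_boxFn_one_last hb]

/-- A function in `H¹(B₁, a)` that exceeds by `m` near the thin box a function with nonnegative
thin trace has energy controlling `m`. -/
lemma sq_mul_boxMass_le (hn : 1 ≤ n) (hb : b (Fin.last n) = coordVec (Fin.last n)) {a : ℝ}
    (ha : a < 1) {ρ : ℝ} (hρ : 0 < ρ) (hρn : n * ρ ^ 2 ≤ 1 / 2) {K : ℝ} (hK : 0 < K)
    (hsK : ∀ t, deriv smoothStep t ≤ K) {Φ z : Amb n → ℝ} {G : Amb n → Amb n}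
    {f : EuclideanSpace ℝ (Fin n) → ℝ} (hw : HasWeakGradientOn (unitBall n) Φ G)
    (hΦ : MemLp Φ 2 ((bulkMeasure n a).restrict (unitBall n)))
    (hG : MemLp G 2 ((bulkMeasure n a).restrict (unitBall n)))
    (hz : AEStronglyMeasurable z (volume.restrict (unitBall n))) (hf : IsThinTrace z f)
    (hf0 : ∀ᵐ x ∂(volume.restrict (thinBall n)), 0 ≤ f x) {m δ₀ : ℝ} (hm : 0 ≤ m) (hδ₀ : 0 < δ₀)
    (hlow : ∀ X ∈ unitBall n, |yCoord X| ≤ δ₀ → boxFn b ρ (fun _ => 1) X ≠ 0 → z X + m ≤ Φ X) :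
    m ^ 2 * boxMass n ρ ≤ weightMass a *
      (4 * K * √(∫ X in unitBall n, ‖Φ X‖ ^ 2 ∂(bulkMeasure n a))
        + √(∫ X in unitBall n, ‖G X‖ ^ 2 ∂(bulkMeasure n a))) ^ 2 := by
  set χ := boxFn b ρ (fun _ => 1) with hχ
  set A := √(∫ X in unitBall n, ‖Φ X‖ ^ 2 ∂(bulkMeasure n a))
  set B := √(∫ X in unitBall n, ‖G X‖ ^ 2 ∂(bulkMeasure n a))
  set S := √(boxMass n ρ * weightMass a)
  have hbm := boxMass_pos hn hρ
  have hχm : ∀ X, χ X ∈ Icc (0 : ℝ) 1 := boxFn_one_mem ρ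
  have hχc : Continuous χ := (contDiff_boxFn_one ρ).continuous
  have hyc := continuous_yCoord (n := n)
  have hmol : ∀ δ, 0 < δ → ∀ y, thinMollifier δ y ≤ δ⁻¹ * K := fun δ hδ y =>
    mul_le_mul_of_nonneg_left (hsK _) (by positivity)
  have hcm : ∀ δ, Continuous fun X => χ X * thinMollifier δ (yCoord X) := fun δ =>
    hχc.mul ((continuous_thinMollifier δ).comp hyc)
  have hbox : ∀ δ, boxFn b ρ (thinMollifier δ)
      = fun X => χ X * thinMollifier δ (yCoord X) := fun δ =>
    funext fun X => boxFn_eq_mul hb ρ (thinMollifier δ) X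
  have hmy : ∀ δ, 0 < δ → δ ≤ 1 / 4 → ∀ X, 1 / 4 < |yCoord X| →
      χ X * thinMollifier δ (yCoord X) = 0 := fun δ hδ h4 X hX => by
    rw [thinMollifier_eq_zero hδ (h4.trans hX.le), mul_zero]
  have hms : ∀ δ, 0 < δ → δ ≤ 1 / 4 →
      HasCompactSupport (fun X => χ X * thinMollifier δ (yCoord X)) ∧
      tsupport (fun X => χ X * thinMollifier δ (yCoord X)) ⊆ unitBall n := fun δ hδ h4 =>
    support_subset_of_box hn hb hρ hρn (fun X hX => by rw [← hχ] at hX; rw [hX, zero_mul])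
      (hmy δ hδ h4)
  -- The test function `χ` times `thinKernel` has normal derivative equal to the difference of the
  -- mollified boxes at widths `δ` and `1/4`. The mean of `Φ` near the thin set is thus its mean at
  -- width `1/4` minus an integral of the normal component of `G`, both bounded independently of
  -- `δ`.
  have hup : ∀ δ, 0 < δ → δ ≤ 1 / 4 →
      ∫ X, Φ X * (χ X * thinMollifier δ (yCoord X)) ≤ (4 * K * A + B) * S := by
    intro δ hδ h4
    set ψ : Amb n → ℝ := fun X => χ X * thinKernel δ (yCoord X) with hψ
    have hψy : ∀ X, 1 / 4 < |yCoord X| → ψ X = 0 := fun X hX => by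
      simp only [hψ]; rw [thinKernel_eq_zero hδ h4 hX.le, mul_zero]
    obtain ⟨hψc, hψs⟩ := support_subset_of_box hn hb hρ hρn (k := ψ)
      (fun X hX => by simp only [hψ]; rw [← hχ] at hX; rw [hX, zero_mul]) hψy
    have hψd : ContDiff ℝ ∞ ψ := (contDiff_boxFn_one ρ).mul
      ((contDiff_thinKernel δ).comp (contDiff_coord (Fin.last n)))
    have hi := hw.integral_eq hψd hψc hψs (coordVec (Fin.last n))
    have hfd : ∀ X, fderiv ℝ ψ X (coordVec (Fin.last n))
        = χ X * (thinMollifier δ (yCoord X) - thinMollifier (1 / 4) (yCoord X)) := fun X =>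
      fderiv_boxFn_one_mul_last hb ρ (hasDerivAt_thinKernel δ _)
    have e1 := integrable_mul_of_tsupport_subset hw.1 (hcm δ) (hms δ hδ h4).1 (hms δ hδ h4).2
    have e2 := integrable_mul_of_tsupport_subset hw.1 (hcm (1 / 4))
      (hms (1 / 4) (by norm_num) le_rfl).1 (hms (1 / 4) (by norm_num) le_rfl).2
    have e3 : ∫ X, Φ X * fderiv ℝ ψ X (coordVec (Fin.last n))
        = (∫ X, Φ X * (χ X * thinMollifier δ (yCoord X)))
          - ∫ X, Φ X * (χ X * thinMollifier (1 / 4) (yCoord X)) := by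
      rw [← integral_sub e1 e2]
      exact integral_congr_ae (.of_forall fun X => by simp only [hfd]; ring)
    have e4 := abs_integral_mul_le_boxMass hn hb ha hρ (C := 4 * K) (by positivity) hΦ
      (hcm (1 / 4)) (fun X => by
        rw [abs_of_nonneg (mul_nonneg (hχm X).1 (thinMollifier_nonneg (by norm_num) _)), mul_comm]
        refine mul_le_mul_of_nonneg_right ?_ (hχm X).1
        simpa using hmol (1 / 4) (by norm_num) (yCoord X)) (hmy _ (by norm_num) le_rfl)
      (fun X hX => image_eq_zero_of_notMem_tsupport
        (f := fun X => χ X * thinMollifier (1 / 4) (yCoord X)) fun h =>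
        hX ((hms (1 / 4) (by norm_num) le_rfl).2 h))
    have hGi : MemLp (fun X => inner ℝ (G X) (coordVec (Fin.last n))) 2
        ((bulkMeasure n a).restrict (unitBall n)) := hG.inner_const _
    have hGle : ∀ X, ‖inner ℝ (G X) (coordVec (Fin.last n))‖ ^ 2 ≤ ‖G X‖ ^ 2 := fun X => by
      refine pow_le_pow_left₀ (norm_nonneg _) ((norm_inner_le_norm _ _).trans ?_) 2
      simp
    have e5 := abs_integral_mul_le_boxMass hn hb ha hρ (C := 1) zero_le_one hGi
      hψd.continuous (fun X => by
        simp only [hψ]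
        rw [abs_mul, abs_of_nonneg (hχm X).1, one_mul]
        exact mul_le_of_le_one_right (hχm X).1 (abs_thinKernel_le _ _)) hψy
      (fun X hX => image_eq_zero_of_notMem_tsupport fun h => hX (hψs h))
    have e6 : √(∫ X in unitBall n, ‖inner ℝ (G X) (coordVec (Fin.last n))‖ ^ 2
        ∂(bulkMeasure n a)) ≤ B := by
      refine Real.sqrt_le_sqrt (integral_mono ?_ ?_ hGle)
      · exact (memLp_two_iff_integrable_sq_norm hGi.1).mp hGi
      · exact (memLp_two_iff_integrable_sq_norm hG.1).mp hG
    have e7 : (1 : ℝ) * √(∫ X in unitBall n, ‖inner ℝ (G X) (coordVec (Fin.last n))‖ ^ 2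
        ∂(bulkMeasure n a)) * S ≤ B * S := by
      rw [one_mul]; exact mul_le_mul_of_nonneg_right e6 (Real.sqrt_nonneg _)
    have e8 := abs_le.mp e4
    have e9 := abs_le.mp e5
    rw [e3] at hi
    have : (4 * K * A + B) * S = 4 * K * A * S + B * S := by ring
    linarith [e8.2, e9.1]
  obtain ⟨hint, hlim⟩ := hf.tendsto_mean hz
  have hpos : ∀ᶠ δ in 𝓝[>] (0 : ℝ), 0 < δ := self_mem_nhdsWithin
  have hsmall : ∀ᶠ δ in 𝓝[>] (0 : ℝ), δ < min (1 / 4) δ₀ :=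
    nhdsWithin_le_nhds (gt_mem_nhds (lt_min (by norm_num) hδ₀))
  have hae : ∀ᵐ X : Amb n, X ∈ unitBall n → 0 ≤ f (xPart X) :=
    (ae_restrict_iff' Metric.isOpen_ball.measurableSet).mp (ae_xPart hf0)
  -- In the layer `Φ ≥ z + m ≥ m - |z - f|`, because `f ≥ 0`; the last term has vanishing mean.
  have hkey : ∀ᶠ δ in 𝓝[>] (0 : ℝ),
      m * boxMass n ρ - K * (δ⁻¹ * ∫ X in thinLayer n δ, |z X - f (xPart X)|)
        ≤ (4 * K * A + B) * S := by
    filter_upwards [hpos, hsmall, hint] with δ hδ hδs hδi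
    have h4 : δ ≤ 1 / 4 := hδs.le.trans (min_le_left _ _)
    have h5 : δ ≤ δ₀ := hδs.le.trans (min_le_right _ _)
    refine le_trans ?_ (hup δ hδ h4)
    have i1 : Integrable fun X => m * (χ X * thinMollifier δ (yCoord X)) := by
      have := integrable_boxFn (b := b) hρ hn (integrable_thinMollifier hδ)
      rw [hbox δ] at this
      exact this.const_mul m
    have i1' : ∫ X, m * (χ X * thinMollifier δ (yCoord X)) = m * boxMass n ρ := by
      rw [integral_const_mul]
      have := integral_boxFn (b := b) ρ (thinMollifier δ)
      rw [hbox δ] at this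
      rw [this, integral_thinMollifier hδ, mul_one]
    have i2 : Integrable ((thinLayer n δ).indicator fun X => K * δ⁻¹ * |z X - f (xPart X)|) :=
      (integrable_indicator_iff (measurableSet_thinLayer δ)).mpr (hδi.abs.const_mul _)
    have i2' : ∫ X, (thinLayer n δ).indicator (fun X => K * δ⁻¹ * |z X - f (xPart X)|) X
        = K * (δ⁻¹ * ∫ X in thinLayer n δ, |z X - f (xPart X)|) := by
      rw [integral_indicator (measurableSet_thinLayer δ), integral_const_mul, mul_assoc]
    rw [← i1', ← i2', ← integral_sub i1 i2]
    refine integral_mono_ae (i1.sub i2)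
      (integrable_mul_of_tsupport_subset hw.1 (hcm δ) (hms δ hδ h4).1 (hms δ hδ h4).2) ?_
    filter_upwards [hae] with X hX
    have hρ0 := mul_nonneg (hχm X).1 (thinMollifier_nonneg hδ (yCoord X))
    by_cases hne : χ X * thinMollifier δ (yCoord X) = 0
    · simp only [hne, mul_zero, zero_sub]
      exact neg_nonpos.mpr (indicator_nonneg (fun X _ => by positivity) X)
    · have hXb : X ∈ unitBall n := (hms δ hδ h4).2 (subset_tsupport _ hne)
      have hy : |yCoord X| < δ := not_le.mp fun h =>
        hne (by rw [thinMollifier_eq_zero hδ h, mul_zero])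
      have hl := hlow X hXb (hy.le.trans h5) fun h => hne (by rw [h, zero_mul])
      rw [indicator_of_mem (show X ∈ thinLayer n δ from ⟨hXb, hy⟩)]
      have h6 : χ X * thinMollifier δ (yCoord X) ≤ K * δ⁻¹ := by
        have := mul_le_mul (hχm X).2 (hmol δ hδ (yCoord X)) (thinMollifier_nonneg hδ _) zero_le_one
        linarith
      have h7 : m - |z X - f (xPart X)| ≤ Φ X := by
        have := neg_abs_le (z X - f (xPart X))
        linarith [hX hXb]
      have h8 := mul_le_mul_of_nonneg_right h7 hρ0
      have h9 := mul_le_mul_of_nonneg_right h6 (abs_nonneg (z X - f (xPart X)))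
      linarith
  have hfin : m * boxMass n ρ ≤ (4 * K * A + B) * S := by
    have h1 := (hlim.const_mul K).const_sub (m * boxMass n ρ)
    rw [mul_zero, sub_zero] at h1
    exact le_of_tendsto h1 hkey
  -- `S²` is `boxMass` times `weightMass`, so after squaring one factor `boxMass` cancels.
  have h2 := pow_le_pow_left₀ (by positivity) hfin 2
  rw [mul_pow, mul_pow, Real.sq_sqrt (mul_nonneg hbm.le (weightMass_nonneg a))] at h2
  have h3 : boxMass n ρ * (m ^ 2 * boxMass n ρ)
      ≤ boxMass n ρ * (weightMass a * (4 * K * A + B) ^ 2) := by linarith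
  exact le_of_mul_le_mul_left h3 hbm

end Frame

/-! ### The high modes control the negative part of the low modes -/

/-- An orthonormal frame containing a prescribed thin direction and the normal direction. -/
lemma exists_thin_frame (hn : 1 ≤ n) {u : Amb n} (hu : ‖u‖ = 1) (hy : yCoord u = 0) :
    ∃ b : OrthonormalBasis (Fin (n + 1)) ℝ (Amb n),
      b 0 = u ∧ b (Fin.last n) = coordVec (Fin.last n) := by
  have h0 : (0 : Fin (n + 1)) ≠ Fin.last n := by
    intro h
    have := congrArg Fin.val h
    simp at this
    omega
  set v : Fin (n + 1) → Amb n := fun i => if i = 0 then u else coordVec (Fin.last n) with hv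
  have hin : inner ℝ u (coordVec (Fin.last n)) = 0 := by
    simpa [EuclideanSpace.inner_single_right, yCoord] using hy
  have ho : Orthonormal ℝ (({0, Fin.last n} : Set (Fin (n + 1))).domRestrict v) := by
    refine ⟨?_, ?_⟩
    · rintro ⟨i, hi⟩
      rcases hi with rfl | hi
      · simpa [hv] using hu
      · rw [mem_singleton_iff] at hi
        subst hi
        simp [hv, h0.symm]
    · rintro ⟨i, hi⟩ ⟨j, hj⟩ hij
      have hij' : i ≠ j := fun h => hij (Subtype.ext h)
      rcases hi with rfl | hi <;> rcases hj with rfl | hj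
      · exact absurd rfl hij'
      · rw [mem_singleton_iff] at hj
        subst hj
        simpa [hv, h0.symm] using hin
      · rw [mem_singleton_iff] at hi
        subst hi
        rw [real_inner_comm]
        simpa [hv, h0.symm] using hin
      · rw [mem_singleton_iff] at hi hj
        exact absurd (hi.trans hj.symm) hij'
  obtain ⟨b, hb⟩ := ho.exists_orthonormalBasis_extension_of_card_eq (by simp)
  refine ⟨b, ?_, ?_⟩
  · rw [hb 0 (by simp)]; simp [hv]
  · rw [hb (Fin.last n) (by simp)]; simp [hv, h0.symm]

lemma norm_sub_repr_smul_le (b : OrthonormalBasis (Fin (n + 1)) ℝ (Amb n)) {X : Amb n} {η : ℝ}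
    (h : ∀ i, i ≠ 0 → |b.repr X i| ≤ η) : ‖X - b.repr X 0 • b 0‖ ^ 2 ≤ n * η ^ 2 := by
  rw [← b.repr.norm_map, EuclideanSpace.norm_sq_eq, Fin.sum_univ_succ]
  have h1 : ∀ i, b.repr (X - b.repr X 0 • b 0) i
      = b.repr X i - b.repr X 0 * (if i = 0 then 1 else 0) := by
    intro i
    simp [map_sub, map_smul, b.repr_self]
  simp only [h1, if_true, mul_one, sub_self, norm_zero, ne_eq, OfNat.ofNat_ne_zero,
    not_false_eq_true, zero_pow, zero_add, Fin.succ_ne_zero, if_false, mul_zero, sub_zero]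
  calc ∑ i : Fin n, ‖b.repr X i.succ‖ ^ 2 ≤ ∑ _i : Fin n, η ^ 2 :=
        Finset.sum_le_sum fun i _ => pow_le_pow_left₀ (norm_nonneg _) (h _ (Fin.succ_ne_zero i)) 2
    _ = n * η ^ 2 := by simp

/-- Write `X - |X| u = (X - t u) + (t - |X|) u`; both terms are bounded by the distance from `X` to
`t u`. -/
lemma norm_inv_smul_sub_le {X u : Amb n} (hX : X ≠ 0) (hu : ‖u‖ = 1) {t : ℝ} (ht : 0 ≤ t) :
    ‖‖X‖⁻¹ • X - u‖ ≤ 2 * ‖X - t • u‖ / ‖X‖ := by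
  have hp : 0 < ‖X‖ := norm_pos_iff.mpr hX
  rw [le_div_iff₀ hp]
  have e : ‖‖X‖⁻¹ • X - u‖ * ‖X‖ = ‖(X - t • u) + (t - ‖X‖) • u‖ := by
    rw [mul_comm, ← abs_of_pos hp, ← Real.norm_eq_abs, ← norm_smul, Real.norm_eq_abs, abs_of_pos hp,
      smul_sub, smul_smul, mul_inv_cancel₀ hp.ne', one_smul]
    congr 1
    rw [sub_smul]; abel
  have h2 : ‖(t - ‖X‖) • u‖ ≤ ‖X - t • u‖ := by
    rw [norm_smul, hu, mul_one, Real.norm_eq_abs, abs_sub_comm]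
    have := abs_norm_sub_norm_le X (t • u)
    rwa [norm_smul, hu, mul_one, Real.norm_of_nonneg ht] at this
  rw [e]
  linarith [norm_add_le (X - t • u) ((t - ‖X‖) • u)]

lemma integral_norm_sq_homExt_le (hn : 1 ≤ n) {a : ℝ} (ha : -1 < a) {F : Type*}
    [NormedAddCommGroup F] [NormedSpace ℝ F] {α : ℝ} (hα : 0 ≤ α) (c : USphere n → F) :
    ∫ X in unitBall n, ‖homExt α c X‖ ^ 2 ∂(bulkMeasure n a)
      ≤ (∫ θ, ‖c θ‖ ^ 2 ∂(sphereMeasure n a)) / (n + a) := by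
  have hn' : (1 : ℝ) ≤ n := by exact_mod_cast hn
  rw [show unitBall n = Metric.ball 0 1 from rfl,
    integral_ball_separated (s := 2 * α) (c := fun θ => ‖c θ‖ ^ 2) (by linarith) one_pos
      (norm_sq_homExt_polarMap α c),
    Real.one_rpow, smul_eq_mul, one_div_mul_eq_div]
  have : 0 ≤ ∫ θ, ‖c θ‖ ^ 2 ∂(sphereMeasure n a) := integral_nonneg fun _ => by positivity
  exact div_le_div_of_nonneg_left this (by linarith) (by linarith)

/-- Points of the box are within `n ρ` of the axis and at least `1/4` from the origin, so their
directions are close to the axis. -/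
lemma norm_inv_smul_sub_le_of_box (hn : 1 ≤ n) {b : OrthonormalBasis (Fin (n + 1)) ℝ (Amb n)}
    (hb : b (Fin.last n) = coordVec (Fin.last n)) {ρ : ℝ} (hρ : 0 < ρ) {X : Amb n}
    (hy : |yCoord X| ≤ ρ) (hχ : boxFn b ρ (fun _ => 1) X ≠ 0) :
    1 / 4 ≤ ‖X‖ ∧ ‖‖X‖⁻¹ • X - b 0‖ ≤ 8 * (n * ρ) := by
  have hn' : (1 : ℝ) ≤ n := by exact_mod_cast hn
  obtain ⟨hr0, hri⟩ := boxFn_one_ne_zero hn hρ hχ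
  have hoth : ∀ i, i ≠ 0 → |b.repr X i| ≤ ρ := by
    intro i hi
    induction i using Fin.lastCases with
    | last => rw [repr_last hb]; exact hy
    | cast i => exact hri i fun h => hi (by ext; simpa using h)
  have h1 := norm_sub_repr_smul_le b hoth
  set t := b.repr X 0
  have h2 : ‖X - t • b 0‖ ≤ n * ρ := by
    refine abs_le_of_sq_le_sq' (h1.trans ?_) (by positivity) |>.2
    rw [mul_pow]
    gcongr
    nlinarith
  have h3 : 1 / 4 ≤ ‖X‖ := by
    calc (1 / 4 : ℝ) ≤ t := hr0.1
      _ ≤ ‖t‖ := le_abs_self _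
      _ ≤ ‖b.repr X‖ := PiLp.norm_apply_le (b.repr X) 0
      _ = ‖X‖ := b.repr.norm_map X
  have hXp : 0 < ‖X‖ := by linarith
  refine ⟨h3, (norm_inv_smul_sub_le (norm_pos_iff.mp hXp) (b.orthonormal.1 0) (t := t)
    (by linarith [hr0.1])).trans ?_⟩
  rw [div_le_iff₀ hXp]
  have : 8 * (n * ρ) * (1 / 4) ≤ 8 * (n * ρ) * ‖X‖ := by gcongr
  linarith

lemma integral_norm_add_smul_le {a μ E : ℝ} {φ : USphere n → ℝ} {T : USphere n → Amb n}
    (hφ2 : MemLp φ 2 (sphereMeasure n a)) (hT2 : MemLp T 2 (sphereMeasure n a))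
    (hφE : ∫ θ, ‖φ θ‖ ^ 2 ∂(sphereMeasure n a) ≤ E)
    (hTE : ∫ θ, ‖T θ‖ ^ 2 ∂(sphereMeasure n a) ≤ E) :
    ∫ θ : USphere n, ‖T θ + (μ * φ θ) • (θ : Amb n)‖ ^ 2 ∂(sphereMeasure n a)
      ≤ (2 + 2 * μ ^ 2) * E := by
  have i1 := (memLp_two_iff_integrable_sq_norm hT2.1).mp hT2
  have i2 := (memLp_two_iff_integrable_sq_norm hφ2.1).mp hφ2
  have hU2 := hT2.add (memLp_smul_sphere hφ2 μ)
  calc ∫ θ : USphere n, ‖T θ + (μ * φ θ) • (θ : Amb n)‖ ^ 2 ∂(sphereMeasure n a)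
      ≤ ∫ θ, (2 * ‖T θ‖ ^ 2 + 2 * μ ^ 2 * ‖φ θ‖ ^ 2) ∂(sphereMeasure n a) := by
        refine integral_mono ((memLp_two_iff_integrable_sq_norm hU2.1).mp hU2)
          ((i1.const_mul 2).add (i2.const_mul _)) fun θ => ?_
        have h1 : ‖(μ * φ θ) • (θ : Amb n)‖ = |μ| * ‖φ θ‖ := by
          rw [norm_smul, norm_mul, show ‖(θ : Amb n)‖ = 1 by simp, mul_one, Real.norm_eq_abs]
        have h2 := norm_add_le (T θ) ((μ * φ θ) • (θ : Amb n))
        rw [h1] at h2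
        have h3 := pow_le_pow_left₀ (norm_nonneg _) h2 2
        have h4 : |μ| ^ 2 = μ ^ 2 := sq_abs μ
        have h5 := sq_nonneg (‖T θ‖ - |μ| * ‖φ θ‖)
        rw [← h4]
        linarith
    _ = 2 * (∫ θ, ‖T θ‖ ^ 2 ∂(sphereMeasure n a))
        + 2 * μ ^ 2 * ∫ θ, ‖φ θ‖ ^ 2 ∂(sphereMeasure n a) := by
        rw [integral_add (i1.const_mul 2) (i2.const_mul _), integral_const_mul,
          integral_const_mul]
    _ ≤ 2 * E + 2 * μ ^ 2 * E := by gcongr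
    _ = _ := by ring

open EvenPoly

/-- Directions in the box are so close to `b 0` that the Lipschitz bound loses at most half of the
depth `M`; `|X| ≥ 1/4` bounds the radial factor from below. -/
lemma homExt_fn_le_of_box (hn : 1 ≤ n) {b : OrthonormalBasis (Fin (n + 1)) ℝ (Amb n)}
    (hb : b (Fin.last n) = coordVec (Fin.last n)) {μ : ℝ} (hμ : 0 < μ) {ρ : ℝ} (hρ : 0 < ρ)
    {Λ M : ℝ} (hΛ : 0 ≤ Λ) (hM : 0 ≤ M) {q : EvenPoly n}
    (hlip : ∀ X ∈ Metric.closedBall (0 : Amb n) 1, ∀ Y ∈ Metric.closedBall (0 : Amb n) 1,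
      |fn q X - fn q Y| ≤ Λ * ‖X - Y‖) (hbM : fn q (b 0) = -M)
    (hsmall : Λ * (8 * (n * ρ)) ≤ M / 2) {X : Amb n} (hy : |yCoord X| ≤ ρ)
    (hχ : boxFn b ρ (fun _ => 1) X ≠ 0) :
    homExt μ (fun θ : USphere n => fn q (θ : Amb n)) X ≤ -((1 / 4 : ℝ) ^ μ / 2 * M) := by
  obtain ⟨h3, h5⟩ := norm_inv_smul_sub_le_of_box hn hb hρ hy hχ
  have h6 := hlip (‖X‖⁻¹ • X) (by rw [mem_closedBall_zero_iff]; exact norm_inv_smul_self_le X)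
    (b 0) (by rw [mem_closedBall_zero_iff, b.orthonormal.1 0])
  have h7 := (abs_le.mp (h6.trans ((mul_le_mul_of_nonneg_left h5 hΛ).trans hsmall))).2
  rw [hbM] at h7
  rw [homExt_fn hμ]
  have h9 : (1 / 4 : ℝ) ^ μ ≤ ‖X‖ ^ μ := by gcongr
  calc ‖X‖ ^ μ * fn q (‖X‖⁻¹ • X) ≤ ‖X‖ ^ μ * (-(M / 2)) := by
        gcongr; linarith
    _ = -(‖X‖ ^ μ * (M / 2)) := by ring
    _ ≤ -((1 / 4 : ℝ) ^ μ * (M / 2)) := by gcongr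
    _ = _ := by ring

lemma sq_mul_sqrt_add_sqrt_le {A B p q E k : ℝ} (hE : 0 ≤ E) (hk : 0 ≤ k) (hp : 0 ≤ p)
    (hq : 0 ≤ q) (hA : A ≤ p * E) (hB : B ≤ q * E) :
    (k * √A + √B) ^ 2 ≤ (k * √p + √q) ^ 2 * E := by
  have s1 := Real.sqrt_le_sqrt hA
  have s2 := Real.sqrt_le_sqrt hB
  rw [Real.sqrt_mul hp] at s1
  rw [Real.sqrt_mul hq] at s2
  calc (k * √A + √B) ^ 2 ≤ (k * (√p * √E) + √q * √E) ^ 2 := by gcongr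
    _ = (k * √p + √q) ^ 2 * √E ^ 2 := by ring
    _ = _ := by rw [Real.sq_sqrt hE]

/-- The high modes control the negative part of the low modes on the thin sphere. -/
lemma exists_low_mode_bound (hn : 1 ≤ n) {a : ℝ} (ha : -1 < a) (ha' : a < 1) {μ : ℝ} (hμ : 1 ≤ μ)
    {C : ℝ} (hC : 0 ≤ C) : ∃ C₀ : ℝ, 0 < C₀ ∧
      ∀ (Θ E M : ℝ) (q : EvenPoly n) (c φ : USphere n → ℝ) (T : USphere n → Amb n) (u : USphere n),
        0 < Θ → 0 ≤ M → (∀ X ∈ Metric.closedBall (0 : Amb n) 1, |fn q X| ≤ C * √Θ) →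
        (∀ X ∈ Metric.closedBall (0 : Amb n) 1, ∀ Y ∈ Metric.closedBall (0 : Amb n) 1,
          |fn q X - fn q Y| ≤ C * √Θ * ‖X - Y‖) →
        homExt μ c ∈ admissibleClass a c → (∀ θ, c θ = fn q (θ : Amb n) + φ θ) →
        IsTangentialGradient φ T → MemLp φ 2 (sphereMeasure n a) →
        MemLp T 2 (sphereMeasure n a) → ∫ θ, ‖φ θ‖ ^ 2 ∂(sphereMeasure n a) ≤ E →
        ∫ θ, ‖T θ‖ ^ 2 ∂(sphereMeasure n a) ≤ E →
        yCoord (u : Amb n) = 0 → fn q (u : Amb n) = -M →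
        M ^ 2 * (M / √Θ) ^ (n - 1) ≤ C₀ * E := by
  have hn' : (1 : ℝ) ≤ n := by exact_mod_cast hn
  obtain ⟨K, hK, hsK⟩ := exists_deriv_smoothStep_le
  set k₀ : ℝ := 16⁻¹ * (∫ t, unitBump t) * (2⁻¹ * ∫ t, unitBump t) ^ (n - 1) with hk₀
  have hk₀p : 0 < k₀ := by
    have : 0 < ∫ t, unitBump t := unitBump.integral_pos
    positivity
  set D : ℝ := (4 * K * √((n + a)⁻¹) + √((2 + 2 * μ ^ 2) * (n + a)⁻¹)) ^ 2 with hD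
  -- The factor `16 n` yields both `n ρ ≤ 1/16` and a loss of at most `M/2` over the box; the `+ 1`
  -- keeps `L` positive when `C = 0`.
  set L : ℝ := 16 * n * (C + 1) with hL
  have hLp : 0 < L := by positivity
  set g : ℝ := ((1 / 4 : ℝ) ^ μ / 2) ^ 2 with hg
  have hgp : 0 < g := by positivity
  -- The `+ 1` makes the constant positive, since `weightMass` is only known to be nonnegative.
  refine ⟨(weightMass a * D * L ^ (n - 1)) / (g * k₀) + 1, ?_, ?_⟩
  · have := weightMass_nonneg a
    positivity
  intro Θ E M q c φ T u hΘ hM hsup hlip hz hc hT hφ2 hT2 hφE hTE huy huM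
  have hE : 0 ≤ E := le_trans (integral_nonneg fun _ => by positivity) hTE
  have hsΘ : 0 < √Θ := Real.sqrt_pos.mpr hΘ
  rcases hM.eq_or_lt with rfl | hMp
  · have := weightMass_nonneg a
    rw [zero_pow two_ne_zero, zero_mul]
    positivity
  have hu1 : ‖(u : Amb n)‖ = 1 := by simp
  obtain ⟨b, hb0, hb⟩ := exists_thin_frame hn hu1 huy
  -- The scale on which a function with Lipschitz constant `C √Θ` and value `-M` at the centre stays
  -- below `-M/2`.
  set ρ : ℝ := M / (L * √Θ) with hρ
  have hρp : 0 < ρ := by positivity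
  have hMC : M ≤ C * √Θ := by
    have := hsup u (by rw [mem_closedBall_zero_iff, hu1])
    rwa [huM, abs_neg, abs_of_pos hMp] at this
  have hρM : ρ * (L * √Θ) = M := by rw [hρ]; field_simp
  have hρn : n * ρ ≤ 1 / 16 := by
    have h1 : ρ * (L * √Θ) ≤ C * √Θ := hρM.trans_le hMC
    have h2 : ρ * L ≤ C := le_of_mul_le_mul_right (by linarith) hsΘ
    have h3 : 16 * (n * ρ) * (C + 1) ≤ 1 * (C + 1) := by rw [hL] at h2; linarith
    have := le_of_mul_le_mul_right h3 (by linarith)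
    linarith
  have hρn2 : n * ρ ^ 2 ≤ 1 / 2 := by
    have : ρ ≤ n * ρ := le_mul_of_one_le_left hρp.le hn'
    nlinarith
  obtain ⟨hzH, ⟨f, hf, hf0⟩, -, -⟩ := hz
  obtain ⟨-, Gz, hGz, -⟩ := hzH
  have hzm : AEStronglyMeasurable (homExt μ c) (volume.restrict (unitBall n)) :=
    hGz.1.aestronglyMeasurable
  set G := homExt (μ - 1) fun θ : USphere n => T θ + (μ * φ θ) • (θ : Amb n) with hG
  have hGw : HasWeakGradientOn (unitBall n) (homExt μ φ) G :=
    hT.homExt_gradient_unitBall hn (by linarith)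
  have hU2 : MemLp (fun θ : USphere n => T θ + (μ * φ θ) • (θ : Amb n)) 2 (sphereMeasure n a) :=
    hT2.add (memLp_smul_sphere hφ2 μ)
  have hzφ : homExt μ c = fun X => homExt μ (fun θ : USphere n => fn q (θ : Amb n)) X
      + homExt μ φ X := by
    rw [← homExt_add]; congr 1; exact funext hc
  have hbM : fn q (b 0) = -M := by rw [hb0, huM]
  have hsmall : C * √Θ * (8 * (n * ρ)) ≤ M / 2 := by
    calc C * √Θ * (8 * (n * ρ)) ≤ (C + 1) * √Θ * (8 * (n * ρ)) := by gcongr; linarith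
      _ = ρ * (L * √Θ) / 2 := by rw [hL]; ring
      _ = M / 2 := by rw [hρM]
  -- The trace estimate is applied to the extension of `φ`, which is `z` minus that of the low modes
  -- and so exceeds `z` by `m` on the box.
  have hkey := sq_mul_boxMass_le hn hb ha' hρp hρn2 hK hsK (m := (1 / 4 : ℝ) ^ μ / 2 * M)
    (δ₀ := ρ) hGw (memLp_homExt (by linarith) hφ2) (memLp_homExt (by linarith) hU2) hzm hf hf0
    (by positivity) hρp (fun X _ hXy hχ => by
      rw [congrFun hzφ X]
      have := homExt_fn_le_of_box (μ := μ) hn hb (by linarith) hρp (by positivity) hM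
        hlip hbM hsmall hXy hχ
      linarith)
  have hφi := integral_norm_sq_homExt_le hn ha (α := μ) (by linarith) φ
  have hGi := integral_norm_sq_homExt_le hn ha (α := μ - 1) (by linarith)
    (fun θ : USphere n => T θ + (μ * φ θ) • (θ : Amb n))
  have hUE := integral_norm_add_smul_le (μ := μ) hφ2 hT2 hφE hTE
  have hnap : 0 < (n : ℝ) + a := by linarith
  have s3 := sq_mul_sqrt_add_sqrt_le (k := 4 * K) hE (by positivity) (by positivity) (by positivity)
    (hφi.trans (show _ ≤ (n + a)⁻¹ * E by rw [div_eq_inv_mul]; gcongr))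
    (hGi.trans (show _ ≤ (2 + 2 * μ ^ 2) * (n + a)⁻¹ * E by
      rw [div_le_iff₀ hnap]
      refine hUE.trans_eq ?_
      field_simp))
  have hfin := hkey.trans (mul_le_mul_of_nonneg_left s3 (weightMass_nonneg a))
  -- The box mass is proportional to `ρ^{n-1}`, hence to `(M/√Θ)^{n-1}`.
  have hbox : boxMass n ρ * L ^ (n - 1) = k₀ * (M / √Θ) ^ (n - 1) := by
    rw [boxMass_eq hn hρp, ← hk₀, mul_assoc, ← mul_pow]
    congr 2
    rw [hρ]; field_simp
  have h1 : M ^ 2 * (M / √Θ) ^ (n - 1) * (g * k₀) ≤ weightMass a * D * L ^ (n - 1) * E := by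
    calc M ^ 2 * (M / √Θ) ^ (n - 1) * (g * k₀)
        = g * M ^ 2 * (k₀ * (M / √Θ) ^ (n - 1)) := by ring
      _ = ((1 / 4 : ℝ) ^ μ / 2 * M) ^ 2 * boxMass n ρ * L ^ (n - 1) := by
          rw [← hbox, hg]; ring
      _ ≤ weightMass a * (D * E) * L ^ (n - 1) :=
          mul_le_mul_of_nonneg_right hfin (by positivity)
      _ = _ := by ring
  have h2 : M ^ 2 * (M / √Θ) ^ (n - 1) ≤ weightMass a * D * L ^ (n - 1) / (g * k₀) * E := by
    rw [div_mul_eq_mul_div]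
    exact (le_div_iff₀ (mul_pos hgp hk₀p)).mpr h1
  linarith [h2]

/-! ### The exponent `β` and the choice of rates -/

/-- The hypothesis reads `M^{n+1} ≤ C E Θ^{(n-1)/2}`; raising it to the power `2/(n+1) = 1 - β`
leaves exactly `Θ^β`. This is what dictates the value of `β`. -/
lemma sq_le_rpow_of_mul_pow_le (hn : 1 ≤ n) {β : ℝ} (hβ : β = ((n : ℝ) - 1) / ((n : ℝ) + 1))
    {C Θ E M : ℝ} (hC : 0 ≤ C) (hΘ : 0 < Θ) (hE : 0 ≤ E) (hM : 0 ≤ M)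
    (h : M ^ 2 * (M / √Θ) ^ (n - 1) ≤ C * E) :
    M ^ 2 ≤ C ^ (1 - β) * (Θ ^ β * E ^ (1 - β)) := by
  have hn' : (1 : ℝ) ≤ n := by exact_mod_cast hn
  have hβ1 : 1 - β = 2 / ((n : ℝ) + 1) := by rw [hβ]; field_simp; ring
  have hβp : 0 < 1 - β := by rw [hβ1]; positivity
  have h1 : M ^ (n + 1) ≤ C * E * Θ ^ (((n : ℝ) - 1) / 2) := by
    have e : Θ ^ (((n : ℝ) - 1) / 2) = √Θ ^ (n - 1) := by
      rw [Real.sqrt_eq_rpow, ← Real.rpow_natCast, ← Real.rpow_mul hΘ.le, Nat.cast_sub hn]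
      congr 1; push_cast; ring
    rw [e]
    have hp : 0 < √Θ ^ (n - 1) := pow_pos (Real.sqrt_pos.mpr hΘ) _
    rw [div_pow, ← mul_div_assoc, div_le_iff₀ hp, ← pow_add] at h
    rwa [show 2 + (n - 1) = n + 1 by omega] at h
  have h2 := Real.rpow_le_rpow (by positivity) h1 hβp.le
  rw [← Real.rpow_natCast, ← Real.rpow_mul hM, Real.mul_rpow (by positivity) (by positivity),
    Real.mul_rpow hC hE, ← Real.rpow_mul hΘ.le] at h2
  have e1 : ((n + 1 : ℕ) : ℝ) * (1 - β) = (2 : ℕ) := by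
    rw [hβ1]; push_cast; field_simp
  have e2 : ((n : ℝ) - 1) / 2 * (1 - β) = β := by rw [hβ1, hβ]; field_simp
  rw [e1, e2, Real.rpow_natCast] at h2
  linarith

/-- The choice of the rates in the epiperimetric inequality. -/
lemma exists_epiperimetric_rates {β d γ C K : ℝ} (hβ : 0 ≤ β) (hβ1 : β < 1) (hd : 0 < d)
    (hγ : 0 < γ) (hC : 0 ≤ C) (hK : 0 ≤ K) :
    ∃ δ : ℝ, 0 < δ ∧ ∃ ε : ℝ, 0 < ε ∧ ∃ ε₁ : ℝ, 0 < ε₁ ∧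
      ∀ Θ E I J Q W W' : ℝ, 0 < Θ → 0 ≤ E → I ≤ E → E ≤ C * Θ → J ≤ K * (Θ ^ β * E ^ (1 - β)) →
        γ * E ≤ Q → d * W ≤ E →
        W' - W = (δ * Θ ^ (-β) * E ^ β) / (d + 2 * (δ * Θ ^ (-β) * E ^ β))
          * ((δ * Θ ^ (-β) * E ^ β) * (I + J) - 2 * Q / d) →
        W' ≤ W * (1 - ε * Θ ^ (-β) * |W| ^ β) - ε₁ * Θ ^ (-β) * E ^ (1 + β) := by
  set A := C ^ β + K with hA
  have hCβ : 0 ≤ C ^ β := Real.rpow_nonneg hC _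
  have hAp : 0 ≤ A := by positivity
  -- Chosen so that `κ (I + J) ≤ δ A E ≤ γ E / d`, half of the guaranteed gain `2 Q / d`.
  set δ := γ / (d * (A + 1)) with hδ
  have hδp : 0 < δ := by positivity
  set r := δ * γ / (d * (d + 2 * (δ * C ^ β))) with hr
  have hrp : 0 < r := by positivity
  -- The decrease is `r Θ^{-β} E^{1+β}`. One half becomes the gradient term; the other pays for the
  -- power of `W` through `d W ≤ E`, whence the factor `d^{1+β}`.
  refine ⟨δ, hδp, r / 2 * d ^ (1 + β), by positivity, r / 2, by positivity, ?_⟩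
  intro Θ E I J Q W W' hΘ hE hI hEΘ hJ hQ hW heq
  have hΘn : 0 < Θ ^ (-β) := Real.rpow_pos_of_pos hΘ _
  have hEβ : 0 ≤ E ^ β := Real.rpow_nonneg hE _
  have hΘΘ : Θ ^ (-β) * Θ ^ β = 1 := by
    rw [← Real.rpow_add hΘ, neg_add_cancel, Real.rpow_zero]
  have hEE : E ^ β * E = E ^ (1 + β) := by
    rw [Real.rpow_add_of_nonneg hE zero_le_one hβ, Real.rpow_one, mul_comm]
  have hEE' : E ^ β * E ^ (1 - β) = E := by
    rw [← Real.rpow_add_of_nonneg hE hβ (by linarith), add_sub_cancel, Real.rpow_one]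
  -- Since `E ≤ C Θ`, the rate `κ` is bounded, so the denominator `d + 2 κ` stays under control.
  have hκC : Θ ^ (-β) * E ^ β ≤ C ^ β := by
    calc Θ ^ (-β) * E ^ β ≤ Θ ^ (-β) * (C * Θ) ^ β := by gcongr
      _ = C ^ β * (Θ ^ (-β) * Θ ^ β) := by rw [Real.mul_rpow hC hΘ.le]; ring
      _ = C ^ β := by rw [hΘΘ, mul_one]
  set κ := δ * Θ ^ (-β) * E ^ β with hκ
  have hκp : 0 ≤ κ := by positivity
  have hκle : κ ≤ δ * C ^ β := by rw [hκ, mul_assoc]; gcongr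
  have h1 : κ * (I + J) ≤ γ * E / d := by
    have i1 : κ * I ≤ δ * C ^ β * E := by
      calc κ * I ≤ κ * E := by gcongr
        _ ≤ _ := by gcongr
    have i2 : κ * J ≤ δ * K * E := by
      calc κ * J ≤ κ * (K * (Θ ^ β * E ^ (1 - β))) := by gcongr
        _ = δ * K * (Θ ^ (-β) * Θ ^ β) * (E ^ β * E ^ (1 - β)) := by rw [hκ]; ring
        _ = δ * K * E := by rw [hΘΘ, hEE', mul_one]
    have i3 : δ * (A + 1) = γ / d := by rw [hδ]; field_simp
    calc κ * (I + J) ≤ δ * A * E := by rw [hA]; linarith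
      _ ≤ δ * (A + 1) * E := by gcongr; linarith
      _ = γ * E / d := by rw [i3]; ring
  have h2 : κ * (I + J) - 2 * Q / d ≤ -(γ * E / d) := by
    have : 2 * (γ * E) / d ≤ 2 * Q / d := by gcongr
    have e : 2 * (γ * E) / d = 2 * (γ * E / d) := by ring
    linarith
  have h3 : W' - W ≤ -(r * Θ ^ (-β) * E ^ (1 + β)) := by
    rw [heq]
    calc κ / (d + 2 * κ) * (κ * (I + J) - 2 * Q / d)
        ≤ κ / (d + 2 * κ) * (-(γ * E / d)) := by gcongr
      _ = -(κ * (γ * E / d) / (d + 2 * κ)) := by ring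
      _ ≤ -(κ * (γ * E / d) / (d + 2 * (δ * C ^ β))) := by gcongr
      _ = -(r * Θ ^ (-β) * (E ^ β * E)) := by rw [hr, hκ]; field_simp
      _ = _ := by rw [hEE]
  have h4 : r / 2 * d ^ (1 + β) * Θ ^ (-β) * (W * |W| ^ β) ≤ r / 2 * Θ ^ (-β) * E ^ (1 + β) := by
    -- For `W ≤ 0` the term to be absorbed is nonpositive, so nothing has to be paid.
    rcases le_or_gt W 0 with hW0 | hW0
    · have : W * |W| ^ β ≤ 0 := mul_nonpos_of_nonpos_of_nonneg hW0 (by positivity)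
      have h5 := mul_nonpos_of_nonneg_of_nonpos
        (by positivity : 0 ≤ r / 2 * d ^ (1 + β) * Θ ^ (-β)) this
      exact h5.trans (by positivity)
    · rw [abs_of_pos hW0]
      have e : W * W ^ β = W ^ (1 + β) := by rw [Real.rpow_add hW0, Real.rpow_one]
      calc r / 2 * d ^ (1 + β) * Θ ^ (-β) * (W * W ^ β)
          = r / 2 * Θ ^ (-β) * (d * W) ^ (1 + β) := by
            rw [e, Real.mul_rpow hd.le hW0.le]; ring
        _ ≤ _ := by gcongr
  linarith

/-! ### The correction on the thin sphere and the conclusion -/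

open EvenPoly

/-- On the thin sphere `y = 0` and `|x| = 1`, so the extension of `|x|^{2m}` equals one. The even
homogeneity matters here: `|x|^{2m}` is a polynomial. -/
lemma exists_harm_eq_one_thin (n : ℕ) {a : ℝ} (ha : -1 < a) (m : ℕ) :
    ∃ h ∈ harm n a (2 * m), ∀ θ : USphere n, yCoord (θ : Amb n) = 0 → fn h (θ : Amb n) = 1 := by
  obtain ⟨h, hh, q, rfl⟩ := exists_harm_extension (n := n) ha m
  refine ⟨_, hh, fun θ hθ => ?_⟩
  have h1 := fn_rSq (θ : Amb n)
  rw [rSq, fn_add, fn_X_last, hθ, show ‖(θ : Amb n)‖ = 1 by simp] at h1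
  rw [fn_add, fn_mul, fn_pow, fn_X_last, hθ, show fn (xSq n) (θ : Amb n) = 1 by linarith]
  simp

/-- The thin sphere carries a minimizer of each polynomial. -/
lemma exists_thin_minimizer (hn : 1 ≤ n) (p : EvenPoly n) :
    ∃ u : USphere n, yCoord (u : Amb n) = 0 ∧
      ∀ θ : USphere n, yCoord (θ : Amb n) = 0 → fn p (u : Amb n) ≤ fn p (θ : Amb n) := by
  have hcl : IsClosed {θ : USphere n | yCoord (θ : Amb n) = 0} :=
    isClosed_eq (continuous_yCoord.comp continuous_subtype_val) continuous_const
  have hne : {θ : USphere n | yCoord (θ : Amb n) = 0}.Nonempty := by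
    have h0 : (0 : Fin (n + 1)) ≠ Fin.last n := by
      intro h
      have := congrArg Fin.val h
      simp at this
      omega
    exact ⟨⟨coordVec 0, by simp⟩, by simp [yCoord, h0.symm]⟩
  obtain ⟨u, hu, hmin⟩ := hcl.isCompact.exists_isMinOn hne
    ((contDiff_fn p).continuous.comp continuous_subtype_val).continuousOn
  exact ⟨u, hu, fun θ hθ => hmin hθ⟩

end

open EvenPoly

theorem theorem1p2 (n m : ℕ) (hn : 1 ≤ n) (hm : 1 ≤ m) (s a : ℝ) (hs : s ∈ Set.Ioo (0 : ℝ) 1)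
    (ha : a = 1 - 2 * s) (β : ℝ) (hβ : β = ((n : ℝ) - 1) / ((n : ℝ) + 1)) :
    ∃ ε : ℝ, 0 < ε ∧ ∃ ε₁ : ℝ, 0 < ε₁ ∧
      ∀ (Θ : ℝ) (c : USphere n → ℝ) (z : Amb n → ℝ), 0 < Θ → MemH1Sphere a c →
        z = homExt (2 * (m : ℝ)) c → z ∈ admissibleClass a c →
        sphereNormSq a c ≤ Θ → |weissEnergy a (2 * (m : ℝ)) z| ≤ Θ →
        ∃ ζ ∈ admissibleClass a c,
          weissEnergy a (2 * (m : ℝ)) ζ ≤ weissEnergy a (2 * (m : ℝ)) z *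
              (1 - ε * Θ ^ (-β) * |weissEnergy a (2 * (m : ℝ)) z| ^ β) ∧
          ∃ (φ : USphere n → ℝ) (T : USphere n → Amb n),
            MemLp φ 2 (sphereMeasure n a) ∧ IsHighModePart a (2 * (m : ℝ)) c φ ∧
            IsTangentialGradient φ T ∧ MemLp T 2 (sphereMeasure n a) ∧
            weissEnergy a (2 * (m : ℝ)) ζ ≤ weissEnergy a (2 * (m : ℝ)) z *
                (1 - ε * Θ ^ (-β) * |weissEnergy a (2 * (m : ℝ)) z| ^ β)
              - ε₁ * Θ ^ (-β) * (sphereNormSq a T) ^ (1 + β) := by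
  have ha1 : -1 < a := by rw [ha]; linarith [hs.2]
  have ha2 : a < 1 := by rw [ha]; linarith [hs.1]
  have hn' : (1 : ℝ) ≤ n := by exact_mod_cast hn
  have hβ0 : 0 ≤ β := by rw [hβ]; exact div_nonneg (by linarith) (by linarith)
  have hβ1 : β < 1 := by rw [hβ, div_lt_one (by linarith)]; linarith
  have := isFiniteMeasure_sphereMeasure (n := n) ha1
  rw [show 2 * (m : ℝ) = ((2 * m : ℕ) : ℝ) by push_cast; ring]
  obtain ⟨h, hh, hone⟩ := exists_harm_eq_one_thin n ha1 m
  have hL : 1 ≤ 2 * m := by omega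
  -- Apart from `L ≥ 1`, only the existence of `h` depends on the form `2m` of the homogeneity.
  generalize 2 * m = L at hh hL ⊢
  have hL' : (1 : ℝ) ≤ L := by exact_mod_cast hL
  obtain ⟨Cs, hCs, hsplit⟩ := exists_modeSplitting hn ha1 L
  obtain ⟨C₀, hC₀, hbound⟩ := exists_low_mode_bound hn ha1 ha2 hL' hCs
  set lam := homEigenvalue n a L with hlam
  set lam' := homEigenvalue n a (L + 1 : ℕ) with hlam'
  have hlam0 : 0 ≤ lam := homEigenvalue_nonneg hn ha1 L
  have hlt : lam < lam' := homEigenvalue_strictMono hn ha1 L.lt_succ_self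
  -- Makes the gap inequality also give `I ≤ E`, so that one quantity `E` controls both `φ` and its
  -- gradient.
  have hlam1 : 1 ≤ lam' := by
    rw [hlam', homEigenvalue]
    push_cast
    nlinarith
  have hlamp : 0 < lam' := by linarith
  set d : ℝ := n + a - 1 + 2 * L with hd
  have hdp : 0 < d := by rw [hd]; linarith
  -- The relative spectral gap: `λ' I ≤ E` implies `E - λ I ≥ γ E`.
  set γ : ℝ := 1 - lam / lam' with hγ
  have hγp : 0 < γ := by rw [hγ, sub_pos, div_lt_one hlamp]; exact hlt
  set H : ℝ := ∫ θ : USphere n, ‖fn h (θ : Amb n)‖ ^ 2 ∂(sphereMeasure n a) with hH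
  have hHp : 0 ≤ H := integral_nonneg fun _ => by positivity
  obtain ⟨δ, hδ, ε, hε, ε₁, hε₁, hrate⟩ := exists_epiperimetric_rates hβ0 hβ1 hdp hγp
    (show 0 ≤ (d + lam) / γ by positivity) (show 0 ≤ C₀ ^ (1 - β) * H by positivity)
  refine ⟨ε, hε, ε₁, hε₁, ?_⟩
  rintro Θ c z hΘ ⟨hc, R, hR, hR2⟩ rfl hz hcΘ hWΘ
  obtain ⟨p, φ, S, T, hms, hcp, hhigh, hpn, hsup, hlip⟩ := hsplit c R hc hR hR2
    (ae_reflSphere_eq (by linarith) hz.2.2.2)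
  set E : ℝ := ∫ θ, ‖T θ‖ ^ 2 ∂(sphereMeasure n a) with hE
  set I : ℝ := ∫ θ, ‖φ θ‖ ^ 2 ∂(sphereMeasure n a) with hI
  have hE0 : 0 ≤ E := integral_nonneg fun _ => by positivity
  have hI0 : 0 ≤ I := integral_nonneg fun _ => by positivity
  have hgap : lam' * I ≤ E := hms.gap
  have hIE : I ≤ E := (le_mul_of_one_le_left hI0 hlam1).trans hgap
  have hsΘ : Cs * √(sphereNormSq a c) ≤ Cs * √Θ := by gcongr
  obtain ⟨u, huy, humin⟩ := exists_thin_minimizer hn p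
  -- The least nonnegative multiple of `h` that makes `P + M h` nonnegative on the thin sphere.
  set M := max 0 (-fn p (u : Amb n)) with hM
  have hM2 : M ^ 2 ≤ C₀ ^ (1 - β) * (Θ ^ β * E ^ (1 - β)) := by
    rcases le_total 0 (fn p (u : Amb n)) with hp | hp
    · rw [hM, max_eq_left (by linarith), zero_pow two_ne_zero]
      positivity
    · have hMe : M = -fn p (u : Amb n) := max_eq_right (by linarith)
      exact sq_le_rpow_of_mul_pow_le hn hβ hC₀.le hΘ hE0 (le_max_left _ _)
        (hbound Θ E M p c φ T u hΘ (le_max_left _ _) (fun X hX => (hsup X hX).trans hsΘ)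
          (fun X hX Y hY => (hlip X hX Y hY).trans (by gcongr)) hz hcp hms.grad_high
          hms.memLp_high hms.memLp_grad_high hIE le_rfl huy (by rw [hMe, neg_neg]))
  set W := weissEnergy a L (homExt L c) with hW
  have hcfun : (fun θ : USphere n => fn p (θ : Amb n) + φ θ) = c := (funext hcp).symm
  have hWeq := hms.weissEnergy_homExt hn ha1 hL
  rw [hcfun] at hWeq
  have hS0 : 0 ≤ ∫ θ, ‖S θ‖ ^ 2 ∂(sphereMeasure n a) := integral_nonneg fun _ => by positivity
  have hQ : γ * E ≤ E - lam * I := by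
    have : lam * I ≤ lam / lam' * E := by
      rw [div_mul_eq_mul_div, le_div_iff₀ hlamp]
      calc lam * I * lam' = lam * (lam' * I) := by ring
        _ ≤ lam * E := by gcongr
    rw [hγ]; linarith
  have hlI : 0 ≤ lam * I := by positivity
  -- The low modes contribute nonpositively to `d W`, and `φ` contributes at most `E`.
  have hWE : d * W ≤ E := by
    have := hms.low_le
    linarith
  -- The low modes contribute at least `-λ ‖P‖² ≥ -λ Θ` to `d W ≤ d Θ`, which bounds `E - λ I`,
  -- hence `γ E`.
  have hEΘ : E ≤ (d + lam) / γ * Θ := by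
    rw [div_mul_eq_mul_div, le_div_iff₀ hγp]
    have h1 : lam * ∫ θ : USphere n, ‖fn p (θ : Amb n)‖ ^ 2 ∂(sphereMeasure n a) ≤ lam * Θ := by
      gcongr; exact hpn.trans hcΘ
    have h2 : d * W ≤ d * Θ := by
      gcongr; exact (le_abs_self _).trans hWΘ
    linarith
  set κ : ℝ := δ * Θ ^ (-β) * E ^ β with hκ
  have hκ0 : 0 ≤ κ := by positivity
  have hA : ∀ θ : USphere n,
      fn (p + M • h) (θ : Amb n) = fn p (θ : Amb n) + M * fn h (θ : Amb n) := fun θ => by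
    rw [fn_add, fn_smul]
  have hhg : IsTangentialGradient (fun θ : USphere n => fn h (θ : Amb n)) (sphGrad L h) :=
    isTangentialGradient_fn hh.1
  have hcmp := hms.weissEnergy_sub hn ha1 hL hh M hκ0
  rw [hcfun] at hcmp
  simp only [← hA] at hcmp
  have hζ := add_homExt_mem_admissibleClass hn ha1 hL' hκ0 (q := p + M • h)
    (D := fun θ => φ θ + (-M) * fn h (θ : Amb n)) hz
    (fun θ => by rw [hA, hcp]; ring)
    (by simp only [hA]; exact hms.grad_low.add (hhg.const_smul M))
    (hms.grad_high.add (hhg.const_smul (-M))) (memLp_fn _)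
    (hms.memLp_high.add ((memLp_fn h).const_mul (-M)))
    (hms.memLp_grad_low.add ((memLp_sphGrad L h).const_smul M))
    (hms.memLp_grad_high.add ((memLp_sphGrad L h).const_smul (-M)))
    (fun θ hθ => by
      rw [hA, hone θ hθ]
      linarith [humin θ hθ, le_max_right 0 (-fn p (u : Amb n))])
  have hfin := hrate Θ E I (M ^ 2 * H) (E - lam * I) W _ hΘ hE0 hIE hEΘ
    (by
      calc M ^ 2 * H ≤ C₀ ^ (1 - β) * (Θ ^ β * E ^ (1 - β)) * H := by gcongr
        _ = _ := by ring) hQ hWE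
    (hcmp.trans (by rw [hd]; ring))
  -- The weaker inequality follows from the stronger one by dropping the nonnegative gradient term.
  refine ⟨_, hζ, hfin.trans (sub_le_self _ (by positivity)), φ, T, hms.memLp_high, hhigh,
    hms.grad_high, hms.memLp_grad_high, hfin⟩
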